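/- **Setting.** Let $h(x)=-x\log_2x-(1-x)\log_2(1-x)$, let $|x|$ be the Hamming weight and $K_w^{(n)}(x)=\sum_{j}(-1)^j\binom{x}{j}\binom{n-x}{w-j}$ the Krawtchouk polynomials. For a code $C\subseteq\mathbb F_2^n$ and $I\subseteq\{1,\dots,n\}$, $C_I$ is the punctured code $\{c_I:c\in C\}$ and $C^I=\{c_I:c\in C,\ c_{I^c}=0\}$ the shortened code. For every length $n$ let integers $k,t,s,k_{\rm aux},t_{\rm aux},w,u$ be given with $k_{\rm aux},t_{\rm aux}\le s\le k\le n$, $w\le n-s$, $u\le\min(t,n-s)$, $t-u\le s$, $t\le n$, and let $N_{\rm aux}\ge1$ be a constant. Put $$\delta=\frac{K_w^{(n-s)}(u)K_{t_{\rm aux}}^{(s)}(t-u)}{\binom{n-s}{w}\binom{s}{t_{\rm aux}}},\quad \widetilde H=\frac{\binom{n-s}{w}\binom{s}{t_{\rm aux}}}{2^{k-k_{\rm aux}}},\quad P_{\rm succ}=\frac{\binom{s}{t-u}\binom{n-s}{u}}{\binom nt}.$$ **The double-RLPN decoder.** The input is a uniformly random binary $[n,k]$-code $C$ and $y=c+e$,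 with $c\in C$ uniform and $e$ a fixed vector of weight $t$. The decoder performs $\lceil n^{C_0}/P_{\rm succ}\rceil$ iterations, where $C_0\geq 1$ is an arbitrary integer constant. Each iteration draws a uniform set $\mathscr P$ of $s$ positions, with complement $\mathscr N$, and independent uniform $[s,k_{\rm aux}]$-codes with generator matrices $G^{(1)},\dots,G^{(N_{\rm aux})}$, and stops if $\dim C_{\mathscr P}<s$. Otherwise: 1. for each $j$ it computes the set $\mathscr H^{(j)}$ of all pairs $(h,m)$ such that $h\in C^\perp$, $|h_{\mathscr N}|=w$ and $|h_{\mathscr P}+mG^{(j)}|=t_{\rm aux}$. The vectors $h$ are searched by $n^{C_0}$ randomized runs of the two-level representation technique (BJMM) applied to the code $C^{\mathscr N}$, and the $m$ by a procedure Decode; 2. for each $j$ it computes by a fast Fourier transform the set of candidates $\mathscr S^{(j)}=\{x\in\mathbb F_2^{k_{\rm aux}}:\sum_{(h,m)\in\mathscr H^{(j)}}(-1)^{\langle y,h\rangle+\langle x,m\rangle}\ge\frac\delta2\widetilde H\}$; 3. for every $(s_1,\dots,s_{N_{\rm aux}})\in\prod_j\mathscr S^{(j)}$ it computes with Dumer's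 information set decoder all $v\in\mathbb F_2^{s}$ of weight $t-u$ with $G^{(j)}v=s_j$ for all $j$ and then, for each such $v$, with Dumer's decoder again, all $z$ of weight $u$ such that $y-(v,z)\in C$ ($v$ placed on $\mathscr P$, $z$ on $\mathscr N$). Each run of Dumer's decoder for all solutions of weight $t'$ in length $m$, with window length $L$ and weight $p$ on the window, is repeated $n^{C_0}\lceil\binom{m}{t'}/(\binom Lp\binom{m-L}{t'-p})\rceil$ times. As usual in this framework, steps 1 and 3 are taken to return all the objects sought, and they are charged the expected number of steps of the runs performed. **Assumptions.** * The limits $R,\tau,\sigma,R_{\rm aux},\tau_{\rm aux},\omega,\mu$ of $k/n,\ t/n,\ s/n,\ k_{\rm aux}/n,\ t_{\rm aux}/n,\ w/n,\ u/n$ exist. * Decode has expected time $2^{n\sigma\cdot o(1)}$ for every input word, the mean being over the auxiliary code. * (Parameter constraint.) For some constant $\alpha_0>0$: $\widetilde H\delta^2/n^{\alpha_0+8}\to\infty$, $\binom{n-s}{w}\binom{s}{t_{\rm aux}}2^{-k}=O(n^{\alpha_0})$ and $\binom{s}{t_{\rm aux}}2^{-(s-k_{\rm aux})}=O(n^{\alpha_0})$.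 * (Conjecture on weight distributions.) For fixed $\mathscr P$ and $e$ with $|e|=t$, let $C$ be uniform among the $[n,k]$-codes with $\dim C_{\mathscr P}=s$, let $C_{\rm aux}$ be a uniform $[s,k_{\rm aux}]$-code, let $x$ be uniform in $\mathbb F_2^s\setminus(C_{\rm aux}^\perp+e_{\mathscr P})$, and let $N_{i,j}$ be the number of $z\in C+e$ with $z_{\mathscr P}\in x+C_{\rm aux}^\perp$, $|z_{\mathscr P}|=j$, $|z_{\mathscr N}|=i$. Up to a factor polynomial in $n$, uniform in $\mathscr P$ and $e$, the probability that $\sum_{i,j}K_w^{(n-s)}(i)K_{t_{\rm aux}}^{(s)}(j)N_{i,j}\ge\frac12K_w^{(n-s)}(u)K_{t_{\rm aux}}^{(s)}(t-u)$ is at most $\max_{(i,j)}\mathbb P(N_{i,j}\ne0)+2^{-n}$, where the maximum is over the pairs $(i,j)\in[0,n-s]\times[0,s]$ with $|K_w^{(n-s)}(u)K_{t_{\rm aux}}^{(s)}(t-u)|\le n^{3.2}|K_w^{(n-s)}(i)K_{t_{\rm aux}}^{(s)}(j)|$. * $R<1$, $\sigma>0$, the numbers $R_{\rm aux},\tau_{\rm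 aux},\omega,\mu$ are non-negative, and $$\sigma\le R,\quad \tau-\sigma\le\mu\le\tau,\quad \omega\le\tfrac{1-\sigma}2,\quad \tau_{\rm aux}\le\tfrac\sigma2,\quad \nu_{\rm samples}\ge-2\,\varepsilon_{\rm bias},$$ $$(1-\sigma)h\!\left(\tfrac\omega{1-\sigma}\right)+\sigma h\!\left(\tfrac{\tau_{\rm aux}}\sigma\right)-R\le0,\qquad \sigma h\!\left(\tfrac{\tau_{\rm aux}}\sigma\right)-(\sigma-R_{\rm aux})\le0.$$ * If $\frac{\mu}{1-\sigma}$ is at least the first root $\frac12-\sqrt{\theta(1-\theta)}$, $\theta=\frac\omega{1-\sigma}$, then $\frac1n\log_2|K_w^{(n-s)}(u)|\to(1-\sigma)\widetilde\kappa(\frac\mu{1-\sigma},\theta)$; likewise, if $\frac{\tau-\mu}\sigma\ge\frac12-\sqrt{\theta'(1-\theta')}$, $\theta'=\frac{\tau_{\rm aux}}\sigma$, then $\frac1n\log_2|K_{t_{\rm aux}}^{(s)}(t-u)|\to\sigma\widetilde\kappa(\frac{\tau-\mu}\sigma,\theta')$. * The internal parameters of the parity-check search and of the two uses of Dumer's decoder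 satisfy the evident integer constraints, and their relative limits attain the minima that define $\alpha_{\rm eq}$ and $\alpha_{\text{ISD-Dumer}}$ below (whose domains are thus non-empty). **Notation.** For $\theta\le\frac12$, with $z=\frac{1-2x-\sqrt{(1-2x)^2-4\theta(1-\theta)}}{2(1-\theta)}$, $$\widetilde\kappa(x,\theta)=\begin{cases}x\log_2(1-z)+(1-x)\log_2(1+z)-\theta\log_2z&\text{if }x\le\frac12-\sqrt{\theta(1-\theta)},\\ \frac12(1-h(x)+h(\theta))&\text{otherwise,}\end{cases}$$ $$\varepsilon_{\rm bias}=\sigma\Big[\widetilde\kappa\Big(\tfrac{\tau-\mu}\sigma,\tfrac{\tau_{\rm aux}}\sigma\Big)-h\Big(\tfrac{\tau_{\rm aux}}\sigma\Big)\Big]+(1-\sigma)\Big[\widetilde\kappa\Big(\tfrac\mu{1-\sigma},\tfrac\omega{1-\sigma}\Big)-h\Big(\tfrac\omega{1-\sigma}\Big)\Big],$$ $$\pi=h(\tau)-\sigma h\Big(\tfrac{\tau-\mu}\sigma\Big)-(1-\sigma)h\Big(\tfrac\mu{1-\sigma}\Big)\ (\ge0,\ \text{the exponent of }1/P_{\rm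 succ}),$$ $$\nu_{\rm samples}=(1-\sigma)h\Big(\tfrac\omega{1-\sigma}\Big)+\sigma h\Big(\tfrac{\tau_{\rm aux}}\sigma\Big)-(R-R_{\rm aux}),\qquad \nu_{\rm ISD}=\max\Big(\sigma h\Big(\tfrac{\tau-\mu}\sigma\Big)-N_{\rm aux}R_{\rm aux},\,0\Big),$$ $$\nu_{\rm candidates}=\max\Big(\sup_{(\eta,\zeta)\in\mathcal A}\sigma h\Big(\tfrac\zeta\sigma\Big)+(1-\sigma)h\Big(\tfrac\eta{1-\sigma}\Big)-(1-R),\,0\Big),$$ where $\mathcal A$ is the set of $(\eta,\zeta)\in[0,1-\sigma]\times[0,\sigma]$ with $$\sigma\Big[\widetilde\kappa\Big(\tfrac{\tau-\mu}\sigma,\tfrac{\tau_{\rm aux}}\sigma\Big)-\widetilde\kappa\Big(\tfrac\zeta\sigma,\tfrac{\tau_{\rm aux}}\sigma\Big)\Big]+(1-\sigma)\Big[\widetilde\kappa\Big(\tfrac\mu{1-\sigma},\tfrac\omega{1-\sigma}\Big)-\widetilde\kappa\Big(\tfrac\eta{1-\sigma},\tfrac\omega{1-\sigma}\Big)\Big]\le0,$$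 $$\alpha_{\rm ISD}=\max\Big(\sigma\,\alpha_{\text{ISD-Dumer}}\Big(1-\tfrac{N_{\rm aux}R_{\rm aux}}\sigma,\tfrac{\tau-\mu}\sigma\Big),\ \nu_{\rm ISD}+(1-\sigma)\,\alpha_{\text{ISD-Dumer}}\Big(\tfrac{R-\sigma}{1-\sigma},\tfrac\mu{1-\sigma}\Big)\Big).$$ Here $$\alpha_{\text{ISD-Dumer}}(R',\tau')=\min_{\lambda,\vartheta}\Big[h(\tau')-(1-R'-\lambda)h\Big(\tfrac{\tau'-\vartheta}{1-R'-\lambda}\Big)-(R'+\lambda)h\Big(\tfrac\vartheta{R'+\lambda}\Big)+\max\Big(\tfrac{R'+\lambda}2h\Big(\tfrac\vartheta{R'+\lambda}\Big),(R'+\lambda)h\Big(\tfrac\vartheta{R'+\lambda}\Big)-\lambda\Big)\Big]$$ over $0\le\lambda\le1-R'$, $\max(R'+\lambda+\tau'-1,0)\le\vartheta\le\min(\tau',R'+\lambda)$, and $\alpha_{\rm eq}(R',\omega')$ is the minimum of $$\max\big(\nu_0,\,2\nu_0-\lambda_1,\,\nu_1,\,2\nu_1-(\lambda_2-\lambda_1),\,\nu_2,\,2\nu_2-(R'-\lambda_2)\big),\quad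 \nu_0=\tfrac{h(\pi_1)}2,\ \nu_1=h(\pi_1)-\lambda_1,\ \nu_2=h(\pi_2)-\lambda_2,$$ over the non-negative $(\pi_1,\pi_2,\lambda_1,\lambda_2)$ with $\lambda_1\le\lambda_2\le R'$, $\pi_1\le\pi_2\le\omega'$, $\pi_2\le2\pi_1$, $\omega'\le2\pi_2$, $\pi_2\le\lambda_1$, $\omega'\le\lambda_2$, $\lambda_1=\pi_2+(1-\pi_2)h\big(\frac{\pi_1-\pi_2/2}{1-\pi_2}\big)$ and $\lambda_2=\omega'+(1-\omega')h\big(\frac{\pi_2-\omega'/2}{1-\omega'}\big)$. **Statement.** Under these assumptions the expected running time of the double-RLPN decoder is at most $2^{n(\alpha+o(1))}$, uniformly in the error $e$ of weight $t$, where $$\alpha=\pi+\max\Big((1-\sigma)\,\alpha_{\rm eq}\Big(\tfrac{R-\sigma}{1-\sigma},\tfrac\omega{1-\sigma}\Big),\ \nu_{\rm samples},\ R_{\rm aux},\ N_{\rm aux}\,\nu_{\rm candidates}+\alpha_{\rm ISD}\Big).$$ -/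

import Mathlib

open Filter Topology Asymptotics
open scoped Classical BigOperators Matrix

noncomputable section

namespace DoubleRLPN

/-! ### Binary codes -/

/-- The binary field. -/
abbrev F2 := ZMod 2

/-- Restriction `v ↦ v_I` of a vector to a set of positions. -/
def restr {n : ℕ} (I : Finset (Fin n)) : (Fin n → F2) →ₗ[F2] (I → F2) :=
  LinearMap.funLeft F2 F2 (fun i : I => (i : Fin n))

/-- Extension by zero outside of `I` of a vector indexed by `I`. -/
def ext {n : ℕ} (I : Finset (Fin n)) : (I → F2) →ₗ[F2] (Fin n → F2) :=
  Function.ExtendByZero.linearMap F2 (fun i : I => (i : Fin n))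

/-- The code spanned by the rows of a matrix. -/
def rowCode {k : ℕ} {ι : Type} (G : Matrix (Fin k) ι F2) : Submodule F2 (ι → F2) :=
  Submodule.span F2 (Set.range G.row)

/-- The generator matrices (full rank `k × ι` matrices) of the codes of dimension `k`.  Every code
of dimension `k` has the same number of generator matrices, so that the code generated by a uniform
element is uniform among the codes of dimension `k`. -/
def genMatrices (k : ℕ) (ι : Type) [Fintype ι] : Finset (Matrix (Fin k) ι F2) :=
  Finset.univ.filter fun G => LinearIndependent F2 G.row

/-- The words of the dual code `C^⊥`, that is, the parity-checks of `C`. -/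
def dualWords {n : ℕ} (C : Submodule F2 (Fin n → F2)) : Finset (Fin n → F2) :=
  Finset.univ.filter fun h => ∀ c ∈ C, c ⬝ᵥ h = 0

/-- The punctured code `C_I`. -/
def punctured {n : ℕ} (C : Submodule F2 (Fin n → F2)) (I : Finset (Fin n)) :
    Submodule F2 (I → F2) :=
  C.map (restr I)

/-- The shortened code `C^I`: restrictions to `I` of the codewords that vanish outside of `I`. -/
def shortened {n : ℕ} (C : Submodule F2 (Fin n → F2)) (I : Finset (Fin n)) :
    Submodule F2 (I → F2) :=
  (C ⊓ LinearMap.ker (restr Iᶜ)).map (restr I)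

/-- The sign `(-1)^b`. -/
def sign (b : F2) : ℤ := if b = 0 then 1 else -1

/-- The value at the integer `x` of the Krawtchouk polynomial `K_w^{(n)}`. -/
def krawtchouk (n w x : ℕ) : ℤ :=
  ∑ j ∈ Finset.range (w + 1), (-1) ^ j * (x.choose j : ℤ) * ((n - x).choose (w - j) : ℤ)

/-! ### Parameters of the decoder for one length `n` -/

/-- The integer parameters for one code length.  The set `𝒫` has `s` elements, `𝒩 = 𝒫ᶜ`. -/
structure Params where
  /-- dimension of the code -/
  k : ℕ
  /-- weight of the error -/
  t : ℕ
  /-- size of `𝒫` -/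
  s : ℕ
  /-- dimension of the auxiliary codes -/
  kaux : ℕ
  /-- decoding distance of the auxiliary codes -/
  taux : ℕ
  /-- weight on `𝒩` of the parity-checks -/
  w : ℕ
  /-- number of errors betted on `𝒩` -/
  u : ℕ
  /-- weight of the vectors of the first level of the parity-check search -/
  p₁ : ℕ
  /-- weight of the vectors of the second level of the parity-check search -/
  p₂ : ℕ
  /-- number of parity constraints imposed at the first level of the parity-check search -/
  l₁ : ℕ
  /-- number of parity constraints imposed at the second level of the parity-check search -/
  l₂ : ℕ
  /-- window length of the information set decoder on `𝒫` -/
  La : ℕ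
  /-- weight on the window of the information set decoder on `𝒫` -/
  pa : ℕ
  /-- window length of the information set decoder on `𝒩` -/
  Lb : ℕ
  /-- weight on the window of the information set decoder on `𝒩` -/
  pb : ℕ

/-- The integer constraints without which the parameters are meaningless. -/
structure Params.Valid (n : ℕ) (q : Params) : Prop where
  s_le_k : q.s ≤ q.k
  k_le_n : q.k ≤ n
  t_le_n : q.t ≤ n
  kaux_le_s : q.kaux ≤ q.s
  taux_le_s : q.taux ≤ q.s
  w_le : q.w ≤ n - q.s
  u_le_t : q.u ≤ q.t
  u_le : q.u ≤ n - q.s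
  tu_le : q.t - q.u ≤ q.s
  La_le : q.La ≤ q.s
  pa_le : q.pa ≤ q.t - q.u
  pa_le_La : q.pa ≤ q.La
  pa_rest : q.t - q.u - q.pa ≤ q.s - q.La
  Lb_le : q.Lb ≤ n - q.s
  pb_le : q.pb ≤ q.u
  pb_le_Lb : q.pb ≤ q.Lb
  pb_rest : q.u - q.pb ≤ n - q.s - q.Lb

/-- The product `K_w^{(n-s)}(i) K_{t_aux}^{(s)}(j)`. -/
def Params.kk (n : ℕ) (q : Params) (i j : ℕ) : ℤ :=
  krawtchouk (n - q.s) q.w i * krawtchouk q.s q.taux j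

/-- The bias `δ = K_w^{(n-s)}(u) K_{t_aux}^{(s)}(t-u) / (binom(n-s,w) binom(s,t_aux))`. -/
def Params.bias (n : ℕ) (q : Params) : ℝ :=
  (q.kk n q.u (q.t - q.u) : ℝ) / (((n - q.s).choose q.w : ℝ) * (q.s.choose q.taux : ℝ))

/-- The expected number of LPN samples `H̃ = binom(n-s,w) binom(s,t_aux) / 2^{k-k_aux}`. -/
def Params.samples (n : ℕ) (q : Params) : ℝ :=
  ((n - q.s).choose q.w : ℝ) * (q.s.choose q.taux : ℝ) / 2 ^ (q.k - q.kaux)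

/-- The probability `binom(s,t-u) binom(n-s,u) / binom(n,t)` that a random `𝒩` contains exactly `u`
of the `t` error positions. -/
def Params.succ (n : ℕ) (q : Params) : ℝ :=
  (q.s.choose (q.t - q.u) : ℝ) * ((n - q.s).choose q.u : ℝ) / (n.choose q.t : ℝ)

/-! ### Computations with a step count

A step is a bit operation up to a fixed polynomial in `n`: handling one vector of length at most `n`
(addition, inner product, insertion in or look-up from a sorted table) is charged `n ^ 2`, and one
Gaussian elimination `n ^ 3`. -/

/-- The result of a computation together with its number of steps (for a procedure with internal
coins: the mean of the number of steps over these coins). -/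
structure Timed (α : Type) where
  /-- the result -/
  val : α
  /-- the number of steps -/
  steps : ℝ

/-! ### Computing the parity-checks of given weight -/

section ParityChecks

variable {ι : Type} [Fintype ι]

/-- The vectors of weight `p` supported on `I`. -/
def wordsOn (I : Finset ι) (p : ℕ) : Finset (ι → F2) :=
  Finset.univ.filter fun x => (∀ i, i ∉ I → x i = 0) ∧ hammingNorm x = p

/-- The vectors `x` and `y` agree on their first `l` coordinates. -/
def AgreeUpTo {κ : ℕ} (l : ℕ) (x y : Fin κ → F2) : Prop := ∀ i : Fin κ, (i : ℕ) < l → x i = y i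

/-- Merging of two lists: all sums `x + x'` with `x ∈ A`, `x' ∈ A'` for which `B (x + x')` agrees
with the target `a` on the first `l` coordinates are formed (the colliding pairs being found by
sorting), and those sums that satisfy `keep` are returned, without repetition. -/
def merge {κ : ℕ} (n : ℕ) (B : Matrix (Fin κ) ι F2) (l : ℕ) (a : Fin κ → F2)
    (keep : (ι → F2) → Prop) (A A' : Finset (ι → F2)) : Timed (Finset (ι → F2)) :=
  let pairs := (A ×ˢ A').filter fun z => AgreeUpTo l (B *ᵥ (z.1 + z.2)) a
  { val := (pairs.image fun z => z.1 + z.2).filter keep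
    steps := (n : ℝ) ^ 2 * ((A.card : ℝ) + A'.card + pairs.card) }

/-- One run of the representation technique with two levels of representations for finding
solutions `x` of weight `w` to `B x = 0`.
Level 1: vectors of weight `p₁`, obtained by a meet in the middle along the partition `I, Iᶜ`, whose
first `l₁` syndrome bits are prescribed.  Level 2: sums of weight `p₂` of two vectors of level 1
whose first `l₂` syndrome bits are prescribed.  Last step: sums of weight `w` of two vectors of
level 2 with zero syndrome.  The prescribed syndromes are `a`, `a'` (level 1) and `b` (level 2). -/
def parityCheckRun {κ : ℕ} (n p₁ p₂ l₁ l₂ w : ℕ) (B : Matrix (Fin κ) ι F2) (I : Finset ι)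
    (a a' b : Fin κ → F2) : Timed (Finset (ι → F2)) :=
  let left := wordsOn I (p₁ / 2)
  let right := wordsOn Iᶜ (p₁ - p₁ / 2)
  let level1 := fun c : Fin κ → F2 => merge n B l₁ c (fun _ => True) left right
  let level2 := fun c : Fin κ → F2 =>
    merge n B l₂ b (fun x => hammingNorm x = p₂) (level1 c).val (level1 (b - c)).val
  let final := merge n B κ 0 (fun x => hammingNorm x = w) (level2 a).val (level2 a').val
  { val := final.val
    steps := (level1 a).steps + (level1 (b - a)).steps + (level1 a').steps + (level1 (b - a')).steps
      + (level2 a).steps + (level2 a').steps + final.steps }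

end ParityChecks

/-- The procedure that returns the set of all parity-checks of `C` of weight `w` on `𝒩 = 𝒫ᶜ`.
The restrictions to `𝒩` of the parity-checks of `C` are the parity-checks of the shortened code
`C^𝒩` of dimension `k - s`.  The procedure consists of `n ^ c` runs of the representation
technique, each with a fresh random generator matrix `B` of `C^𝒩`, a fresh random balanced
partition and fresh random prescribed syndromes. -/
def parityCheckEquations {n : ℕ} (c : ℕ) (q : Params) (C : Submodule F2 (Fin n → F2))
    (P : Finset (Fin n)) : Timed (Finset (Fin n → F2)) where
  val := (dualWords C).filter fun h => hammingNorm (restr Pᶜ h) = q.w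
  steps := (n : ℝ) ^ c *
    𝔼 B ∈ (Finset.univ.filter fun B : Matrix (Fin (q.k - q.s)) ↥Pᶜ F2 =>
        rowCode B = shortened C Pᶜ),
    𝔼 I ∈ Finset.powersetCard (Fintype.card ↥Pᶜ / 2) (Finset.univ : Finset ↥Pᶜ),
    𝔼 a : Fin (q.k - q.s) → F2, 𝔼 a' : Fin (q.k - q.s) → F2, 𝔼 b : Fin (q.k - q.s) → F2,
      ((n : ℝ) ^ 3 + (parityCheckRun n q.p₁ q.p₂ q.l₁ q.l₂ q.w B I a a' b).steps)

/-! ### Dumer's information set decoder -/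

section Dumer

variable {ι : Type} [Fintype ι] {M : Type} [AddCommGroup M] [Module F2 M]

/-- The vectors supported on `J`. -/
def supportedOn (J : Finset ι) : Submodule F2 (ι → F2) where
  carrier := {x | ∀ i, i ∉ J → x i = 0}
  add_mem' := by
    intro x y hx hy i hi
    simp [hx i hi, hy i hi]
  zero_mem' := by
    intro i _
    rfl
  smul_mem' := by
    intro a x hx i hi
    simp [hx i hi]

/-- One run of Dumer's decoder for the equation `φ x = y` of unknown `x` of weight `t`, with window
`K`, first half window `K₁ ⊆ K` and weight `p` on the window.  Gaussian elimination removes the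
unknowns outside of the window; if this is not possible because the columns outside of the window
are dependent, the run stops.  Otherwise all pairs `(x₁, x₂)` of vectors of weights `p / 2` and
`p - p / 2` on the two half windows that satisfy the equations left by the elimination are found by
sorting, and each of them is completed to a solution `x`, which is kept if its weight is `t`. -/
def dumerRun (n p t : ℕ) (φ : (ι → F2) →ₗ[F2] M) (y : M) (K K₁ : Finset ι) :
    Timed (Finset (ι → F2)) :=
  let A := wordsOn K₁ (p / 2)
  let A' := wordsOn (K \ K₁) (p - p / 2)
  let pairs := (A ×ˢ A').filter fun z => φ (z.1 + z.2) - y ∈ (supportedOn Kᶜ).map φ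
  if Disjoint (supportedOn Kᶜ) (LinearMap.ker φ) then
    { val := Finset.univ.filter fun x => hammingNorm x = t ∧ φ x = y ∧
        ∃ z ∈ pairs, ∀ i ∈ K, x i = z.1 i + z.2 i
      steps := (n : ℝ) ^ 3 + (n : ℝ) ^ 2 * ((A.card : ℝ) + A'.card + pairs.card) }
  else { val := ∅, steps := (n : ℝ) ^ 3 }

/-- Dumer's decoder, which returns all the solutions `x` of weight `t` to `φ x = y`.  It performs
`n ^ c` times as many runs as the inverse of the probability
`binom(L,p) binom(m-L,t-p) / binom(m,t)` that a random window of length `L` contains exactly `p` of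
the `t` nonzero positions of a solution, with fresh random windows and half windows. -/
def decodeDumer (n c L p t : ℕ) (φ : (ι → F2) →ₗ[F2] M) (y : M) : Timed (Finset (ι → F2)) where
  val := Finset.univ.filter fun x => hammingNorm x = t ∧ φ x = y
  steps := (n : ℝ) ^ c *
    (⌈((Fintype.card ι).choose t : ℝ) /
      ((L.choose p : ℝ) * ((Fintype.card ι - L).choose (t - p) : ℝ))⌉₊ : ℝ) *
    𝔼 K ∈ Finset.powersetCard L (Finset.univ : Finset ι),
    𝔼 K₁ ∈ Finset.powersetCard (L / 2) K, (dumerRun n p t φ y K K₁).steps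

end Dumer

/-! ### The double-RLPN decoder -/

/-- Fast Fourier (Walsh-Hadamard) transform, one step per addition; the result is
`x ↦ ∑ v, f v * (-1) ^ ⟨x, v⟩`. -/
def fft : (k : ℕ) → ((Fin k → F2) → ℤ) → Timed ((Fin k → F2) → ℤ)
  | 0, f => { val := f, steps := 1 }
  | k + 1, f =>
    let f₀ := fft k fun v => f (Fin.cons 0 v)
    let f₁ := fft k fun v => f (Fin.cons 1 v)
    { val := fun x => f₀.val (Fin.tail x) + sign (x 0) * f₁.val (Fin.tail x)
      steps := f₀.steps + f₁.steps + 2 ^ (k + 1) }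

/-- Cost of the decoding procedure of the auxiliary codes, for one length and one set `𝒫`: the
(mean) number of steps for the auxiliary code of generator matrix `G` and the word `z`. -/
abbrev DecCost (n : ℕ) (q : Params) :=
  (P : Finset (Fin n)) → Matrix (Fin q.kaux) P F2 → (P → F2) → ℝ

/-- Decoding of the auxiliary code: all the messages `m` such that the codeword `m G` is at distance
`t_aux` from `z`. -/
def decodeAux {n : ℕ} {q : Params} (cost : DecCost n q) (P : Finset (Fin n))
    (G : Matrix (Fin q.kaux) P F2) (z : P → F2) : Timed (Finset (Fin q.kaux → F2)) where
  val := Finset.univ.filter fun m => hammingNorm (z + m ᵥ* G) = q.taux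
  steps := cost P G z

/-- The LPN samples: all pairs `(h, m)` where `h` is a parity-check returned by
`parityCheckEquations` and `m G` is an auxiliary codeword at distance `t_aux` from `h_𝒫`. -/
def lpnSamples {n : ℕ} {q : Params} (c : ℕ) (cost : DecCost n q)
    (C : Submodule F2 (Fin n → F2)) (P : Finset (Fin n)) (G : Matrix (Fin q.kaux) P F2) :
    Timed (Finset ((Fin n → F2) × (Fin q.kaux → F2))) :=
  let W := parityCheckEquations c q C P
  let dec := fun h : Fin n → F2 => decodeAux cost P G (restr P h)
  { val := W.val.biUnion fun h => (dec h).val.image fun m => (h, m)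
    steps := W.steps +
      ∑ h ∈ W.val, ((n : ℝ) ^ 2 + (dec h).steps + (n : ℝ) ^ 2 * ((dec h).val.card : ℝ)) }

/-- FFT decoding: tabulates `f(m) = ∑_{(h,m) ∈ H} (-1)^⟨y,h⟩`, computes its Fourier transform and
returns the set of candidates, where it is at least `δ H̃ / 2`. -/
def fftDecode {n : ℕ} (q : Params) (y : Fin n → F2)
    (H : Finset ((Fin n → F2) × (Fin q.kaux → F2))) : Timed (Finset (Fin q.kaux → F2)) :=
  let f := fun m : Fin q.kaux → F2 => ∑ a ∈ H.filter (fun a => a.2 = m), sign (y ⬝ᵥ a.1)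
  let F := fft q.kaux f
  { val := Finset.univ.filter fun x => q.bias n / 2 * q.samples n ≤ (F.val x : ℝ)
    steps := (n : ℝ) ^ 2 * ((H.card : ℝ) + 2 ^ q.kaux) + (n : ℝ) ^ 2 * F.steps
      + (n : ℝ) ^ 2 * 2 ^ q.kaux }

/-- Given a candidate `v` for `e_𝒫`, all the vectors `z` of weight `u` indexed by `𝒩` such that
`y - (v, z)` is a codeword of `C`. -/
def solveSubProblem {n : ℕ} (c : ℕ) (q : Params) (C : Submodule F2 (Fin n → F2))
    (P : Finset (Fin n)) (y : Fin n → F2) (v : P → F2) : Timed (Finset (↥Pᶜ → F2)) :=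
  decodeDumer n c q.Lb q.pb q.u (C.mkQ ∘ₗ ext Pᶜ) (C.mkQ (y - ext P v))

/-- Recovering `e`: for every tuple of candidates `(s_1, …, s_{N_aux})`, all the vectors `v` of
weight `t - u` with `G_j v = s_j` for all `j` are computed, and for each of them the
corresponding sub-problem is solved. -/
def recoverError {n : ℕ} {Naux : ℕ} (c : ℕ) (q : Params) (C : Submodule F2 (Fin n → F2))
    (P : Finset (Fin n)) (y : Fin n → F2) (G : Fin Naux → Matrix (Fin q.kaux) P F2)
    (S : Fin Naux → Finset (Fin q.kaux → F2)) : Timed (Finset (Fin n → F2)) :=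
  let first := fun a : Fin Naux → Fin q.kaux → F2 =>
    decodeDumer n c q.La q.pa (q.t - q.u) (LinearMap.pi fun j => (G j).mulVecLin) a
  let second := fun v : P → F2 => solveSubProblem c q C P y v
  { val := (Fintype.piFinset S).biUnion fun a => (first a).val.biUnion fun v =>
      (second v).val.image fun z => ext P v + ext Pᶜ z
    steps := ∑ a ∈ Fintype.piFinset S, ((n : ℝ) ^ 2 + (first a).steps +
      ∑ v ∈ (first a).val, ((n : ℝ) ^ 3 + (second v).steps)) }

/-- The coins of one iteration: the set `𝒫 = 𝒩ᶜ` and the generator matrices of the auxiliary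
codes. -/
abbrev Coins (n Naux : ℕ) (q : Params) :=
  Σ P : Finset (Fin n), (Fin Naux → Matrix (Fin q.kaux) P F2)

/-- The coins are uniform in this set: `𝒫` is uniform among the sets of size `s`, and the auxiliary
codes are independent and uniform among the `[s, k_aux]` codes. -/
def coins (n Naux : ℕ) (q : Params) : Finset (Coins n Naux q) :=
  (Finset.powersetCard q.s Finset.univ).sigma fun P =>
    Fintype.piFinset fun _ => genMatrices q.kaux P

/-- One iteration of the double-RLPN decoder; a set `𝒫` such that `C_𝒫` is not of full dimension
`s` is discarded. -/
def iteration {n Naux : ℕ} {q : Params} (c : ℕ) (cost : DecCost n q)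
    (C : Submodule F2 (Fin n → F2)) (y : Fin n → F2) (r : Coins n Naux q) :
    Timed (Finset (Fin n → F2)) :=
  if Module.finrank F2 (punctured C r.1) = q.s then
    let H := fun j : Fin Naux => lpnSamples c cost C r.1 (r.2 j)
    let S := fun j : Fin Naux => fftDecode q y (H j).val
    let out := recoverError c q C r.1 y r.2 fun j => (S j).val
    { val := out.val
      steps := (n : ℝ) ^ 3 + ∑ j, ((H j).steps + (S j).steps) + out.steps }
  else { val := ∅, steps := (n : ℝ) ^ 3 }

/-- The number of iterations `N_iter`: a polynomial factor times `1 / P_succ`. -/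
def numIter (n c : ℕ) (q : Params) : ℕ := ⌈(n : ℝ) ^ c / q.succ n⌉₊

/-- The double-RLPN decoder on the code `C` and the received word `y`, with the coins `r`. -/
def decoder {n Naux : ℕ} {q : Params} (c : ℕ) (cost : DecCost n q)
    (C : Submodule F2 (Fin n → F2)) (y : Fin n → F2)
    (r : Fin (numIter n c q) → Coins n Naux q) : Timed (Finset (Fin n → F2)) where
  val := Finset.univ.biUnion fun i => (iteration c cost C y (r i)).val
  steps := ∑ i, (iteration c cost C y (r i)).steps

/-- The expected running time of the decoder on `y = m G + e`, for a fixed error `e`, a uniform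
`[n, k]`-code of generator matrix `G`, a uniform codeword `m G`, and independent uniform coins for
the iterations. -/
def expectedTime {n : ℕ} (Naux c : ℕ) (q : Params) (cost : DecCost n q) (e : Fin n → F2) : ℝ :=
  𝔼 G ∈ genMatrices q.k (Fin n), 𝔼 m : Fin q.k → F2,
    𝔼 r ∈ Fintype.piFinset (fun _ : Fin (numIter n c q) => coins n Naux q),
      (decoder c cost (rowCode G) (m ᵥ* G + e) r).steps

/-! ### The standing assumptions of the analysis -/

/-- The auxiliary decoding procedure has expected running time `2^{n σ o(1)}`, for every input word
and on average over the auxiliary code. -/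
def DecodeIsEfficient (σ : ℝ) (q : ℕ → Params) (cost : (n : ℕ) → DecCost n (q n)) : Prop :=
  (∀ n P G z, 0 ≤ cost n P G z) ∧
  ∃ ε : ℕ → ℝ, Tendsto ε atTop (𝓝 0) ∧ ∀ᶠ n in atTop,
    ∀ P : Finset (Fin n), P.card = (q n).s → ∀ z : P → F2,
      𝔼 G ∈ genMatrices (q n).kaux P, cost n P G z ≤ (2 : ℝ) ^ ((n : ℝ) * σ * ε n)

/-- The constraint on the integer parameters: for some constant `α > 0`,
`H̃ = ω(n^{α+8} / δ²)`, `binom(n-s,w) binom(s,t_aux) / 2^k = O(n^α)` and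
`binom(s,t_aux) / 2^{s-k_aux} = O(n^α)`. -/
def ParameterConstraint (q : ℕ → Params) : Prop :=
  ∃ α : ℝ, 0 < α ∧
    Tendsto (fun n : ℕ => (q n).samples n * (q n).bias n ^ 2 / (n : ℝ) ^ (α + 8)) atTop atTop ∧
    (fun n : ℕ => ((n - (q n).s).choose (q n).w : ℝ) * ((q n).s.choose (q n).taux : ℝ) /
      2 ^ (q n).k) =O[atTop] (fun n : ℕ => (n : ℝ) ^ α) ∧
    (fun n : ℕ => ((q n).s.choose (q n).taux : ℝ) / 2 ^ ((q n).s - (q n).kaux))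
      =O[atTop] (fun n : ℕ => (n : ℝ) ^ α)

/-- Probability of an event under the uniform distribution on a finite set. -/
def prob {α : Type} (Ω : Finset α) (E : α → Prop) : ℝ := ((Ω.filter E).card : ℝ) / Ω.card

/-- Sample space for the weight distributions: `C` (through its generator matrix) is uniform among
the `[n, k]`-codes such that `C_𝒫` is of dimension `s`, the auxiliary code is uniform among the
`[s, k_aux]`-codes, and `x` is uniform in `F_2^s` outside of the coset `C_aux^⊥ + e_𝒫`. -/
def weightSpace {n : ℕ} (q : Params) (P : Finset (Fin n)) (e : Fin n → F2) :
    Finset (Matrix (Fin q.k) (Fin n) F2 × Matrix (Fin q.kaux) P F2 × (P → F2)) :=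
  Finset.univ.filter fun a =>
    a.1 ∈ genMatrices q.k (Fin n) ∧ Module.finrank F2 (punctured (rowCode a.1) P) = q.s ∧
    a.2.1 ∈ genMatrices q.kaux P ∧ a.2.1 *ᵥ a.2.2 ≠ a.2.1 *ᵥ restr P e

/-- The number `N_{i,j}` of pairs `(r, c)` in `(x + C_aux^⊥) × C^𝒩` such that `|r| = j` and
`|(r + e_𝒫) R + e_𝒩 + c| = i`.  As `{(r + e_𝒫, (r + e_𝒫) R + c)}` is the set of the codewords of
`C`, these pairs correspond to the words `z` of `C + e` such that `z_𝒫 ∈ x + C_aux^⊥`,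
`|z_𝒫| = j` and `|z_𝒩| = i`. -/
def numWords {n : ℕ} {q : Params} (P : Finset (Fin n)) (e : Fin n → F2)
    (a : Matrix (Fin q.k) (Fin n) F2 × Matrix (Fin q.kaux) P F2 × (P → F2)) (i j : ℕ) : ℕ :=
  (Finset.univ.filter fun z : Fin n → F2 =>
    z - e ∈ rowCode a.1 ∧ a.2.1 *ᵥ restr P z = a.2.1 *ᵥ a.2.2 ∧
    hammingNorm (restr P z) = j ∧ hammingNorm (restr Pᶜ z) = i).card

/-- The set `𝒜` of the pairs `(i, j)` in `[0, n-s] × [0, s]` such that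
`|K_w(u) K_{t_aux}(t-u) / (K_w(i) K_{t_aux}(j))| ≤ n^{3.2}`. -/
def dominantPairs (n : ℕ) (q : Params) : Finset (ℕ × ℕ) :=
  (Finset.range (n - q.s + 1) ×ˢ Finset.range (q.s + 1)).filter fun a =>
    |(q.kk n q.u (q.t - q.u) : ℝ)| ≤ (n : ℝ) ^ (3.2 : ℝ) * |(q.kk n a.1 a.2 : ℝ)|

/-- The conjecture on the weight distributions: for all complementary sets `𝒫`, `𝒩` of sizes `s`,
`n - s` and all errors `e` of weight `t`, up to a factor polynomial in `n`,
`P(∑ K_w(i) K_{t_aux}(j) N_{i,j} ≥ K_w(u) K_{t_aux}(t-u) / 2)` is at most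
`max_{(i,j) ∈ 𝒜} P(N_{i,j} ≠ 0) + 2^{-n}`. -/
def BiasConjecture (q : ℕ → Params) : Prop :=
  ∃ b d : ℕ, ∀ᶠ n in atTop, ∀ P : Finset (Fin n), P.card = (q n).s →
    ∀ e : Fin n → F2, hammingNorm e = (q n).t → ∃ ij ∈ dominantPairs n (q n),
      prob (weightSpace (q n) P e) (fun a =>
          (1 / 2 : ℝ) * (q n).kk n (q n).u ((q n).t - (q n).u) ≤
            ((∑ j ∈ Finset.range ((q n).s + 1), ∑ i ∈ Finset.range (n - (q n).s + 1),
              (q n).kk n i j * (numWords P e a i j : ℤ) : ℤ) : ℝ)) ≤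
        b * (n : ℝ) ^ d *
          (prob (weightSpace (q n) P e) (fun a => numWords P e a ij.1 ij.2 ≠ 0) + 1 / 2 ^ n)

/-! ### Asymptotic exponents -/

/-- The binary entropy in bits. -/
def h₂ (x : ℝ) : ℝ := Real.binEntropy x / Real.log 2

/-- The relative position `1/2 - √(ω(1-ω))` of the first root of the Krawtchouk polynomials of
relative degree `ω`. -/
def firstRoot (ω : ℝ) : ℝ := 1 / 2 - √(ω * (1 - ω))

/-- The exponent `κ̃(τ, ω)` of the value at `τ n` of the Krawtchouk polynomial of order `n` and
degree `ω n`. -/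
def kappa (τ ω : ℝ) : ℝ :=
  if τ ≤ firstRoot ω then
    let z := (1 - 2 * τ - √((1 - 2 * τ) ^ 2 - 4 * ω * (1 - ω))) / (2 * (1 - ω))
    τ * Real.logb 2 (1 - z) + (1 - τ) * Real.logb 2 (1 + z) - ω * Real.logb 2 z
  else (1 - h₂ τ + h₂ ω) / 2

/-- Admissible relative internal parameters `(λ, ω)` of Dumer's decoder for a code of rate `R` and
the relative distance `τ`. -/
def dumerRegion (R τ : ℝ) : Set (ℝ × ℝ) :=
  {x | 0 ≤ x.1 ∧ x.1 ≤ 1 - R ∧ max (R + x.1 + τ - 1) 0 ≤ x.2 ∧ x.2 ≤ min τ (R + x.1)}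

/-- Exponent of Dumer's decoder with the relative internal parameters `x = (λ, ω)`. -/
def dumerExponent (R τ : ℝ) (x : ℝ × ℝ) : ℝ :=
  (h₂ τ - (1 - R - x.1) * h₂ ((τ - x.2) / (1 - R - x.1)) - (R + x.1) * h₂ (x.2 / (R + x.1))) +
    max ((R + x.1) / 2 * h₂ (x.2 / (R + x.1))) ((R + x.1) * h₂ (x.2 / (R + x.1)) - x.1)

/-- The exponent `α_{ISD-Dumer}(R, τ)`. -/
def alphaDumer (R τ : ℝ) : ℝ := sInf (dumerExponent R τ '' dumerRegion R τ)

/-- Admissible relative internal parameters `(π₁, π₂, λ₁, λ₂)` of the search for all parity-checks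
of relative weight `ω` of a code of rate `R`. -/
def bjmmRegion (R ω : ℝ) : Set (ℝ × ℝ × ℝ × ℝ) :=
  {x | ∃ π₁ π₂ l₁ l₂ : ℝ, x = (π₁, π₂, l₁, l₂) ∧ 0 ≤ π₁ ∧ 0 ≤ π₂ ∧ 0 ≤ l₁ ∧ 0 ≤ l₂ ∧
    l₁ ≤ l₂ ∧ l₂ ≤ R ∧ π₁ ≤ π₂ ∧ π₂ ≤ ω ∧ π₂ ≤ 2 * π₁ ∧ ω ≤ 2 * π₂ ∧ π₂ ≤ l₁ ∧ ω ≤ l₂ ∧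
    l₁ = π₂ + (1 - π₂) * h₂ ((π₁ - π₂ / 2) / (1 - π₂)) ∧
    l₂ = ω + (1 - ω) * h₂ ((π₂ - ω / 2) / (1 - ω))}

/-- Exponent of the search for parity-checks with the relative internal parameters
`x = (π₁, π₂, λ₁, λ₂)`. -/
def bjmmExponent (R : ℝ) (x : ℝ × ℝ × ℝ × ℝ) : ℝ :=
  let l₁ := x.2.2.1
  let l₂ := x.2.2.2
  let ν₀ := h₂ x.1 / 2
  let ν₁ := h₂ x.1 - l₁
  let ν₂ := h₂ x.2.1 - l₂
  max (max (max ν₀ (2 * ν₀ - l₁)) (max ν₁ (2 * ν₁ - (l₂ - l₁)))) (max ν₂ (2 * ν₂ - (R - l₂)))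

/-- The exponent `α_eq(R, ω)` of the search for all parity-checks of relative weight `ω` of a code
of rate `R`. -/
def alphaEq (R ω : ℝ) : ℝ := sInf (bjmmExponent R '' bjmmRegion R ω)

/-- The relative parameters (limits of `k/n, t/n, s/n, k_aux/n, t_aux/n, w/n, u/n`). -/
structure Rel where
  R : ℝ
  τ : ℝ
  σ : ℝ
  Raux : ℝ
  τaux : ℝ
  ω : ℝ
  μ : ℝ

namespace Rel

variable (a : Rel)

/-- Exponent of the inverse of the success probability of one iteration. -/
def succExp : ℝ :=
  h₂ a.τ - a.σ * h₂ ((a.τ - a.μ) / a.σ) - (1 - a.σ) * h₂ (a.μ / (1 - a.σ))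

/-- Exponent of the number of LPN samples. -/
def samplesExp : ℝ :=
  (1 - a.σ) * h₂ (a.ω / (1 - a.σ)) + a.σ * h₂ (a.τaux / a.σ) - (a.R - a.Raux)

/-- Exponent of the bias `δ`. -/
def biasExp : ℝ :=
  a.σ * (kappa ((a.τ - a.μ) / a.σ) (a.τaux / a.σ) - h₂ (a.τaux / a.σ)) +
    (1 - a.σ) * (kappa (a.μ / (1 - a.σ)) (a.ω / (1 - a.σ)) - h₂ (a.ω / (1 - a.σ)))

/-- The relative pairs `(η, ζ)` that may produce false candidates. -/
def dominant : Set (ℝ × ℝ) :=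
  {x | 0 ≤ x.1 ∧ x.1 ≤ 1 - a.σ ∧ 0 ≤ x.2 ∧ x.2 ≤ a.σ ∧
    a.σ * (kappa ((a.τ - a.μ) / a.σ) (a.τaux / a.σ) - kappa (x.2 / a.σ) (a.τaux / a.σ)) +
      (1 - a.σ) * (kappa (a.μ / (1 - a.σ)) (a.ω / (1 - a.σ)) -
        kappa (x.1 / (1 - a.σ)) (a.ω / (1 - a.σ))) ≤ 0}

/-- Exponent of the number of candidates. -/
def candidatesExp : ℝ :=
  max (sSup ((fun x : ℝ × ℝ =>
    a.σ * h₂ (x.2 / a.σ) + (1 - a.σ) * h₂ (x.1 / (1 - a.σ)) - (1 - a.R)) '' a.dominant)) 0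

/-- Exponent of the number of solutions of the decoding problem on `𝒫`. -/
def isdSolutionsExp (Naux : ℕ) : ℝ :=
  max (a.σ * h₂ ((a.τ - a.μ) / a.σ) - Naux * a.Raux) 0

/-- Exponent of the treatment of one tuple of candidates. -/
def isdExp (Naux : ℕ) : ℝ :=
  max (a.σ * alphaDumer (1 - Naux * a.Raux / a.σ) ((a.τ - a.μ) / a.σ))
    (a.isdSolutionsExp Naux +
      (1 - a.σ) * alphaDumer ((a.R - a.σ) / (1 - a.σ)) (a.μ / (1 - a.σ)))

/-- The complexity exponent of the double-RLPN decoder. -/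
def exponent (Naux : ℕ) : ℝ :=
  a.succExp + max (max ((1 - a.σ) * alphaEq ((a.R - a.σ) / (1 - a.σ)) (a.ω / (1 - a.σ)))
    a.samplesExp) (max a.Raux (Naux * a.candidatesExp + a.isdExp Naux))

/-- The constraints on the relative parameters. -/
structure Admissible : Prop where
  R_lt : a.R < 1
  σ_pos : 0 < a.σ
  Raux_nonneg : 0 ≤ a.Raux
  τaux_nonneg : 0 ≤ a.τaux
  ω_nonneg : 0 ≤ a.ω
  μ_nonneg : 0 ≤ a.μ
  σ_le : a.σ ≤ a.R
  le_μ : a.τ - a.σ ≤ a.μ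
  μ_le : a.μ ≤ a.τ
  ω_le : a.ω ≤ 1 - a.σ
  samples_ge : -2 * a.biasExp ≤ a.samplesExp
  checks_le : (1 - a.σ) * h₂ (a.ω / (1 - a.σ)) + a.σ * h₂ (a.τaux / a.σ) - a.R ≤ 0
  aux_le : a.σ * h₂ (a.τaux / a.σ) - (a.σ - a.Raux) ≤ 0
  /-- the formula for `κ̃` is meant for relative degrees at most `1/2` -/
  ω_le_half : a.ω ≤ (1 - a.σ) / 2
  τaux_le_half : a.τaux ≤ a.σ / 2

end Rel

/-- The integer parameters have the given relative limits. -/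
structure HasLimits (q : ℕ → Params) (a : Rel) : Prop where
  k : Tendsto (fun n => ((q n).k : ℝ) / n) atTop (𝓝 a.R)
  t : Tendsto (fun n => ((q n).t : ℝ) / n) atTop (𝓝 a.τ)
  s : Tendsto (fun n => ((q n).s : ℝ) / n) atTop (𝓝 a.σ)
  kaux : Tendsto (fun n => ((q n).kaux : ℝ) / n) atTop (𝓝 a.Raux)
  taux : Tendsto (fun n => ((q n).taux : ℝ) / n) atTop (𝓝 a.τaux)
  w : Tendsto (fun n => ((q n).w : ℝ) / n) atTop (𝓝 a.ω)
  u : Tendsto (fun n => ((q n).u : ℝ) / n) atTop (𝓝 a.μ)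

/-- When one of the two evaluation points `u` and `t - u` lies (asymptotically) at or beyond the
first root of the corresponding Krawtchouk polynomial, where this polynomial oscillates, its value
is of the order of magnitude given by `κ̃`. -/
structure KrawtchoukMagnitude (q : ℕ → Params) (a : Rel) : Prop where
  on_N : firstRoot (a.ω / (1 - a.σ)) ≤ a.μ / (1 - a.σ) →
    Tendsto (fun n : ℕ =>
        Real.logb 2 |(krawtchouk (n - (q n).s) (q n).w (q n).u : ℝ)| / n) atTop
      (𝓝 ((1 - a.σ) * kappa (a.μ / (1 - a.σ)) (a.ω / (1 - a.σ))))
  on_P : firstRoot (a.τaux / a.σ) ≤ (a.τ - a.μ) / a.σ →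
    Tendsto (fun n : ℕ =>
        Real.logb 2 |(krawtchouk (q n).s (q n).taux ((q n).t - (q n).u) : ℝ)| / n) atTop
      (𝓝 (a.σ * kappa ((a.τ - a.μ) / a.σ) (a.τaux / a.σ)))

/-- The internal parameters of the search for parity-checks and of the two information set decoders
have relative limits that are optimal in the definitions of their exponents. -/
structure OptimalInternal (Naux : ℕ) (q : ℕ → Params) (a : Rel) : Prop where
  parityChecks : ∃ x ∈ bjmmRegion ((a.R - a.σ) / (1 - a.σ)) (a.ω / (1 - a.σ)),
    bjmmExponent ((a.R - a.σ) / (1 - a.σ)) x =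
      alphaEq ((a.R - a.σ) / (1 - a.σ)) (a.ω / (1 - a.σ)) ∧
    Tendsto (fun n : ℕ => ((q n).p₁ : ℝ) / ((n - (q n).s : ℕ) : ℝ)) atTop (𝓝 x.1) ∧
    Tendsto (fun n : ℕ => ((q n).p₂ : ℝ) / ((n - (q n).s : ℕ) : ℝ)) atTop (𝓝 x.2.1) ∧
    Tendsto (fun n : ℕ => ((q n).l₁ : ℝ) / ((n - (q n).s : ℕ) : ℝ)) atTop (𝓝 x.2.2.1) ∧
    Tendsto (fun n : ℕ => ((q n).l₂ : ℝ) / ((n - (q n).s : ℕ) : ℝ)) atTop (𝓝 x.2.2.2)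
  isd_on_P : ∃ x ∈ dumerRegion (1 - Naux * a.Raux / a.σ) ((a.τ - a.μ) / a.σ),
    dumerExponent (1 - Naux * a.Raux / a.σ) ((a.τ - a.μ) / a.σ) x =
      alphaDumer (1 - Naux * a.Raux / a.σ) ((a.τ - a.μ) / a.σ) ∧
    Tendsto (fun n => ((q n).La : ℝ) / (q n).s) atTop (𝓝 (1 - Naux * a.Raux / a.σ + x.1)) ∧
    Tendsto (fun n => ((q n).pa : ℝ) / (q n).s) atTop (𝓝 x.2)
  isd_on_N : ∃ x ∈ dumerRegion ((a.R - a.σ) / (1 - a.σ)) (a.μ / (1 - a.σ)),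
    dumerExponent ((a.R - a.σ) / (1 - a.σ)) (a.μ / (1 - a.σ)) x =
      alphaDumer ((a.R - a.σ) / (1 - a.σ)) (a.μ / (1 - a.σ)) ∧
    Tendsto (fun n : ℕ => ((q n).Lb : ℝ) / ((n - (q n).s : ℕ) : ℝ)) atTop
      (𝓝 ((a.R - a.σ) / (1 - a.σ) + x.1)) ∧
    Tendsto (fun n : ℕ => ((q n).pb : ℝ) / ((n - (q n).s : ℕ) : ℝ)) atTop (𝓝 x.2)

end DoubleRLPN

end

/-!
The decoder performs `numIter` iterations with independent coins, so that its expected running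
time is `numIter`, of exponent `π`, times the mean cost of one iteration (`expectedTime_le`). The
mean cost is bounded for each fixed set `𝒫` and each fixed error (`expect_iteration_le`), by a sum
of explicit expressions in binomial coefficients, powers of two and Krawtchouk polynomials. The
exponents of these are computed with the calculus of `ExpBound`, in which the binomial
coefficients contribute the homogeneous entropy `homEntropy`, and their maximum is the one of the
theorem (`eventually_expectedTime_le`). The bounds do not depend on the error, which gives the
uniformity.

*Random codes.* The law of a random code is invariant under the automorphisms of the space, so
that `r` independent vectors are orthogonal to a random `[n, k]`-code with probability at most
`2 ^ (-kr)`, and are contained in it with probability at most `2 ^ (-(n - k) r)`. The case `r = 1`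
bounds mean values. The moment method with `r = l` (`prob_card_gt_le`) shows that a number of
parity-checks, codewords or collisions exceeds its mean value by an exponential factor `2 ^ (nγ)`
only with a probability exponentially small in `nγl`, up to a factor `8 ^ n` for a union over all
windows and words. Choosing `l` large compared with `1 / γ`, the exceptional codes do not matter
even if each iteration is charged its worst-case cost on them.

*Parity-checks and samples.* The prescribed partial syndromes of the representation technique are
uniform, which gives the mean sizes of its lists, and the collisions at its last level are the
pairs whose sum is the restriction of a parity-check (`expect_parityCheckEquations_le`). The
parity-checks themselves have no larger exponent than the search, by the subadditivity of the
entropy (`entropy_subadditive`); each has few neighbours in a random auxiliary code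
(`expect_card_decodeAux_le`).

*Candidates.* The mean number of parity-checks near a given word has exponent at most `0` by
assumption. Parseval's identity for the Fourier transform then bounds the sum of the squares of
the scores of the candidates by `2 ^ k_aux` times the number of samples, and as each candidate
contributes the square of the threshold `δ H̃ / 2`, there are about `2 ^ k_aux / (δ ^ 2 H̃)`
candidates at most (`card_candidates_mul_le`), provided that `δ > 0`. The size of `δ` is known:
beyond the first root of the Krawtchouk polynomial by assumption, and before it since the
quotients of consecutive values dominate the larger root of the characteristic equation of their
recurrence (`krawtchouk_ratio`, `le_krawtchouk`). That bound on the candidates is covered by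
`ν_candidates`, because pairs of weights above half of the lengths, where the exponent `kappa` is
an explicit entropy, already belong to the set over which the supremum is taken
(`Rel.Admissible.le_candidatesExp`).

*Negative bias.* If `δ < 0`, the threshold is negative, and nothing but `2 ^ k_aux` bounds the
number of candidates. It is here that the conjecture enters. By Poisson's summation formula
(`two_pow_mul_fft_eq`) the event of the conjecture says that a score lies above the threshold, and
the mean-square bound shows that this has probability at least `1 / 2` if `δ ^ 2 H̃` is
exponentially large. So by the conjecture a dominant pair of weights occurs with non-negligible
probability; but Parseval's bound for the Krawtchouk polynomials (`krawtchouk_sq_mul_choose_le`)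
and the union bound make this probability at most polynomial in `n` divided by `δ ^ 2 H̃`
(`bias_sq_mul_samples_le`). Hence the exponent of `δ ^ 2 H̃` vanishes
(`gain_nonpos_of_frequently_neg`), `R_aux ≤ ν_candidates`, and the trivial bound suffices
(`exists_candidates_bound`).

*Information set decoding.* The colliding pairs of Dumer's decoder have differences that can be
completed outside of the window to elements of a random subspace, and the solutions on `𝒫` have
differences that are orthogonal to all the auxiliary codes; both numbers are concentrated by the
moment method (`card_colliding_le`, `decodeDumer_card_le`), and the exponents add up to `α_ISD`
(`exists_isd_exponents`).
-/

noncomputable section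

namespace DoubleRLPN

/-! ### Uniform probability on finite sets -/

section Probability

variable {α β : Type}

lemma prob_eq_card (Ω : Finset α) (E : α → Prop) [DecidablePred E] :
    prob Ω E = ((Ω.filter E).card : ℝ) / Ω.card := by
  unfold prob
  congr!

lemma prob_nonneg (Ω : Finset α) (E : α → Prop) : 0 ≤ prob Ω E := by
  unfold prob; positivity

lemma prob_eq_zero {Ω : Finset α} {E : α → Prop} (h : ∀ a ∈ Ω, ¬ E a) : prob Ω E = 0 := by
  unfold prob
  rw [Finset.filter_false_of_mem h]
  simp

lemma prob_mono {Ω : Finset α} {E F : α → Prop} (h : ∀ a ∈ Ω, E a → F a) :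
    prob Ω E ≤ prob Ω F := by
  unfold prob
  refine div_le_div_of_nonneg_right ?_ (Nat.cast_nonneg _)
  exact_mod_cast Finset.card_le_card fun a ha => by
    rw [Finset.mem_filter] at ha ⊢
    exact ⟨ha.1, h a ha.1 ha.2⟩

lemma prob_eq_expect (Ω : Finset α) (E : α → Prop) :
    prob Ω E = 𝔼 a ∈ Ω, (if E a then (1 : ℝ) else 0) := by
  rw [Finset.expect_eq_sum_div_card, Finset.sum_boole, prob]

lemma prob_exists_le {Ω : Finset α} (I : Finset β) (E : β → α → Prop) {p : ℝ}
    (h : ∀ i ∈ I, prob Ω (E i) ≤ p) :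
    prob Ω (fun a => ∃ i ∈ I, E i a) ≤ I.card * p := by
  have h1 : ((Ω.filter fun a => ∃ i ∈ I, E i a).card : ℝ) ≤
      ∑ i ∈ I, ((Ω.filter (E i)).card : ℝ) := by
    have : (Ω.filter fun a => ∃ i ∈ I, E i a) = I.biUnion fun i => Ω.filter (E i) := by
      ext a; simp only [Finset.mem_filter, Finset.mem_biUnion]; tauto
    rw [this]
    exact_mod_cast Finset.card_biUnion_le
  calc prob Ω (fun a => ∃ i ∈ I, E i a) ≤ (∑ i ∈ I, ((Ω.filter (E i)).card : ℝ)) / Ω.card := by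
        exact div_le_div_of_nonneg_right ((le_of_eq (by congr!)).trans h1) (Nat.cast_nonneg _)
    _ = ∑ i ∈ I, prob Ω (E i) := by rw [Finset.sum_div]; rfl
    _ ≤ ∑ i ∈ I, p := Finset.sum_le_sum h
    _ = I.card * p := by simp

lemma expect_card_filter (Ω : Finset α) (B : Finset β) (E : α → β → Prop) :
    𝔼 a ∈ Ω, ((B.filter (E a)).card : ℝ) = ∑ b ∈ B, prob Ω fun a => E a b := by
  simp_rw [prob_eq_expect, ← Finset.expect_sum_comm]
  refine Finset.expect_congr rfl fun a _ => ?_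
  rw [Finset.sum_boole]

lemma expect_mono {Ω : Finset α} {f g : α → ℝ} (h : ∀ a ∈ Ω, f a ≤ g a) :
    𝔼 a ∈ Ω, f a ≤ 𝔼 a ∈ Ω, g a := by
  rw [Finset.expect_eq_sum_div_card, Finset.expect_eq_sum_div_card]
  gcongr with a ha
  exact h a ha

lemma expect_le_of_le {Ω : Finset α} {f : α → ℝ} {b : ℝ} (hb : 0 ≤ b) (h : ∀ a ∈ Ω, f a ≤ b) :
    𝔼 a ∈ Ω, f a ≤ b := by
  rcases Ω.eq_empty_or_nonempty with rfl | hΩ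
  · simpa using hb
  · exact (expect_mono h).trans (Finset.expect_const hΩ b).le

lemma expect_nonneg' {Ω : Finset α} {f : α → ℝ} (h : ∀ a ∈ Ω, 0 ≤ f a) : 0 ≤ 𝔼 a ∈ Ω, f a := by
  rw [Finset.expect_eq_sum_div_card]
  exact div_nonneg (Finset.sum_nonneg h) (Nat.cast_nonneg _)

lemma expect_filter_union_le (Ω : Finset α) (B : Finset β) (E : α → β → Prop) {p : ℝ}
    (h : ∀ b ∈ B, prob Ω (fun a => E a b) ≤ p) :
    𝔼 a ∈ Ω, ((B.filter (E a)).card : ℝ) ≤ B.card * p := by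
  rw [expect_card_filter]
  refine (Finset.sum_le_sum h).trans ?_
  simp

/-- Markov's inequality. -/
lemma prob_ge_mul_le {Ω : Finset α} {f : α → ℝ} (hf : ∀ a ∈ Ω, 0 ≤ f a) (t : ℝ) :
    prob Ω (fun a => t ≤ f a) * t ≤ 𝔼 a ∈ Ω, f a := by
  rw [prob_eq_expect, Finset.expect_mul]
  refine expect_mono fun a ha => ?_
  split_ifs with h
  · simpa using h
  · simpa using hf a ha

end Probability

/-! ### Linearly independent tuples over the binary field -/

section Tuples

variable {V : Type} [AddCommGroup V] [Module F2 V]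

/-- The linearly independent `r`-tuples of elements of `A`. -/
def indepTuples (r : ℕ) (A : Finset V) : Finset (Fin r → V) :=
  (Fintype.piFinset fun _ => A).filter fun v => LinearIndependent F2 v

lemma mem_indepTuples {r : ℕ} {A : Finset V} {v : Fin r → V} :
    v ∈ indepTuples r A ↔ (∀ i, v i ∈ A) ∧ LinearIndependent F2 v := by
  simp [indepTuples]

lemma card_indepTuples_le (r : ℕ) (A : Finset V) : (indepTuples r A).card ≤ A.card ^ r := by
  refine (Finset.card_filter_le _ _).trans ?_
  simp

variable [Fintype V]

lemma card_span_le {r : ℕ} (v : Fin r → V) :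
    ((Finset.univ : Finset V).filter fun x =>
      x ∈ Submodule.span F2 (Set.range v)).card ≤ 2 ^ r := by
  have h1 : ((Finset.univ : Finset V).filter fun x => x ∈ Submodule.span F2 (Set.range v)).card
      = Nat.card (Submodule.span F2 (Set.range v)) := by
    rw [Nat.card_eq_fintype_card, Fintype.card_subtype]
  rw [h1, Module.natCard_eq_pow_finrank (K := F2)]
  have : Module.finrank F2 (Submodule.span F2 (Set.range v)) ≤ r := by
    exact (finrank_range_le_card (R := F2) v).trans (by simp)
  simpa using Nat.pow_le_pow_right (by norm_num : 0 < 2) this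

/-- Extending an independent tuple by any element outside of its span shows that a set of `b`
elements has at least `(b - 2 ^ r) ^ r` independent `r`-tuples. -/
lemma pow_le_card_indepTuples (r l : ℕ) (hr : r ≤ l) (A : Finset V) :
    (A.card - 2 ^ l) ^ r ≤ (indepTuples r A).card := by
  induction r with
  | zero =>
    simp only [pow_zero]
    apply Finset.card_pos.mpr
    exact ⟨Fin.elim0, mem_indepTuples.mpr ⟨fun i => i.elim0, linearIndependent_empty_type⟩⟩
  | succ r ih =>
    have ih := ih (by omega)
    let W : (Fin r → V) → Finset V := fun v => A.filter fun x => x ∉ Submodule.span F2 (Set.range v)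
    have hW : ∀ v, A.card - 2 ^ l ≤ (W v).card := by
      intro v
      have h1 := Finset.card_filter_add_card_filter_not (s := A)
        (fun x => x ∈ Submodule.span F2 (Set.range v))
      have h2 : (A.filter fun x => x ∈ Submodule.span F2 (Set.range v)).card ≤ 2 ^ r :=
        (Finset.card_le_card (Finset.filter_subset_filter _ (Finset.subset_univ _))).trans
          (card_span_le v)
      have h3 : 2 ^ r ≤ 2 ^ l := Nat.pow_le_pow_right (by norm_num) (by omega)
      simp only [W]
      omega
    have hcard : ((indepTuples r A).sigma W).card ≤ (indepTuples (r + 1) A).card := by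
      refine Finset.card_le_card_of_injOn (fun p => Fin.cons p.2 p.1) ?_ ?_
      · rintro ⟨v, x⟩ h
        simp only [Finset.coe_sigma, Set.mem_sigma_iff, Finset.mem_coe] at h
        obtain ⟨hv, hx⟩ := h
        rw [mem_indepTuples] at hv
        simp only [W, Finset.mem_filter] at hx
        simp only [Finset.mem_coe]
        rw [mem_indepTuples]
        refine ⟨fun i => ?_, linearIndependent_finCons.mpr ⟨hv.2, hx.2⟩⟩
        refine Fin.cases hx.1 (fun j => ?_) i
        exact hv.1 j
      · rintro ⟨v, x⟩ _ ⟨v', x'⟩ _ h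
        have h := Fin.cons_inj.mp h
        simp only [Sigma.mk.injEq]
        exact ⟨h.2, heq_of_eq h.1⟩
    refine le_trans ?_ hcard
    rw [Finset.card_sigma]
    calc (A.card - 2 ^ l) ^ (r + 1) = (A.card - 2 ^ l) ^ r * (A.card - 2 ^ l) := pow_succ _ _
      _ ≤ (indepTuples r A).card * (A.card - 2 ^ l) := Nat.mul_le_mul_right _ ih
      _ = ∑ v ∈ indepTuples r A, (A.card - 2 ^ l) := by simp
      _ ≤ _ := Finset.sum_le_sum fun v _ => hW v

/-- If independent `l`-tuples of `B` lie in a random set `U` with probability at most `θ ^ l`, then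
`U` contains much more than `|B| θ` elements of `B` with small probability only.  This is the moment
method: a set with `b > T + 2 ^ l` elements in `U` yields `T ^ l` independent `l`-tuples. -/
lemma prob_card_gt_le {Ω : Type} (Om : Finset Ω) (U : Ω → V → Prop) (B : Finset V) (l : ℕ)
    {θ T : ℝ} (hθ : 0 ≤ θ) (hT : 0 < T)
    (hU : ∀ v ∈ indepTuples l B, prob Om (fun ω => ∀ i, U ω (v i)) ≤ θ ^ l) :
    prob Om (fun ω => T + 2 ^ l < ((B.filter (U ω)).card : ℝ)) ≤ (B.card * θ / T) ^ l := by
  rcases (indepTuples l B).eq_empty_or_nonempty with h0 | -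
  · -- without independent tuples, `B` has at most `2 ^ l` elements, unless `l = 0`
    rcases Nat.eq_zero_or_pos l with rfl | hl
    · simp only [pow_zero]
      unfold prob
      exact div_le_one_of_le₀ (by exact_mod_cast Finset.card_filter_le _ _) (Nat.cast_nonneg _)
    have h1 := pow_le_card_indepTuples l l le_rfl B
    rw [h0, Finset.card_empty, Nat.le_zero, pow_eq_zero_iff (by omega)] at h1
    have h2 : prob Om (fun ω => T + 2 ^ l < ((B.filter (U ω)).card : ℝ)) = 0 := by
      unfold prob
      rw [Finset.filter_false_of_mem]
      · simp
      intro ω _ h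
      have h3 : (B.filter (U ω)).card ≤ 2 ^ l := (Finset.card_filter_le _ _).trans (by omega)
      have h4 : ((B.filter (U ω)).card : ℝ) ≤ 2 ^ l := by exact_mod_cast h3
      linarith
    rw [h2, div_pow, mul_pow]
    positivity
  have h1 : prob Om (fun ω => T + 2 ^ l < ((B.filter (U ω)).card : ℝ)) ≤
      prob Om (fun ω => T ^ l ≤ ((indepTuples l B).filter fun v => ∀ i, U ω (v i)).card) := by
    refine prob_mono fun ω _ h => ?_
    have h2 := pow_le_card_indepTuples l l le_rfl (B.filter (U ω))
    have h3 : indepTuples l (B.filter (U ω)) ⊆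
        (indepTuples l B).filter fun v => ∀ i, U ω (v i) := by
      intro v hv
      rw [mem_indepTuples] at hv
      rw [Finset.mem_filter, mem_indepTuples]
      exact ⟨⟨fun i => (Finset.mem_filter.mp (hv.1 i)).1, hv.2⟩,
        fun i => (Finset.mem_filter.mp (hv.1 i)).2⟩
    have h4 : T ≤ (((B.filter (U ω)).card - 2 ^ l : ℕ) : ℝ) := by
      have : 2 ^ l ≤ (B.filter (U ω)).card := by
        have : (2 : ℝ) ^ l ≤ ((B.filter (U ω)).card : ℝ) := by linarith
        exact_mod_cast this
      rw [Nat.cast_sub this]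
      push_cast
      linarith
    calc T ^ l ≤ (((B.filter (U ω)).card - 2 ^ l : ℕ) : ℝ) ^ l := by gcongr
      _ ≤ _ := by exact_mod_cast h2.trans (Finset.card_le_card h3)
  -- Markov's inequality for the number of independent `l`-tuples in `U`
  have h2 := prob_ge_mul_le (Ω := Om)
    (f := fun ω => (((indepTuples l B).filter fun v => ∀ i, U ω (v i)).card : ℝ))
    (fun _ _ => Nat.cast_nonneg _) (T ^ l)
  have h3 := expect_filter_union_le Om (indepTuples l B) (fun ω v => ∀ i, U ω (v i)) hU
  have h4 : ((indepTuples l B).card : ℝ) ≤ (B.card : ℝ) ^ l := by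
    exact_mod_cast card_indepTuples_le l B
  rw [div_pow, mul_pow, le_div_iff₀ (by positivity)]
  calc _ ≤ _ := mul_le_mul_of_nonneg_right h1 (by positivity)
    _ ≤ _ := h2
    _ ≤ (indepTuples l B).card * θ ^ l := by convert h3
    _ ≤ _ := mul_le_mul_of_nonneg_right h4 (by positivity)

end Tuples

/-! ### Random codes -/

section RandomCodes

/-- Two independent tuples are related by an automorphism of the space. -/
lemma exists_equiv_of_linearIndependent {V : Type} [AddCommGroup V] [Module F2 V]
    [FiniteDimensional F2 V] {r : ℕ} {v v' : Fin r → V}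
    (hv : LinearIndependent F2 v) (hv' : LinearIndependent F2 v') :
    ∃ e : V ≃ₗ[F2] V, ∀ i, e (v i) = v' i := by
  let b := Module.Basis.span hv
  let b' := Module.Basis.span hv'
  obtain ⟨g, hg⟩ := Submodule.exists_linearEquiv_restrict_eq (b.equiv b' (Equiv.refl _))
  refine ⟨g, fun i => ?_⟩
  have h1 := hg (b i)
  rw [Module.Basis.equiv_apply] at h1
  simpa [b, b', Module.Basis.span_apply] using h1.symm

/-- A random subspace of dimension at most `d` whose law is invariant under automorphisms contains
a given independent `r`-tuple with probability at most `(2 ^ d / |V|) ^ r`. -/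
lemma prob_forall_mem_le_of_invariant {V : Type} [AddCommGroup V] [Module F2 V] [Fintype V]
    {Ω : Type} (Om : Finset Ω) (U : Ω → Submodule F2 V) (d : ℕ)
    (hd : ∀ ω ∈ Om, Module.finrank F2 (U ω) ≤ d) (hdV : d ≤ Module.finrank F2 V)
    (hinv : ∀ e : V ≃ₗ[F2] V, ∃ σ : Ω → Ω, Set.InjOn σ Om ∧ ∀ ω ∈ Om, σ ω ∈ Om ∧
      ∀ x ∈ U ω, e x ∈ U (σ ω)) {r : ℕ} (v : Fin r → V) (hv : LinearIndependent F2 v) :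
    prob Om (fun ω => ∀ i, v i ∈ U ω) ≤ ((2 : ℝ) ^ d / 2 ^ Module.finrank F2 V) ^ r := by
  set D := Module.finrank F2 V with hD
  let N : (Fin r → V) → ℕ := fun v => (Om.filter fun ω => ∀ i, v i ∈ U ω).card
  let X := indepTuples r (Finset.univ : Finset V)
  -- by invariance, no independent tuple is contained in `U` less often than `v`
  have hN : ∀ v' ∈ X, N v ≤ N v' := by
    intro v' hv'
    obtain ⟨e, he⟩ := exists_equiv_of_linearIndependent hv (mem_indepTuples.mp hv').2
    obtain ⟨σ, hσ, hσU⟩ := hinv e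
    refine Finset.card_le_card_of_injOn σ ?_ (hσ.mono fun x hx => (Finset.mem_filter.mp hx).1)
    intro ω hω
    have hω := Finset.mem_filter.mp hω
    refine Finset.mem_coe.mpr (Finset.mem_filter.mpr ⟨(hσU ω hω.1).1, fun i => ?_⟩)
    rw [← he]
    exact (hσU ω hω.1).2 _ (hω.2 i)
  have hrD : r ≤ D := by simpa using hv.fintype_card_le_finrank
  have hX : X.card = ∏ i : Fin r, (2 ^ D - 2 ^ i.val) := by
    have := card_linearIndependent (K := F2) (V := V) hrD
    rw [ZMod.card, Nat.card_eq_fintype_card, Fintype.card_subtype] at this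
    rw [← this]
    congr 1
  -- double counting of the pairs of an independent tuple and a subspace that contains it
  have hcount : X.card * N v ≤ Om.card * ∏ i : Fin r, (2 ^ d - 2 ^ i.val) := by
    calc X.card * N v = ∑ v' ∈ X, N v := by simp
      _ ≤ ∑ v' ∈ X, N v' := Finset.sum_le_sum hN
      _ = ∑ ω ∈ Om, (X.filter fun v' => ∀ i, v' i ∈ U ω).card :=
          (Finset.sum_card_bipartiteAbove_eq_sum_card_bipartiteBelow _).symm
      _ ≤ ∑ ω ∈ Om, ∏ i : Fin r, (2 ^ d - 2 ^ i.val) := by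
          refine Finset.sum_le_sum fun ω hω => ?_
          have h1 : (X.filter fun v' => ∀ i, v' i ∈ U ω).card ≤
              Nat.card {s : Fin r → U ω // LinearIndependent F2 s} := by
            rw [Nat.card_eq_fintype_card, Fintype.card_subtype]
            refine Finset.card_le_card_of_injOn
              (fun v' i => if h : v' i ∈ U ω then (⟨v' i, h⟩ : U ω) else 0) ?_ ?_
            · intro v' hv'
              have hv' := Finset.mem_filter.mp hv'
              have h2 := (mem_indepTuples.mp hv'.1).2
              refine Finset.mem_coe.mpr (Finset.mem_filter.mpr ⟨Finset.mem_univ _, ?_⟩)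
              refine LinearIndependent.of_comp (U ω).subtype ?_
              convert h2 using 1
              funext i
              simp [hv'.2 i]
            · intro v' hv' v'' hv'' h
              have hv' := (Finset.mem_filter.mp hv').2
              have hv'' := (Finset.mem_filter.mp hv'').2
              funext i
              have := congrFun h i
              simpa [hv' i, hv'' i] using this
          refine h1.trans ?_
          by_cases hr : r ≤ Module.finrank F2 (U ω)
          · rw [card_linearIndependent hr, ZMod.card]
            exact Finset.prod_le_prod' fun i _ =>
              Nat.sub_le_sub_right (Nat.pow_le_pow_right (by norm_num) (hd ω hω)) _
          · have : IsEmpty {s : Fin r → U ω // LinearIndependent F2 s} :=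
              ⟨fun s => hr (by simpa using s.2.fintype_card_le_finrank)⟩
            simp
      _ = _ := by simp
  have hpos : 0 < X.card :=
    Finset.card_pos.mpr ⟨v, mem_indepTuples.mpr ⟨fun _ => Finset.mem_univ _, hv⟩⟩
  have hratio : ((∏ i : Fin r, (2 ^ d - 2 ^ i.val) : ℕ) : ℝ) ≤
      X.card * ((2 : ℝ) ^ d / 2 ^ D) ^ r := by
    rw [hX]
    push_cast
    have : ((2 : ℝ) ^ d / 2 ^ D) ^ r = ∏ i : Fin r, ((2 : ℝ) ^ d / 2 ^ D) := by
      rw [Finset.prod_const, Finset.card_fin]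
    rw [this, ← Finset.prod_mul_distrib]
    refine Finset.prod_le_prod (fun _ _ => Nat.cast_nonneg _) fun i _ => ?_
    have hi : 2 ^ i.val ≤ 2 ^ D := Nat.pow_le_pow_right (by norm_num) (by omega)
    rcases le_total (2 ^ d) (2 ^ i.val) with h | h
    · rw [Nat.sub_eq_zero_of_le h]
      simp only [Nat.cast_zero]
      positivity
    · rw [Nat.cast_sub h, Nat.cast_sub hi]
      push_cast
      rw [mul_div_assoc', le_div_iff₀ (by positivity)]
      have h1 : (2 : ℝ) ^ d ≤ 2 ^ D := pow_le_pow_right₀ (by norm_num) hdV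
      have h2 : (0 : ℝ) ≤ 2 ^ i.val := by positivity
      nlinarith
  rw [prob_eq_card]
  rcases Om.eq_empty_or_nonempty with rfl | hOm
  · simp only [Finset.filter_empty, Finset.card_empty, Nat.cast_zero, zero_div]
    positivity
  rw [div_le_iff₀ (by exact_mod_cast Finset.card_pos.mpr hOm)]
  have hpos' : (0 : ℝ) < X.card := by exact_mod_cast hpos
  refine le_of_mul_le_mul_left ?_ hpos'
  change (X.card : ℝ) * N v ≤ _
  calc (X.card : ℝ) * N v ≤ Om.card * ((∏ i : Fin r, (2 ^ d - 2 ^ i.val) : ℕ) : ℝ) := by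
        exact_mod_cast hcount
    _ ≤ Om.card * (X.card * ((2 : ℝ) ^ d / 2 ^ D) ^ r) := by gcongr
    _ = X.card * (((2 : ℝ) ^ d / 2 ^ D) ^ r * Om.card) := by ring

variable {ι : Type} [Fintype ι]

lemma mem_genMatrices {k : ℕ} {G : Matrix (Fin k) ι F2} :
    G ∈ genMatrices k ι ↔ LinearIndependent F2 G.row := by
  simp [genMatrices]

lemma finrank_rowCode {k : ℕ} {G : Matrix (Fin k) ι F2} (hG : G ∈ genMatrices k ι) :
    Module.finrank F2 (rowCode G) = k := by
  have := finrank_span_eq_card (mem_genMatrices.mp hG)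
  rw [Fintype.card_fin] at this
  exact this

lemma le_card_of_mem_genMatrices {k : ℕ} {G : Matrix (Fin k) ι F2} (hG : G ∈ genMatrices k ι) :
    k ≤ Fintype.card ι := by
  simpa using (mem_genMatrices.mp hG).fintype_card_le_finrank

lemma mul_toMatrix_mem_genMatrices {k : ℕ} {G : Matrix (Fin k) ι F2} (hG : G ∈ genMatrices k ι)
    (A A' : Matrix ι ι F2) (h : A * A' = 1) : G * A ∈ genMatrices k ι := by
  rw [mem_genMatrices] at hG ⊢
  have : (G * A).row = fun i => A.vecMulLinear (G.row i) := by
    funext i; ext j; simp [Matrix.mul_apply, Matrix.vecMul, dotProduct]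
  rw [this]
  refine hG.map' A.vecMulLinear (LinearMap.ker_eq_bot_of_injective
    (Function.LeftInverse.injective (g := A'.vecMulLinear) ?_))
  intro x
  simp [Matrix.vecMul_vecMul, h]

lemma finrank_ker_genMatrix {k : ℕ} {G : Matrix (Fin k) ι F2} (hG : G ∈ genMatrices k ι) :
    Module.finrank F2 (LinearMap.ker G.mulVecLin) = Fintype.card ι - k := by
  have h1 := LinearMap.finrank_range_add_finrank_ker G.mulVecLin
  have h2 : Module.finrank F2 (LinearMap.range G.mulVecLin) = k := by
    have := (mem_genMatrices.mp hG).rank_matrix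
    simpa [Matrix.rank] using this
  rw [h2] at h1
  simp at h1
  omega

/-- Parity-check tuples: `r` independent vectors are orthogonal to a random `[n, k]`-code with
probability at most `2 ^ (-k r)`. -/
lemma prob_mulVec_eq_zero_le (k : ℕ) {r : ℕ} (v : Fin r → ι → F2) (hv : LinearIndependent F2 v) :
    prob (genMatrices k ι) (fun G => ∀ i, G *ᵥ v i = 0) ≤ ((1 : ℝ) / 2 ^ k) ^ r := by
  by_cases hk : k ≤ Fintype.card ι
  · have h := prob_forall_mem_le_of_invariant (genMatrices k ι)
      (fun G => LinearMap.ker G.mulVecLin) (Fintype.card ι - k)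
      (fun G hG => (finrank_ker_genMatrix hG).le) (by simp) ?_ v hv
    · simp only [LinearMap.mem_ker, Matrix.mulVecLin_apply, Module.finrank_fintype_fun_eq_card] at h
      refine h.trans (le_of_eq ?_)
      congr 1
      rw [div_eq_div_iff (by positivity) (by positivity), one_mul, ← pow_add,
        Nat.sub_add_cancel hk]
    · intro e
      have h1 : LinearMap.toMatrix' e.toLinearMap * LinearMap.toMatrix' e.symm.toLinearMap = 1 := by
        rw [← LinearMap.toMatrix'_comp]; simp
      have h2 : LinearMap.toMatrix' e.symm.toLinearMap * LinearMap.toMatrix' e.toLinearMap = 1 := by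
        rw [← LinearMap.toMatrix'_comp]; simp
      refine ⟨fun G => G * LinearMap.toMatrix' e.symm.toLinearMap, ?_, ?_⟩
      · intro G _ G' _ h
        have := congrArg (· * LinearMap.toMatrix' e.toLinearMap) h
        simpa [Matrix.mul_assoc, h2] using this
      · intro G hG
        refine ⟨mul_toMatrix_mem_genMatrices hG _ _ h2, fun x hx => ?_⟩
        rw [LinearMap.mem_ker, Matrix.mulVecLin_apply] at hx ⊢
        have : LinearMap.toMatrix' e.symm.toLinearMap *ᵥ (e x) = x := by
          rw [LinearMap.toMatrix'_mulVec]; simp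
        rw [← Matrix.mulVec_mulVec, this, hx]
  · have : genMatrices k ι = ∅ :=
      Finset.eq_empty_of_forall_notMem fun G hG => hk (le_card_of_mem_genMatrices hG)
    rw [this]
    simp only [prob, Finset.filter_empty, Finset.card_empty, Nat.cast_zero, zero_div]
    positivity

/-- Codeword tuples: a random `[n, k]`-code contains `r` given independent vectors with probability
at most `2 ^ (-(n - k) r)`. -/
lemma prob_mem_rowCode_le (k : ℕ) {r : ℕ} (v : Fin r → ι → F2) (hv : LinearIndependent F2 v) :
    prob (genMatrices k ι) (fun G => ∀ i, v i ∈ rowCode G) ≤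
      ((2 : ℝ) ^ k / 2 ^ Fintype.card ι) ^ r := by
  by_cases hk : k ≤ Fintype.card ι
  · have h := prob_forall_mem_le_of_invariant (genMatrices k ι)
      (fun G => rowCode G) k
      (fun G hG => (finrank_rowCode hG).le) (by simpa using hk) ?_ v hv
    · simpa using h
    · intro e
      have h1 : (LinearMap.toMatrix' e.toLinearMap)ᵀ * (LinearMap.toMatrix' e.symm.toLinearMap)ᵀ
          = 1 := by
        rw [← Matrix.transpose_mul, ← LinearMap.toMatrix'_comp]; simp
      refine ⟨fun G => G * (LinearMap.toMatrix' e.toLinearMap)ᵀ, ?_, ?_⟩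
      · intro G _ G' _ h
        have := congrArg (· * (LinearMap.toMatrix' e.symm.toLinearMap)ᵀ) h
        simpa [Matrix.mul_assoc, h1] using this
      · intro G hG
        refine ⟨mul_toMatrix_mem_genMatrices hG _ _ h1, fun x hx => ?_⟩
        have h3 : rowCode (G * (LinearMap.toMatrix' e.toLinearMap)ᵀ) =
            (rowCode G).map e.toLinearMap := by
          unfold rowCode
          rw [Submodule.map_span]
          congr 1
          rw [← Set.range_comp]
          congr 1
          funext i
          have : (G * (LinearMap.toMatrix' e.toLinearMap)ᵀ).row i =
              G.row i ᵥ* (LinearMap.toMatrix' e.toLinearMap)ᵀ := by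
            ext j; simp [Matrix.mul_apply, Matrix.vecMul, dotProduct]
          rw [this, Matrix.vecMul_transpose, LinearMap.toMatrix'_mulVec]
          rfl
        rw [h3]
        exact Submodule.mem_map_of_mem hx
  · have : genMatrices k ι = ∅ :=
      Finset.eq_empty_of_forall_notMem fun G hG => hk (le_card_of_mem_genMatrices hG)
    rw [this]
    simp only [prob, Finset.filter_empty, Finset.card_empty, Nat.cast_zero, zero_div]
    positivity

/-- A fixed nonzero message is encoded by a random code to a uniform nonzero vector. -/
lemma prob_vecMul_eq_le {k : ℕ} {m : Fin k → F2} (hm : m ≠ 0) (z : ι → F2) :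
    prob (genMatrices k ι) (fun G => m ᵥ* G = z) * ((2 : ℝ) ^ Fintype.card ι - 1) ≤ 1 := by
  have hcardV : Fintype.card (ι → F2) = 2 ^ Fintype.card ι := by simp
  have h2 : (1 : ℝ) ≤ (2 : ℝ) ^ Fintype.card ι := one_le_pow₀ (by norm_num)
  by_cases hz : z = 0
  · have : prob (genMatrices k ι) (fun G => m ᵥ* G = z) = 0 := by
      refine prob_eq_zero fun G hG h => ?_
      subst hz
      refine hm (funext fun i => ?_)
      exact Fintype.linearIndependent_iff.mp (mem_genMatrices.mp hG) m
        (by rw [← h]; ext j; simp [Matrix.vecMul, dotProduct, Finset.sum_apply]) i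
    rw [this, zero_mul]
    norm_num
  -- the nonzero vectors are equally likely, by the action of the automorphisms of the space
  let N : (ι → F2) → ℕ := fun z => ((genMatrices k ι).filter fun G => m ᵥ* G = z).card
  have hN : ∀ z' ∈ (Finset.univ : Finset (ι → F2)).erase 0, N z ≤ N z' := by
    intro z' hz'
    have hz' : z' ≠ 0 := (Finset.mem_erase.mp hz').1
    obtain ⟨e, he⟩ := exists_equiv_of_linearIndependent (r := 1) (v := fun _ => z)
      (v' := fun _ => z') (LinearIndependent.of_subsingleton 0 hz)
      (LinearIndependent.of_subsingleton 0 hz')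
    have he := he 0
    have h1 : (LinearMap.toMatrix' e.toLinearMap)ᵀ * (LinearMap.toMatrix' e.symm.toLinearMap)ᵀ
        = 1 := by
      rw [← Matrix.transpose_mul, ← LinearMap.toMatrix'_comp]; simp
    refine Finset.card_le_card_of_injOn (fun G => G * (LinearMap.toMatrix' e.toLinearMap)ᵀ) ?_ ?_
    · intro G hG
      have hG := Finset.mem_filter.mp hG
      refine Finset.mem_coe.mpr (Finset.mem_filter.mpr
        ⟨mul_toMatrix_mem_genMatrices hG.1 _ _ h1, ?_⟩)
      rw [← Matrix.vecMul_vecMul, hG.2, Matrix.vecMul_transpose, LinearMap.toMatrix'_mulVec]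
      exact he
    · intro G _ G' _ h
      have := congrArg (· * (LinearMap.toMatrix' e.symm.toLinearMap)ᵀ) h
      simpa [Matrix.mul_assoc, h1] using this
  have hsum : (2 ^ Fintype.card ι - 1) * N z ≤ (genMatrices k ι).card := by
    calc (2 ^ Fintype.card ι - 1) * N z
        = ∑ z' ∈ (Finset.univ : Finset (ι → F2)).erase 0, N z := by
          simp [Finset.card_erase_of_mem]
      _ ≤ ∑ z' ∈ (Finset.univ : Finset (ι → F2)).erase 0, N z' := Finset.sum_le_sum hN
      _ ≤ ∑ z' : ι → F2, N z' := Finset.sum_le_sum_of_subset (Finset.erase_subset _ _)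
      _ = (genMatrices k ι).card :=
          (Finset.card_eq_sum_card_fiberwise (fun _ _ => Finset.mem_univ _)).symm
  have h1 : ((2 : ℝ) ^ Fintype.card ι - 1) * N z ≤ (genMatrices k ι).card := by
    have h3 : (1 : ℕ) ≤ 2 ^ Fintype.card ι := Nat.one_le_two_pow
    have := (Nat.cast_le (α := ℝ)).mpr hsum
    rwa [Nat.cast_mul, Nat.cast_sub h3, Nat.cast_pow, Nat.cast_one, Nat.cast_ofNat] at this
  rw [prob_eq_card, div_mul_eq_mul_div]
  refine div_le_one_of_le₀ ?_ (Nat.cast_nonneg _)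
  rw [mul_comm]
  convert h1

end RandomCodes

/-! ### Weights, restrictions and duality -/

section Words

lemma F2.eq_one_of_ne_zero {b : F2} (h : b ≠ 0) : b = 1 := by
  fin_cases b
  · exact absurd rfl h
  · rfl

variable {ι : Type} [Fintype ι]

lemma card_wordsOn (I : Finset ι) (p : ℕ) : (wordsOn I p).card = I.card.choose p := by
  rw [← Finset.card_powersetCard]
  refine Finset.card_bij' (fun x _ => Finset.univ.filter fun i => x i ≠ 0)
    (fun S _ i => if i ∈ S then 1 else 0) ?_ ?_ ?_ ?_
  · intro x hx
    have hx := (Finset.mem_filter.mp hx).2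
    refine Finset.mem_powersetCard.mpr ⟨fun i hi => ?_, hx.2⟩
    by_contra h
    exact (Finset.mem_filter.mp hi).2 (hx.1 i h)
  · intro S hS
    obtain ⟨hS, hc⟩ := Finset.mem_powersetCard.mp hS
    refine Finset.mem_filter.mpr ⟨Finset.mem_univ _, fun i hi => ?_, ?_⟩
    · exact if_neg fun h => hi (hS h)
    · rw [← hc, hammingNorm]
      congr 1
      ext i
      simp
  · intro x _
    funext i
    by_cases h : x i = 0
    · simp [h]
    · simp [F2.eq_one_of_ne_zero h]
  · intro S _
    ext i
    simp

lemma card_filter_hammingNorm (p : ℕ) :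
    ((Finset.univ : Finset (ι → F2)).filter fun x => hammingNorm x = p).card =
      (Fintype.card ι).choose p := by
  rw [← Finset.card_univ, ← card_wordsOn, wordsOn]
  congr 1
  ext x
  simp

variable {n : ℕ} (P : Finset (Fin n))

@[simp] lemma restr_apply (v : Fin n → F2) (i : P) : restr P v i = v i := rfl

lemma ext_apply_mem (v : P → F2) {i : Fin n} (h : i ∈ P) : ext P v i = v ⟨i, h⟩ := by
  unfold ext
  rw [Function.ExtendByZero.linearMap_apply]
  exact Function.Injective.extend_apply Subtype.val_injective v 0 ⟨i, h⟩

lemma ext_apply_notMem (v : P → F2) {i : Fin n} (h : i ∉ P) : ext P v i = 0 := by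
  unfold ext
  rw [Function.ExtendByZero.linearMap_apply, Function.extend_apply', Pi.zero_apply]
  rintro ⟨a, rfl⟩
  exact h a.2

@[simp] lemma restr_ext (v : P → F2) : restr P (ext P v) = v := by
  funext i
  rw [restr_apply, ext_apply_mem P v i.2]

@[simp] lemma restr_compl_ext (v : P → F2) : restr Pᶜ (ext P v) = 0 := by
  funext i
  rw [restr_apply, ext_apply_notMem P v (Finset.mem_compl.mp i.2)]
  rfl

@[simp] lemma restr_ext_compl (v : ↥Pᶜ → F2) : restr P (ext Pᶜ v) = 0 := by
  funext i
  rw [restr_apply, ext_apply_notMem Pᶜ v (by simp)]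
  rfl

lemma ext_restr_add (h : Fin n → F2) : ext P (restr P h) + ext Pᶜ (restr Pᶜ h) = h := by
  funext i
  rw [Pi.add_apply]
  by_cases hi : i ∈ P
  · rw [ext_apply_mem P _ hi, ext_apply_notMem Pᶜ _ (by simpa using hi), add_zero, restr_apply]
  · rw [ext_apply_notMem P _ hi, ext_apply_mem Pᶜ _ (by simpa using hi), zero_add, restr_apply]

lemma ext_injective : Function.Injective (ext P) :=
  Function.LeftInverse.injective (g := restr P) (restr_ext P)

/-- Splitting a vector into its restrictions to `P` and to its complement. -/
def splitEquiv : (Fin n → F2) ≃ (P → F2) × (↥Pᶜ → F2) where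
  toFun h := (restr P h, restr Pᶜ h)
  invFun p := ext P p.1 + ext Pᶜ p.2
  left_inv h := ext_restr_add P h
  right_inv p := by simp [map_add]

lemma dotProduct_eq_add (x y : Fin n → F2) :
    x ⬝ᵥ y = restr P x ⬝ᵥ restr P y + restr Pᶜ x ⬝ᵥ restr Pᶜ y := by
  simp only [dotProduct, restr_apply]
  rw [← Finset.sum_add_sum_compl P, Finset.sum_coe_sort P (fun i => x i * y i),
    Finset.sum_coe_sort Pᶜ (fun i => x i * y i)]

lemma card_compl_coe {s : ℕ} (hP : P.card = s) : Fintype.card ↥Pᶜ = n - s := by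
  rw [Fintype.card_coe, Finset.card_compl, Fintype.card_fin, hP]

/-- The number of vectors with prescribed distance to `v` on `P` and weight on the complement. -/
lemma card_filter_split (v : P → F2) (a b : ℕ) :
    ((Finset.univ : Finset (Fin n → F2)).filter fun h =>
      hammingNorm (restr P h + v) = a ∧ hammingNorm (restr Pᶜ h) = b).card =
      P.card.choose a * (n - P.card).choose b := by
  have h1 : P.card.choose a = ((Finset.univ : Finset (P → F2)).filter fun x =>
      hammingNorm x = a).card := by
    rw [← Fintype.card_coe P]
    convert (card_filter_hammingNorm a).symm
  have h2 : (n - P.card).choose b = ((Finset.univ : Finset (↥Pᶜ → F2)).filter fun x =>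
      hammingNorm x = b).card := by
    rw [← card_compl_coe P rfl]
    convert (card_filter_hammingNorm b).symm
  rw [h1, h2, ← Finset.card_product]
  refine Finset.card_bij' (fun h _ => (restr P h + v, restr Pᶜ h))
    (fun p _ => (splitEquiv P).symm (p.1 - v, p.2)) ?_ ?_ ?_ ?_
  · intro h hh
    simpa using hh
  · intro p hp
    simpa [splitEquiv, map_add, map_sub] using hp
  · intro h _
    rw [add_sub_cancel_right]
    exact (splitEquiv P).left_inv h
  · intro p _
    simp [splitEquiv, map_add, map_sub]

/-- A linear form that vanishes on the kernel of `f` factors through `f`. -/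
lemma exists_dual_comp {V U : Type} [AddCommGroup V] [Module F2 V] [AddCommGroup U] [Module F2 U]
    (f : V →ₗ[F2] U) (φ : V →ₗ[F2] F2) (h : ∀ x, f x = 0 → φ x = 0) :
    ∃ ψ : U →ₗ[F2] F2, ∀ x, φ x = ψ (f x) := by
  have hm : φ ∈ LinearMap.range f.dualMap := by
    rw [LinearMap.range_dualMap_eq_dualAnnihilator_ker, Submodule.mem_dualAnnihilator]
    exact fun x hx => h x hx
  obtain ⟨ψ, hψ⟩ := hm
  exact ⟨ψ, fun x => by rw [← hψ]; rfl⟩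

lemma exists_dotProduct_eq {κ : Type} [Fintype κ] (ψ : (κ → F2) →ₗ[F2] F2) :
    ∃ v : κ → F2, ∀ x, ψ x = x ⬝ᵥ v := by
  refine ⟨fun i => ψ (Pi.single i 1), fun x => ?_⟩
  rw [dotProduct, LinearMap.pi_apply_eq_sum_univ ψ x]
  simp only [smul_eq_mul, eq_comm]
  refine Finset.sum_congr rfl fun i _ => ?_
  congr 2
  funext j
  simp [Pi.single_apply, eq_comm]

/-- A linear form on a code that vanishes on the kernel of `f` is of the form
`c ↦ ⟨f c, v⟩`. -/
lemma exists_dotProduct_comp {κ : Type} [Fintype κ] (C : Submodule F2 (Fin n → F2))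
    (f : (Fin n → F2) →ₗ[F2] (κ → F2)) (φ : (Fin n → F2) →ₗ[F2] F2)
    (h : ∀ c ∈ C, f c = 0 → φ c = 0) : ∃ v : κ → F2, ∀ c ∈ C, φ c = f c ⬝ᵥ v := by
  obtain ⟨ψ, hψ⟩ := exists_dual_comp (f ∘ₗ C.subtype) (φ ∘ₗ C.subtype)
    (fun x hx => h x x.2 hx)
  obtain ⟨v, hv⟩ := exists_dotProduct_eq ψ
  exact ⟨v, fun c hc => (hψ ⟨c, hc⟩).trans (hv _)⟩

/-- The linear form `x ↦ ⟨x, h⟩`. -/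
def dotForm {κ : Type} [Fintype κ] (h : κ → F2) : (κ → F2) →ₗ[F2] F2 where
  toFun x := x ⬝ᵥ h
  map_add' x y := add_dotProduct x y h
  map_smul' a x := by simp

@[simp] lemma dotForm_apply {κ : Type} [Fintype κ] (h x : κ → F2) : dotForm h x = x ⬝ᵥ h := rfl

lemma mem_dualWords {C : Submodule F2 (Fin n → F2)} {h : Fin n → F2} :
    h ∈ dualWords C ↔ ∀ c ∈ C, c ⬝ᵥ h = 0 := by
  simp [dualWords]

lemma forall_mem_rowCode {k : ℕ} {κ : Type} [Fintype κ] (G : Matrix (Fin k) κ F2) (h : κ → F2) :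
    (∀ c ∈ rowCode G, c ⬝ᵥ h = 0) ↔ G *ᵥ h = 0 := by
  constructor
  · intro H
    funext i
    exact H _ (Submodule.subset_span ⟨i, rfl⟩)
  · intro H c hc
    have : rowCode G ≤ LinearMap.ker (dotForm h) := by
      refine Submodule.span_le.mpr ?_
      rintro _ ⟨i, rfl⟩
      exact congrFun H i
    exact this hc

lemma mem_dualWords_rowCode {k : ℕ} (G : Matrix (Fin k) (Fin n) F2) (h : Fin n → F2) :
    h ∈ dualWords (rowCode G) ↔ G *ᵥ h = 0 := by
  rw [mem_dualWords, forall_mem_rowCode]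

/-- The dual of the shortened code is the punctured dual code. -/
lemma exists_dualWord_of_orthogonal_shortened (C : Submodule F2 (Fin n → F2)) (v : ↥Pᶜ → F2)
    (hv : ∀ c ∈ shortened C Pᶜ, c ⬝ᵥ v = 0) : ∃ h ∈ dualWords C, restr Pᶜ h = v := by
  obtain ⟨u, hu⟩ := exists_dotProduct_comp C (restr P) (dotForm (ext Pᶜ v)) (by
    intro c hc h0
    rw [dotForm_apply, dotProduct_eq_add P, restr_ext_compl, dotProduct_zero, zero_add, restr_ext]
    refine hv _ ⟨c, ⟨hc, ?_⟩, rfl⟩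
    refine LinearMap.mem_ker.mpr (funext fun i => ?_)
    exact congrFun h0 ⟨i, by simpa using i.2⟩)
  refine ⟨ext P u + ext Pᶜ v, mem_dualWords.mpr fun c hc => ?_, by simp [map_add]⟩
  have h1 := hu c hc
  rw [dotForm_apply] at h1
  rw [dotProduct_add, h1, dotProduct_eq_add P c (ext P u), restr_ext, restr_compl_ext,
    dotProduct_zero, add_zero]
  exact CharTwo.add_self_eq_zero _

end Words

/-! ### The fast Fourier transform -/

section Fourier

lemma sign_zero : sign 0 = 1 := rfl

lemma sign_add (a b : F2) : sign (a + b) = sign a * sign b := by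
  revert a b; decide

lemma abs_sign (a : F2) : |sign a| = 1 := by
  revert a; decide

lemma sign_mul_self (a : F2) : sign a * sign a = 1 := by
  revert a; decide

lemma fft_steps (k : ℕ) (f : (Fin k → F2) → ℤ) : (fft k f).steps = (k + 1) * 2 ^ k := by
  induction k with
  | zero => simp [fft]
  | succ k ih =>
    simp only [fft, ih]
    push_cast
    ring

lemma sum_fin_succ_F2 {k : ℕ} {M : Type} [AddCommMonoid M] (g : (Fin (k + 1) → F2) → M) :
    ∑ x, g x = (∑ x : Fin k → F2, g (Fin.cons 0 x)) + ∑ x : Fin k → F2, g (Fin.cons 1 x) := by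
  rw [← (Fin.consEquiv (fun _ : Fin (k + 1) => F2)).sum_comp, Fintype.sum_prod_type]
  have : (Finset.univ : Finset F2) = {0, 1} := by decide
  rw [this, Finset.sum_pair (by decide)]
  rfl

lemma fft_val (k : ℕ) (f : (Fin k → F2) → ℤ) (x : Fin k → F2) :
    (fft k f).val x = ∑ v, f v * sign (x ⬝ᵥ v) := by
  induction k with
  | zero =>
    simp only [fft, Fintype.sum_unique]
    rw [dotProduct, Finset.univ_eq_empty, Finset.sum_empty, sign_zero, mul_one]
    exact congrArg f (Subsingleton.elim _ _)
  | succ k ih =>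
    rw [sum_fin_succ_F2]
    simp only [fft, ih]
    rw [Finset.mul_sum]
    congr 1
    · refine Finset.sum_congr rfl fun v _ => ?_
      congr 2
      simp [dotProduct, Fin.sum_univ_succ, Fin.tail]
    · refine Finset.sum_congr rfl fun v _ => ?_
      rw [mul_left_comm]
      congr 1
      rw [← sign_add]
      congr 1
      simp [dotProduct, Fin.sum_univ_succ, Fin.tail]

/-- Parseval's identity. -/
lemma fft_parseval (k : ℕ) (f : (Fin k → F2) → ℤ) :
    ∑ x, (fft k f).val x ^ 2 = 2 ^ k * ∑ v, f v ^ 2 := by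
  induction k with
  | zero => simp [fft]
  | succ k ih =>
    rw [sum_fin_succ_F2, sum_fin_succ_F2]
    simp only [fft, Fin.tail_cons, Fin.cons_zero]
    rw [← Finset.sum_add_distrib]
    have h1 : sign 1 = -1 := rfl
    simp only [sign_zero, h1]
    have h2 := ih fun v => f (Fin.cons 0 v)
    have h3 := ih fun v => f (Fin.cons 1 v)
    calc _ = ∑ x, (2 * (fft k fun v => f (Fin.cons 0 v)).val x ^ 2 +
          2 * (fft k fun v => f (Fin.cons 1 v)).val x ^ 2) :=
          Finset.sum_congr rfl fun x _ => by ring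
      _ = _ := by
          rw [Finset.sum_add_distrib, ← Finset.mul_sum, ← Finset.mul_sum, h2, h3]
          ring

/-- Orthogonality of characters. -/
lemma sum_sign_dotProduct {k : ℕ} (v : Fin k → F2) :
    ∑ a : Fin k → F2, sign (a ⬝ᵥ v) = if v = 0 then 2 ^ k else 0 := by
  split_ifs with h
  · simp [h, sign_zero, ZMod.card]
  obtain ⟨i, hi⟩ := Function.ne_iff.mp h
  have h1 : ∑ a : Fin k → F2, sign (a ⬝ᵥ v) = ∑ a : Fin k → F2, sign ((a + Pi.single i 1) ⬝ᵥ v) :=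
    (Equiv.sum_comp (Equiv.addRight (Pi.single i 1 : Fin k → F2)) fun a => sign (a ⬝ᵥ v)).symm
  have h2 : ∀ a : Fin k → F2, sign ((a + Pi.single i 1) ⬝ᵥ v) = -sign (a ⬝ᵥ v) := by
    intro a
    have : sign 1 = -1 := rfl
    rw [add_dotProduct, single_one_dotProduct, sign_add, F2.eq_one_of_ne_zero hi, this]
    ring
  simp only [h2, Finset.sum_neg_distrib] at h1
  linarith

end Fourier

/-! ### Independent coins -/

section Independence

variable {α : Type}

lemma prob_piFinset {r : ℕ} (Ω : Finset α) (E : Fin r → α → Prop) :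
    prob (Fintype.piFinset fun _ : Fin r => Ω) (fun f => ∀ j, E j (f j)) = ∏ j, prob Ω (E j) := by
  have : (Fintype.piFinset fun _ : Fin r => Ω).filter (fun f => ∀ j, E j (f j)) =
      Fintype.piFinset fun j => Ω.filter (E j) := by
    ext f
    simp [forall_and]
  rw [prob_eq_card, this, Fintype.card_piFinset, Fintype.card_piFinset]
  push_cast
  rw [← Finset.prod_div_distrib]
  rfl

lemma expect_piFinset_prod {r : ℕ} (Ω : Finset α) (g : Fin r → α → ℝ) :
    𝔼 f ∈ Fintype.piFinset (fun _ : Fin r => Ω), ∏ j, g j (f j) = ∏ j, 𝔼 a ∈ Ω, g j a := by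
  simp only [Finset.expect_eq_sum_div_card]
  rw [Finset.prod_div_distrib, Finset.prod_univ_sum, Fintype.card_piFinset]
  push_cast
  rfl

lemma expect_piFinset_apply {r : ℕ} {Ω : Finset α} (hΩ : Ω.Nonempty) (j : Fin r) (g : α → ℝ) :
    𝔼 f ∈ Fintype.piFinset (fun _ : Fin r => Ω), g (f j) = 𝔼 a ∈ Ω, g a := by
  have h := expect_piFinset_prod Ω fun i a => if i = j then g a else 1
  have h1 : ∀ f : Fin r → α, ∏ i, (if i = j then g (f i) else 1) = g (f j) := fun f => by
    rw [Finset.prod_ite_eq' Finset.univ j fun i => g (f i), if_pos (Finset.mem_univ j)]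
  simp only [h1] at h
  rw [h]
  have h2 : ∀ i, 𝔼 a ∈ Ω, (if i = j then g a else 1) = if i = j then 𝔼 a ∈ Ω, g a else 1 := by
    intro i
    split_ifs
    · rfl
    · exact Finset.expect_const hΩ 1
  simp only [h2]
  rw [Finset.prod_ite_eq' Finset.univ j fun _ => 𝔼 a ∈ Ω, g a, if_pos (Finset.mem_univ j)]

end Independence

/-! ### Fibres of a random linear map -/

section Fibers

variable {ι : Type} [Fintype ι]

omit [Fintype ι] in
lemma mem_supportedOn {J : Finset ι} {x : ι → F2} : x ∈ supportedOn J ↔ ∀ i, i ∉ J → x i = 0 :=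
  Iff.rfl

lemma card_supportedOn (J : Finset ι) :
    (Finset.univ.filter fun x : ι → F2 => x ∈ supportedOn J).card = 2 ^ J.card := by
  have : (Finset.univ.filter fun x : ι → F2 => x ∈ supportedOn J) =
      Fintype.piFinset fun i => if i ∈ J then Finset.univ else {0} := by
    ext x
    simp only [Finset.mem_filter, Finset.mem_univ, true_and, mem_supportedOn,
      Fintype.mem_piFinset]
    refine forall_congr' fun i => ?_
    split_ifs with h <;> simp [h]
  rw [this, Fintype.card_piFinset]
  simp only [apply_ite Finset.card, Finset.card_univ, ZMod.card, Finset.card_singleton]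
  rw [Finset.prod_ite_mem]
  simp

/-- The word `x` can be completed outside of the window `K` to an element of `N`. -/
def Completable (N : Submodule F2 (ι → F2)) (K : Finset ι) (x : ι → F2) : Prop :=
  ∃ z ∈ supportedOn Kᶜ, x + z ∈ N

/-- The elements of `B` that can be completed outside of the window `K` to an element of `N`. -/
def completable (N : Submodule F2 (ι → F2)) (K : Finset ι) (B : Finset (ι → F2)) :
    Finset (ι → F2) :=
  B.filter (Completable N K)

/-- Concentration of the number of completable words: a given nonzero word belongs to the random
subspace `N` with probability at most `θ`, and there are `2 ^ |Kᶜ|` completions of each word. -/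
lemma prob_completable_gt_le {Ω : Type} (Om : Finset Ω) (N : Ω → Submodule F2 (ι → F2)) {θ T : ℝ}
    (hθ : 0 ≤ θ) (l : ℕ) (hN : ∀ v : Fin l → ι → F2, LinearIndependent F2 v →
      prob Om (fun ω => ∀ i, v i ∈ N ω) ≤ θ ^ l)
    (K : Finset ι) (B : Finset (ι → F2)) (hB : ∀ x ∈ B, x ∈ supportedOn K) (hT : 0 < T) :
    prob Om (fun ω => T + 2 ^ l < ((completable (N ω) K B).card : ℝ)) ≤
      (B.card * (2 ^ Kᶜ.card * θ) / T) ^ l := by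
  unfold completable
  apply prob_card_gt_le Om (fun ω => Completable (N ω) K) B l
    (mul_nonneg (pow_nonneg zero_le_two _) hθ) hT
  intro v hv
  obtain ⟨hvB, hv⟩ := mem_indepTuples.mp hv
  have h1 := prob_exists_le (Ω := Om)
    (Fintype.piFinset fun _ : Fin l => Finset.univ.filter fun x : ι → F2 => x ∈ supportedOn Kᶜ)
    (fun z ω => ∀ i, v i + z i ∈ N ω) (p := θ ^ l) (fun z hz => by
      refine hN (fun i => v i + z i) ?_
      -- the restriction to the window recovers the `v i`
      let g : (ι → F2) →ₗ[F2] (ι → F2) :=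
        LinearMap.pi fun i => if i ∈ K then LinearMap.proj i else 0
      refine LinearIndependent.of_comp g ?_
      have : (g ∘ fun i => v i + z i) = v := by
        funext i
        ext a
        have hz := (Finset.mem_filter.mp (Fintype.mem_piFinset.mp hz i)).2
        by_cases ha : a ∈ K
        · simp [g, ha, hz a (by simpa using ha)]
        · simp [g, ha, hB _ (hvB i) a ha]
      rw [this]
      exact hv)
  refine (prob_mono fun ω _ h => ?_).trans (h1.trans (le_of_eq ?_))
  · choose z hz hzN using h
    exact ⟨z, Fintype.mem_piFinset.mpr fun i =>
      Finset.mem_filter.mpr ⟨Finset.mem_univ _, hz i⟩, hzN⟩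
  · rw [Fintype.card_piFinset, Finset.prod_const, card_supportedOn, Finset.card_univ,
      Fintype.card_fin]
    push_cast
    rw [mul_pow]

end Fibers

/-! ### The cost of Dumer's decoder -/

section DumerCost

variable {ι : Type} [Fintype ι] {M : Type} [AddCommGroup M] [Module F2 M]

/-- The words of weights `p / 2` and `p - p / 2` on the two half windows. -/
def dumerSums (K K₁ : Finset ι) (p : ℕ) : Finset (ι → F2) :=
  (wordsOn K₁ (p / 2) ×ˢ wordsOn (K \ K₁) (p - p / 2)).image fun z => z.1 + z.2

lemma mem_wordsOn {I : Finset ι} {p : ℕ} {x : ι → F2} :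
    x ∈ wordsOn I p ↔ (∀ i, i ∉ I → x i = 0) ∧ hammingNorm x = p := by
  simp [wordsOn]

/-- The number of pairs of words on the two half windows. -/
def dumerPairs (L p : ℕ) : ℕ := (L / 2).choose (p / 2) * (L - L / 2).choose (p - p / 2)

lemma card_dumerSums_le {K K₁ : Finset ι} {L p : ℕ} (hK : K.card = L) (hK₁ : K₁ ⊆ K)
    (hK₁c : K₁.card = L / 2) : (dumerSums K K₁ p).card ≤ dumerPairs L p := by
  refine Finset.card_image_le.trans ?_
  rw [Finset.card_product, card_wordsOn, card_wordsOn, Finset.card_sdiff_of_subset hK₁, hK, hK₁c,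
    dumerPairs]

lemma dumerSums_subset {K K₁ : Finset ι} {p : ℕ} (hK₁ : K₁ ⊆ K) {x : ι → F2}
    (hx : x ∈ dumerSums K K₁ p) : x ∈ supportedOn K := by
  obtain ⟨z, hz, rfl⟩ := Finset.mem_image.mp hx
  obtain ⟨h1, h2⟩ := Finset.mem_product.mp hz
  intro i hi
  rw [Pi.add_apply, (mem_wordsOn.mp h1).1 i fun h => hi (hK₁ h), (mem_wordsOn.mp h2).1 i
    fun h => hi (Finset.mem_sdiff.mp h).1, add_zero]

/-- The differences of two words of the half windows, with the second one fixed. -/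
def dumerDiffs (K K₁ : Finset ι) (p : ℕ) (d : ι → F2) : Finset (ι → F2) :=
  (dumerSums K K₁ p).image fun x => x - d

/-- Some window of length `L` has more than `T` completable differences. -/
def DumerBad (N : Submodule F2 (ι → F2)) (L p : ℕ) (T : ℝ) : Prop :=
  ∃ x ∈ (Finset.univ : Finset (Finset ι × Finset ι × (ι → F2))).filter (fun x =>
      x.1.card = L ∧ x.2.1 ⊆ x.1 ∧ x.2.1.card = L / 2 ∧ x.2.2 ∈ dumerSums x.1 x.2.1 p),
    T < ((completable N x.1 (dumerDiffs x.1 x.2.1 p x.2.2)).card : ℝ)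

lemma prob_dumerBad_le {Ω : Type} (Om : Finset Ω) (N : Ω → Submodule F2 (ι → F2)) {θ T : ℝ}
    (hθ : 0 ≤ θ) (l : ℕ) (hN : ∀ v : Fin l → ι → F2, LinearIndependent F2 v →
      prob Om (fun ω => ∀ i, v i ∈ N ω) ≤ θ ^ l) (L p : ℕ) (hT : 0 < T) :
    prob Om (fun ω => DumerBad (N ω) L p (T + 2 ^ l)) ≤
      8 ^ Fintype.card ι *
        (dumerPairs L p * (2 ^ (Fintype.card ι - L) * θ) / T) ^ l := by
  unfold DumerBad
  refine (prob_exists_le _ _ (p := (dumerPairs L p *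
    (2 ^ (Fintype.card ι - L) * θ) / T) ^ l) fun x hx => ?_).trans ?_
  · obtain ⟨h1, h2, h3, h4⟩ := (Finset.mem_filter.mp hx).2
    refine (prob_completable_gt_le Om N hθ l hN x.1 _ ?_ hT).trans ?_
    · intro y hy
      obtain ⟨y', hy', rfl⟩ := Finset.mem_image.mp hy
      exact Submodule.sub_mem _ (dumerSums_subset h2 hy') (dumerSums_subset h2 h4)
    · rw [Finset.card_compl, h1]
      have : ((dumerDiffs x.1 x.2.1 p x.2.2).card : ℝ) ≤ dumerPairs L p := by
        exact_mod_cast Finset.card_image_le.trans (card_dumerSums_le h1 h2 h3)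
      gcongr
  · refine mul_le_mul_of_nonneg_right ?_ (by positivity)
    have : (Finset.univ : Finset (Finset ι × Finset ι × (ι → F2))).card =
        (2 * (2 * 2)) ^ Fintype.card ι := by
      rw [Finset.card_univ, Fintype.card_prod, Fintype.card_prod, Fintype.card_finset,
        Fintype.card_fun, ZMod.card, ← mul_pow, ← mul_pow]
    calc _ ≤ (((Finset.univ : Finset (Finset ι × Finset ι × (ι → F2))).card : ℕ) : ℝ) := by
          exact_mod_cast Finset.card_filter_le _ _
      _ = _ := by rw [this]; norm_num

lemma not_dumerBad (N : Submodule F2 (ι → F2)) {L p : ℕ} {T : ℝ} (hT : dumerPairs L p ≤ T) :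
    ¬ DumerBad N L p T := by
  rintro ⟨x, hx, h⟩
  obtain ⟨h1, h2, h3, h4⟩ := (Finset.mem_filter.mp hx).2
  have : ((completable N x.1 (dumerDiffs x.1 x.2.1 p x.2.2)).card : ℝ) ≤ dumerPairs L p := by
    exact_mod_cast (Finset.card_filter_le _ _).trans
      (Finset.card_image_le.trans (card_dumerSums_le h1 h2 h3))
  linarith

/-- The colliding pairs of Dumer's decoder have the same syndrome up to completion, so that their
differences to one of them are completable to elements of the kernel. -/
lemma card_colliding_le (φ : (ι → F2) →ₗ[F2] M) (y : M) {K K₁ : Finset ι} (hK₁ : K₁ ⊆ K) {p : ℕ}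
    {T : ℝ} (hT : 0 ≤ T) (h : ¬ DumerBad (LinearMap.ker φ) K.card p T) (hc : K₁.card = K.card / 2) :
    ((((wordsOn K₁ (p / 2)) ×ˢ (wordsOn (K \ K₁) (p - p / 2))).filter fun z =>
      φ (z.1 + z.2) - y ∈ (supportedOn Kᶜ).map φ).card : ℝ) ≤ T := by
  set S := ((wordsOn K₁ (p / 2)) ×ˢ (wordsOn (K \ K₁) (p - p / 2))).filter fun z =>
      φ (z.1 + z.2) - y ∈ (supportedOn Kᶜ).map φ with hS
  rcases S.eq_empty_or_nonempty with h0 | ⟨z₀, hz₀⟩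
  · rw [h0]; simpa using hT
  have hmem : ∀ z ∈ S, z.1 + z.2 ∈ dumerSums K K₁ p := fun z hz =>
    Finset.mem_image_of_mem _ (Finset.mem_filter.mp hz).1
  have h1 : ((completable (LinearMap.ker φ) K (dumerDiffs K K₁ p (z₀.1 + z₀.2))).card : ℝ) ≤ T := by
    by_contra hlt
    exact h ⟨(K, K₁, z₀.1 + z₀.2), Finset.mem_filter.mpr
      ⟨Finset.mem_univ _, rfl, hK₁, hc, hmem _ hz₀⟩, not_le.mp hlt⟩
  refine le_trans ?_ h1
  norm_cast
  refine Finset.card_le_card_of_injOn (fun z => z.1 + z.2 - (z₀.1 + z₀.2)) ?_ ?_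
  · intro z hz
    refine Finset.mem_filter.mpr ⟨Finset.mem_image_of_mem _ (hmem z hz), ?_⟩
    have h2 := Submodule.sub_mem _ (Finset.mem_filter.mp hz).2 (Finset.mem_filter.mp hz₀).2
    obtain ⟨x, hx, hxe⟩ := Submodule.mem_map.mp h2
    refine ⟨-x, Submodule.neg_mem _ hx, ?_⟩
    rw [LinearMap.mem_ker, map_add, map_neg, hxe, map_sub]
    abel
  · intro z hz z' hz' he
    have he : z.1 + z.2 = z'.1 + z'.2 := sub_left_injective he
    obtain ⟨a1, a2⟩ := Finset.mem_product.mp (Finset.mem_filter.mp hz).1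
    obtain ⟨b1, b2⟩ := Finset.mem_product.mp (Finset.mem_filter.mp hz').1
    have a1 := (mem_wordsOn.mp a1).1
    have a2 := (mem_wordsOn.mp a2).1
    have b1 := (mem_wordsOn.mp b1).1
    have b2 := (mem_wordsOn.mp b2).1
    have hp : ∀ i, z.1 i = z'.1 i ∧ z.2 i = z'.2 i := by
      intro i
      have hi := congrFun he i
      simp only [Pi.add_apply] at hi
      by_cases hi₁ : i ∈ K₁
      · have hn : i ∉ K \ K₁ := fun h => (Finset.mem_sdiff.mp h).2 hi₁
        rw [a2 i hn, b2 i hn] at hi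
        exact ⟨by simpa using hi, by rw [a2 i hn, b2 i hn]⟩
      · rw [a1 i hi₁, b1 i hi₁] at hi
        exact ⟨by rw [a1 i hi₁, b1 i hi₁], by simpa using hi⟩
    exact Prod.ext (funext fun i => (hp i).1) (funext fun i => (hp i).2)

/-- A bound of the cost of Dumer's decoder, in length `m` and for weight `t`, when there are at most
`T` colliding pairs in each run; `n` is the ambient length, in which the cost of linear algebra is
counted. -/
def dumerCost (n c m L p t : ℕ) (T : ℝ) : ℝ :=
  (n : ℝ) ^ c * (⌈(m.choose t : ℝ) / ((L.choose p : ℝ) * ((m - L).choose (t - p) : ℝ))⌉₊ : ℝ) *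
    ((n : ℝ) ^ 3 + (n : ℝ) ^ 2 *
      (((L / 2).choose (p / 2) : ℝ) + ((L - L / 2).choose (p - p / 2) : ℝ) + T))

lemma dumerCost_nonneg {n c m L p t : ℕ} {T : ℝ} (hT : 0 ≤ T) : 0 ≤ dumerCost n c m L p t T := by
  unfold dumerCost; positivity

lemma decodeDumer_steps_le (n c L p t : ℕ) (φ : (ι → F2) →ₗ[F2] M) (y : M) {T : ℝ} (hT : 0 ≤ T)
    (h : ¬ DumerBad (LinearMap.ker φ) L p T) :
    (decodeDumer n c L p t φ y).steps ≤ dumerCost n c (Fintype.card ι) L p t T := by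
  unfold decodeDumer dumerCost
  refine mul_le_mul_of_nonneg_left ?_ (by positivity)
  refine expect_le_of_le (by positivity) fun K hK => ?_
  refine expect_le_of_le (by positivity) fun K₁ hK₁ => ?_
  obtain ⟨-, rfl⟩ := Finset.mem_powersetCard.mp hK
  obtain ⟨hK₁, hc⟩ := Finset.mem_powersetCard.mp hK₁
  unfold dumerRun
  simp only
  split_ifs
  · have h1 := card_colliding_le φ y hK₁ hT h hc
    simp only
    rw [card_wordsOn, card_wordsOn, Finset.card_sdiff_of_subset hK₁, hc]
    gcongr
  · simp only
    have : (0 : ℝ) ≤ (n : ℝ) ^ 2 * (((K.card / 2).choose (p / 2) : ℝ) +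
      ((K.card - K.card / 2).choose (p - p / 2) : ℝ) + T) := by positivity
    linarith

/-- Some coset of `N` has more than `T` words of weight `t`. -/
def FiberBad (N : Submodule F2 (ι → F2)) (t : ℕ) (T : ℝ) : Prop :=
  ∃ x ∈ (Finset.univ : Finset (ι → F2)), T < ((completable N Finset.univ
    ((wordsOn Finset.univ t).image fun v => v - x)).card : ℝ)

lemma prob_fiberBad_le {Ω : Type} (Om : Finset Ω) (N : Ω → Submodule F2 (ι → F2)) {θ T : ℝ}
    (hθ : 0 ≤ θ) (l : ℕ) (hN : ∀ v : Fin l → ι → F2, LinearIndependent F2 v →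
      prob Om (fun ω => ∀ i, v i ∈ N ω) ≤ θ ^ l) (t : ℕ) (hT : 0 < T) :
    prob Om (fun ω => FiberBad (N ω) t (T + 2 ^ l)) ≤
      2 ^ Fintype.card ι * ((Fintype.card ι).choose t * θ / T) ^ l := by
  unfold FiberBad
  refine (prob_exists_le _ _ (p := ((Fintype.card ι).choose t * θ / T) ^ l)
    fun x hx => ?_).trans ?_
  · refine (prob_completable_gt_le Om N hθ l hN Finset.univ _ (fun y _ i hi =>
      absurd (Finset.mem_univ i) hi) hT).trans ?_
    have h1 : ((((wordsOn Finset.univ t).image fun v : ι → F2 => v - x).card : ℕ) : ℝ) ≤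
        (Fintype.card ι).choose t := by
      rw [← Finset.card_univ, ← card_wordsOn]
      exact_mod_cast Finset.card_image_le
    rw [Finset.compl_univ, Finset.card_empty, pow_zero, one_mul]
    gcongr
  · refine mul_le_mul_of_nonneg_right ?_ (by positivity)
    simp [ZMod.card]

lemma decodeDumer_card_le (n c L p t : ℕ) (φ : (ι → F2) →ₗ[F2] M) (y : M) {T : ℝ} (hT : 0 ≤ T)
    (h : ¬ FiberBad (LinearMap.ker φ) t T) : ((decodeDumer n c L p t φ y).val.card : ℝ) ≤ T := by
  unfold decodeDumer
  simp only
  rcases (Finset.univ.filter fun x => hammingNorm x = t ∧ φ x = y).eq_empty_or_nonempty with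
    h0 | ⟨x₀, hx₀⟩
  · rw [h0]; simpa using hT
  have h1 : ((completable (LinearMap.ker φ) Finset.univ
      ((wordsOn Finset.univ t).image fun v => v - x₀)).card : ℝ) ≤ T := by
    by_contra hlt
    exact h ⟨x₀, Finset.mem_univ _, not_le.mp hlt⟩
  refine le_trans ?_ h1
  norm_cast
  refine Finset.card_le_card_of_injOn (fun x => x - x₀) ?_ fun x _ y _ h => sub_left_injective h
  intro x hx
  have hx := (Finset.mem_filter.mp hx).2
  have hx₀ := (Finset.mem_filter.mp hx₀).2
  refine Finset.mem_filter.mpr ⟨Finset.mem_image_of_mem _ (mem_wordsOn.mpr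
    ⟨fun i hi => absurd (Finset.mem_univ i) hi, hx.1⟩), 0, Submodule.zero_mem _, ?_⟩
  rw [LinearMap.mem_ker, add_zero, map_sub, hx.2, hx₀.2, sub_self]

lemma not_fiberBad (N : Submodule F2 (ι → F2)) {t : ℕ} {T : ℝ}
    (hT : ((Fintype.card ι).choose t : ℝ) ≤ T) : ¬ FiberBad N t T := by
  rintro ⟨x, -, h⟩
  refine not_lt.mpr hT (h.trans_le ?_)
  rw [← Finset.card_univ, ← card_wordsOn]
  exact_mod_cast (Finset.card_filter_le _ _).trans Finset.card_image_le

end DumerCost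

/-! ### Parity-checks and LPN samples -/

section Samples

lemma prob_or_le {α : Type} (Ω : Finset α) (E F : α → Prop) :
    prob Ω (fun a => E a ∨ F a) ≤ prob Ω E + prob Ω F := by
  unfold prob
  rw [← add_div]
  refine div_le_div_of_nonneg_right ?_ (Nat.cast_nonneg _)
  have : Ω.filter (fun a => E a ∨ F a) = Ω.filter E ∪ Ω.filter F := by
    ext a
    simp only [Finset.mem_filter, Finset.mem_union]
    tauto
  have h := Finset.card_union_le (Ω.filter E) (Ω.filter F)
  rw [← this] at h
  refine le_trans (le_of_eq ?_) (Nat.cast_le.mpr h |>.trans (le_of_eq (Nat.cast_add _ _)))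
  congr!

variable {n : ℕ} (q : Params) (P : Finset (Fin n))

/-- The parity-checks of weight `w` on the complement of `P`. -/
def checks (C : Submodule F2 (Fin n → F2)) : Finset (Fin n → F2) :=
  (dualWords C).filter fun h => hammingNorm (restr Pᶜ h) = q.w

/-- The parity-checks of weight `w` on the complement of `P` and at distance `t_aux` from `v`
on `P`. -/
def checksNear (C : Submodule F2 (Fin n → F2)) (v : P → F2) : Finset (Fin n → F2) :=
  (dualWords C).filter fun h => hammingNorm (restr P h + v) = q.taux ∧
    hammingNorm (restr Pᶜ h) = q.w

/-- Concentration of the number of parity-checks with a given property `p`. -/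
lemma prob_card_dualWords_gt_le (k l : ℕ) (p : (Fin n → F2) → Prop) [DecidablePred p] {b T : ℝ}
    (hT : 0 < T) (hb : ((Finset.univ.filter p).card : ℝ) ≤ b) :
    prob (genMatrices k (Fin n)) (fun G => T + 2 ^ l <
      (((dualWords (rowCode G)).filter p).card : ℝ)) ≤ (b * (1 / 2 ^ k) / T) ^ l := by
  have h := prob_card_gt_le (genMatrices k (Fin n)) (fun G h => G *ᵥ h = 0)
    (Finset.univ.filter p) l (θ := 1 / 2 ^ k) (by positivity) hT
    fun v hv => prob_mulVec_eq_zero_le k v (mem_indepTuples.mp hv).2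
  refine (prob_mono fun G _ hG => ?_).trans (h.trans (by gcongr))
  have : (dualWords (rowCode G)).filter p =
      (Finset.univ.filter p).filter fun h => G *ᵥ h = 0 := by
    ext h
    simp only [Finset.mem_filter, mem_dualWords_rowCode, Finset.mem_univ, true_and]
    tauto
  rw [this] at hG
  convert hG

/-- The mean number of parity-checks with a given property; the summand `1` stands for the zero
vector, which is always a parity-check. -/
lemma expect_card_dualWords_le (k : ℕ) (p : (Fin n → F2) → Prop) [DecidablePred p] {b : ℝ}
    (hb : ((Finset.univ.filter p).card : ℝ) ≤ b) :
    𝔼 G ∈ genMatrices k (Fin n), (((dualWords (rowCode G)).filter p).card : ℝ) ≤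
      1 + b / 2 ^ k := by
  have h1 : ∀ G : Matrix (Fin k) (Fin n) F2, (((dualWords (rowCode G)).filter p).card : ℝ) ≤
      1 + (((Finset.univ.filter fun h => p h ∧ h ≠ 0).filter fun h => G *ᵥ h = 0).card : ℝ) := by
    intro G
    have : (dualWords (rowCode G)).filter p ⊆
        insert 0 ((Finset.univ.filter fun h => p h ∧ h ≠ 0).filter fun h => G *ᵥ h = 0) := by
      intro h
      simp only [Finset.mem_filter, mem_dualWords_rowCode, Finset.mem_univ, true_and,
        Finset.mem_insert]
      tauto
    have := (Finset.card_le_card this).trans (Finset.card_insert_le _ _)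
    rw [add_comm] at this
    exact_mod_cast this
  have h2 := expect_filter_union_le (genMatrices k (Fin n))
    (Finset.univ.filter fun h => p h ∧ h ≠ 0) (fun G h => G *ᵥ h = 0) (p := 1 / 2 ^ k)
    (fun h hh => by
      have h0 := (Finset.mem_filter.mp hh).2.2
      have := prob_mulVec_eq_zero_le k (fun _ : Fin 1 => h)
        (LinearIndependent.of_subsingleton (R := F2) (0 : Fin 1) h0)
      simpa using this)
  have h3 : ((Finset.univ.filter fun h => p h ∧ h ≠ 0).card : ℝ) ≤ b := by
    refine le_trans ?_ hb
    refine Nat.cast_le.mpr (Finset.card_le_card fun h hh => ?_)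
    exact Finset.mem_filter.mpr ⟨Finset.mem_univ _, (Finset.mem_filter.mp hh).2.1⟩
  rcases (genMatrices k (Fin n)).eq_empty_or_nonempty with he | he
  · rw [he]
    have : 0 ≤ b := le_trans (by positivity) hb
    simp only [Finset.expect_empty]
    positivity
  calc _ ≤ 𝔼 G ∈ genMatrices k (Fin n), (1 + (((Finset.univ.filter fun h => p h ∧ h ≠ 0).filter
        fun h => G *ᵥ h = 0).card : ℝ)) := expect_mono fun G _ => h1 G
    _ ≤ _ := by
      rw [Finset.expect_add_distrib, Finset.expect_const he]
      refine add_le_add_right (le_trans ?_ (h2.trans (mul_le_mul_of_nonneg_right h3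
        (by positivity)))) _ |>.trans (le_of_eq (by ring))
      refine expect_mono fun G _ => le_of_eq ?_
      congr!

variable {P}

lemma card_filter_checks (hP : P.card = q.s) :
    (((Finset.univ : Finset (Fin n → F2)).filter fun h =>
      hammingNorm (restr Pᶜ h) = q.w).card : ℝ) = 2 ^ q.s * ((n - q.s).choose q.w : ℝ) := by
  have h1 : ((Finset.univ : Finset (Fin n → F2)).filter fun h =>
      hammingNorm (restr Pᶜ h) = q.w).card = ((Finset.univ : Finset (P → F2)) ×ˢ
        (wordsOn (Finset.univ : Finset ↥Pᶜ) q.w)).card := by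
    refine Finset.card_equiv (splitEquiv P) fun h => ?_
    simp [splitEquiv, mem_wordsOn]
  rw [h1, Finset.card_product, card_wordsOn, Finset.card_univ, Finset.card_univ,
    card_compl_coe P hP, Fintype.card_fun, ZMod.card, Fintype.card_coe, hP]
  push_cast
  rfl

lemma card_filter_checksNear (hP : P.card = q.s) (v : P → F2) :
    (((Finset.univ : Finset (Fin n → F2)).filter fun h => hammingNorm (restr P h + v) = q.taux ∧
      hammingNorm (restr Pᶜ h) = q.w).card : ℝ) =
      (q.s.choose q.taux : ℝ) * ((n - q.s).choose q.w : ℝ) := by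
  rw [← hP]
  exact_mod_cast card_filter_split P v q.taux q.w

lemma card_translate_le (z : P → F2) (t : ℕ) :
    ((Finset.univ : Finset (P → F2)).filter fun x => hammingNorm (z + x) = t).card ≤
      P.card.choose t := by
  rw [← Fintype.card_coe P, ← Finset.card_univ (α := P), ← card_wordsOn]
  refine Finset.card_le_card_of_injOn (fun x : P → F2 => z + x) (fun x hx => ?_)
    fun x _ y _ h => add_left_cancel (a := z) h
  exact mem_wordsOn.mpr ⟨fun i hi => absurd (Finset.mem_univ i) hi, (Finset.mem_filter.mp hx).2⟩

/-- The mean number of codewords of a random auxiliary code at distance `t_aux` from `z`: the zero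
codeword aside, they behave as uniform words. -/
lemma expect_card_decodeAux_le (hP : P.card = q.s) (hs : 0 < q.s) (z : P → F2) :
    𝔼 G ∈ genMatrices q.kaux P, ((Finset.univ.filter fun m : Fin q.kaux → F2 =>
      hammingNorm (z + m ᵥ* G) = q.taux).card : ℝ) ≤
      (if hammingNorm z = q.taux then 1 else 0) +
        2 * ((q.s.choose q.taux : ℝ) * 2 ^ q.kaux / 2 ^ q.s) := by
  have hrw := expect_card_filter (genMatrices q.kaux P) (Finset.univ : Finset (Fin q.kaux → F2))
    fun G m => hammingNorm (z + m ᵥ* G) = q.taux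
  have hle : 𝔼 G ∈ genMatrices q.kaux P, ((Finset.univ.filter fun m : Fin q.kaux → F2 =>
      hammingNorm (z + m ᵥ* G) = q.taux).card : ℝ) = ∑ m : Fin q.kaux → F2,
        prob (genMatrices q.kaux P) fun G => hammingNorm (z + m ᵥ* G) = q.taux := by
    rw [← hrw]
    refine Finset.expect_congr rfl fun G _ => ?_
    congr!
  rw [hle, ← Finset.add_sum_erase _ _ (Finset.mem_univ (0 : Fin q.kaux → F2))]
  refine add_le_add ?_ ?_
  · split_ifs with h
    · rw [prob]
      exact div_le_one_of_le₀ (by exact_mod_cast Finset.card_filter_le _ _) (Nat.cast_nonneg _)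
    · exact (prob_eq_zero fun G _ => by simpa using h).le
  · -- a given word is hit with probability at most `1 / (2 ^ s - 1) ≤ 2 / 2 ^ s`
    have hs2 : (2 : ℝ) ≤ 2 ^ q.s := by
      calc (2 : ℝ) = 2 ^ 1 := (pow_one _).symm
        _ ≤ 2 ^ q.s := pow_le_pow_right₀ (by norm_num) hs
    have h1 : ∀ m ∈ (Finset.univ : Finset (Fin q.kaux → F2)).erase 0,
        prob (genMatrices q.kaux P) (fun G => hammingNorm (z + m ᵥ* G) = q.taux) ≤
          (q.s.choose q.taux : ℝ) * (2 / 2 ^ q.s) := by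
      intro m hm
      have hm : m ≠ 0 := Finset.ne_of_mem_erase hm
      have h2 := prob_exists_le (Ω := genMatrices q.kaux P)
        ((Finset.univ : Finset (P → F2)).filter fun x => hammingNorm (z + x) = q.taux)
        (fun x G => m ᵥ* G = x) (p := 2 / 2 ^ q.s) (fun x _ => by
          have h3 := prob_vecMul_eq_le (k := q.kaux) hm x
          rw [Fintype.card_coe, hP] at h3
          rw [le_div_iff₀ (by positivity)]
          have h4 := prob_nonneg (genMatrices q.kaux P) fun G => m ᵥ* G = x
          nlinarith)
      refine (prob_mono fun G _ h => ?_).trans (h2.trans ?_)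
      · exact ⟨m ᵥ* G, Finset.mem_filter.mpr ⟨Finset.mem_univ _, h⟩, rfl⟩
      · have := card_translate_le z q.taux
        rw [hP] at this
        gcongr
    refine (Finset.sum_le_sum h1).trans ?_
    rw [Finset.sum_const, nsmul_eq_mul]
    have h5 : ((((Finset.univ : Finset (Fin q.kaux → F2)).erase 0).card : ℕ) : ℝ) ≤ 2 ^ q.kaux := by
      have : ((Finset.univ : Finset (Fin q.kaux → F2)).erase 0).card ≤ 2 ^ q.kaux := by
        refine (Finset.card_erase_le).trans ?_
        simp [ZMod.card]
      exact_mod_cast this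
    calc _ ≤ (2 : ℝ) ^ q.kaux * ((q.s.choose q.taux : ℝ) * (2 / 2 ^ q.s)) := by gcongr
      _ = _ := by ring

variable {q} (c : ℕ) (cost : DecCost n q) (C : Submodule F2 (Fin n → F2))

/-- The number of LPN samples, as a sum over the parity-checks. -/
lemma card_lpnSamples_le (G : Matrix (Fin q.kaux) P F2) :
    ((lpnSamples c cost C P G).val.card : ℝ) ≤ ∑ h ∈ checks q P C,
      ((Finset.univ.filter fun m : Fin q.kaux → F2 =>
        hammingNorm (restr P h + m ᵥ* G) = q.taux).card : ℝ) := by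
  have : (lpnSamples c cost C P G).val.card ≤ ∑ h ∈ checks q P C,
      (Finset.univ.filter fun m : Fin q.kaux → F2 =>
        hammingNorm (restr P h + m ᵥ* G) = q.taux).card := by
    unfold lpnSamples
    refine Finset.card_biUnion_le.trans ?_
    refine Finset.sum_le_sum fun h _ => ?_
    exact Finset.card_image_le
  exact_mod_cast this

/-- A bound for the mean over the auxiliary code of the number of LPN samples. -/
lemma expect_sum_decodeAux_le (hP : P.card = q.s) (hs : 0 < q.s) :
    𝔼 G ∈ genMatrices q.kaux P, ∑ h ∈ checks q P C,
      ((Finset.univ.filter fun m : Fin q.kaux → F2 =>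
        hammingNorm (restr P h + m ᵥ* G) = q.taux).card : ℝ) ≤
      (checksNear q P C 0).card + (checks q P C).card *
        (2 * ((q.s.choose q.taux : ℝ) * 2 ^ q.kaux / 2 ^ q.s)) := by
  rw [Finset.expect_sum_comm]
  refine (Finset.sum_le_sum fun h _ => expect_card_decodeAux_le q hP hs (restr P h)).trans ?_
  rw [Finset.sum_add_distrib, Finset.sum_const, nsmul_eq_mul, Finset.sum_boole]
  refine add_le_add_left ?_ _
  have : (checks q P C).filter (fun h => hammingNorm (restr P h) = q.taux) ⊆
      checksNear q P C 0 := by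
    intro h
    simp only [checks, checksNear, Finset.mem_filter, add_zero]
    tauto
  exact_mod_cast Finset.card_le_card this

lemma expect_lpnSamples_steps_le (hP : P.card = q.s) (hs : 0 < q.s) {D : ℝ}
    (hne : (genMatrices q.kaux P).Nonempty)
    (hD : ∀ z : P → F2, 𝔼 G ∈ genMatrices q.kaux P, cost P G z ≤ D) :
    𝔼 G ∈ genMatrices q.kaux P, (lpnSamples c cost C P G).steps ≤
      (parityCheckEquations c q C P).steps + (checks q P C).card * ((n : ℝ) ^ 2 + D) +
      (n : ℝ) ^ 2 * ((checksNear q P C 0).card + (checks q P C).card *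
        (2 * ((q.s.choose q.taux : ℝ) * 2 ^ q.kaux / 2 ^ q.s))) := by
  have h1 : ∀ G : Matrix (Fin q.kaux) P F2, (lpnSamples c cost C P G).steps =
      (parityCheckEquations c q C P).steps + (∑ h ∈ checks q P C, ((n : ℝ) ^ 2 +
        cost P G (restr P h)) + (n : ℝ) ^ 2 * ∑ h ∈ checks q P C,
      ((Finset.univ.filter fun m : Fin q.kaux → F2 =>
        hammingNorm (restr P h + m ᵥ* G) = q.taux).card : ℝ)) := by
    intro G
    unfold lpnSamples
    rw [Finset.mul_sum, ← Finset.sum_add_distrib]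
    rfl
  simp only [h1]
  rw [Finset.expect_add_distrib, Finset.expect_const hne, Finset.expect_add_distrib,
    ← Finset.mul_expect, add_assoc]
  refine add_le_add le_rfl (add_le_add ?_ ?_)
  · rw [Finset.expect_sum_comm, ← nsmul_eq_mul, ← Finset.sum_const]
    refine Finset.sum_le_sum fun h _ => ?_
    rw [Finset.expect_add_distrib, Finset.expect_const hne]
    exact add_le_add le_rfl (hD _)
  · exact mul_le_mul_of_nonneg_left (expect_sum_decodeAux_le C hP hs) (by positivity)

/-- The function whose Fourier transform selects the candidates. -/
def sampleTable (y : Fin n → F2) (H : Finset ((Fin n → F2) × (Fin q.kaux → F2))) :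
    (Fin q.kaux → F2) → ℤ :=
  fun m => ∑ a ∈ H.filter (fun a => a.2 = m), sign (y ⬝ᵥ a.1)

lemma mem_lpnSamples {G : Matrix (Fin q.kaux) P F2} {a : (Fin n → F2) × (Fin q.kaux → F2)} :
    a ∈ (lpnSamples c cost C P G).val ↔ a.1 ∈ dualWords C ∧
      hammingNorm (restr P a.1 + a.2 ᵥ* G) = q.taux ∧ hammingNorm (restr Pᶜ a.1) = q.w := by
  unfold lpnSamples decodeAux parityCheckEquations
  constructor
  · intro ha
    obtain ⟨h, hh, ha3⟩ := Finset.mem_biUnion.mp ha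
    obtain ⟨m, hm, rfl⟩ := Finset.mem_image.mp ha3
    obtain ⟨h1, h2⟩ := Finset.mem_filter.mp hh
    exact ⟨h1, (Finset.mem_filter.mp hm).2, h2⟩
  · rintro ⟨h1, h2, h3⟩
    exact Finset.mem_biUnion.mpr ⟨a.1, Finset.mem_filter.mpr ⟨h1, h3⟩,
      Finset.mem_image.mpr ⟨a.2, Finset.mem_filter.mpr ⟨Finset.mem_univ _, h2⟩, rfl⟩⟩

/-- If no word of length `s` is at distance `t_aux` from the restriction of more than `T`
parity-checks, then Parseval's identity bounds the Fourier transform in the mean square by the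
number of samples. -/
lemma sum_sq_fft_le (y : Fin n → F2) (G : Matrix (Fin q.kaux) P F2) {T : ℝ} (hT0 : 0 ≤ T)
    (hT : ∀ v, ((checksNear q P C v).card : ℝ) ≤ T) :
    ∑ x, (((fft q.kaux (sampleTable y (lpnSamples c cost C P G).val)).val x : ℤ) : ℝ) ^ 2 ≤
      2 ^ q.kaux * (T * (lpnSamples c cost C P G).val.card) := by
  set H := (lpnSamples c cost C P G).val with hH
  set f := sampleTable y H with hf
  -- the samples with message `m` come from distinct parity-checks near the codeword `m G`
  have hcount : ∀ m, ((H.filter fun a => a.2 = m).card : ℝ) ≤ T := by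
    intro m
    refine le_trans ?_ (hT (m ᵥ* G))
    norm_cast
    refine Finset.card_le_card_of_injOn (fun a => a.1) ?_ ?_
    · intro a ha
      obtain ⟨ha1, rfl⟩ := Finset.mem_filter.mp ha
      exact Finset.mem_filter.mpr ((mem_lpnSamples c cost C).mp ha1)
    · intro a ha b hb h
      exact Prod.ext h ((Finset.mem_filter.mp ha).2.trans (Finset.mem_filter.mp hb).2.symm)
  have hfle : ∀ m, |(f m : ℝ)| ≤ ((H.filter fun a => a.2 = m).card : ℝ) := by
    intro m
    have : |f m| ≤ ((H.filter fun a => a.2 = m).card : ℤ) := by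
      refine (Finset.abs_sum_le_sum_abs _ _).trans ?_
      simp [abs_sign]
    exact_mod_cast this
  have hsq : ∀ m, (f m : ℝ) ^ 2 ≤ T * ((H.filter fun a => a.2 = m).card : ℝ) := by
    intro m
    rw [← sq_abs, pow_two]
    exact mul_le_mul ((hfle m).trans (hcount m)) (hfle m) (abs_nonneg _) hT0
  have hpars : ∑ x, (((fft q.kaux f).val x : ℤ) : ℝ) ^ 2 = 2 ^ q.kaux * ∑ m, (f m : ℝ) ^ 2 := by
    exact_mod_cast fft_parseval q.kaux f
  have hsum : ∑ m : Fin q.kaux → F2, ((H.filter fun a => a.2 = m).card : ℝ) = H.card := by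
    have := Finset.card_eq_sum_card_fiberwise (s := H) (t := Finset.univ) (f := fun a => a.2)
      (fun a _ => Finset.mem_univ _)
    rw [this]
    push_cast
    refine Finset.sum_congr rfl fun m _ => ?_
    congr!
  rw [hpars]
  refine mul_le_mul_of_nonneg_left ?_ (by positivity)
  rw [← hsum, Finset.mul_sum]
  exact Finset.sum_le_sum fun m _ => hsq m

/-- Every candidate contributes at least the square of the threshold to Parseval's sum, which
bounds the number of candidates. -/
lemma card_candidates_mul_le (y : Fin n → F2) (G : Matrix (Fin q.kaux) P F2) {T : ℝ} (hT0 : 0 ≤ T)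
    (hT : ∀ v, ((checksNear q P C v).card : ℝ) ≤ T) (hpos : 0 ≤ q.bias n / 2 * q.samples n) :
    ((fftDecode q y (lpnSamples c cost C P G).val).val.card : ℝ) *
        (q.bias n / 2 * q.samples n) ^ 2 ≤
      2 ^ q.kaux * (T * (lpnSamples c cost C P G).val.card) := by
  refine le_trans ?_ (sum_sq_fft_le c cost C y G hT0 hT)
  rw [← nsmul_eq_mul, ← Finset.sum_const]
  refine (Finset.sum_le_sum fun x hx => ?_).trans
    (Finset.sum_le_sum_of_subset_of_nonneg (Finset.subset_univ _) fun _ _ _ => sq_nonneg _)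
  exact pow_le_pow_left₀ hpos (Finset.mem_filter.mp hx).2 2

lemma card_candidates_le (y : Fin n → F2) (H : Finset ((Fin n → F2) × (Fin q.kaux → F2))) :
    ((fftDecode q y H).val.card : ℝ) ≤ 2 ^ q.kaux := by
  have : (fftDecode q y H).val.card ≤ 2 ^ q.kaux :=
    (Finset.card_le_univ _).trans (by simp [ZMod.card])
  exact_mod_cast this

end Samples

/-! ### The mean cost of one iteration -/

section Iteration

lemma prod_fin_le_pow {r : ℕ} {f : Fin r → ℝ} {b : ℝ} (h0 : ∀ j, 0 ≤ f j) (h : ∀ j, f j ≤ b) :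
    ∏ j, f j ≤ b ^ r := by
  refine (Finset.prod_le_prod (fun j _ => h0 j) fun j _ => h j).trans (le_of_eq ?_)
  simp

lemma genMatrices_nonempty {k : ℕ} {ι : Type} [Fintype ι] (h : k ≤ Fintype.card ι) :
    (genMatrices k ι).Nonempty := by
  obtain ⟨f⟩ := Function.Embedding.nonempty_of_card_le (α := Fin k) (β := ι) (by simpa using h)
  refine ⟨fun i => Pi.basisFun F2 ι (f i), mem_genMatrices.mpr ?_⟩
  exact (Pi.basisFun F2 ι).linearIndependent.comp f f.injective

variable {n : ℕ} {q : Params} {P : Finset (Fin n)} {Naux : ℕ}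

/-- The words that, extended by zero to `P`, are codewords of `C`. -/
def errorSpace (P : Finset (Fin n)) (C : Submodule F2 (Fin n → F2)) : Submodule F2 (↥Pᶜ → F2) :=
  LinearMap.ker (C.mkQ ∘ₗ ext Pᶜ)

/-- The words that are orthogonal to all the auxiliary codes. -/
def auxKernel (G : Fin Naux → Matrix (Fin q.kaux) P F2) : Submodule F2 (P → F2) :=
  LinearMap.ker (LinearMap.pi fun j => (G j).mulVecLin)

/-- The exceptional codes: too many parity-checks near some word, too many parity-checks, or a
window with too many collisions in the information set decoder. -/
def CodeBad (q : Params) (P : Finset (Fin n)) (T₁ T₂ T₃ : ℝ) (C : Submodule F2 (Fin n → F2)) :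
    Prop :=
  (∃ v ∈ (Finset.univ : Finset (P → F2)), T₁ < ((checksNear q P C v).card : ℝ)) ∨
    T₂ < ((checks q P C).card : ℝ) ∨ DumerBad (errorSpace P C) q.Lb q.pb T₃

/-- The exceptional tuples of auxiliary codes: too many solutions of a decoding problem, or a window
with too many collisions in the information set decoder. -/
def AuxBad (T₄ T₅ : ℝ) (G : Fin Naux → Matrix (Fin q.kaux) P F2) : Prop :=
  FiberBad (auxKernel G) (q.t - q.u) T₄ ∨ DumerBad (auxKernel G) q.La q.pa T₅

lemma prob_mem_errorSpace_le (k l : ℕ) (v : Fin l → ↥Pᶜ → F2) (hv : LinearIndependent F2 v) :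
    prob (genMatrices k (Fin n)) (fun G => ∀ i, v i ∈ errorSpace P (rowCode G)) ≤
      ((2 : ℝ) ^ k / 2 ^ n) ^ l := by
  have h := prob_mem_rowCode_le k (fun i => ext Pᶜ (v i))
    (hv.map' (ext Pᶜ) (LinearMap.ker_eq_bot.mpr (ext_injective Pᶜ)))
  rw [Fintype.card_fin] at h
  refine le_trans (prob_mono fun G _ hG i => ?_) h
  have := hG i
  rwa [errorSpace, LinearMap.mem_ker, LinearMap.comp_apply, Submodule.mkQ_apply,
    Submodule.Quotient.mk_eq_zero] at this

lemma prob_mem_auxKernel_le (l : ℕ) (v : Fin l → P → F2) (hv : LinearIndependent F2 v) :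
    prob (Fintype.piFinset fun _ : Fin Naux => genMatrices q.kaux P)
      (fun G => ∀ i, v i ∈ auxKernel G) ≤ (((1 : ℝ) / 2 ^ q.kaux) ^ Naux) ^ l := by
  have h := prob_piFinset (r := Naux) (genMatrices q.kaux P) fun _ G => ∀ i, G *ᵥ v i = 0
  refine (prob_mono fun G _ hG => ?_).trans (h.le.trans ?_)
  · intro j i
    exact congrFun (LinearMap.mem_ker.mp (hG i)) j
  · rw [← pow_mul, mul_comm, pow_mul]
    exact prod_fin_le_pow (fun j => prob_nonneg _ _) fun j => prob_mulVec_eq_zero_le q.kaux v hv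

lemma prob_exists_checksNear_gt_le (hP : P.card = q.s) (hsn : q.s ≤ n) (l : ℕ) {ρ T₁ : ℝ}
    (hρ : 0 ≤ ρ) (hT₁ : 0 < T₁)
    (h₁ : (q.s.choose q.taux : ℝ) * ((n - q.s).choose q.w : ℝ) * (1 / 2 ^ q.k) ≤ ρ * T₁) :
    prob (genMatrices q.k (Fin n)) (fun G => ∃ v ∈ (Finset.univ : Finset (P → F2)),
      T₁ + 2 ^ l < ((checksNear q P (rowCode G) v).card : ℝ)) ≤ 8 ^ n * ρ ^ l := by
  refine (prob_exists_le _ _ (p := ρ ^ l) fun v _ => ?_).trans ?_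
  · refine (prob_card_dualWords_gt_le q.k l _ hT₁ (card_filter_checksNear q hP v).le).trans ?_
    exact pow_le_pow_left₀ (by positivity) ((div_le_iff₀ hT₁).mpr h₁) l
  · refine mul_le_mul_of_nonneg_right ?_ (by positivity)
    rw [Finset.card_univ, Fintype.card_fun, ZMod.card, Fintype.card_coe, hP]
    push_cast
    exact (pow_le_pow_left₀ (by norm_num) (by norm_num) _).trans
      (pow_le_pow_right₀ (by norm_num : (1 : ℝ) ≤ 8) hsn)

/-- The thresholds exceed the mean values by the factor `1 / ρ`, so that the exceptional codes have
probability of order `ρ ^ l`; the factor `8 ^ n` counts the words and the windows with a marked half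
and word. -/
lemma prob_codeBad_le (hP : P.card = q.s) (hsn : q.s ≤ n) (l : ℕ) {ρ T₁ T₂ T₃ : ℝ} (hρ : 0 ≤ ρ)
    (hT₁ : 0 < T₁) (hT₂ : 0 < T₂) (hT₃ : 0 < T₃)
    (h₁ : (q.s.choose q.taux : ℝ) * ((n - q.s).choose q.w : ℝ) * (1 / 2 ^ q.k) ≤ ρ * T₁)
    (h₂ : 2 ^ q.s * ((n - q.s).choose q.w : ℝ) * (1 / 2 ^ q.k) ≤ ρ * T₂)
    (h₃ : dumerPairs q.Lb q.pb * (2 ^ (n - q.s - q.Lb) * ((2 : ℝ) ^ q.k / 2 ^ n)) ≤ ρ * T₃) :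
    prob (genMatrices q.k (Fin n)) (fun G => CodeBad q P (T₁ + 2 ^ l) (T₂ + 2 ^ l) (T₃ + 2 ^ l)
      (rowCode G)) ≤ 3 * 8 ^ n * ρ ^ l := by
  have hρl : 0 ≤ ρ ^ l := by positivity
  have a1 := prob_exists_checksNear_gt_le hP hsn l hρ hT₁ h₁
  have a2 : prob (genMatrices q.k (Fin n)) (fun G =>
      T₂ + 2 ^ l < ((checks q P (rowCode G)).card : ℝ)) ≤ 8 ^ n * ρ ^ l := by
    refine (prob_card_dualWords_gt_le q.k l _ hT₂ (card_filter_checks q hP).le).trans ?_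
    refine (pow_le_pow_left₀ (by positivity) ((div_le_iff₀ hT₂).mpr h₂) l).trans ?_
    exact le_mul_of_one_le_left hρl (one_le_pow₀ (by norm_num))
  have a3 : prob (genMatrices q.k (Fin n)) (fun G =>
      DumerBad (errorSpace P (rowCode G)) q.Lb q.pb (T₃ + 2 ^ l)) ≤ 8 ^ n * ρ ^ l := by
    refine (prob_dumerBad_le _ _ (by positivity) l (prob_mem_errorSpace_le q.k l) q.Lb q.pb
      hT₃).trans ?_
    rw [card_compl_coe P hP]
    refine mul_le_mul (pow_le_pow_right₀ (by norm_num) (Nat.sub_le _ _)) ?_ (by positivity)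
      (by positivity)
    exact pow_le_pow_left₀ (by positivity) ((div_le_iff₀ hT₃).mpr h₃) l
  have a4 := prob_or_le (genMatrices q.k (Fin n)) (fun G =>
      T₂ + 2 ^ l < ((checks q P (rowCode G)).card : ℝ))
    (fun G => DumerBad (errorSpace P (rowCode G)) q.Lb q.pb (T₃ + 2 ^ l))
  have a5 := prob_or_le (genMatrices q.k (Fin n))
    (fun G => ∃ v ∈ (Finset.univ : Finset (P → F2)),
      T₁ + 2 ^ l < ((checksNear q P (rowCode G) v).card : ℝ)) (fun G =>
      T₂ + 2 ^ l < ((checks q P (rowCode G)).card : ℝ) ∨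
      DumerBad (errorSpace P (rowCode G)) q.Lb q.pb (T₃ + 2 ^ l))
  unfold CodeBad
  linarith

/-- The analogue of `prob_codeBad_le` for the auxiliary codes. -/
lemma prob_auxBad_le (hP : P.card = q.s) (hsn : q.s ≤ n) (l : ℕ) {ρ T₄ T₅ : ℝ} (hρ : 0 ≤ ρ)
    (hT₄ : 0 < T₄) (hT₅ : 0 < T₅)
    (h₄ : (q.s.choose (q.t - q.u) : ℝ) * (1 / 2 ^ q.kaux) ^ Naux ≤ ρ * T₄)
    (h₅ : dumerPairs q.La q.pa * (2 ^ (q.s - q.La) * ((1 : ℝ) / 2 ^ q.kaux) ^ Naux) ≤ ρ * T₅) :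
    prob (Fintype.piFinset fun _ : Fin Naux => genMatrices q.kaux P)
      (fun G => AuxBad (T₄ + 2 ^ l) (T₅ + 2 ^ l) G) ≤ 2 * 8 ^ n * ρ ^ l := by
  have hρl : 0 ≤ ρ ^ l := by positivity
  have a1 : prob (Fintype.piFinset fun _ : Fin Naux => genMatrices q.kaux P) (fun G =>
      FiberBad (auxKernel G) (q.t - q.u) (T₄ + 2 ^ l)) ≤ 8 ^ n * ρ ^ l := by
    refine (prob_fiberBad_le _ _ (by positivity) l (prob_mem_auxKernel_le l) (q.t - q.u)
      hT₄).trans ?_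
    rw [Fintype.card_coe, hP]
    refine mul_le_mul ((pow_le_pow_left₀ (by norm_num) (by norm_num) _).trans
      (pow_le_pow_right₀ (by norm_num : (1 : ℝ) ≤ 8) hsn)) ?_ (by positivity) (by positivity)
    exact pow_le_pow_left₀ (by positivity) ((div_le_iff₀ hT₄).mpr h₄) l
  have a2 : prob (Fintype.piFinset fun _ : Fin Naux => genMatrices q.kaux P) (fun G =>
      DumerBad (auxKernel G) q.La q.pa (T₅ + 2 ^ l)) ≤ 8 ^ n * ρ ^ l := by
    refine (prob_dumerBad_le _ _ (by positivity) l (prob_mem_auxKernel_le l) q.La q.pa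
      hT₅).trans ?_
    rw [Fintype.card_coe, hP]
    refine mul_le_mul (pow_le_pow_right₀ (by norm_num) hsn) ?_ (by positivity) (by positivity)
    exact pow_le_pow_left₀ (by positivity) ((div_le_iff₀ hT₅).mpr h₅) l
  have a3 := prob_or_le (Fintype.piFinset fun _ : Fin Naux => genMatrices q.kaux P) (fun G =>
      FiberBad (auxKernel G) (q.t - q.u) (T₄ + 2 ^ l))
    (fun G => DumerBad (auxKernel G) q.La q.pa (T₅ + 2 ^ l))
  unfold AuxBad
  linarith

/-- The cost of the treatment of one tuple of candidates, when there are at most `T₄` solutions on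
`P` and at most `T₅` and `T₃` collisions in the two information set decoders. -/
def isdCost (n c : ℕ) (q : Params) (T₃ T₄ T₅ : ℝ) : ℝ :=
  (n : ℝ) ^ 2 + dumerCost n c q.s q.La q.pa (q.t - q.u) T₅ +
    T₄ * ((n : ℝ) ^ 3 + dumerCost n c (n - q.s) q.Lb q.pb q.u T₃)

lemma isdCost_nonneg {n c : ℕ} {q : Params} {T₃ T₄ T₅ : ℝ} (h₃ : 0 ≤ T₃) (h₄ : 0 ≤ T₄)
    (h₅ : 0 ≤ T₅) : 0 ≤ isdCost n c q T₃ T₄ T₅ := by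
  unfold isdCost
  have := dumerCost_nonneg (n := n) (c := c) (m := q.s) (L := q.La) (p := q.pa)
    (t := q.t - q.u) h₅
  have := dumerCost_nonneg (n := n) (c := c) (m := n - q.s) (L := q.Lb) (p := q.pb) (t := q.u) h₃
  positivity

lemma recoverError_steps_le (hP : P.card = q.s) (c : ℕ) (C : Submodule F2 (Fin n → F2))
    (y : Fin n → F2) (G : Fin Naux → Matrix (Fin q.kaux) P F2)
    (S : Fin Naux → Finset (Fin q.kaux → F2)) {T₃ T₄ T₅ : ℝ} (h₃ : 0 ≤ T₃) (h₄ : 0 ≤ T₄)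
    (h₅ : 0 ≤ T₅) (hC : ¬ DumerBad (errorSpace P C) q.Lb q.pb T₃) (hG : ¬ AuxBad T₄ T₅ G) :
    (recoverError c q C P y G S).steps ≤ (∏ j, ((S j).card : ℝ)) * isdCost n c q T₃ T₄ T₅ := by
  unfold AuxBad at hG
  rw [not_or] at hG
  have hcard : ((Fintype.piFinset S).card : ℝ) = ∏ j, ((S j).card : ℝ) := by
    rw [Fintype.card_piFinset]
    push_cast
    rfl
  rw [← hcard, ← nsmul_eq_mul, ← Finset.sum_const]
  unfold recoverError isdCost
  refine Finset.sum_le_sum fun a _ => ?_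
  have h1 := decodeDumer_steps_le n c q.La q.pa (q.t - q.u)
    (LinearMap.pi fun j => (G j).mulVecLin) a h₅ hG.2
  have h2 := decodeDumer_card_le n c q.La q.pa (q.t - q.u)
    (LinearMap.pi fun j => (G j).mulVecLin) a h₄ hG.1
  rw [Fintype.card_coe, hP] at h1
  have h3 : ∀ v, (solveSubProblem c q C P y v).steps ≤
      dumerCost n c (n - q.s) q.Lb q.pb q.u T₃ := by
    intro v
    have := decodeDumer_steps_le n c q.Lb q.pb q.u (C.mkQ ∘ₗ ext Pᶜ) (C.mkQ (y - ext P v)) h₃ hC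
    rwa [card_compl_coe P hP] at this
  have h0 := dumerCost_nonneg (n := n) (c := c) (m := n - q.s) (L := q.Lb) (p := q.pb) (t := q.u)
    h₃
  refine add_le_add (add_le_add le_rfl h1) ?_
  refine (Finset.sum_le_sum fun v _ => add_le_add le_rfl (h3 v)).trans ?_
  rw [Finset.sum_const, nsmul_eq_mul]
  exact mul_le_mul_of_nonneg_right h2 (by positivity)

/-- The cost of the treatment of one tuple of candidates in the worst case. -/
def isdCostMax (n c : ℕ) (q : Params) : ℝ :=
  isdCost n c q (dumerPairs q.Lb q.pb) (q.s.choose (q.t - q.u)) (dumerPairs q.La q.pa)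

lemma isdCostMax_nonneg {n c : ℕ} {q : Params} : 0 ≤ isdCostMax n c q :=
  isdCost_nonneg (Nat.cast_nonneg _) (Nat.cast_nonneg _) (Nat.cast_nonneg _)

lemma recoverError_steps_le_max (hP : P.card = q.s) (c : ℕ) (C : Submodule F2 (Fin n → F2))
    (y : Fin n → F2) (G : Fin Naux → Matrix (Fin q.kaux) P F2)
    (S : Fin Naux → Finset (Fin q.kaux → F2)) :
    (recoverError c q C P y G S).steps ≤ (∏ j, ((S j).card : ℝ)) * isdCostMax n c q := by
  refine recoverError_steps_le hP c C y G S (Nat.cast_nonneg _) (Nat.cast_nonneg _)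
    (Nat.cast_nonneg _) (not_dumerBad _ le_rfl) ?_
  unfold AuxBad
  rw [not_or]
  exact ⟨not_fiberBad _ (by rw [Fintype.card_coe, hP]), not_dumerBad _ le_rfl⟩

lemma fftDecode_steps (y : Fin n → F2) (H : Finset ((Fin n → F2) × (Fin q.kaux → F2))) :
    (fftDecode q y H).steps = (n : ℝ) ^ 2 * H.card + (n : ℝ) ^ 2 * ((q.kaux + 3) * 2 ^ q.kaux) := by
  unfold fftDecode
  simp only [fft_steps]
  ring

/-- The sum over the parity-checks of the numbers of neighbouring auxiliary codewords. -/
def sampleSum (C : Submodule F2 (Fin n → F2)) (G : Matrix (Fin q.kaux) P F2) : ℝ :=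
  ∑ h ∈ checks q P C, ((Finset.univ.filter fun m : Fin q.kaux → F2 =>
    hammingNorm (restr P h + m ᵥ* G) = q.taux).card : ℝ)

/-- The parameter `2 binom(s,t_aux) 2^{k_aux - s}` that governs the number of auxiliary codewords at
distance `t_aux` from a word. -/
def auxDensity (q : Params) : ℝ := 2 * ((q.s.choose q.taux : ℝ) * 2 ^ q.kaux / 2 ^ q.s)

lemma auxDensity_nonneg (q : Params) : 0 ≤ auxDensity q := by unfold auxDensity; positivity

/-- A bound of the cost of one iteration that does not depend on the received word.  The function
`M` bounds the number of candidates of one auxiliary code.  In the exceptional cases, all tuples of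
vectors are counted as candidates and each of them is charged the worst-case cost. -/
lemma iteration_steps_le (hP : P.card = q.s) (c : ℕ) (cost : DecCost n q)
    (C : Submodule F2 (Fin n → F2)) (hC : Module.finrank F2 (punctured C P) = q.s)
    (y : Fin n → F2) (G : Fin Naux → Matrix (Fin q.kaux) P F2) {T₁ T₂ T₃ T₄ T₅ : ℝ}
    (h₃ : 0 ≤ T₃) (h₄ : 0 ≤ T₄) (h₅ : 0 ≤ T₅) (M : Matrix (Fin q.kaux) P F2 → ℝ)
    (hM0 : ∀ A, 0 ≤ M A)
    (hM : ¬ CodeBad q P T₁ T₂ T₃ C → ∀ j,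
      ((fftDecode q y (lpnSamples c cost C P (G j)).val).val.card : ℝ) ≤ M (G j)) :
    (iteration c cost C y ⟨P, G⟩).steps ≤ (n : ℝ) ^ 3 +
      (∑ j, ((lpnSamples c cost C P (G j)).steps + (n : ℝ) ^ 2 * sampleSum C (G j) +
        (n : ℝ) ^ 2 * ((q.kaux + 3) * 2 ^ q.kaux)) +
      ((if CodeBad q P T₁ T₂ T₃ C then 0 else ∏ j, M (G j)) * isdCost n c q T₃ T₄ T₅ +
      ((if CodeBad q P T₁ T₂ T₃ C then 1 else 0) + (if AuxBad T₄ T₅ G then 1 else 0)) *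
        ((2 ^ q.kaux) ^ Naux * isdCostMax n c q))) := by
  have hit : (iteration c cost C y ⟨P, G⟩).steps = (n : ℝ) ^ 3 +
      ∑ j, ((lpnSamples c cost C P (G j)).steps +
        (fftDecode q y (lpnSamples c cost C P (G j)).val).steps) +
      (recoverError c q C P y G fun j =>
        (fftDecode q y (lpnSamples c cost C P (G j)).val).val).steps := by
    unfold iteration
    rw [if_pos hC]
  rw [hit, add_assoc]
  refine add_le_add le_rfl (add_le_add (Finset.sum_le_sum fun j _ => ?_) ?_)
  · rw [fftDecode_steps, add_assoc]
    refine add_le_add le_rfl (add_le_add ?_ le_rfl)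
    exact mul_le_mul_of_nonneg_left (card_lpnSamples_le c cost C (G j)) (by positivity)
  · set S := fun j => (fftDecode q y (lpnSamples c cost C P (G j)).val).val with hS
    have hI := isdCost_nonneg (n := n) (c := c) (q := q) h₃ h₄ h₅
    have hX : 0 ≤ (2 ^ q.kaux) ^ Naux * isdCostMax n c q :=
      mul_nonneg (by positivity) isdCostMax_nonneg
    have hmax : (recoverError c q C P y G S).steps ≤
        (2 ^ q.kaux) ^ Naux * isdCostMax n c q := by
      refine (recoverError_steps_le_max hP c C y G S).trans ?_
      refine mul_le_mul_of_nonneg_right ?_ isdCostMax_nonneg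
      exact prod_fin_le_pow (fun j => Nat.cast_nonneg _) fun j => card_candidates_le y _
    by_cases hb : CodeBad q P T₁ T₂ T₃ C
    · rw [if_pos hb, if_pos hb, zero_mul, zero_add]
      refine hmax.trans (le_mul_of_one_le_left hX ?_)
      split_ifs <;> norm_num
    · rw [if_neg hb, if_neg hb]
      have hprod : 0 ≤ ∏ j, M (G j) := Finset.prod_nonneg fun j _ => hM0 _
      by_cases hg : AuxBad T₄ T₅ G
      · rw [if_pos hg, zero_add, one_mul]
        exact hmax.trans (le_add_of_nonneg_left (mul_nonneg hprod hI))
      · rw [if_neg hg, add_zero, zero_mul, add_zero]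
        have hd : ¬ DumerBad (errorSpace P C) q.Lb q.pb T₃ := fun h => hb (Or.inr (Or.inr h))
        refine (recoverError_steps_le hP c C y G S h₃ h₄ h₅ hd hg).trans ?_
        refine mul_le_mul_of_nonneg_right ?_ hI
        exact Finset.prod_le_prod (fun j _ => Nat.cast_nonneg _) fun j _ => hM hb j

/-- The mean cost of one iteration for a fixed set `P`: the search for the parity-checks and the
samples, the Fourier transforms, the treatment of the candidates, and the exceptional cases. -/
lemma expect_iteration_le (hP : P.card = q.s) (hs : 0 < q.s) (hsn : q.s ≤ n) (hkn : q.k ≤ n)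
    (hks : q.kaux ≤ q.s) (c l : ℕ) (cost : DecCost n q) {D E : ℝ} (hD0 : 0 ≤ D)
    (hD : ∀ z : P → F2, 𝔼 G ∈ genMatrices q.kaux P, cost P G z ≤ D)
    (hE : 𝔼 G ∈ genMatrices q.k (Fin n), (if Module.finrank F2 (punctured (rowCode G) P) = q.s
      then (parityCheckEquations c q (rowCode G) P).steps else 0) ≤ E)
    {ρ T₁ T₂ T₃ T₄ T₅ : ℝ} (hρ : 0 ≤ ρ)
    (hT₁ : 0 < T₁) (hT₂ : 0 < T₂) (hT₃ : 0 < T₃) (hT₄ : 0 < T₄) (hT₅ : 0 < T₅)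
    (h₁ : (q.s.choose q.taux : ℝ) * ((n - q.s).choose q.w : ℝ) * (1 / 2 ^ q.k) ≤ ρ * T₁)
    (h₂ : 2 ^ q.s * ((n - q.s).choose q.w : ℝ) * (1 / 2 ^ q.k) ≤ ρ * T₂)
    (h₃ : dumerPairs q.Lb q.pb * (2 ^ (n - q.s - q.Lb) * ((2 : ℝ) ^ q.k / 2 ^ n)) ≤ ρ * T₃)
    (h₄ : (q.s.choose (q.t - q.u) : ℝ) * (1 / 2 ^ q.kaux) ^ Naux ≤ ρ * T₄)
    (h₅ : dumerPairs q.La q.pa * (2 ^ (q.s - q.La) * ((1 : ℝ) / 2 ^ q.kaux) ^ Naux) ≤ ρ * T₅)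
    (M : Submodule F2 (Fin n → F2) → Matrix (Fin q.kaux) P F2 → ℝ) (hM0 : ∀ C A, 0 ≤ M C A)
    (hM : ∀ C y, ¬ CodeBad q P (T₁ + 2 ^ l) (T₂ + 2 ^ l) (T₃ + 2 ^ l) C → ∀ A,
      ((fftDecode q y (lpnSamples c cost C P A).val).val.card : ℝ) ≤ M C A) {μ : ℝ} (hμ : 0 ≤ μ)
    (hMμ : ∀ C, ¬ CodeBad q P (T₁ + 2 ^ l) (T₂ + 2 ^ l) (T₃ + 2 ^ l) C →
      𝔼 A ∈ genMatrices q.kaux P, M C A ≤ μ)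
    (y : Matrix (Fin q.k) (Fin n) F2 → (Fin q.k → F2) → Fin n → F2) :
    𝔼 A ∈ Fintype.piFinset (fun _ : Fin Naux => genMatrices q.kaux P),
      𝔼 G ∈ genMatrices q.k (Fin n), 𝔼 m : Fin q.k → F2,
        (iteration c cost (rowCode G) (y G m) ⟨P, A⟩).steps ≤
      (n : ℝ) ^ 3 + (Naux * (E + (1 + 2 ^ q.s * ((n - q.s).choose q.w : ℝ) / 2 ^ q.k) *
          ((n : ℝ) ^ 2 + D) + 2 * (n : ℝ) ^ 2 *
          (1 + (q.s.choose q.taux : ℝ) * ((n - q.s).choose q.w : ℝ) / 2 ^ q.k +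
          (1 + 2 ^ q.s * ((n - q.s).choose q.w : ℝ) / 2 ^ q.k) * auxDensity q) +
          (n : ℝ) ^ 2 * ((q.kaux + 3) * 2 ^ q.kaux)) +
        (μ ^ Naux * isdCost n c q (T₃ + 2 ^ l) (T₄ + 2 ^ l) (T₅ + 2 ^ l) +
          5 * 8 ^ n * ρ ^ l * ((2 ^ q.kaux) ^ Naux * isdCostMax n c q))) := by
  set Tc := (2 : ℝ) ^ l with hTc
  have hTc0 : 0 ≤ Tc := by positivity
  set Ω := genMatrices q.kaux P with hΩ
  have hΩne : Ω.Nonempty := genMatrices_nonempty (by rw [Fintype.card_coe, hP]; exact hks)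
  have hΩ' : (Fintype.piFinset (fun _ : Fin Naux => Ω)).Nonempty :=
    Fintype.piFinset_nonempty.mpr fun _ => hΩne
  have hGne : (genMatrices q.k (Fin n)).Nonempty := genMatrices_nonempty (by simpa using hkn)
  set I := isdCost n c q (T₃ + Tc) (T₄ + Tc) (T₅ + Tc) with hI
  have hI0 : 0 ≤ I := isdCost_nonneg (by positivity) (by positivity) (by positivity)
  set X := (2 ^ q.kaux) ^ Naux * isdCostMax n c q with hX
  have hX0 : 0 ≤ X := mul_nonneg (by positivity) isdCostMax_nonneg
  set ad := auxDensity q with had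
  have had0 : 0 ≤ ad := auxDensity_nonneg q
  set F := (n : ℝ) ^ 2 * ((q.kaux + 3) * 2 ^ q.kaux) with hF
  have hF0 : 0 ≤ F := by positivity
  let bad := fun G : Matrix (Fin q.k) (Fin n) F2 =>
    CodeBad q P (T₁ + Tc) (T₂ + Tc) (T₃ + Tc) (rowCode G)
  let pc := fun G : Matrix (Fin q.k) (Fin n) F2 =>
    if Module.finrank F2 (punctured (rowCode G) P) = q.s
      then (parityCheckEquations c q (rowCode G) P).steps else 0
  let W := fun G : Matrix (Fin q.k) (Fin n) F2 => ((checks q P (rowCode G)).card : ℝ)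
  let Z := fun G : Matrix (Fin q.k) (Fin n) F2 => ((checksNear q P (rowCode G) 0).card : ℝ)
  set pA := prob (Fintype.piFinset fun _ : Fin Naux => Ω)
      (fun G => AuxBad (T₄ + Tc) (T₅ + Tc) G) with hpA
  have hpA0 : 0 ≤ pA := prob_nonneg _ _
  have hpA1 : pA ≤ 2 * 8 ^ n * ρ ^ l := prob_auxBad_le hP hsn l hρ hT₄ hT₅ h₄ h₅
  -- averaging over the auxiliary codes, for a fixed code
  have step1 : ∀ G ∈ genMatrices q.k (Fin n),
      𝔼 A ∈ Fintype.piFinset (fun _ : Fin Naux => Ω), 𝔼 m : Fin q.k → F2,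
        (iteration c cost (rowCode G) (y G m) ⟨P, A⟩).steps ≤ (n : ℝ) ^ 3 +
      (Naux * (pc G + W G * ((n : ℝ) ^ 2 + D) + 2 * (n : ℝ) ^ 2 * (Z G + W G * ad) + F) +
        (μ ^ Naux * I + ((if bad G then 1 else 0) + pA) * X)) := by
    intro G _
    have hW0 : 0 ≤ W G := Nat.cast_nonneg _
    have hZ0 : 0 ≤ Z G := Nat.cast_nonneg _
    by_cases hfin : Module.finrank F2 (punctured (rowCode G) P) = q.s
    · have hpt : ∀ A : Fin Naux → Matrix (Fin q.kaux) P F2, 𝔼 m : Fin q.k → F2,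
          (iteration c cost (rowCode G) (y G m) ⟨P, A⟩).steps ≤ (n : ℝ) ^ 3 +
          (∑ j, ((lpnSamples c cost (rowCode G) P (A j)).steps +
            (n : ℝ) ^ 2 * sampleSum (rowCode G) (A j) + F) +
          ((if bad G then 0 else ∏ j, M (rowCode G) (A j)) * I +
            ((if bad G then 1 else 0) + (if AuxBad (T₄ + Tc) (T₅ + Tc) A then 1 else 0)) * X)) := by
        intro A
        refine (expect_mono fun m _ => iteration_steps_le hP c cost (rowCode G) hfin (y G m) A
          (T₁ := T₁ + Tc) (T₂ := T₂ + Tc) (T₃ := T₃ + Tc) (T₄ := T₄ + Tc) (T₅ := T₅ + Tc)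
          (by positivity) (by positivity) (by positivity) (M (rowCode G)) (hM0 _)
          fun hb j => hM _ _ hb _).trans (le_of_eq ?_)
        exact Finset.expect_const Finset.univ_nonempty _
      refine (expect_mono fun A _ => hpt A).trans ?_
      rw [Finset.expect_add_distrib, Finset.expect_const hΩ', Finset.expect_add_distrib,
        Finset.expect_add_distrib, Finset.expect_sum_comm]
      refine add_le_add le_rfl (add_le_add ?_ (add_le_add ?_ ?_))
      · -- the samples
        have hj : ∀ j : Fin Naux, 𝔼 A ∈ Fintype.piFinset (fun _ : Fin Naux => Ω),
            ((lpnSamples c cost (rowCode G) P (A j)).steps +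
            (n : ℝ) ^ 2 * sampleSum (rowCode G) (A j) + F) ≤
            pc G + W G * ((n : ℝ) ^ 2 + D) + 2 * (n : ℝ) ^ 2 * (Z G + W G * ad) + F := by
          intro j
          rw [expect_piFinset_apply hΩne j fun A => (lpnSamples c cost (rowCode G) P A).steps +
            (n : ℝ) ^ 2 * sampleSum (rowCode G) A + F, Finset.expect_add_distrib,
            Finset.expect_const hΩne, Finset.expect_add_distrib, ← Finset.mul_expect]
          have e1 := expect_lpnSamples_steps_le (q := q) c cost (rowCode G) hP hs hΩne hD
          have e2 := mul_le_mul_of_nonneg_left (expect_sum_decodeAux_le (q := q) (rowCode G) hP hs)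
            (by positivity : (0 : ℝ) ≤ (n : ℝ) ^ 2)
          have e3 : pc G = (parityCheckEquations c q (rowCode G) P).steps := if_pos hfin
          unfold sampleSum
          rw [e3]
          simp only [W, Z, had, auxDensity]
          linarith
        refine (Finset.sum_le_sum fun j _ => hj j).trans (le_of_eq ?_)
        rw [Finset.sum_const, Finset.card_univ, Fintype.card_fin, nsmul_eq_mul]
      · -- the candidates
        rw [← Finset.expect_mul]
        refine mul_le_mul_of_nonneg_right ?_ hI0
        by_cases hb : bad G
        · simp only [if_pos hb]
          rw [Finset.expect_const_zero]
          positivity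
        · simp only [if_neg hb]
          rw [expect_piFinset_prod Ω fun _ => M (rowCode G)]
          exact prod_fin_le_pow (fun j => expect_nonneg' fun A _ => hM0 _ A) fun j => hMμ _ hb
      · rw [← Finset.expect_mul, Finset.expect_add_distrib, Finset.expect_const hΩ',
          ← prob_eq_expect]
    · -- the iteration stops after the computation of the dimension
      have hit : ∀ (A : Fin Naux → Matrix (Fin q.kaux) P F2) m,
          (iteration c cost (rowCode G) (y G m) ⟨P, A⟩).steps = (n : ℝ) ^ 3 := by
        intro A m
        unfold iteration
        rw [if_neg hfin]
      simp only [hit]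
      rw [Finset.expect_const hΩ', Finset.expect_const Finset.univ_nonempty]
      have : pc G = 0 := if_neg hfin
      rw [this]
      have : (0 : ℝ) ≤ (if bad G then 1 else 0) := by split_ifs <;> norm_num
      refine le_add_of_nonneg_right ?_
      positivity
  -- averaging over the code
  rw [Finset.expect_comm]
  refine (expect_mono step1).trans ?_
  rw [Finset.expect_add_distrib, Finset.expect_const hGne, Finset.expect_add_distrib,
    Finset.expect_add_distrib, Finset.expect_const hGne, ← Finset.mul_expect,
    ← Finset.expect_mul, Finset.expect_add_distrib, Finset.expect_add_distrib,
    Finset.expect_add_distrib, Finset.expect_const hGne, Finset.expect_add_distrib,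
    Finset.expect_const hGne, ← Finset.expect_mul, ← Finset.mul_expect,
    Finset.expect_add_distrib, ← Finset.expect_mul, ← prob_eq_expect]
  have eW : 𝔼 G ∈ genMatrices q.k (Fin n), W G ≤
      1 + 2 ^ q.s * ((n - q.s).choose q.w : ℝ) / 2 ^ q.k :=
    expect_card_dualWords_le q.k _ (card_filter_checks q hP).le
  have eZ : 𝔼 G ∈ genMatrices q.k (Fin n), Z G ≤
      1 + (q.s.choose q.taux : ℝ) * ((n - q.s).choose q.w : ℝ) / 2 ^ q.k :=
    expect_card_dualWords_le q.k _ (card_filter_checksNear q hP 0).le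
  have eB : prob (genMatrices q.k (Fin n)) bad ≤ 3 * 8 ^ n * ρ ^ l :=
    prob_codeBad_le hP hsn l hρ hT₁ hT₂ hT₃ h₁ h₂ h₃
  have eX : (prob (genMatrices q.k (Fin n)) bad + pA) * X ≤ 5 * 8 ^ n * ρ ^ l * X :=
    mul_le_mul_of_nonneg_right (by linarith) hX0
  gcongr

/-- The expected running time is the number of iterations times the mean cost of an iteration. -/
lemma expectedTime_le (c : ℕ) (cost : DecCost n q) (e : Fin n → F2) {B : ℝ}
    (hB0 : 0 ≤ B) (hB : ∀ P : Finset (Fin n), P.card = q.s →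
      𝔼 A ∈ Fintype.piFinset (fun _ : Fin Naux => genMatrices q.kaux P),
        𝔼 G ∈ genMatrices q.k (Fin n), 𝔼 m : Fin q.k → F2,
          (iteration c cost (rowCode G) (m ᵥ* G + e) ⟨P, A⟩).steps ≤ B) :
    expectedTime Naux c q cost e ≤ numIter n c q * B := by
  unfold expectedTime
  rcases (coins n Naux q).eq_empty_or_nonempty with hc | hc
  · rcases Nat.eq_zero_or_pos (numIter n c q) with h0 | h0
    · have : ∀ (C : Submodule F2 (Fin n → F2)) y (r : Fin (numIter n c q) → Coins n Naux q),
          (decoder c cost C y r).steps = 0 := by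
        intro C y r
        change ∑ i, (iteration c cost C y (r i)).steps = 0
        exact Finset.sum_eq_zero fun (i : Fin (numIter n c q)) _ => absurd i.2 (by omega)
      simp only [this, Finset.expect_const_zero]
      positivity
    · have : Fintype.piFinset (fun _ : Fin (numIter n c q) => coins n Naux q) = ∅ := by
        rw [hc]
        have : Nonempty (Fin (numIter n c q)) := ⟨⟨0, h0⟩⟩
        exact Finset.eq_empty_of_forall_notMem fun f hf =>
          absurd (Fintype.mem_piFinset.mp hf (Classical.arbitrary _)) (Finset.notMem_empty _)
      simp only [this, Finset.expect_empty, Finset.expect_const_zero]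
      positivity
  have h1 : ∀ (C : Submodule F2 (Fin n → F2)) y,
      𝔼 r ∈ Fintype.piFinset (fun _ : Fin (numIter n c q) => coins n Naux q),
        (decoder c cost C y r).steps =
      numIter n c q * 𝔼 r ∈ coins n Naux q, (iteration c cost C y r).steps := by
    intro C y
    unfold decoder
    simp only
    rw [Finset.expect_sum_comm]
    rw [Finset.sum_congr rfl fun i _ => expect_piFinset_apply hc i fun r =>
      (iteration c cost C y r).steps]
    rw [Finset.sum_const, Finset.card_univ, Fintype.card_fin, nsmul_eq_mul]
  simp only [h1, ← Finset.mul_expect]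
  refine mul_le_mul_of_nonneg_left ?_ (Nat.cast_nonneg _)
  -- the mean over the coins is a weighted mean over `P`, and the bound `B` holds for each `P`
  rw [Finset.expect_congr rfl fun G _ => Finset.expect_comm _ _ _, Finset.expect_comm,
    Finset.expect_eq_sum_div_card, div_le_iff₀ (by exact_mod_cast hc.card_pos)]
  unfold coins
  rw [Finset.sum_sigma, Finset.card_sigma]
  push_cast
  rw [Finset.mul_sum]
  refine Finset.sum_le_sum fun P hP => ?_
  have h2 := hB P (Finset.mem_powersetCard.mp hP).2
  rcases (Fintype.piFinset fun _ : Fin Naux => genMatrices q.kaux P).eq_empty_or_nonempty with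
    he | he
  · rw [he]; simp
  · rwa [Finset.expect_eq_sum_div_card, div_le_iff₀ (by exact_mod_cast he.card_pos)] at h2

end Iteration

/-! ### The cost of the search for parity-checks -/

section ParityCheckCost

lemma prob_agree_le {κ : ℕ} (l : ℕ) (v : Fin κ → F2) :
    prob (Finset.univ : Finset (Fin κ → F2)) (fun b => AgreeUpTo l v b) ≤ 1 / 2 ^ min l κ := by
  have h1 : (Finset.univ : Finset (Fin κ → F2)).filter (fun b => AgreeUpTo l v b) =
      Fintype.piFinset fun i : Fin κ => if (i : ℕ) < l then {v i} else Finset.univ := by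
    ext b
    rw [Finset.mem_filter, Fintype.mem_piFinset]
    simp only [Finset.mem_univ, true_and]
    refine forall_congr' fun i => ?_
    split_ifs with h <;> simp [h, eq_comm]
  have h2 : ((Finset.univ : Finset (Fin κ → F2)).filter (fun b => AgreeUpTo l v b)).card *
      2 ^ min l κ = 2 ^ κ := by
    rw [h1, Fintype.card_piFinset]
    simp only [apply_ite Finset.card, Finset.card_univ, ZMod.card, Finset.card_singleton]
    rw [Finset.prod_ite, Finset.prod_const_one, one_mul, Finset.prod_const, ← pow_add]
    congr 1
    have h3 := Finset.card_filter_add_card_filter_not (s := (Finset.univ : Finset (Fin κ)))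
      (fun i : Fin κ => (i : ℕ) < l)
    have h4 : ((Finset.univ : Finset (Fin κ)).filter fun i : Fin κ =>
        (i : ℕ) < l).card = min l κ := by
      rw [Fin.card_filter_val_lt]
      exact min_comm _ _
    rw [h4, Finset.card_univ, Fintype.card_fin] at h3
    omega
  rw [prob_eq_card, div_le_div_iff₀ (by simp) (by positivity), one_mul]
  rw [Finset.card_univ, Fintype.card_fun, ZMod.card, Fintype.card_fin]
  exact_mod_cast h2.le

lemma agreeUpTo_sub {κ : ℕ} {l : ℕ} {v a b : Fin κ → F2} :
    AgreeUpTo l v (b - a) ↔ AgreeUpTo l (v + a) b := by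
  unfold AgreeUpTo
  refine forall_congr' fun i => forall_congr' fun _ => ?_
  rw [Pi.sub_apply, Pi.add_apply, eq_sub_iff_add_eq]

/-- The mean number of elements of a list that have a random prescribed partial syndrome. -/
lemma expect_card_agree_le {κ : ℕ} {β : Type} (S : Finset β) (f : β → Fin κ → F2) (l : ℕ) :
    𝔼 b : Fin κ → F2, ((S.filter fun x => AgreeUpTo l (f x) b).card : ℝ) ≤
      S.card / 2 ^ min l κ := by
  have h := expect_filter_union_le (Finset.univ : Finset (Fin κ → F2)) S
    (fun b x => AgreeUpTo l (f x) b) (p := 1 / 2 ^ min l κ) fun x _ => prob_agree_le l (f x)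
  rw [mul_one_div] at h
  exact h

variable {ι : Type} [Fintype ι] {κ : ℕ}

lemma mem_merge {n : ℕ} {B : Matrix (Fin κ) ι F2} {l : ℕ} {a : Fin κ → F2}
    {keep : (ι → F2) → Prop} {A A' : Finset (ι → F2)} {x : ι → F2} :
    x ∈ (merge n B l a keep A A').val ↔
      (∃ z ∈ A ×ˢ A', AgreeUpTo l (B *ᵥ (z.1 + z.2)) a ∧ z.1 + z.2 = x) ∧ keep x := by
  unfold merge
  simp only [Finset.mem_filter, Finset.mem_image, and_assoc]

lemma card_merge_val_le (n : ℕ) (B : Matrix (Fin κ) ι F2) (l : ℕ) (a : Fin κ → F2)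
    (keep : (ι → F2) → Prop) (A A' : Finset (ι → F2)) : (merge n B l a keep A A').val.card ≤
      ((A ×ˢ A').filter fun z => AgreeUpTo l (B *ᵥ (z.1 + z.2)) a).card :=
  (Finset.card_filter_le _ _).trans Finset.card_image_le

/-- The pairs of vectors of weight `p₂` with the same syndrome. -/
def equalSyndromes (p₂ : ℕ) (B : Matrix (Fin κ) ι F2) : Finset ((ι → F2) × (ι → F2)) :=
  (wordsOn Finset.univ p₂ ×ˢ wordsOn Finset.univ p₂).filter fun z => B *ᵥ (z.1 + z.2) = 0

/-- The sizes of the lists of one run, for fixed prescribed syndromes. -/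
lemma parityCheckRun_steps_le (n p₁ p₂ l₁ l₂ w : ℕ) (B : Matrix (Fin κ) ι F2) (I : Finset ι)
    (a a' b : Fin κ → F2) :
    let L := wordsOn I (p₁ / 2)
    let R := wordsOn Iᶜ (p₁ - p₁ / 2)
    let D := (L ×ˢ R).image fun z => z.1 + z.2
    let F₁ := fun a => (((L ×ˢ R).filter fun z => AgreeUpTo l₁ (B *ᵥ (z.1 + z.2)) a).card : ℝ)
    let F₂ := fun a b => ((((D ×ˢ D).filter fun z => AgreeUpTo l₁ (B *ᵥ z.1) a).filter fun z =>
      AgreeUpTo l₂ (B *ᵥ (z.1 + z.2)) b).card : ℝ)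
    let Q := fun b => (((wordsOn Finset.univ p₂).filter fun x => AgreeUpTo l₂ (B *ᵥ x) b).card : ℝ)
    let E := fun b => (((equalSyndromes p₂ B).filter fun z =>
      AgreeUpTo l₂ (B *ᵥ z.1) b).card : ℝ)
    (parityCheckRun n p₁ p₂ l₁ l₂ w B I a a' b).steps ≤ (n : ℝ) ^ 2 * (4 * ((L.card : ℝ) + R.card)
      + 2 * (F₁ a + F₁ (b - a) + (F₁ a' + F₁ (b - a'))) + (F₂ a b + F₂ a' b) + 2 * Q b + E b) := by
  intro L R D F₁ F₂ Q E
  let level1 := fun c : Fin κ → F2 => merge n B l₁ c (fun _ => True) L R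
  let level2 := fun c : Fin κ → F2 =>
    merge n B l₂ b (fun x => hammingNorm x = p₂) (level1 c).val (level1 (b - c)).val
  let final := merge n B κ 0 (fun x => hammingNorm x = w) (level2 a).val (level2 a').val
  have e0 : (parityCheckRun n p₁ p₂ l₁ l₂ w B I a a' b).steps =
      (level1 a).steps + (level1 (b - a)).steps + (level1 a').steps + (level1 (b - a')).steps
      + (level2 a).steps + (level2 a').steps + final.steps := rfl
  have hmem1 : ∀ c x, x ∈ (level1 c).val → x ∈ D ∧ AgreeUpTo l₁ (B *ᵥ x) c := by
    intro c x hx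
    obtain ⟨⟨z, hz1, hz2, rfl⟩, -⟩ := mem_merge.mp hx
    exact ⟨Finset.mem_image_of_mem _ hz1, hz2⟩
  have hmem2 : ∀ c x, x ∈ (level2 c).val → hammingNorm x = p₂ ∧ AgreeUpTo l₂ (B *ᵥ x) b := by
    intro c x hx
    obtain ⟨⟨z, -, hz2, rfl⟩, hx2⟩ := mem_merge.mp hx
    exact ⟨hx2, hz2⟩
  have hcard1 : ∀ c, ((level1 c).val.card : ℝ) ≤ F₁ c := by
    intro c
    exact Nat.cast_le.mpr (card_merge_val_le _ _ _ _ _ _ _)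
  have hcard2 : ∀ c, ((level2 c).val.card : ℝ) ≤ Q b := by
    intro c
    refine Nat.cast_le.mpr (Finset.card_le_card fun x hx => ?_)
    obtain ⟨h1, h2⟩ := hmem2 c x hx
    exact Finset.mem_filter.mpr ⟨mem_wordsOn.mpr
      ⟨fun i hi => absurd (Finset.mem_univ i) hi, h1⟩, h2⟩
  have hs1 : ∀ c, (level1 c).steps = (n : ℝ) ^ 2 * ((L.card : ℝ) + R.card + F₁ c) := fun c => rfl
  have hs2 : ∀ c, (level2 c).steps ≤
      (n : ℝ) ^ 2 * (F₁ c + F₁ (b - c) + F₂ c b) := by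
    intro c
    refine mul_le_mul_of_nonneg_left (add_le_add (add_le_add (hcard1 c) (hcard1 _)) ?_)
      (by positivity)
    refine Nat.cast_le.mpr (Finset.card_le_card fun z hz => ?_)
    obtain ⟨hz1, hz2⟩ := Finset.mem_filter.mp hz
    obtain ⟨ha, hb⟩ := Finset.mem_product.mp hz1
    exact Finset.mem_filter.mpr ⟨Finset.mem_filter.mpr ⟨Finset.mem_product.mpr
      ⟨(hmem1 _ _ ha).1, (hmem1 _ _ hb).1⟩, (hmem1 _ _ ha).2⟩, hz2⟩
  have hs3 : final.steps ≤ (n : ℝ) ^ 2 * (Q b + Q b + E b) := by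
    refine mul_le_mul_of_nonneg_left (add_le_add (add_le_add (hcard2 a) (hcard2 a')) ?_)
      (by positivity)
    refine Nat.cast_le.mpr (Finset.card_le_card fun z hz => ?_)
    obtain ⟨hz1, hz2⟩ := Finset.mem_filter.mp hz
    obtain ⟨ha, hb⟩ := Finset.mem_product.mp hz1
    refine Finset.mem_filter.mpr ⟨Finset.mem_filter.mpr ⟨Finset.mem_product.mpr
      ⟨mem_wordsOn.mpr ⟨fun i hi => absurd (Finset.mem_univ i) hi, (hmem2 _ _ ha).1⟩,
        mem_wordsOn.mpr ⟨fun i hi => absurd (Finset.mem_univ i) hi, (hmem2 _ _ hb).1⟩⟩,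
        funext fun i => hz2 i i.2⟩, (hmem2 _ _ ha).2⟩
  rw [e0, hs1, hs1, hs1, hs1]
  have := hs2 a
  have := hs2 a'
  linarith

/-- The mean cost of one run over the prescribed syndromes. -/
lemma expect_parityCheckRun_le (n p₁ p₂ l₁ l₂ w : ℕ) (B : Matrix (Fin κ) ι F2) (I : Finset ι) :
    𝔼 a : Fin κ → F2, 𝔼 a' : Fin κ → F2, 𝔼 b : Fin κ → F2,
      (parityCheckRun n p₁ p₂ l₁ l₂ w B I a a' b).steps ≤ (n : ℝ) ^ 2 *
        (4 * ((I.card.choose (p₁ / 2) : ℝ) + ((Fintype.card ι - I.card).choose (p₁ - p₁ / 2) : ℝ)) +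
        8 * ((I.card.choose (p₁ / 2) * (Fintype.card ι - I.card).choose (p₁ - p₁ / 2) : ℕ) /
          2 ^ min l₁ κ) +
        2 * (((I.card.choose (p₁ / 2) * (Fintype.card ι - I.card).choose (p₁ - p₁ / 2) : ℕ) : ℝ) ^ 2
          / 2 ^ min l₁ κ / 2 ^ min l₂ κ) +
        2 * ((Fintype.card ι).choose p₂ / 2 ^ min l₂ κ) +
        (equalSyndromes p₂ B).card / 2 ^ min l₂ κ) := by
  set L := wordsOn I (p₁ / 2) with hL
  set R := wordsOn Iᶜ (p₁ - p₁ / 2) with hR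
  set D := (L ×ˢ R).image fun z => z.1 + z.2 with hD
  set F₁ := fun a => (((L ×ˢ R).filter fun z => AgreeUpTo l₁ (B *ᵥ (z.1 + z.2)) a).card : ℝ)
    with hF₁
  set F₂ := fun a b => ((((D ×ˢ D).filter fun z => AgreeUpTo l₁ (B *ᵥ z.1) a).filter fun z =>
    AgreeUpTo l₂ (B *ᵥ (z.1 + z.2)) b).card : ℝ) with hF₂
  set Q := fun b => (((wordsOn Finset.univ p₂).filter fun x =>
    AgreeUpTo l₂ (B *ᵥ x) b).card : ℝ) with hQ
  set E := fun b => (((equalSyndromes p₂ B).filter fun z =>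
    AgreeUpTo l₂ (B *ᵥ z.1) b).card : ℝ) with hE
  set NN := I.card.choose (p₁ / 2) * (Fintype.card ι - I.card).choose (p₁ - p₁ / 2) with hNN
  have hLR : (L ×ˢ R).card = NN := by
    rw [Finset.card_product, card_wordsOn, card_wordsOn, Finset.card_compl]
  have ne : (Finset.univ : Finset (Fin κ → F2)).Nonempty := Finset.univ_nonempty
  have b1 : 𝔼 a : Fin κ → F2, F₁ a ≤ NN / 2 ^ min l₁ κ := by
    rw [← hLR]
    exact expect_card_agree_le (L ×ˢ R) (fun z => B *ᵥ (z.1 + z.2)) l₁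
  have b1' : ∀ a, 𝔼 b : Fin κ → F2, F₁ (b - a) ≤ NN / 2 ^ min l₁ κ := by
    intro a
    rw [← hLR]
    refine le_trans (le_of_eq ?_)
      (expect_card_agree_le (L ×ˢ R) (fun z => B *ᵥ (z.1 + z.2) + a) l₁)
    simp only [hF₁, agreeUpTo_sub]
  have b2 : 𝔼 a : Fin κ → F2, 𝔼 b : Fin κ → F2, F₂ a b ≤
      (NN : ℝ) ^ 2 / 2 ^ min l₁ κ / 2 ^ min l₂ κ := by
    have h1 : ∀ a, 𝔼 b : Fin κ → F2, F₂ a b ≤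
        (((D ×ˢ D).filter fun z => AgreeUpTo l₁ (B *ᵥ z.1) a).card : ℝ) / 2 ^ min l₂ κ :=
      fun a => expect_card_agree_le ((D ×ˢ D).filter fun z => AgreeUpTo l₁ (B *ᵥ z.1) a)
        (fun z => B *ᵥ (z.1 + z.2)) l₂
    refine (expect_mono fun a _ => h1 a).trans ?_
    rw [← Finset.expect_div]
    refine div_le_div_of_nonneg_right ?_ (by positivity)
    refine (expect_card_agree_le (D ×ˢ D) (fun z => B *ᵥ z.1) l₁).trans ?_
    refine div_le_div_of_nonneg_right ?_ (by positivity)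
    rw [Finset.card_product, ← pow_two]
    have : D.card ≤ NN := Finset.card_image_le.trans hLR.le
    exact_mod_cast Nat.pow_le_pow_left this 2
  have b3 : 𝔼 b : Fin κ → F2, Q b ≤ (Fintype.card ι).choose p₂ / 2 ^ min l₂ κ := by
    rw [← Finset.card_univ, ← card_wordsOn]
    exact expect_card_agree_le (wordsOn Finset.univ p₂) (fun x => B *ᵥ x) l₂
  have b4 : 𝔼 b : Fin κ → F2, E b ≤ (equalSyndromes p₂ B).card / 2 ^ min l₂ κ :=
    expect_card_agree_le (equalSyndromes p₂ B) (fun z => B *ᵥ z.1) l₂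
  have h1 := fun a a' b => parityCheckRun_steps_le n p₁ p₂ l₁ l₂ w B I a a' b
  simp only at h1
  refine (expect_mono fun a _ => expect_mono fun a' _ => expect_mono fun b _ => h1 a a' b).trans ?_
  simp only [← Finset.mul_expect]
  refine mul_le_mul_of_nonneg_left ?_ (by positivity)
  simp only [Finset.expect_add_distrib, ← Finset.mul_expect, Finset.expect_const ne]
  have b5 : 𝔼 a : Fin κ → F2, 𝔼 b : Fin κ → F2, F₁ (b - a) ≤ NN / 2 ^ min l₁ κ :=
    expect_le_of_le (by positivity) fun a _ => b1' a
  have hLc : (L.card : ℝ) = I.card.choose (p₁ / 2) := by rw [hL, card_wordsOn]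
  have hRc : (R.card : ℝ) = (Fintype.card ι - I.card).choose (p₁ - p₁ / 2) := by
    rw [hR, card_wordsOn, Finset.card_compl]
  have e1 : ∀ x y : ℝ, x = (I.card.choose (p₁ / 2) : ℝ) →
      y = ((Fintype.card ι - I.card).choose (p₁ - p₁ / 2) : ℝ) →
      4 * (x + y) = 4 * ((I.card.choose (p₁ / 2) : ℝ) +
        ((Fintype.card ι - I.card).choose (p₁ - p₁ / 2) : ℝ)) := by
    rintro _ _ rfl rfl; rfl
  rw [e1 _ _ hLc hRc]
  linarith

variable {n : ℕ} {q : Params} {P : Finset (Fin n)}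

/-- A bound for the mean cost of the search for parity-checks. -/
def checksCost (n c : ℕ) (q : Params) : ℝ :=
  let m := n - q.s
  let N₁ := ((m / 2).choose (q.p₁ / 2) : ℝ)
  let N₁' := ((m - m / 2).choose (q.p₁ - q.p₁ / 2) : ℝ)
  let N₂ := (m.choose q.p₂ : ℝ)
  let e₁ := min q.l₁ (q.k - q.s)
  let e₂ := min q.l₂ (q.k - q.s)
  (n : ℝ) ^ c * ((n : ℝ) ^ 3 + (n : ℝ) ^ 2 * (4 * (N₁ + N₁') + 8 * (N₁ * N₁' / 2 ^ e₁) +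
    2 * ((N₁ * N₁') ^ 2 / 2 ^ e₁ / 2 ^ e₂) + 2 * (N₂ / 2 ^ e₂) +
    (N₂ + N₂ ^ 2 * (2 ^ q.s / 2 ^ q.k)) / 2 ^ e₂))

/-- The pairs of vectors of weight `p₂` whose sum is the restriction of a parity-check. -/
def checkPairs (q : Params) (P : Finset (Fin n)) (C : Submodule F2 (Fin n → F2)) :
    Finset ((↥Pᶜ → F2) × (↥Pᶜ → F2)) :=
  (wordsOn Finset.univ q.p₂ ×ˢ wordsOn Finset.univ q.p₂).filter fun z =>
    ∃ h ∈ dualWords C, restr Pᶜ h = z.1 + z.2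

/-- The sum of the two vectors is the restriction of a parity-check. -/
def SumIsCheck {k : ℕ} (G : Matrix (Fin k) (Fin n) F2) (z : (↥Pᶜ → F2) × (↥Pᶜ → F2)) : Prop :=
  ∃ h ∈ Finset.univ.filter (fun h : Fin n → F2 => restr Pᶜ h = z.1 + z.2), G *ᵥ h = 0

/-- Two vectors that collide at the last level have a sum orthogonal to the shortened code, and such
a sum is the restriction of a parity-check of `C`; the number of such pairs does not depend on the
parity-check matrix drawn for the shortened code. -/
lemma parityCheckEquations_steps_le (hP : P.card = q.s) (c : ℕ) (C : Submodule F2 (Fin n → F2)) :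
    let m := n - q.s
    let N₁ := ((m / 2).choose (q.p₁ / 2) : ℝ)
    let N₁' := ((m - m / 2).choose (q.p₁ - q.p₁ / 2) : ℝ)
    let N₂ := (m.choose q.p₂ : ℝ)
    let e₁ := min q.l₁ (q.k - q.s)
    let e₂ := min q.l₂ (q.k - q.s)
    (parityCheckEquations c q C P).steps ≤ (n : ℝ) ^ c * ((n : ℝ) ^ 3 +
      (n : ℝ) ^ 2 * (4 * (N₁ + N₁') + 8 * (N₁ * N₁' / 2 ^ e₁) +
        2 * ((N₁ * N₁') ^ 2 / 2 ^ e₁ / 2 ^ e₂) + 2 * (N₂ / 2 ^ e₂) +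
        (checkPairs q P C).card / 2 ^ e₂)) := by
  intro m N₁ N₁' N₂ e₁ e₂
  refine mul_le_mul_of_nonneg_left ?_ (by positivity)
  refine expect_le_of_le (by positivity) fun B hB => expect_le_of_le (by positivity) fun I hI => ?_
  have ne : (Finset.univ : Finset (Fin (q.k - q.s) → F2)).Nonempty := Finset.univ_nonempty
  simp only [Finset.expect_add_distrib, Finset.expect_const ne]
  refine add_le_add le_rfl ((expect_parityCheckRun_le n q.p₁ q.p₂ q.l₁ q.l₂ q.w B I).trans ?_)
  refine mul_le_mul_of_nonneg_left ?_ (by positivity)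
  have hIc : I.card = m / 2 := by
    rw [(Finset.mem_powersetCard.mp hI).2, card_compl_coe P hP]
  rw [hIc, card_compl_coe P hP]
  have hE : ((equalSyndromes q.p₂ B).card : ℝ) ≤ (checkPairs q P C).card := by
    refine Nat.cast_le.mpr (Finset.card_le_card fun z hz => ?_)
    obtain ⟨h1, h2⟩ := Finset.mem_filter.mp hz
    refine Finset.mem_filter.mpr ⟨h1, ?_⟩
    refine exists_dualWord_of_orthogonal_shortened P C _ ?_
    rw [← (Finset.mem_filter.mp hB).2]
    exact (forall_mem_rowCode B _).mpr h2
  push_cast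
  have : ((equalSyndromes q.p₂ B).card : ℝ) / 2 ^ e₂ ≤ (checkPairs q P C).card / 2 ^ e₂ := by
    gcongr
  linarith

/-- The mean number of collisions at the last level: the pairs of equal vectors always collide,
and the sum of any other pair has `2 ^ s` extensions, each of which is a parity-check with
probability at most `2 ^ (-k)`. -/
lemma expect_card_checkPairs_le (hP : P.card = q.s) :
    𝔼 G ∈ genMatrices q.k (Fin n), ((checkPairs q P (rowCode G)).card : ℝ) ≤
      ((n - q.s).choose q.p₂ : ℝ) + ((n - q.s).choose q.p₂ : ℝ) ^ 2 * (2 ^ q.s / 2 ^ q.k) := by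
  set W := wordsOn (Finset.univ : Finset ↥Pᶜ) q.p₂ with hW
  have hWc : W.card = (n - q.s).choose q.p₂ := by
    rw [hW, card_wordsOn, Finset.card_univ, card_compl_coe P hP]
  let B := (W ×ˢ W).filter fun z => z.1 + z.2 ≠ 0
  have h1 : ∀ G : Matrix (Fin q.k) (Fin n) F2, ((checkPairs q P (rowCode G)).card : ℝ) ≤
      W.card + ((B.filter (SumIsCheck G)).card : ℝ) := by
    intro G
    have hsub : checkPairs q P (rowCode G) ⊆
        (W.image fun x => (x, x)) ∪ B.filter (SumIsCheck G) := by
      intro z hz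
      obtain ⟨hz1, h, hh, hhz⟩ := Finset.mem_filter.mp hz
      by_cases h0 : z.1 + z.2 = 0
      · refine Finset.mem_union_left _ (Finset.mem_image.mpr ⟨z.1, (Finset.mem_product.mp hz1).1,
          Prod.ext rfl ?_⟩)
        have : z.1 = -z.2 := eq_neg_of_add_eq_zero_left h0
        rw [this]
        funext i
        exact CharTwo.neg_eq (z.2 i)
      · exact Finset.mem_union_right _ (Finset.mem_filter.mpr
          ⟨Finset.mem_filter.mpr ⟨hz1, h0⟩, h, by simpa using hhz,
            (mem_dualWords_rowCode G h).mp hh⟩)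
    have := (Finset.card_le_card hsub).trans ((Finset.card_union_le _ _).trans
      (Nat.add_le_add_right Finset.card_image_le _))
    exact_mod_cast this
  have h2 := expect_filter_union_le (genMatrices q.k (Fin n)) B SumIsCheck
      (p := 2 ^ q.s / 2 ^ q.k) (by
    intro z hz
    have hz0 := (Finset.mem_filter.mp hz).2
    refine (prob_exists_le _ _ (p := 1 / 2 ^ q.k) fun h hh => ?_).trans (le_of_eq ?_)
    · have h0 : h ≠ 0 := by
        rintro rfl
        exact hz0 (by simpa [eq_comm] using hh)
      have := prob_mulVec_eq_zero_le q.k (fun _ : Fin 1 => h)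
        (LinearIndependent.of_subsingleton (R := F2) (0 : Fin 1) h0)
      simpa using this
    · have : ((Finset.univ : Finset (Fin n → F2)).filter fun h =>
          restr Pᶜ h = z.1 + z.2).card = ((Finset.univ : Finset (P → F2)) ×ˢ {z.1 + z.2}).card := by
        refine Finset.card_equiv (splitEquiv P) fun h => ?_
        simp [splitEquiv, eq_comm]
      rw [this, Finset.card_product, Finset.card_singleton, mul_one, Finset.card_univ,
        Fintype.card_fun, ZMod.card, Fintype.card_coe, hP]
      push_cast
      ring)
  rcases (genMatrices q.k (Fin n)).eq_empty_or_nonempty with he | he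
  · rw [he, Finset.expect_empty]
    positivity
  refine (expect_mono fun G _ => h1 G).trans ?_
  rw [Finset.expect_add_distrib, Finset.expect_const he, hWc]
  refine add_le_add le_rfl (h2.trans ?_)
  refine mul_le_mul_of_nonneg_right ?_ (by positivity)
  rw [← hWc, pow_two]
  exact_mod_cast (Finset.card_filter_le _ _).trans (Finset.card_product _ _).le

lemma parityCheckEquations_steps_nonneg (c : ℕ) (C : Submodule F2 (Fin n → F2)) :
    0 ≤ (parityCheckEquations c q C P).steps := by
  refine mul_nonneg (by positivity) (expect_nonneg' fun B _ => expect_nonneg' fun I _ =>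
    expect_nonneg' fun a _ => expect_nonneg' fun a' _ => expect_nonneg' fun b _ => ?_)
  unfold parityCheckRun merge
  positivity

lemma expect_parityCheckEquations_le (hP : P.card = q.s) (hkn : q.k ≤ n) (c : ℕ) :
    𝔼 G ∈ genMatrices q.k (Fin n), (if Module.finrank F2 (punctured (rowCode G) P) = q.s
      then (parityCheckEquations c q (rowCode G) P).steps else 0) ≤ checksCost n c q := by
  have hne : (genMatrices q.k (Fin n)).Nonempty := genMatrices_nonempty (by simpa using hkn)
  have h1 : ∀ G : Matrix (Fin q.k) (Fin n) F2,
      (if Module.finrank F2 (punctured (rowCode G) P) = q.s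
        then (parityCheckEquations c q (rowCode G) P).steps else 0) ≤
      (parityCheckEquations c q (rowCode G) P).steps := by
    intro G
    split_ifs
    · exact le_rfl
    · exact parityCheckEquations_steps_nonneg c _
  refine (expect_mono fun G _ => (h1 G).trans (parityCheckEquations_steps_le hP c _)).trans ?_
  simp only [← Finset.mul_expect, Finset.expect_add_distrib, Finset.expect_const hne,
    ← Finset.expect_div]
  unfold checksCost
  simp only
  gcongr
  exact expect_card_checkPairs_le hP

end ParityCheckCost

/-! ### Exponential order of sequences -/

section ExponentialOrder

/-- The sequence `f` is at most `2 ^ (n (a + o(1)))`. -/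
def ExpBound (f : ℕ → ℝ) (a : ℝ) : Prop :=
  ∀ β > 0, ∀ᶠ n : ℕ in atTop, f n ≤ (2 : ℝ) ^ ((n : ℝ) * (a + β))

namespace ExpBound

variable {f g : ℕ → ℝ} {a b : ℝ}

lemma mono_right (hf : ExpBound f a) (h : a ≤ b) : ExpBound f b := fun β hβ => by
  filter_upwards [hf β hβ] with n hn
  refine hn.trans (Real.rpow_le_rpow_of_exponent_le (by norm_num) ?_)
  gcongr

lemma mono_left (hf : ExpBound f a) (h : ∀ᶠ n in atTop, g n ≤ f n) : ExpBound g a := fun β hβ => by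
  filter_upwards [hf β hβ, h] with n hn h
  exact h.trans hn

lemma of_tendsto {x : ℕ → ℝ} (hx : Tendsto x atTop (𝓝 a)) :
    ExpBound (fun n => (2 : ℝ) ^ ((n : ℝ) * x n)) a := fun β hβ => by
  filter_upwards [hx.eventually_lt_const (lt_add_of_pos_right a hβ)] with n hn
  refine Real.rpow_le_rpow_of_exponent_le (by norm_num) ?_
  gcongr

lemma natPow (c : ℕ) : ExpBound (fun n => (n : ℝ) ^ c) 0 := fun β hβ => by
  have h := isLittleO_pow_const_const_pow_of_one_lt (R := ℝ) c
    (r := (2 : ℝ) ^ β) (Real.one_lt_rpow (by norm_num) hβ)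
  filter_upwards [h.bound one_pos] with n hn
  rw [Real.norm_of_nonneg (by positivity), Real.norm_of_nonneg (by positivity), one_mul,
    ← Real.rpow_mul_natCast (by norm_num), mul_comm β] at hn
  rwa [zero_add]

lemma const (c : ℝ) : ExpBound (fun _ => c) 0 := fun β hβ => by
  obtain ⟨N, hN⟩ := exists_nat_ge c
  filter_upwards [natPow 1 β hβ, eventually_ge_atTop N] with n hn h
  refine le_trans ?_ hn
  rw [pow_one]
  exact hN.trans (by exact_mod_cast h)

lemma mul (hf : ExpBound f a) (hg : ExpBound g b) (hg0 : ∀ n, 0 ≤ g n) :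
    ExpBound (fun n => f n * g n) (a + b) := fun β hβ => by
  filter_upwards [hf (β / 2) (by positivity), hg (β / 2) (by positivity)] with n h1 h2
  calc f n * g n ≤ (2 : ℝ) ^ ((n : ℝ) * (a + β / 2)) * (2 : ℝ) ^ ((n : ℝ) * (b + β / 2)) :=
        mul_le_mul h1 h2 (hg0 n) (by positivity)
    _ = _ := by rw [← Real.rpow_add (by norm_num)]; ring_nf

lemma add (hf : ExpBound f a) (hg : ExpBound g a) : ExpBound (fun n => f n + g n) a :=
  fun β hβ => by
  filter_upwards [hf (β / 2) (by positivity), hg (β / 2) (by positivity),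
    const 2 (β / 2) (by positivity)] with n h1 h2 h3
  have h3 : (2 : ℝ) ≤ 2 ^ ((n : ℝ) * (0 + β / 2)) := h3
  calc f n + g n ≤ 2 * (2 : ℝ) ^ ((n : ℝ) * (a + β / 2)) := by linarith
    _ ≤ 2 ^ ((n : ℝ) * (0 + β / 2)) * (2 : ℝ) ^ ((n : ℝ) * (a + β / 2)) := by gcongr
    _ = _ := by rw [← Real.rpow_add (by norm_num)]; ring_nf

lemma const_mul (hf : ExpBound f a) (hf0 : ∀ n, 0 ≤ f n) (c : ℝ) :
    ExpBound (fun n => c * f n) a := by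
  simpa using (const c).mul hf hf0

lemma natPow_mul (hf : ExpBound f a) (hf0 : ∀ n, 0 ≤ f n) (c : ℕ) :
    ExpBound (fun n => (n : ℝ) ^ c * f n) a := by
  simpa using (natPow c).mul hf hf0

lemma pow (hf : ExpBound f a) (hf0 : ∀ n, 0 ≤ f n) (N : ℕ) :
    ExpBound (fun n => f n ^ N) (N * a) := by
  induction N with
  | zero => simpa using const 1
  | succ N ih =>
    simp_rw [pow_succ]
    push_cast
    rw [add_mul, one_mul]
    exact ih.mul hf hf0

lemma two_pow {x : ℕ → ℕ} (hx : Tendsto (fun n => (x n : ℝ) / n) atTop (𝓝 a)) :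
    ExpBound (fun n => (2 : ℝ) ^ x n) a := by
  refine (of_tendsto hx).mono_left ?_
  filter_upwards [eventually_gt_atTop 0] with n hn
  have : (n : ℝ) * ((x n : ℝ) / n) = x n := by field_simp
  rw [this, Real.rpow_natCast]

lemma inv_two_pow {x : ℕ → ℕ} (hx : Tendsto (fun n => (x n : ℝ) / n) atTop (𝓝 a)) :
    ExpBound (fun n => 1 / (2 : ℝ) ^ x n) (-a) := by
  refine (of_tendsto hx.neg).mono_left ?_
  filter_upwards [eventually_gt_atTop 0] with n hn
  have : (n : ℝ) * (-((x n : ℝ) / n)) = -x n := by field_simp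
  rw [this, Real.rpow_neg (by norm_num), Real.rpow_natCast, one_div]

/-- If the sequence does not tend to zero too fast, its exponent is non-negative. -/
lemma nonneg_of_frequently (hf : ExpBound f a) {c : ℝ} (hc : 0 < c)
    (h : ∃ᶠ n in atTop, c ≤ f n) : 0 ≤ a := by
  by_contra! ha
  have h1 : Tendsto (fun n : ℕ => ((2 : ℝ) ^ (a / 2)) ^ n) atTop (𝓝 0) :=
    tendsto_pow_atTop_nhds_zero_of_lt_one (by positivity)
      (Real.rpow_lt_one_of_one_lt_of_neg (by norm_num) (by linarith))
  refine h ?_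
  filter_upwards [hf (-a / 2) (by linarith), h1.eventually_lt_const hc] with n h2 h3
  rw [← Real.rpow_mul_natCast (by norm_num)] at h3
  have : (n : ℝ) * (a + -a / 2) = a / 2 * n := by ring
  rw [this] at h2
  linarith

end ExpBound

/-- A uniform exponential bound, given for every larger exponent, can be absorbed in one error
sequence. -/
lemma exists_tendsto_zero_of_expBound {T : ℕ → ℝ} {a : ℝ} (h : ExpBound T a) :
    ∃ ε : ℕ → ℝ, Tendsto ε atTop (𝓝 0) ∧
      ∀ᶠ n : ℕ in atTop, T n ≤ (2 : ℝ) ^ ((n : ℝ) * (a + ε n)) := by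
  refine ⟨fun n => if T n ≤ 0 then 0 else max 0 (Real.logb 2 (T n) / n - a), ?_, ?_⟩
  · rw [Metric.tendsto_nhds]
    intro β hβ
    filter_upwards [h (β / 2) (by positivity), eventually_gt_atTop 0] with n hn hn0
    have hn0' : (0 : ℝ) < n := by exact_mod_cast hn0
    rcases le_or_gt (T n) 0 with hT | hT
    · simpa [hT] using hβ
    · rw [if_neg hT.not_ge, Real.dist_eq, sub_zero, abs_of_nonneg (le_max_left _ _), max_lt_iff]
      refine ⟨hβ, ?_⟩
      have : Real.logb 2 (T n) ≤ n * (a + β / 2) := by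
        rwa [Real.logb_le_iff_le_rpow (by norm_num) hT]
      have : Real.logb 2 (T n) / n ≤ a + β / 2 := by
        rw [div_le_iff₀ hn0']; linarith
      linarith
  · filter_upwards [eventually_gt_atTop 0] with n hn0
    have hn0' : (0 : ℝ) < n := by exact_mod_cast hn0
    rcases le_or_gt (T n) 0 with hT | hT
    · exact hT.trans (by positivity)
    · rw [if_neg hT.not_ge, ← Real.logb_le_iff_le_rpow (by norm_num) hT]
      have : Real.logb 2 (T n) / n ≤ a + max 0 (Real.logb 2 (T n) / n - a) := by
        linarith [le_max_right 0 (Real.logb 2 (T n) / n - a)]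
      rw [div_le_iff₀ hn0'] at this
      linarith

end ExponentialOrder

/-! ### Binomial coefficients and entropy -/

section Binomials

open Real in
/-- The homogeneous form `x h(y / x)` of the binary entropy. -/
def homEntropy (x y : ℝ) : ℝ := (negMulLog y + negMulLog (x - y) - negMulLog x) / Real.log 2

lemma tendsto_homEntropy {x y : ℕ → ℝ} {a b : ℝ} (hx : Tendsto x atTop (𝓝 a))
    (hy : Tendsto y atTop (𝓝 b)) :
    Tendsto (fun n => homEntropy (x n) (y n)) atTop (𝓝 (homEntropy a b)) := by
  have h : ∀ {z : ℕ → ℝ} {c : ℝ}, Tendsto z atTop (𝓝 c) →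
      Tendsto (fun n => Real.negMulLog (z n)) atTop (𝓝 (Real.negMulLog c)) := fun {z c} hz =>
    (Real.continuous_negMulLog.tendsto c).comp hz
  exact (((h hy).add (h (hx.sub hy))).sub (h hx)).div_const _

lemma homEntropy_mul {c x y : ℝ} : homEntropy (c * x) (c * y) = c * homEntropy x y := by
  unfold homEntropy
  rw [← mul_sub, Real.negMulLog_mul, Real.negMulLog_mul, Real.negMulLog_mul]
  ring

lemma h₂_eq_homEntropy (y : ℝ) : h₂ y = homEntropy 1 y := by
  rw [h₂, homEntropy, Real.binEntropy_eq_negMulLog_add_negMulLog_one_sub]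
  simp

lemma mul_h₂_div {x y : ℝ} (h : x = 0 → y = 0) : x * h₂ (y / x) = homEntropy x y := by
  by_cases hx : x = 0
  · rw [h hx, hx]; simp [homEntropy]
  · rw [h₂_eq_homEntropy, ← homEntropy_mul, mul_one, mul_div_cancel₀ _ hx]

lemma exp_neg_negMulLog_sub (n : ℕ) :
    Real.exp (-Real.negMulLog n - n) = ((n : ℝ) / Real.exp 1) ^ n := by
  rcases Nat.eq_zero_or_pos n with rfl | hn
  · simp
  · have hn : (0 : ℝ) < n := by exact_mod_cast hn
    rw [div_pow, ← Real.exp_nat_mul, mul_one, Real.exp_sub]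
    congr 1
    rw [Real.negMulLog, neg_mul, neg_neg, mul_comm, Real.exp_mul, Real.exp_log hn,
      Real.rpow_natCast]

lemma le_factorial (n : ℕ) : Real.exp (-Real.negMulLog n - n) ≤ n.factorial := by
  rw [exp_neg_negMulLog_sub]
  rcases Nat.eq_zero_or_pos n with rfl | hn
  · simp
  have hn' : (1 : ℝ) ≤ n := by exact_mod_cast hn
  refine le_trans ?_ (Stirling.le_factorial_stirling n)
  refine le_mul_of_one_le_left (by positivity) ?_
  rw [Real.one_le_sqrt]
  nlinarith [Real.pi_gt_three]

lemma factorial_le_exp (n : ℕ) :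
    (n.factorial : ℝ) ≤ 3 * (n + 1) * Real.exp (-Real.negMulLog n - n) := by
  rw [exp_neg_negMulLog_sub]
  rcases Nat.eq_zero_or_pos n with rfl | hn
  · norm_num
  have hn' : (1 : ℝ) ≤ n := by exact_mod_cast hn
  have h := Stirling.stirlingSeq'_antitone (Nat.zero_le (n - 1))
  simp only [Function.comp, Nat.succ_eq_add_one, zero_add, Nat.sub_add_cancel hn,
    Stirling.stirlingSeq_one] at h
  rw [Stirling.stirlingSeq, div_le_iff₀ (by positivity)] at h
  refine h.trans ?_
  have h1 : √(2 * (n : ℝ)) = √2 * √n := Real.sqrt_mul (by norm_num) _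
  have h2 : √(n : ℝ) ≤ n + 1 := by
    rw [Real.sqrt_le_left (by positivity)]; nlinarith
  have h3 : Real.exp 1 ≤ 3 := by linarith [Real.exp_one_lt_d9]
  rw [h1]
  have h4 : √(2 : ℝ) ≠ 0 := by positivity
  calc _ = Real.exp 1 * √(n : ℝ) * ((n : ℝ) / Real.exp 1) ^ n := by field_simp
    _ ≤ _ := by gcongr

lemma homEntropy_mul_log_two (m j : ℝ) :
    homEntropy m j * Real.log 2 =
      Real.negMulLog j + Real.negMulLog (m - j) - Real.negMulLog m := by
  unfold homEntropy
  rw [div_mul_cancel₀ _ (Real.log_pos (by norm_num)).ne']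

lemma two_rpow_homEntropy (m j : ℝ) : (2 : ℝ) ^ homEntropy m j =
    Real.exp (Real.negMulLog j + Real.negMulLog (m - j) - Real.negMulLog m) := by
  rw [← homEntropy_mul_log_two, mul_comm, Real.exp_mul, Real.exp_log (by norm_num)]

lemma choose_le_two_rpow {m j : ℕ} (h : j ≤ m) :
    (m.choose j : ℝ) ≤ 3 * (m + 1) * (2 : ℝ) ^ homEntropy m j := by
  rw [Nat.cast_choose ℝ h, div_le_iff₀ (by positivity), two_rpow_homEntropy]
  refine (factorial_le_exp m).trans ?_
  have h1 := le_factorial j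
  have h2 := le_factorial (m - j)
  rw [Nat.cast_sub h] at h2
  calc _ = 3 * ((m : ℝ) + 1) * Real.exp (Real.negMulLog j + Real.negMulLog (m - j) -
        Real.negMulLog m) * (Real.exp (-Real.negMulLog j - j) *
          Real.exp (-Real.negMulLog ((m : ℝ) - j) - ((m : ℝ) - j))) := by
        rw [mul_assoc, mul_assoc, ← Real.exp_add, ← Real.exp_add]; ring_nf
    _ ≤ _ := by gcongr

lemma two_rpow_le_choose {m j : ℕ} (h : j ≤ m) :
    (2 : ℝ) ^ homEntropy m j ≤ 9 * (m + 1) ^ 2 * (m.choose j : ℝ) := by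
  rw [Nat.cast_choose ℝ h, ← mul_div_assoc, le_div_iff₀ (by positivity), two_rpow_homEntropy]
  have h1 := factorial_le_exp j
  have h2 := factorial_le_exp (m - j)
  have h3 := le_factorial m
  rw [Nat.cast_sub h] at h2
  have h4 : (j : ℝ) ≤ m := by exact_mod_cast h
  have h5 : (0 : ℝ) ≤ j := by positivity
  calc Real.exp (Real.negMulLog j + Real.negMulLog (m - j) - Real.negMulLog m) *
      ((j.factorial : ℝ) * ((m - j).factorial : ℝ))
      ≤ Real.exp (Real.negMulLog j + Real.negMulLog (m - j) - Real.negMulLog m) *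
        ((3 * (j + 1) * Real.exp (-Real.negMulLog j - j)) *
          (3 * ((m : ℝ) - j + 1) * Real.exp (-Real.negMulLog ((m : ℝ) - j) - ((m : ℝ) - j)))) := by
        gcongr
    _ = 9 * ((j + 1) * ((m : ℝ) - j + 1)) * (Real.exp (Real.negMulLog j +
        Real.negMulLog (m - j) - Real.negMulLog m) * Real.exp (-Real.negMulLog j - j) *
          Real.exp (-Real.negMulLog ((m : ℝ) - j) - ((m : ℝ) - j))) := by ring
    _ = 9 * ((j + 1) * ((m : ℝ) - j + 1)) * Real.exp (-Real.negMulLog m - m) := by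
        rw [← Real.exp_add, ← Real.exp_add]; ring_nf
    _ ≤ 9 * ((m + 1) ^ 2) * (m.factorial : ℝ) := by
        gcongr
        nlinarith
    _ = _ := by ring

variable {m j : ℕ → ℕ} {μ κ : ℝ}

lemma tendsto_homEntropy_natCast (hm : Tendsto (fun n => (m n : ℝ) / n) atTop (𝓝 μ))
    (hj : Tendsto (fun n => (j n : ℝ) / n) atTop (𝓝 κ)) :
    Tendsto (fun n : ℕ => homEntropy (m n) (j n) / n) atTop (𝓝 (homEntropy μ κ)) := by
  refine (tendsto_homEntropy hm hj).congr' ?_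
  filter_upwards [eventually_gt_atTop 0] with n hn
  rw [div_eq_inv_mul, div_eq_inv_mul, homEntropy_mul, div_eq_inv_mul]

lemma ExpBound.natCast_of_tendsto (hm : Tendsto (fun n => (m n : ℝ) / n) atTop (𝓝 μ)) :
    ExpBound (fun n => (m n : ℝ) + 1) 0 := by
  refine (ExpBound.natPow 2).mono_left ?_
  have h1 := hm.eventually_lt_const (lt_add_of_pos_right μ one_pos)
  obtain ⟨N, hN⟩ := exists_nat_ge (μ + 2)
  filter_upwards [h1, eventually_ge_atTop N, eventually_gt_atTop 0] with n h1 h2 h3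
  have h3' : (1 : ℝ) ≤ n := by exact_mod_cast h3
  have h2' : (N : ℝ) ≤ n := by exact_mod_cast h2
  rw [div_lt_iff₀ (by linarith)] at h1
  nlinarith

lemma ExpBound.two_rpow_homEntropy (hm : Tendsto (fun n => (m n : ℝ) / n) atTop (𝓝 μ))
    (hj : Tendsto (fun n => (j n : ℝ) / n) atTop (𝓝 κ)) :
    ExpBound (fun n => (2 : ℝ) ^ homEntropy (m n) (j n)) (homEntropy μ κ) := by
  refine (ExpBound.of_tendsto (tendsto_homEntropy_natCast hm hj)).mono_left ?_
  filter_upwards [eventually_gt_atTop 0] with n hn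
  rw [mul_div_cancel₀ _ (by positivity)]

lemma ExpBound.choose (hm : Tendsto (fun n => (m n : ℝ) / n) atTop (𝓝 μ))
    (hj : Tendsto (fun n => (j n : ℝ) / n) atTop (𝓝 κ)) :
    ExpBound (fun n => ((m n).choose (j n) : ℝ)) (homEntropy μ κ) := by
  have h1 := ((natCast_of_tendsto hm).const_mul (fun n => by positivity) 3).mul
    (two_rpow_homEntropy hm hj) (fun n => by positivity)
  rw [zero_add] at h1
  refine h1.mono_left (Eventually.of_forall fun n => ?_)
  rcases le_or_gt (j n) (m n) with h | h
  · exact choose_le_two_rpow h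
  · rw [Nat.choose_eq_zero_of_lt h]
    simp only [Nat.cast_zero]
    positivity

lemma ExpBound.inv_choose (hm : Tendsto (fun n => (m n : ℝ) / n) atTop (𝓝 μ))
    (hj : Tendsto (fun n => (j n : ℝ) / n) atTop (𝓝 κ)) (h : ∀ᶠ n in atTop, j n ≤ m n) :
    ExpBound (fun n => 1 / ((m n).choose (j n) : ℝ)) (-homEntropy μ κ) := by
  have h0 : ExpBound (fun n => (2 : ℝ) ^ (-homEntropy (m n) (j n))) (-homEntropy μ κ) := by
    refine (ExpBound.of_tendsto (tendsto_homEntropy_natCast hm hj).neg).mono_left ?_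
    filter_upwards [eventually_gt_atTop 0] with n hn
    rw [mul_neg, mul_div_cancel₀ _ (by positivity)]
  have h1 := (((natCast_of_tendsto hm).pow (fun n => by positivity) 2).const_mul
    (fun n => by positivity) 9).mul h0 (fun n => by positivity)
  rw [mul_zero, zero_add] at h1
  refine h1.mono_left ?_
  filter_upwards [h] with n hn
  have h2 := two_rpow_le_choose hn
  have h3 : (0 : ℝ) < (m n).choose (j n) := by exact_mod_cast Nat.choose_pos hn
  rw [Real.rpow_neg (by norm_num), ← div_eq_mul_inv, div_le_div_iff₀ h3 (by positivity), one_mul]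
  exact h2

end Binomials

/-! ### Krawtchouk polynomials -/

section Krawtchouk

open Polynomial

lemma coeff_one_sub_X_pow (x j : ℕ) :
    ((1 - X : ℤ[X]) ^ x).coeff j = (-1) ^ j * (x.choose j : ℤ) := by
  have h : (1 - X : ℤ[X]) ^ x = ((1 + X : ℤ[X]) ^ x).comp (C (-1) * X) := by
    simp [sub_eq_add_neg]
  rw [h, comp_C_mul_X_coeff, coeff_one_add_X_pow, mul_comm]

lemma krawtchouk_eq_coeff (n w x : ℕ) :
    krawtchouk n w x = ((1 - X : ℤ[X]) ^ x * (1 + X) ^ (n - x)).coeff w := by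
  rw [coeff_mul, Finset.Nat.sum_antidiagonal_eq_sum_range_succ_mk, krawtchouk]
  refine Finset.sum_congr rfl fun j _ => ?_
  rw [coeff_one_sub_X_pow, coeff_one_add_X_pow]

lemma krawtchouk_zero_right (n w : ℕ) : krawtchouk n w 0 = n.choose w := by
  rw [krawtchouk_eq_coeff, pow_zero, one_mul, coeff_one_add_X_pow, Nat.sub_zero]

lemma krawtchouk_zero_degree (n x : ℕ) : krawtchouk n 0 x = 1 := by
  simp [krawtchouk]

/-- The difference equation of the Krawtchouk polynomials in the evaluation point. -/
lemma krawtchouk_recurrence {n w x : ℕ} (hx : x + 2 ≤ n) :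
    ((n : ℤ) - (x + 1)) * krawtchouk n w (x + 2) =
      ((n : ℤ) - 2 * w) * krawtchouk n w (x + 1) - (x + 1) * krawtchouk n w x := by
  obtain ⟨r, rfl⟩ : ∃ r, n = x + 2 + r := ⟨n - (x + 2), by omega⟩
  have e1 : x + 2 + r - (x + 1) = r + 1 := by omega
  have e2 : x + 2 + r - x = r + 2 := by omega
  have e3 : x + 2 + r - (x + 2) = r := by omega
  rw [krawtchouk_eq_coeff, krawtchouk_eq_coeff, krawtchouk_eq_coeff, e1, e2, e3]
  -- the differential equation of the generating function
  have hid : ((r : ℤ[X]) + 1) * ((1 - X) ^ (x + 2) * (1 + X) ^ r) =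
      ((x + 2 + r : ℤ[X])) * ((1 - X) ^ (x + 1) * (1 + X) ^ (r + 1)) -
        2 * (X * derivative ((1 - X : ℤ[X]) ^ (x + 1) * (1 + X) ^ (r + 1))) -
        ((x : ℤ[X]) + 1) * ((1 - X) ^ x * (1 + X) ^ (r + 2)) := by
    simp only [derivative_mul, derivative_pow, derivative_sub, derivative_add, derivative_one,
      derivative_X, Nat.add_sub_cancel, Nat.cast_add, Nat.cast_one]
    simp only [map_add, map_natCast, map_one]
    ring
  have h := congrArg (fun p => p.coeff w) hid
  have hX : ∀ p : ℤ[X], (X * derivative p).coeff w = w * p.coeff w := by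
    intro p
    cases w with
    | zero => simp
    | succ w => rw [coeff_X_mul, coeff_derivative]; push_cast; ring
  have c1 : ((r : ℤ[X]) + 1) = C ((r : ℤ) + 1) := by simp
  have c2 : (x + 2 + r : ℤ[X]) = C ((x : ℤ) + 2 + r) := by simp
  have c3 : ((x : ℤ[X]) + 1) = C ((x : ℤ) + 1) := by simp
  have c4 : (2 : ℤ[X]) = C 2 := by simp
  rw [c1, c2, c3, c4] at h
  simp only [coeff_sub, coeff_C_mul, hX] at h
  push_cast
  linear_combination h

lemma abs_krawtchouk_le {n w x : ℕ} (hx : x ≤ n) : |krawtchouk n w x| ≤ n.choose w := by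
  have h : (n.choose w : ℤ) = ∑ j ∈ Finset.range (w + 1),
      (x.choose j : ℤ) * ((n - x).choose (w - j) : ℤ) := by
    have := Nat.add_choose_eq x (n - x) w
    rw [Nat.add_sub_cancel' hx, Finset.Nat.sum_antidiagonal_eq_sum_range_succ_mk] at this
    rw [this]
    push_cast
    rfl
  rw [h, krawtchouk]
  refine (Finset.abs_sum_le_sum_abs _ _).trans (le_of_eq (Finset.sum_congr rfl fun j _ => ?_))
  rw [abs_mul, abs_mul, abs_pow, abs_neg, abs_one, one_pow, one_mul, Nat.abs_cast, Nat.abs_cast]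

end Krawtchouk

/-! ### Krawtchouk polynomials before the first root -/

section FirstRoot

/-- The factor `y` of the saddle point `z = θ y` in the definition of `kappa`; unlike `z` it is
bounded away from zero. -/
def saddleFactor (x θ : ℝ) : ℝ := 2 / (1 - 2 * x + √((1 - 2 * x) ^ 2 - 4 * θ * (1 - θ)))

variable {x θ : ℝ}

lemma discr_nonneg (h0 : 0 ≤ θ) (h1 : θ ≤ 1) (hx : x ≤ firstRoot θ) :
    0 ≤ (1 - 2 * x) ^ 2 - 4 * θ * (1 - θ) := by
  unfold firstRoot at hx
  have h2 : 0 ≤ θ * (1 - θ) := mul_nonneg h0 (by linarith)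
  have h3 := Real.sq_sqrt h2
  have h4 := Real.sqrt_nonneg (θ * (1 - θ))
  nlinarith

lemma one_sub_two_mul_pos (h0 : 0 < θ) (h1 : θ < 1) (hx : x ≤ firstRoot θ) : 0 < 1 - 2 * x := by
  unfold firstRoot at hx
  have h4 := Real.sqrt_pos.mpr (mul_pos h0 (by linarith : (0 : ℝ) < 1 - θ))
  linarith

lemma saddle_eq (h0 : 0 ≤ θ) (h1 : θ < 1) (hx : x ≤ firstRoot θ) (hx2 : 0 < 1 - 2 * x) :
    (1 - 2 * x - √((1 - 2 * x) ^ 2 - 4 * θ * (1 - θ))) / (2 * (1 - θ)) = θ * saddleFactor x θ := by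
  have hs := Real.sq_sqrt (discr_nonneg h0 h1.le hx)
  have hs0 := Real.sqrt_nonneg ((1 - 2 * x) ^ 2 - 4 * θ * (1 - θ))
  rw [saddleFactor]
  set s := √((1 - 2 * x) ^ 2 - 4 * θ * (1 - θ))
  have h3 : 1 - 2 * x + s ≠ 0 := by positivity
  have h4 : 1 - θ ≠ 0 := by linarith
  field_simp
  linear_combination -hs

lemma kappa_eq_of_le (h0 : 0 ≤ θ) (h1 : θ < 1) (hx : x ≤ firstRoot θ) (hx2 : 0 < 1 - 2 * x) :
    kappa x θ = x * Real.logb 2 (1 - θ * saddleFactor x θ) +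
      (1 - x) * Real.logb 2 (1 + θ * saddleFactor x θ) +
      Real.negMulLog θ / Real.log 2 - θ * Real.logb 2 (saddleFactor x θ) := by
  rw [kappa, if_pos hx]
  simp only [saddle_eq h0 h1 hx hx2]
  rcases h0.eq_or_lt with rfl | h0
  · simp
  have hy : 0 < saddleFactor x θ := by unfold saddleFactor; positivity
  rw [Real.logb_mul h0.ne' hy.ne', Real.negMulLog, Real.logb, Real.logb, Real.logb, Real.logb]
  ring

/-- The exponent is continuous before the first root. -/
lemma tendsto_kappa {X T : ℕ → ℝ} (hX : Tendsto X atTop (𝓝 x)) (hT : Tendsto T atTop (𝓝 θ))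
    (hT0 : ∀ᶠ n in atTop, 0 ≤ T n) (hθ : θ ≤ 1 / 2) (hx0 : 0 ≤ x) (hx : x < firstRoot θ) :
    Tendsto (fun n => kappa (X n) (T n)) atTop (𝓝 (kappa x θ)) := by
  have hθ0 : 0 ≤ θ := ge_of_tendsto hT hT0
  have hroot : ∀ {T : ℕ → ℝ}, Tendsto T atTop (𝓝 θ) →
      Tendsto (fun n => firstRoot (T n)) atTop (𝓝 (firstRoot θ)) := fun {T} hT =>
    tendsto_const_nhds.sub ((hT.mul (tendsto_const_nhds.sub hT)).sqrt)
  have hx2 : 0 < 1 - 2 * x := by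
    unfold firstRoot at hx
    linarith [Real.sqrt_nonneg (θ * (1 - θ))]
  have hθ1 : θ < 1 / 2 := by
    refine lt_of_le_of_ne hθ fun h => ?_
    rw [h, firstRoot] at hx
    have : (1 / 2 : ℝ) * (1 - 1 / 2) = (1 / 2) ^ 2 := by norm_num
    rw [this, Real.sqrt_sq (by norm_num)] at hx
    linarith
  have hev : ∀ᶠ n in atTop, kappa (X n) (T n) =
      X n * Real.logb 2 (1 - T n * saddleFactor (X n) (T n)) +
      (1 - X n) * Real.logb 2 (1 + T n * saddleFactor (X n) (T n)) +
      Real.negMulLog (T n) / Real.log 2 - T n * Real.logb 2 (saddleFactor (X n) (T n)) := by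
    have h1 : Tendsto (fun n => firstRoot (T n) - X n) atTop (𝓝 (firstRoot θ - x)) :=
      (hroot hT).sub hX
    have h2 : Tendsto (fun n => 1 - 2 * X n) atTop (𝓝 (1 - 2 * x)) :=
      tendsto_const_nhds.sub (hX.const_mul 2)
    filter_upwards [hT0, h1.eventually_const_lt (sub_pos.mpr hx), h2.eventually_const_lt hx2,
      hT.eventually_lt_const (by linarith : θ < 1)] with n a b c d
    exact kappa_eq_of_le a d (by linarith) c
  rw [tendsto_congr' hev, kappa_eq_of_le hθ0 (by linarith) hx.le hx2]
  have hy : Tendsto (fun n => saddleFactor (X n) (T n)) atTop (𝓝 (saddleFactor x θ)) := by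
    unfold saddleFactor
    refine tendsto_const_nhds.div ?_ ?_
    · have h2 : Tendsto (fun n => 1 - 2 * X n) atTop (𝓝 (1 - 2 * x)) :=
        tendsto_const_nhds.sub (hX.const_mul 2)
      exact h2.add (((h2.pow 2).sub ((hT.const_mul 4).mul (tendsto_const_nhds.sub hT))).sqrt)
    · positivity
  have hy0 : 0 < saddleFactor x θ := by unfold saddleFactor; positivity
  have hz1 : θ * saddleFactor x θ < 1 := by
    unfold saddleFactor
    have hs := Real.sqrt_nonneg ((1 - 2 * x) ^ 2 - 4 * θ * (1 - θ))
    rw [mul_div_assoc', div_lt_one (by positivity)]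
    have hx' := hx
    unfold firstRoot at hx'
    have h3 : θ ≤ √(θ * (1 - θ)) := Real.le_sqrt_of_sq_le (by nlinarith)
    linarith
  have hlog : ∀ {f : ℕ → ℝ} {l : ℝ}, Tendsto f atTop (𝓝 l) → l ≠ 0 →
      Tendsto (fun n => Real.logb 2 (f n)) atTop (𝓝 (Real.logb 2 l)) := fun hf hl =>
    (hf.log hl).div_const _
  have hz := hT.mul hy
  refine Tendsto.sub (Tendsto.add (Tendsto.add (hX.mul (hlog (tendsto_const_nhds.sub hz) ?_))
    ((tendsto_const_nhds.sub hX).mul (hlog (tendsto_const_nhds.add hz) ?_))) ?_)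
    (hT.mul (hlog hy hy0.ne'))
  · linarith
  · positivity
  · exact ((Real.continuous_negMulLog.tendsto θ).comp hT).div_const _

/-- The logarithm of the generating function of the Krawtchouk polynomial, divided by the length. -/
def genLog (x θ z : ℝ) : ℝ :=
  x * Real.logb 2 (1 - z) + (1 - x) * Real.logb 2 (1 + z) - θ * Real.logb 2 z

lemma kappa_eq_genLog (h0 : 0 ≤ θ) (h1 : θ < 1) (hx : x ≤ firstRoot θ) (hx2 : 0 < 1 - 2 * x) :
    kappa x θ = genLog x θ (θ * saddleFactor x θ) := by
  rw [kappa, if_pos hx]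
  simp only [saddle_eq h0 h1 hx hx2]
  rfl

lemma saddle_lt_one (h0 : 0 < θ) (h1 : θ < 1 / 2) (hx : x ≤ firstRoot θ) :
    θ * saddleFactor x θ < 1 := by
  have hx2 := one_sub_two_mul_pos h0 (by linarith) hx
  unfold saddleFactor
  have hs := Real.sqrt_nonneg ((1 - 2 * x) ^ 2 - 4 * θ * (1 - θ))
  rw [mul_div_assoc', div_lt_one (by positivity)]
  have hx' := hx
  unfold firstRoot at hx'
  have h3 : θ < √(θ * (1 - θ)) := Real.lt_sqrt_of_sq_lt (by nlinarith)
  linarith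

lemma saddle_pos (h0 : 0 < θ) (h1 : θ < 1 / 2) (hx : x ≤ firstRoot θ) :
    0 < θ * saddleFactor x θ := by
  have hx2 := one_sub_two_mul_pos h0 (by linarith) hx
  unfold saddleFactor
  positivity

lemma saddle_quadratic (h0 : 0 < θ) (h1 : θ < 1 / 2) (hx : x ≤ firstRoot θ) :
    (1 - θ) * (θ * saddleFactor x θ) ^ 2 - (1 - 2 * x) * (θ * saddleFactor x θ) + θ = 0 := by
  have hx2 := one_sub_two_mul_pos h0 (by linarith) hx
  have hs := Real.sq_sqrt (discr_nonneg h0.le (by linarith) hx)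
  rw [← saddle_eq h0.le (by linarith) hx hx2]
  set s := √((1 - 2 * x) ^ 2 - 4 * θ * (1 - θ))
  have h4 : 1 - θ ≠ 0 := by linarith
  field_simp
  linear_combination hs

lemma saddle_le_vertex (h0 : 0 < θ) (h1 : θ < 1 / 2) (hx : x ≤ firstRoot θ) :
    2 * (1 - θ) * (θ * saddleFactor x θ) ≤ 1 - 2 * x := by
  have hx2 := one_sub_two_mul_pos h0 (by linarith) hx
  rw [← saddle_eq h0.le (by linarith) hx hx2]
  have hs := Real.sqrt_nonneg ((1 - 2 * x) ^ 2 - 4 * θ * (1 - θ))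
  have h4 : 2 * (1 - θ) ≠ 0 := by linarith
  rw [mul_div_cancel₀ _ h4]
  linarith

lemma saddle_mono (h0 : 0 < θ) (h1 : θ < 1 / 2) {x' : ℝ} (hxx' : x ≤ x') (hx : x' ≤ firstRoot θ) :
    θ * saddleFactor x θ ≤ θ * saddleFactor x' θ := by
  have hx2 := one_sub_two_mul_pos h0 (by linarith) hx
  unfold saddleFactor
  refine mul_le_mul_of_nonneg_left ?_ h0.le
  have : √((1 - 2 * x') ^ 2 - 4 * θ * (1 - θ)) ≤ √((1 - 2 * x) ^ 2 - 4 * θ * (1 - θ)) :=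
    Real.sqrt_le_sqrt (by nlinarith)
  have h5 := Real.sqrt_nonneg ((1 - 2 * x') ^ 2 - 4 * θ * (1 - θ))
  refine div_le_div_of_nonneg_left (by norm_num) (by positivity) (by linarith)

/-- Up to the saddle point the generating function decreases. -/
lemma genLog_saddle_le (h0 : 0 < θ) (h1 : θ < 1 / 2) (hx : x ≤ firstRoot θ)
    {z : ℝ} (hz0 : 0 < z) (hz : z ≤ θ * saddleFactor x θ) :
    genLog x θ (θ * saddleFactor x θ) ≤ genLog x θ z := by
  have hz1 := saddle_lt_one h0 h1 hx
  have hq := saddle_quadratic h0 h1 hx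
  have hv := saddle_le_vertex h0 h1 hx
  set z₀ := θ * saddleFactor x θ
  have hderiv : ∀ t ∈ Set.Icc z z₀, HasDerivAt (genLog x θ)
      ((x * (-1 / (1 - t)) + (1 - x) * (1 / (1 + t)) - θ * (1 / t)) / Real.log 2) t := by
    intro t ht
    have ht0 : 0 < t := hz0.trans_le ht.1
    have ht1 : t < 1 := ht.2.trans_lt hz1
    have d1 : HasDerivAt (fun t => Real.logb 2 (1 - t)) (-1 / (1 - t) / Real.log 2) t :=
      (((hasDerivAt_id t).const_sub 1).log (by simpa using (by linarith : 1 - t ≠ 0))).div_const _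
    have d2 : HasDerivAt (fun t => Real.logb 2 (1 + t)) (1 / (1 + t) / Real.log 2) t :=
      (((hasDerivAt_id t).const_add 1).log (by simpa using (by linarith : 1 + t ≠ 0))).div_const _
    have d3 : HasDerivAt (fun t => Real.logb 2 t) (1 / t / Real.log 2) t :=
      ((hasDerivAt_id t).log ht0.ne').div_const _
    exact (((d1.const_mul x).add (d2.const_mul (1 - x))).sub (d3.const_mul θ)).congr_deriv
      (by ring)
  have hanti : AntitoneOn (genLog x θ) (Set.Icc z z₀) := by
    refine antitoneOn_of_deriv_nonpos (convex_Icc _ _)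
      (fun t ht => (hderiv t ht).continuousAt.continuousWithinAt)
      (fun t ht => (hderiv t (interior_subset ht)).differentiableAt.differentiableWithinAt)
      fun t ht => ?_
    have ht := interior_subset ht
    rw [(hderiv t ht).deriv]
    have ht0 : 0 < t := hz0.trans_le ht.1
    have ht1 : t < 1 := ht.2.trans_lt hz1
    refine div_nonpos_of_nonpos_of_nonneg ?_ (Real.log_nonneg (by norm_num))
    have e : x * (-1 / (1 - t)) + (1 - x) * (1 / (1 + t)) - θ * (1 / t) =
        -((1 - θ) * t ^ 2 - (1 - 2 * x) * t + θ) / (t * (1 - t) * (1 + t)) := by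
      have a1 : 1 - t ≠ 0 := by linarith
      have a2 : 1 + t ≠ 0 := by linarith
      field_simp
      ring
    rw [e]
    refine div_nonpos_of_nonpos_of_nonneg ?_
      (mul_nonneg (mul_nonneg ht0.le (by linarith)) (by linarith))
    have e2 : (1 - θ) * t ^ 2 - (1 - 2 * x) * t + θ =
        (z₀ - t) * ((1 - 2 * x) - (1 - θ) * (t + z₀)) := by linear_combination hq
    rw [e2, neg_nonpos]
    refine mul_nonneg (by linarith [ht.2]) ?_
    nlinarith [ht.2]
  exact hanti (Set.left_mem_Icc.mpr hz) (Set.right_mem_Icc.mpr hz) hz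

lemma saddle_zero (h1 : θ < 1 / 2) : θ * saddleFactor 0 θ = θ / (1 - θ) := by
  have h5 : (1 - 2 * (0 : ℝ)) ^ 2 - 4 * θ * (1 - θ) = (1 - 2 * θ) ^ 2 := by ring
  rw [saddleFactor, h5, Real.sqrt_sq (by linarith), mul_div_assoc',
    div_eq_div_iff (by linarith) (by linarith)]
  ring

/-- Increments of the exponent are bounded by its slope at the left end point: the exponent at
`x'` is the value of `genLog` at its own saddle point, which is at most that at the saddle point
of `x`, and `genLog` is affine in `x`. -/
lemma kappa_sub_le (h0 : 0 < θ) (h1 : θ < 1 / 2) {x' : ℝ} (hxx' : x ≤ x')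
    (hx : x' ≤ firstRoot θ) :
    kappa x' θ - kappa x θ ≤ (x' - x) *
      Real.logb 2 ((1 - θ * saddleFactor x θ) / (1 + θ * saddleFactor x θ)) := by
  have hx2 := one_sub_two_mul_pos h0 (by linarith) hx
  have hx3 := one_sub_two_mul_pos h0 (by linarith) (hxx'.trans hx)
  have hz0 := saddle_pos h0 h1 (hxx'.trans hx)
  have hz1 := saddle_lt_one h0 h1 (hxx'.trans hx)
  rw [kappa_eq_genLog h0.le (by linarith) hx hx2,
    kappa_eq_genLog h0.le (by linarith) (hxx'.trans hx) hx3]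
  have h := genLog_saddle_le h0 h1 hx hz0 (saddle_mono h0 h1 hxx' hx)
  rw [Real.logb_div (by linarith) (by linarith)]
  unfold genLog at h ⊢
  linarith

/-- Before the first root, the ratio of consecutive values of the Krawtchouk polynomial is at least
the larger root of the characteristic equation of its recurrence, whose coefficients vary
monotonically. -/
lemma krawtchouk_ratio {n w : ℕ} (hw : 0 < w) (hwn : 2 * w < n) :
    ∀ u : ℕ, u + 1 ≤ n → (u : ℝ) / n ≤ firstRoot ((w : ℝ) / n) →
      0 < krawtchouk n w u ∧
      (1 - (w : ℝ) / n * saddleFactor ((u : ℝ) / n) ((w : ℝ) / n)) /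
        (1 + (w : ℝ) / n * saddleFactor ((u : ℝ) / n) ((w : ℝ) / n)) * krawtchouk n w u ≤
        krawtchouk n w (u + 1) := by
  have hn : (0 : ℝ) < n := by exact_mod_cast (by omega : 0 < n)
  have hθ0 : 0 < (w : ℝ) / n := by positivity
  have hθ1 : (w : ℝ) / n < 1 / 2 := by
    rw [div_lt_div_iff₀ hn (by norm_num)]
    exact_mod_cast (by omega : w * 2 < 1 * n)
  set θ := (w : ℝ) / n with hθ
  have hwθ : (w : ℝ) = n * θ := by rw [hθ]; field_simp
  intro u
  induction u with
  | zero =>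
    intro _ hroot
    have hpos : 0 < krawtchouk n w 0 := by
      rw [krawtchouk_zero_right]
      exact_mod_cast Nat.choose_pos (by omega)
    refine ⟨hpos, ?_⟩
    -- at `0` both the ratio of the values and the root are equal to `1 - 2 θ`
    have hq : (n : ℤ) * krawtchouk n w 1 = ((n : ℤ) - 2 * w) * krawtchouk n w 0 := by
      rw [krawtchouk_zero_right]
      have h2 : krawtchouk n w 1 = ((n - 1).choose w : ℤ) - ((n - 1).choose (w - 1) : ℤ) := by
        obtain ⟨v, rfl⟩ : ∃ v, w = v + 1 := ⟨w - 1, by omega⟩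
        rw [krawtchouk, Finset.sum_range_succ', Finset.sum_range_succ', Finset.sum_eq_zero]
        · simp; ring
        · intro j _
          rw [Nat.choose_eq_zero_of_lt (by omega : 1 < j + 1 + 1)]
          simp
      obtain ⟨N, rfl⟩ : ∃ N, n = N + 1 := ⟨n - 1, by omega⟩
      obtain ⟨v, rfl⟩ : ∃ v, w = v + 1 := ⟨w - 1, by omega⟩
      have h3 := Nat.add_one_mul_choose_eq N v
      have h4 := Nat.choose_succ_succ N v
      simp only [Nat.add_sub_cancel] at h2
      simp only [Nat.succ_eq_add_one] at h4
      rw [h2]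
      have h3' : ((N : ℤ) + 1) * N.choose v = (N + 1).choose (v + 1) * (v + 1) := by
        exact_mod_cast h3
      have h4' : ((N + 1).choose (v + 1) : ℤ) = N.choose v + N.choose (v + 1) := by
        exact_mod_cast h4
      push_cast
      linear_combination (-(N : ℤ) - 1) * h4' - 2 * h3'
    have hq' : (n : ℝ) * krawtchouk n w 1 = ((n : ℝ) - 2 * w) * krawtchouk n w 0 := by
      exact_mod_cast hq
    have hz : θ * saddleFactor (((0 : ℕ) : ℝ) / n) θ = θ / (1 - θ) := by
      rw [Nat.cast_zero, zero_div, saddle_zero hθ1]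
    rw [hz]
    have h6 : 1 - θ ≠ 0 := by linarith
    have h7 : (1 - θ / (1 - θ)) / (1 + θ / (1 - θ)) = 1 - 2 * θ := by
      field_simp
      ring
    rw [h7, zero_add]
    rw [hwθ] at hq'
    have : (n : ℝ) * krawtchouk n w 1 = n * ((1 - 2 * θ) * krawtchouk n w 0) := by
      rw [hq']; ring
    exact (mul_left_cancel₀ hn.ne' this).ge
  | succ u ih =>
    intro hu hroot
    have hle : (u : ℝ) / n ≤ ((u + 1 : ℕ) : ℝ) / n := by push_cast; gcongr; linarith
    obtain ⟨hpos, hrat⟩ := ih (by omega) (hle.trans hroot)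
    set x := ((u + 1 : ℕ) : ℝ) / n with hx
    have hmono := saddle_mono hθ0 hθ1 hle hroot
    have z0 := saddle_pos hθ0 hθ1 (hle.trans hroot)
    have z1 := saddle_lt_one hθ0 hθ1 (hle.trans hroot)
    have y0 := saddle_pos hθ0 hθ1 hroot
    have y1 := saddle_lt_one hθ0 hθ1 hroot
    have hq := saddle_quadratic hθ0 hθ1 hroot
    set z := θ * saddleFactor ((u : ℝ) / n) θ
    set y := θ * saddleFactor x θ
    have hposR : (0 : ℝ) < krawtchouk n w u := by exact_mod_cast hpos
    have hr : (1 - y) / (1 + y) ≤ (1 - z) / (1 + z) := by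
      rw [div_le_div_iff₀ (by linarith) (by linarith)]
      nlinarith
    have hrpos : 0 < (1 - y) / (1 + y) := div_pos (by linarith) (by linarith)
    have hK1 : (1 - y) / (1 + y) * krawtchouk n w u ≤ krawtchouk n w (u + 1) :=
      (mul_le_mul_of_nonneg_right hr hposR.le).trans hrat
    have hKpos : (0 : ℝ) < krawtchouk n w (u + 1) := (mul_pos hrpos hposR).trans_le hK1
    refine ⟨by exact_mod_cast hKpos, ?_⟩
    have hrec := krawtchouk_recurrence (n := n) (w := w) (x := u) (by omega)
    have hrec' : ((n : ℝ) - (u + 1)) * krawtchouk n w (u + 2) =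
      ((n : ℝ) - 2 * w) * krawtchouk n w (u + 1) - (u + 1) * krawtchouk n w u := by
      exact_mod_cast hrec
    have hux : (u : ℝ) + 1 = n * x := by rw [hx]; push_cast; field_simp
    rw [hux, hwθ] at hrec'
    have hx1 : 0 < 1 - x := by
      have := one_sub_two_mul_pos hθ0 (by linarith) hroot
      have : 0 ≤ x := by rw [hx]; positivity
      linarith
    have hrec2 : (1 - x) * krawtchouk n w (u + 2) =
        (1 - 2 * θ) * krawtchouk n w (u + 1) - x * krawtchouk n w u := by
      have : (n : ℝ) * ((1 - x) * krawtchouk n w (u + 2)) = n *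
        ((1 - 2 * θ) * krawtchouk n w (u + 1) - x * krawtchouk n w u) := by linarith
      exact mul_left_cancel₀ hn.ne' this
    -- `ρ = (1 - y) / (1 + y)` is a root of `(1 - x) ρ ^ 2 - (1 - 2 θ) ρ + x = 0`
    set ρ := (1 - y) / (1 + y) with hρ
    have hroot2 : (1 - x) * ρ ^ 2 - (1 - 2 * θ) * ρ + x = 0 := by
      rw [hρ]
      have : 1 + y ≠ 0 := by linarith
      field_simp
      linear_combination 2 * hq
    have hx0 : 0 ≤ x := by rw [hx]; positivity
    have key : (1 - x) * (ρ * (ρ * krawtchouk n w (u + 1))) ≤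
        (1 - x) * (ρ * krawtchouk n w (u + 2)) := by
      have e1 : (1 - x) * (ρ * (krawtchouk n w (u + 2) : ℝ)) =
          ρ * ((1 - 2 * θ) * krawtchouk n w (u + 1)) - x * (ρ * krawtchouk n w u) := by
        linear_combination ρ * hrec2
      rw [e1]
      have e2 : (1 - x) * (ρ * (ρ * (krawtchouk n w (u + 1) : ℝ))) =
          ρ * ((1 - 2 * θ) * krawtchouk n w (u + 1)) - x * krawtchouk n w (u + 1) := by
        linear_combination (krawtchouk n w (u + 1) : ℝ) * hroot2
      rw [e2]
      have := mul_le_mul_of_nonneg_left hK1 hx0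
      linarith
    exact le_of_mul_le_mul_left (le_of_mul_le_mul_left key hx1) hrpos

/-- Exponential lower bound for the Krawtchouk polynomials before their first root: each step from
`u` to `u + 1` multiplies the value by at least the factor of `krawtchouk_ratio`, and the
exponent grows by at most the logarithm of that factor, by `kappa_sub_le`. -/
lemma le_krawtchouk {n w : ℕ} (hwn : 2 * w < n) (u : ℕ) (hu : u ≤ n)
    (hroot : (u : ℝ) / n ≤ firstRoot ((w : ℝ) / n)) :
    (n.choose w : ℝ) * (2 : ℝ) ^ ((n : ℝ) * (kappa ((u : ℝ) / n) ((w : ℝ) / n) -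
      h₂ ((w : ℝ) / n))) ≤ krawtchouk n w u := by
  have hn : (0 : ℝ) < n := by exact_mod_cast (by omega : 0 < n)
  rcases Nat.eq_zero_or_pos w with rfl | hw
  · have h1 : kappa ((u : ℝ) / n) (((0 : ℕ) : ℝ) / n) = 0 := by
      rw [kappa, if_pos hroot]
      simp only [Nat.cast_zero, zero_div, firstRoot, zero_mul, Real.sqrt_zero, sub_zero] at hroot ⊢
      have : √((1 - 2 * ((u : ℝ) / n)) ^ 2 - 4 * 0 * 1) = 1 - 2 * ((u : ℝ) / n) := by
        rw [mul_zero, zero_mul, sub_zero, Real.sqrt_sq (by linarith)]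
      simp [Real.sqrt_sq (by linarith : 0 ≤ 1 - 2 * ((u : ℝ) / n))]
    rw [h1, krawtchouk_zero_degree]
    simp [h₂]
  have hθ0 : 0 < (w : ℝ) / n := by positivity
  have hθ1 : (w : ℝ) / n < 1 / 2 := by
    rw [div_lt_div_iff₀ hn (by norm_num)]
    exact_mod_cast (by omega : w * 2 < 1 * n)
  induction u with
  | zero =>
    have h1 : kappa (((0 : ℕ) : ℝ) / n) ((w : ℝ) / n) = h₂ ((w : ℝ) / n) := by
      have hr2 : 0 < 1 - 2 * (((0 : ℕ) : ℝ) / n) := by simp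
      rw [kappa_eq_genLog hθ0.le (by linarith) hroot hr2]
      set θ := (w : ℝ) / n
      have h6 : 1 - θ ≠ 0 := by linarith
      have hz : θ * saddleFactor (((0 : ℕ) : ℝ) / n) θ = θ / (1 - θ) := by
        rw [Nat.cast_zero, zero_div, saddle_zero hθ1]
      rw [hz, genLog, h₂, Real.binEntropy_eq_negMulLog_add_negMulLog_one_sub]
      have h7 : 1 + θ / (1 - θ) = 1 / (1 - θ) := by field_simp; ring
      rw [h7, Real.logb_div hθ0.ne' h6, Real.logb_div one_ne_zero h6, Real.logb_one]
      simp only [Real.negMulLog, Real.logb, Nat.cast_zero, zero_div]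
      ring
    rw [h1, sub_self, mul_zero, Real.rpow_zero, mul_one, krawtchouk_zero_right]
    simp
  | succ u ih =>
    have hle : (u : ℝ) / n ≤ ((u + 1 : ℕ) : ℝ) / n := by push_cast; gcongr; linarith
    have ih := ih (by omega) (hle.trans hroot)
    obtain ⟨hpos, hrat⟩ := krawtchouk_ratio hw hwn u (by omega) (hle.trans hroot)
    have hk := kappa_sub_le hθ0 hθ1 hle hroot
    have z0 := saddle_pos hθ0 hθ1 (hle.trans hroot)
    have z1 := saddle_lt_one hθ0 hθ1 (hle.trans hroot)
    set θ := (w : ℝ) / n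
    set z := θ * saddleFactor ((u : ℝ) / n) θ
    have hr : 0 < (1 - z) / (1 + z) := div_pos (by linarith) (by linarith)
    have hstep : (n : ℝ) * (kappa (((u + 1 : ℕ) : ℝ) / n) θ - kappa ((u : ℝ) / n) θ) ≤
        Real.logb 2 ((1 - z) / (1 + z)) := by
      have : ((u + 1 : ℕ) : ℝ) / n - (u : ℝ) / n = 1 / n := by push_cast; field_simp; ring
      rw [this] at hk
      calc _ ≤ (n : ℝ) * (1 / n * Real.logb 2 ((1 - z) / (1 + z))) := by gcongr
        _ = _ := by field_simp
    have hstep' : (2 : ℝ) ^ ((n : ℝ) * (kappa (((u + 1 : ℕ) : ℝ) / n) θ - kappa ((u : ℝ) / n) θ)) ≤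
        (1 - z) / (1 + z) := by
      rwa [← Real.le_logb_iff_rpow_le (by norm_num) hr]
    refine le_trans ?_ hrat
    calc _ = (2 : ℝ) ^ ((n : ℝ) * (kappa (((u + 1 : ℕ) : ℝ) / n) θ - kappa ((u : ℝ) / n) θ)) *
        ((n.choose w : ℝ) * (2 : ℝ) ^ ((n : ℝ) * (kappa ((u : ℝ) / n) θ - h₂ θ))) := by
          rw [mul_left_comm, ← Real.rpow_add (by norm_num)]
          ring_nf
      _ ≤ _ := mul_le_mul hstep' ih (by positivity) hr.le

end FirstRoot

/-! ### Exponents of the parameters of the decoder -/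

section Exponents

lemma tendsto_div_div {x y : ℕ → ℕ} {a b : ℝ} (hx : Tendsto (fun n => (x n : ℝ) / n) atTop (𝓝 a))
    (hy : Tendsto (fun n => (y n : ℝ) / n) atTop (𝓝 b)) (hb : b ≠ 0) :
    Tendsto (fun n => (x n : ℝ) / y n) atTop (𝓝 (a / b)) := by
  refine (hx.div hy hb).congr' ?_
  filter_upwards [eventually_gt_atTop 0] with n hn
  have : (n : ℝ) ≠ 0 := by positivity
  exact div_div_div_cancel_right₀ this _ _

lemma tendsto_mul_of_tendsto_div {x y : ℕ → ℕ} {a b : ℝ}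
    (hx : Tendsto (fun n => (x n : ℝ) / y n) atTop (𝓝 a))
    (hy : Tendsto (fun n => (y n : ℝ) / n) atTop (𝓝 b)) (hb : b ≠ 0) :
    Tendsto (fun n => (x n : ℝ) / n) atTop (𝓝 (b * a)) := by
  refine (hy.mul hx).congr' ?_
  filter_upwards [hy.eventually_ne hb] with n hn
  have : (y n : ℝ) ≠ 0 := fun h => hn (by rw [h, zero_div])
  rw [div_mul_div_comm, mul_comm (n : ℝ), mul_div_mul_left _ _ this]

lemma tendsto_natSub {x y : ℕ → ℕ} {a b : ℝ} (hx : Tendsto (fun n => (x n : ℝ) / n) atTop (𝓝 a))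
    (hy : Tendsto (fun n => (y n : ℝ) / n) atTop (𝓝 b)) (h : ∀ᶠ n in atTop, y n ≤ x n) :
    Tendsto (fun n => ((x n - y n : ℕ) : ℝ) / n) atTop (𝓝 (a - b)) := by
  refine (hx.sub hy).congr' ?_
  filter_upwards [h] with n hn
  rw [Nat.cast_sub hn, sub_div]

lemma tendsto_self_div : Tendsto (fun n : ℕ => (n : ℝ) / n) atTop (𝓝 1) := by
  refine tendsto_const_nhds.congr' ?_
  filter_upwards [eventually_gt_atTop 0] with n hn
  rw [div_self (by positivity)]

lemma tendsto_half {x : ℕ → ℕ} {a : ℝ} (hx : Tendsto (fun n => (x n : ℝ) / n) atTop (𝓝 a)) :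
    Tendsto (fun n => ((x n / 2 : ℕ) : ℝ) / n) atTop (𝓝 (a / 2)) := by
  have h1 : Tendsto (fun n : ℕ => (x n : ℝ) / n / 2 - 1 / n) atTop (𝓝 (a / 2)) := by
    simpa using (hx.div_const 2).sub tendsto_one_div_atTop_nhds_zero_nat
  refine tendsto_of_tendsto_of_tendsto_of_le_of_le h1 (hx.div_const 2) (fun n => ?_) fun n => ?_
  · have : (x n : ℝ) / 2 - 1 ≤ ((x n / 2 : ℕ) : ℝ) := by
      have : x n ≤ 2 * (x n / 2) + 1 := by omega
      have : (x n : ℝ) ≤ 2 * ((x n / 2 : ℕ) : ℝ) + 1 := by exact_mod_cast this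
      linarith
    calc (x n : ℝ) / n / 2 - 1 / n = ((x n : ℝ) / 2 - 1) / n := by ring
      _ ≤ _ := by gcongr
  · calc ((x n / 2 : ℕ) : ℝ) / n ≤ ((x n : ℝ) / 2) / n := by
          gcongr; exact Nat.cast_div_le
      _ = _ := by ring

lemma homEntropy_half (x y : ℝ) : homEntropy (x / 2) (y / 2) = homEntropy x y / 2 := by
  rw [div_eq_inv_mul, div_eq_inv_mul, homEntropy_mul, div_eq_inv_mul]

lemma continuous_h₂ : Continuous h₂ := Real.binEntropy_continuous.div_const _

/-- The magnitude of a Krawtchouk polynomial is given by `kappa`: before the first root by the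
lower bound `le_krawtchouk`, beyond it by assumption. -/
lemma expBound_inv_krawtchouk {m w u : ℕ → ℕ} {M W U : ℝ}
    (hm : Tendsto (fun n => (m n : ℝ) / n) atTop (𝓝 M))
    (hw : Tendsto (fun n => (w n : ℝ) / n) atTop (𝓝 W))
    (hu : Tendsto (fun n => (u n : ℝ) / n) atTop (𝓝 U)) (hM : 0 < M) (hWM : W ≤ M / 2)
    (hum : ∀ᶠ n in atTop, u n ≤ m n)
    (hK : ∀ᶠ n in atTop, krawtchouk (m n) (w n) (u n) ≠ 0)
    (hroot : firstRoot (W / M) ≤ U / M → Tendsto (fun n : ℕ =>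
      Real.logb 2 |(krawtchouk (m n) (w n) (u n) : ℝ)| / n) atTop (𝓝 (M * kappa (U / M) (W / M)))) :
    ExpBound (fun n => 1 / |(krawtchouk (m n) (w n) (u n) : ℝ)|)
      (-(M * kappa (U / M) (W / M))) := by
  rcases le_or_gt (firstRoot (W / M)) (U / M) with h | h
  · refine (ExpBound.of_tendsto (hroot h).neg).mono_left ?_
    filter_upwards [hK, eventually_gt_atTop 0] with n h1 hn
    have h2 : (0 : ℝ) < |(krawtchouk (m n) (w n) (u n) : ℝ)| := abs_pos.mpr (by exact_mod_cast h1)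
    rw [mul_neg, mul_div_cancel₀ _ (by positivity), Real.rpow_neg (by norm_num),
      Real.rpow_logb (by norm_num) (by norm_num) h2, one_div]
  have hum' := tendsto_div_div hu hm hM.ne'
  have hwm' := tendsto_div_div hw hm hM.ne'
  have hU0 : 0 ≤ U / M := ge_of_tendsto' hum' fun n => by positivity
  have hW0 : 0 ≤ W / M := ge_of_tendsto' hwm' fun n => by positivity
  have hW2 : W / M ≤ 1 / 2 := by rw [div_le_iff₀ hM]; linarith
  have hW3 : W / M < 1 / 2 := by
    refine lt_of_le_of_ne hW2 fun h' => ?_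
    rw [h', firstRoot] at h
    have : (1 / 2 : ℝ) * (1 - 1 / 2) = (1 / 2) ^ 2 := by norm_num
    rw [this, Real.sqrt_sq (by norm_num)] at h
    linarith
  have hk := tendsto_kappa hum' hwm' (Eventually.of_forall fun n => by positivity) hW2 hU0 h
  have hexp := (hm.mul (hk.sub ((continuous_h₂.tendsto _).comp hwm'))).neg
  have hwlem : ∀ᶠ n in atTop, 2 * w n < m n := by
    filter_upwards [hwm'.eventually_lt_const hW3, hm.eventually_const_lt hM] with n h1 h2
    have h3 : (0 : ℝ) < m n := by
      by_contra h4
      have : (m n : ℝ) = 0 := le_antisymm (not_lt.mp h4) (Nat.cast_nonneg _)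
      rw [this, zero_div] at h2
      exact lt_irrefl _ h2
    rw [div_lt_iff₀ h3] at h1
    have : (2 : ℝ) * w n < m n := by linarith
    exact_mod_cast this
  have hfr : Tendsto (fun n => firstRoot ((w n : ℝ) / m n)) atTop (𝓝 (firstRoot (W / M))) :=
    tendsto_const_nhds.sub ((hwm'.mul (tendsto_const_nhds.sub hwm')).sqrt)
  have hb := (ExpBound.inv_choose hm hw (hwlem.mono fun n h => by omega)).mul
    (ExpBound.of_tendsto hexp) (fun n => by positivity)
  have hexpo : -homEntropy M W + -(M * (kappa (U / M) (W / M) - h₂ (W / M))) =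
      -(M * kappa (U / M) (W / M)) := by
    rw [← mul_h₂_div (fun h => absurd h hM.ne')]
    ring
  rw [hexpo] at hb
  refine hb.mono_left ?_
  filter_upwards [hwlem, hum, (hfr.sub hum').eventually_const_lt (sub_pos.mpr h),
    eventually_gt_atTop 0] with n h1 h2 h3 h4
  have h5 := le_krawtchouk h1 (u n) h2 (by linarith)
  have h6 : (0 : ℝ) < (m n).choose (w n) := by exact_mod_cast Nat.choose_pos (by omega)
  have h7 : (n : ℝ) * (-((m n : ℝ) / n * (kappa ((u n : ℝ) / m n) ((w n : ℝ) / m n) -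
      h₂ ((w n : ℝ) / m n)))) = -((m n : ℝ) * (kappa ((u n : ℝ) / m n) ((w n : ℝ) / m n) -
      h₂ ((w n : ℝ) / m n))) := by
    field_simp
  simp only [Function.comp]
  rw [h7, Real.rpow_neg (by norm_num), ← one_div, div_mul_div_comm, one_mul]
  refine div_le_div_of_nonneg_left zero_le_one (by positivity) (h5.trans (le_abs_self _))

namespace Rel

variable (a : Rel)

/-- The exponent of `K_w(u) K_{t_aux}(t - u)`. -/
def kkExp : ℝ := a.σ * kappa ((a.τ - a.μ) / a.σ) (a.τaux / a.σ) +
  (1 - a.σ) * kappa (a.μ / (1 - a.σ)) (a.ω / (1 - a.σ))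

/-- The exponent of `binom(n-s,w) binom(s,t_aux)`. -/
def sphereExp : ℝ := homEntropy (1 - a.σ) a.ω + homEntropy a.σ a.τaux

/-- The exponent of `δ ^ 2 H̃`. -/
def gain : ℝ := a.samplesExp + 2 * a.biasExp

variable {a}

lemma Admissible.σ_lt (ha : a.Admissible) : a.σ < 1 := ha.σ_le.trans_lt ha.R_lt

lemma Admissible.sphereExp_eq (ha : a.Admissible) : a.sphereExp =
    (1 - a.σ) * h₂ (a.ω / (1 - a.σ)) + a.σ * h₂ (a.τaux / a.σ) := by
  have h1 : 1 - a.σ ≠ 0 := by linarith [ha.σ_lt]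
  rw [sphereExp, mul_h₂_div (fun h => absurd h h1), mul_h₂_div (fun h => absurd h ha.σ_pos.ne')]

lemma Admissible.gain_eq (ha : a.Admissible) :
    a.gain = 2 * a.kkExp - a.sphereExp - (a.R - a.Raux) := by
  rw [ha.sphereExp_eq, gain, samplesExp, biasExp, kkExp]
  ring

lemma Admissible.gain_nonneg (ha : a.Admissible) : 0 ≤ a.gain := by
  have := ha.samples_ge
  unfold gain
  linarith

lemma h₂_le_one (x : ℝ) : h₂ x ≤ 1 := by
  rw [h₂, div_le_one (Real.log_pos (by norm_num))]
  exact Real.binEntropy_le_log_two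

lemma Admissible.candidates_bddAbove (ha : a.Admissible) : BddAbove ((fun x : ℝ × ℝ =>
    a.σ * h₂ (x.2 / a.σ) + (1 - a.σ) * h₂ (x.1 / (1 - a.σ)) - (1 - a.R)) '' a.dominant) := by
  refine ⟨a.R, ?_⟩
  rintro _ ⟨x, _, rfl⟩
  have h1 := mul_le_mul_of_nonneg_left (h₂_le_one (x.2 / a.σ)) ha.σ_pos.le
  have h2 := mul_le_mul_of_nonneg_left (h₂_le_one (x.1 / (1 - a.σ))) (sub_pos.mpr ha.σ_lt).le
  simp only
  linarith

lemma kappa_of_half_le {x θ : ℝ} (h0 : 0 ≤ θ) (h1 : θ ≤ 1 / 2) (hx : 1 / 2 ≤ x) :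
    kappa x θ = (1 - h₂ x + h₂ θ) / 2 := by
  unfold kappa
  split_ifs with h
  · have h2 : 0 ≤ √(θ * (1 - θ)) := Real.sqrt_nonneg _
    unfold firstRoot at h
    have h3 : √(θ * (1 - θ)) = 0 := by linarith
    have h4 : θ = 0 := by
      rw [Real.sqrt_eq_zero (mul_nonneg h0 (by linarith))] at h3
      rcases mul_eq_zero.mp h3 with h | h
      · exact h
      · linarith
    have h5 : x = 1 / 2 := by linarith
    subst h4 h5
    have h6 : h₂ (1 / 2) = 1 := by
      rw [h₂, one_div, Real.binEntropy_two_inv, div_self (Real.log_pos (by norm_num)).ne']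
    rw [h6]
    simp [h₂]
  · rfl

/-- The false candidates are at least as numerous, in the exponent, as `2 ^ k_aux / (δ ^ 2 H̃)`: the
pairs with both relative weights at least `1 / 2`, for which `kappa` is `(1 - h + h) / 2`, are
dominant as soon as the entropy is at most `1 - R + R_aux - gain`. -/
lemma Admissible.le_candidatesExp (ha : a.Admissible) (hR : a.Raux ≤ a.R) :
    a.Raux - a.gain ≤ a.candidatesExp := by
  rw [candidatesExp]
  rcases le_or_gt (a.Raux - a.gain) 0 with h | h
  · exact h.trans (le_max_right _ _)
  refine le_trans ?_ (le_max_left _ _)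
  have hσ := ha.σ_lt
  have hσ0 := ha.σ_pos
  have hσ1 : 0 < 1 - a.σ := by linarith
  have hg := ha.gain_nonneg
  obtain ⟨x, hx, hxE⟩ : ∃ x ∈ Set.Icc (1 / 2 : ℝ) 1, h₂ x = 1 - a.R + a.Raux - a.gain := by
    refine intermediate_value_Icc' (by norm_num) continuous_h₂.continuousOn ⟨?_, ?_⟩
    · have : h₂ 1 = 0 := by simp [h₂]
      rw [this]
      linarith [ha.R_lt]
    · have : h₂ (1 / 2) = 1 := by
        rw [h₂, one_div, Real.binEntropy_two_inv, div_self (Real.log_pos (by norm_num)).ne']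
      rw [this]
      linarith
  refine le_csSup ha.candidates_bddAbove ⟨((1 - a.σ) * x, a.σ * x), ?_, ?_⟩
  · refine ⟨by nlinarith [hx.1], by nlinarith [hx.2], by nlinarith [hx.1], by nlinarith [hx.2], ?_⟩
    simp only [mul_div_cancel_left₀ _ hσ0.ne', mul_div_cancel_left₀ _ hσ1.ne']
    rw [kappa_of_half_le (x := x) (θ := a.τaux / a.σ) (div_nonneg ha.τaux_nonneg hσ0.le)
      (by rw [div_le_iff₀ hσ0]; linarith [ha.τaux_le_half]) hx.1,
      kappa_of_half_le (x := x) (θ := a.ω / (1 - a.σ)) (div_nonneg ha.ω_nonneg hσ1.le)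
      (by rw [div_le_iff₀ hσ1]; linarith [ha.ω_le_half]) hx.1, hxE]
    have h1 := ha.gain_eq
    rw [ha.sphereExp_eq, kkExp] at h1
    linarith
  · simp only [mul_div_cancel_left₀ _ hσ0.ne', mul_div_cancel_left₀ _ hσ1.ne']
    rw [hxE]
    ring

lemma candidatesExp_nonneg : 0 ≤ a.candidatesExp := le_max_right _ _

end Rel

/-- Subadditivity of the entropy of a pair of bits whose sum has mean `ω` and whose components have
mean `π`: the number of pairs of vectors of weight `π` whose sum has weight `ω` is at most the
number of all pairs of vectors of weight `π`. -/
lemma entropy_subadditive {ω p : ℝ} (h0 : 0 ≤ ω) (h1 : ω / 2 ≤ p) (h2 : p ≤ 1 - ω / 2)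
    (h3 : ω < 1) :
    h₂ ω + (ω + (1 - ω) * h₂ ((p - ω / 2) / (1 - ω))) ≤ 2 * h₂ p := by
  rw [mul_h₂_div (fun h => by linarith), h₂_eq_homEntropy, h₂_eq_homEntropy]
  have hl : 0 < Real.log 2 := Real.log_pos (by norm_num)
  -- grouping the pair by its sum, and by its first component
  have hη : Real.negMulLog ω = 2 * Real.negMulLog (ω / 2) - ω * Real.log 2 := by
    have : ω = 2 * (ω / 2) := by ring
    conv_lhs => rw [this, Real.negMulLog_mul]
    rw [Real.negMulLog]
    ring
  have key : ∀ x y : ℝ, 0 ≤ x → 0 ≤ y →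
      Real.negMulLog x + Real.negMulLog y - Real.negMulLog (x + y) =
        (x + y) * Real.binEntropy (x / (x + y)) := by
    intro x y hx hy
    rcases (add_nonneg hx hy).eq_or_lt with h | h
    · have : x = 0 := by linarith
      have : y = 0 := by linarith
      subst x y
      simp
    · have := mul_h₂_div (x := x + y) (y := x) (fun h' => absurd h' h.ne')
      rw [h₂, homEntropy, ← mul_div_assoc, div_left_inj' hl.ne', add_sub_cancel_left] at this
      rw [this]
  have hp1 := key (p - ω / 2) (ω / 2) (by linarith) (by linarith)
  have hp2 := key (ω / 2) (1 - p - ω / 2) (by linarith) (by linarith)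
  have e1 : p - ω / 2 + ω / 2 = p := by ring
  have e2 : ω / 2 + (1 - p - ω / 2) = 1 - p := by ring
  rw [e1] at hp1
  rw [e2] at hp2
  have hm1 : (p - ω / 2) / p ∈ Set.Icc (0 : ℝ) 1 :=
    ⟨div_nonneg (by linarith) (by linarith), div_le_one_of_le₀ (by linarith) (by linarith)⟩
  have hm2 : ω / 2 / (1 - p) ∈ Set.Icc (0 : ℝ) 1 :=
    ⟨div_nonneg (by linarith) (by linarith), div_le_one_of_le₀ (by linarith) (by linarith)⟩
  have hconc := Real.strictConcave_binEntropy.concaveOn.right hm1 hm2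
    (by linarith : 0 ≤ p) (by linarith : 0 ≤ 1 - p) (by ring)
  · have e3 : p • ((p - ω / 2) / p) + (1 - p) • (ω / 2 / (1 - p)) = p := by
      simp only [smul_eq_mul]
      rcases eq_or_ne p 0 with hp | hp
      · have : ω = 0 := by linarith
        simp [hp, this]
      rcases eq_or_ne (1 - p) 0 with hp' | hp'
      · have : ω = 0 := by linarith
        rw [this, hp']
        field_simp
        simp
      rw [mul_div_cancel₀ _ hp, mul_div_cancel₀ _ hp']
      ring
    rw [e3, smul_eq_mul, smul_eq_mul, ← hp1, ← hp2,
      Real.binEntropy_eq_negMulLog_add_negMulLog_one_sub] at hconc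
    unfold homEntropy
    have e4 : 1 - ω - (p - ω / 2) = 1 - p - ω / 2 := by ring
    rw [e4, Real.negMulLog_one]
    have e5 : (Real.negMulLog ω + Real.negMulLog (1 - ω) - 0) / Real.log 2 +
        (ω + (Real.negMulLog (p - ω / 2) + Real.negMulLog (1 - p - ω / 2) -
          Real.negMulLog (1 - ω)) / Real.log 2) =
        (Real.negMulLog ω + ω * Real.log 2 + Real.negMulLog (p - ω / 2) +
          Real.negMulLog (1 - p - ω / 2)) / Real.log 2 := by
      field_simp
      ring
    rw [e5, ← mul_div_assoc, div_le_div_iff_of_pos_right hl, hη]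
    linarith

end Exponents

/-! ### Fourier analysis of the Krawtchouk polynomials -/

section KrawtchoukFourier

variable {ι : Type} [Fintype ι]

lemma sign_sum {β : Type} (s : Finset β) (f : β → F2) :
    sign (∑ i ∈ s, f i) = ∏ i ∈ s, sign (f i) := by
  induction s using Finset.induction_on with
  | empty => rfl
  | insert a s ha ih => rw [Finset.sum_insert ha, Finset.prod_insert ha, sign_add, ih]

lemma sum_wordsOn_univ {M : Type} [AddCommMonoid M] (p : ℕ) (g : (ι → F2) → M) :
    ∑ v ∈ wordsOn Finset.univ p, g v =
      ∑ A ∈ Finset.powersetCard p (Finset.univ : Finset ι), g fun i => if i ∈ A then 1 else 0 := by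
  have hn : ∀ A : Finset ι, hammingNorm (fun i => if i ∈ A then (1 : F2) else 0) = A.card := by
    intro A
    rw [hammingNorm]
    congr 1
    ext i
    simp
  have hf : ∀ v : ι → F2, (fun i => if i ∈ Finset.univ.filter (fun i => v i ≠ 0) then (1 : F2)
      else 0) = v := by
    intro v
    funext i
    by_cases h : v i = 0
    · simp [h]
    · simp [F2.eq_one_of_ne_zero h]
  refine Finset.sum_bij' (fun v _ => Finset.univ.filter fun i => v i ≠ 0)
    (fun A _ i => if i ∈ A then 1 else 0) ?_ ?_ ?_ ?_ ?_
  · intro v hv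
    exact Finset.mem_powersetCard.mpr ⟨Finset.subset_univ _, (mem_wordsOn.mp hv).2⟩
  · intro A hA
    exact mem_wordsOn.mpr ⟨fun i hi => absurd (Finset.mem_univ i) hi,
      (hn A).trans (Finset.mem_powersetCard.mp hA).2⟩
  · intro v _
    exact hf v
  · intro A _
    ext i
    simp
  · intro v _
    rw [hf v]

open Polynomial in
/-- The Krawtchouk polynomials are the Fourier transforms of the spheres. -/
lemma sum_sign_wordsOn (z : ι → F2) (w : ℕ) :
    ∑ v ∈ wordsOn Finset.univ w, sign (z ⬝ᵥ v) =
      krawtchouk (Fintype.card ι) w (hammingNorm z) := by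
  rw [sum_wordsOn_univ, krawtchouk_eq_coeff]
  have h1 : (∏ i : ι, (1 + C (sign (z i)) * X : ℤ[X])) =
      (1 - X) ^ hammingNorm z * (1 + X) ^ (Fintype.card ι - hammingNorm z) := by
    have h2 : ∀ i : ι, (1 + C (sign (z i)) * X : ℤ[X]) = if z i ≠ 0 then 1 - X else 1 + X := by
      intro i
      by_cases h : z i = 0
      · simp [h, sign_zero]
      · have : sign 1 = -1 := rfl
        simp [F2.eq_one_of_ne_zero h, this, sub_eq_add_neg]
    simp only [h2]
    rw [Finset.prod_ite, Finset.prod_const, Finset.prod_const]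
    have h3 := Finset.card_filter_add_card_filter_not (s := (Finset.univ : Finset ι))
      (fun i => z i ≠ 0)
    have h4 : (Finset.univ.filter fun i => z i ≠ 0).card = hammingNorm z := rfl
    rw [h4, Finset.card_univ] at h3
    rw [h4]
    congr 2
    omega
  rw [← h1, Finset.prod_one_add, finsetSum_coeff]
  have h5 : ∀ A : Finset ι, (∏ i ∈ A, (C (sign (z i)) * X : ℤ[X])).coeff w =
      if A.card = w then ∏ i ∈ A, sign (z i) else 0 := by
    intro A
    rw [Finset.prod_mul_distrib, Finset.prod_const, ← map_prod, coeff_C_mul, coeff_X_pow]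
    simp [eq_comm]
  simp only [h5]
  rw [← Finset.sum_filter, Finset.powersetCard_eq_filter]
  refine Finset.sum_congr rfl fun A _ => ?_
  rw [dotProduct, ← sign_sum]
  simp

/-- A consequence of Parseval's identity for the indicator function of a sphere. -/
lemma krawtchouk_sq_mul_choose_le (n w i : ℕ) :
    (krawtchouk n w i) ^ 2 * (n.choose i : ℤ) ≤ 2 ^ n * (n.choose w : ℤ) := by
  let f : (Fin n → F2) → ℤ := fun v => if v ∈ wordsOn Finset.univ w then 1 else 0
  have h1 : ∀ x, (fft n f).val x = krawtchouk n w (hammingNorm x) := by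
    intro x
    have h := sum_sign_wordsOn x w
    rw [Fintype.card_fin] at h
    rw [fft_val, ← h]
    simp only [f, ite_mul, one_mul, zero_mul]
    rw [Finset.sum_ite_mem, Finset.univ_inter]
  have h2 := fft_parseval n f
  have h3 : ∑ v, f v ^ 2 = n.choose w := by
    simp only [f, ite_pow, one_pow, ne_eq, OfNat.ofNat_ne_zero, not_false_eq_true, zero_pow]
    rw [Finset.sum_boole, Finset.filter_mem_eq_inter, Finset.univ_inter, card_wordsOn,
      Finset.card_univ, Fintype.card_fin]
  rw [h3] at h2
  rw [← h2]
  have h4 : (krawtchouk n w i) ^ 2 * (n.choose i : ℤ) =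
      ∑ x ∈ wordsOn (Finset.univ : Finset (Fin n)) i, (fft n f).val x ^ 2 := by
    rw [Finset.sum_congr rfl fun x hx => by rw [h1, (mem_wordsOn.mp hx).2], Finset.sum_const,
      card_wordsOn, Finset.card_univ, Fintype.card_fin, nsmul_eq_mul, mul_comm]
  rw [h4]
  exact Finset.sum_le_sum_of_subset_of_nonneg (Finset.subset_univ _) fun _ _ _ => sq_nonneg _

end KrawtchoukFourier

/-! ### The score of a candidate as a sum over a coset of the code -/

section Poisson

variable {n : ℕ} {q : Params} {P : Finset (Fin n)}

/-- The weighted number of words of the code in a coset that appears in the conjecture. -/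
def cosetSum (q : Params) (P : Finset (Fin n)) (e : Fin n → F2)
    (a : Matrix (Fin q.k) (Fin n) F2 × Matrix (Fin q.kaux) P F2 × (P → F2)) : ℤ :=
  ∑ z ∈ Finset.univ.filter (fun z : Fin n → F2 =>
      z - e ∈ rowCode a.1 ∧ a.2.1 *ᵥ restr P z = a.2.1 *ᵥ a.2.2),
    q.kk n (hammingNorm (restr Pᶜ z)) (hammingNorm (restr P z))

lemma sum_kk_mul_numWords (hP : P.card = q.s) (e : Fin n → F2)
    (a : Matrix (Fin q.k) (Fin n) F2 × Matrix (Fin q.kaux) P F2 × (P → F2)) :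
    ∑ j ∈ Finset.range (q.s + 1), ∑ i ∈ Finset.range (n - q.s + 1),
      q.kk n i j * (numWords P e a i j : ℤ) = cosetSum q P e a := by
  unfold cosetSum
  set S := Finset.univ.filter (fun z : Fin n → F2 =>
      z - e ∈ rowCode a.1 ∧ a.2.1 *ᵥ restr P z = a.2.1 *ᵥ a.2.2) with hS
  have hr : ∀ z : Fin n → F2, hammingNorm (restr P z) ∈ Finset.range (q.s + 1) := by
    intro z
    have := hammingNorm_le_card_fintype (x := restr P z)
    rw [Fintype.card_coe, hP] at this
    exact Finset.mem_range.mpr (by omega)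
  have hr' : ∀ z : Fin n → F2, hammingNorm (restr Pᶜ z) ∈ Finset.range (n - q.s + 1) := by
    intro z
    have := hammingNorm_le_card_fintype (x := restr Pᶜ z)
    rw [card_compl_coe P hP] at this
    exact Finset.mem_range.mpr (by omega)
  rw [← Finset.sum_fiberwise_of_maps_to (s := S) (g := fun z => hammingNorm (restr P z))
    (fun z _ => hr z)]
  refine Finset.sum_congr rfl fun j _ => ?_
  rw [← Finset.sum_fiberwise_of_maps_to (g := fun z => hammingNorm (restr Pᶜ z))
    (fun z _ => hr' z)]
  refine Finset.sum_congr rfl fun i _ => ?_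
  have h1 : ∀ z ∈ (S.filter fun z => hammingNorm (restr P z) = j).filter
      (fun z => hammingNorm (restr Pᶜ z) = i),
      q.kk n (hammingNorm (restr Pᶜ z)) (hammingNorm (restr P z)) = q.kk n i j := by
    intro z hz
    obtain ⟨hz1, hz2⟩ := Finset.mem_filter.mp hz
    rw [hz2, (Finset.mem_filter.mp hz1).2]
  rw [Finset.sum_congr rfl h1, Finset.sum_const, nsmul_eq_mul, mul_comm]
  congr 2
  unfold numWords
  congr 1
  ext z
  simp only [hS, Finset.mem_filter, Finset.mem_univ, true_and]
  tauto

/-- The product of two Krawtchouk polynomials as a character sum. -/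
lemma sum_sign_sphere (hP : P.card = q.s) (z : Fin n → F2) :
    ∑ v ∈ Finset.univ.filter (fun v : Fin n → F2 => hammingNorm (restr P v) = q.taux ∧
      hammingNorm (restr Pᶜ v) = q.w), sign (z ⬝ᵥ v) =
      q.kk n (hammingNorm (restr Pᶜ z)) (hammingNorm (restr P z)) := by
  have h1 := sum_sign_wordsOn (restr P z) q.taux
  have h2 := sum_sign_wordsOn (restr Pᶜ z) q.w
  rw [Fintype.card_coe, hP] at h1
  rw [card_compl_coe P hP] at h2
  rw [Params.kk, ← h1, ← h2, mul_comm, Finset.sum_mul_sum, ← Finset.sum_product']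
  refine Finset.sum_equiv (splitEquiv P) (fun v => ?_) fun v _ => ?_
  · simp [splitEquiv, mem_wordsOn]
  · rw [dotProduct_eq_add P, sign_add]
    rfl

/-- Poisson's summation formula: up to the normalization, the score of `G x` on the received
word `e` is the weighted number of words of `C + e` whose restriction to `P` lies in the coset
of `x`. -/
lemma two_pow_mul_fft_eq (hP : P.card = q.s) (c : ℕ) (cost : DecCost n q)
    {G : Matrix (Fin q.k) (Fin n) F2} (hG : G ∈ genMatrices q.k (Fin n))
    (A : Matrix (Fin q.kaux) P F2) (x : P → F2) (e : Fin n → F2) :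
    2 ^ q.k * (fft q.kaux (sampleTable e (lpnSamples c cost (rowCode G) P A).val)).val (A *ᵥ x) =
      2 ^ q.kaux * cosetSum q P e (G, A, x) := by
  set H := (lpnSamples c cost (rowCode G) P A).val with hH
  set S := Finset.univ.filter (fun v : Fin n → F2 => hammingNorm (restr P v) = q.taux ∧
      hammingNorm (restr Pᶜ v) = q.w) with hS
  have h1 : (fft q.kaux (sampleTable e H)).val (A *ᵥ x) =
      ∑ p ∈ H, sign (e ⬝ᵥ p.1) * sign ((A *ᵥ x) ⬝ᵥ p.2) := by
    rw [fft_val, ← Finset.sum_fiberwise H fun p => p.2]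
    refine Finset.sum_congr rfl fun m _ => ?_
    rw [sampleTable, Finset.sum_mul]
    refine Finset.sum_congr (by congr!) fun p hp => ?_
    rw [(Finset.mem_filter.mp hp).2]
  have hdot : ∀ (m : Fin q.kaux → F2) (x : P → F2), (A *ᵥ x) ⬝ᵥ m = x ⬝ᵥ (m ᵥ* A) := by
    intro m x
    rw [dotProduct_comm, Matrix.dotProduct_mulVec, dotProduct_comm]
  -- `(h, m) ↦ (h + m A, m)` maps the samples to the pairs whose first component lies in the sphere
  have h2 : ∑ p ∈ H, sign (e ⬝ᵥ p.1) * sign ((A *ᵥ x) ⬝ᵥ p.2) =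
      ∑ p ∈ (S ×ˢ (Finset.univ : Finset (Fin q.kaux → F2))).filter
          (fun p => G *ᵥ (p.1 - ext P (p.2 ᵥ* A)) = 0),
        sign (e ⬝ᵥ p.1) * sign ((A *ᵥ (x - restr P e)) ⬝ᵥ p.2) := by
    refine Finset.sum_bij' (fun p _ => (p.1 + ext P (p.2 ᵥ* A), p.2))
      (fun p _ => (p.1 - ext P (p.2 ᵥ* A), p.2)) ?_ ?_ ?_ ?_ ?_
    · intro p hp
      obtain ⟨a1, a2, a3⟩ := (mem_lpnSamples c cost _).mp hp
      refine Finset.mem_filter.mpr ⟨Finset.mem_product.mpr ⟨Finset.mem_filter.mpr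
        ⟨Finset.mem_univ _, ?_, ?_⟩, Finset.mem_univ _⟩, ?_⟩
      · simpa [map_add] using a2
      · simpa [map_add] using a3
      · simpa using (mem_dualWords_rowCode G _).mp a1
    · intro p hp
      obtain ⟨a1, a2⟩ := Finset.mem_filter.mp hp
      obtain ⟨-, a3, a4⟩ := Finset.mem_filter.mp (Finset.mem_product.mp a1).1
      refine (mem_lpnSamples c cost _).mpr ⟨(mem_dualWords_rowCode G _).mpr a2, ?_, ?_⟩
      · simpa [map_sub] using a3
      · simpa [map_sub] using a4
    · intro p _
      simp
    · intro p _
      simp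
    · intro p _
      rw [dotProduct_add, sign_add, dotProduct_eq_add P e (ext P _), restr_ext, restr_compl_ext,
        dotProduct_zero, add_zero, Matrix.mulVec_sub, sub_dotProduct, hdot p.2 (restr P e),
        sub_eq_add_neg, CharTwo.neg_eq, sign_add]
      have := sign_mul_self (restr P e ⬝ᵥ p.2 ᵥ* A)
      linear_combination (-sign (e ⬝ᵥ p.1) * sign (A *ᵥ x ⬝ᵥ p.2)) * this
  have h3 : ∀ p : (Fin n → F2) × (Fin q.kaux → F2),
      (if G *ᵥ (p.1 - ext P (p.2 ᵥ* A)) = 0 then (2 : ℤ) ^ q.k else 0) =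
      ∑ b : Fin q.k → F2, sign ((b ᵥ* G) ⬝ᵥ p.1) * sign ((A *ᵥ restr P (b ᵥ* G)) ⬝ᵥ p.2) := by
    intro p
    rw [← sum_sign_dotProduct]
    refine Finset.sum_congr rfl fun b _ => ?_
    rw [Matrix.dotProduct_mulVec, dotProduct_sub, sub_eq_add_neg, CharTwo.neg_eq, sign_add,
      dotProduct_eq_add P (b ᵥ* G) (ext P _), restr_ext, restr_compl_ext, dotProduct_zero, add_zero,
      hdot]
  rw [h1, h2, Finset.mul_sum]
  have h4 : ∀ p ∈ S ×ˢ (Finset.univ : Finset (Fin q.kaux → F2)),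
      (if G *ᵥ (p.1 - ext P (p.2 ᵥ* A)) = 0 then
        2 ^ q.k * (sign (e ⬝ᵥ p.1) * sign ((A *ᵥ (x - restr P e)) ⬝ᵥ p.2)) else 0) =
      ∑ b : Fin q.k → F2, sign ((b ᵥ* G + e) ⬝ᵥ p.1) *
        sign (p.2 ⬝ᵥ (A *ᵥ (restr P (b ᵥ* G + e) - x))) := by
    intro p _
    have := h3 p
    rw [← mul_boole, mul_comm] at this
    rw [← mul_boole, mul_right_comm, mul_comm (_ * _) (sign _ * sign _)] 
    rw [mul_comm (2 ^ q.k : ℤ), this, Finset.mul_sum]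
    refine Finset.sum_congr rfl fun b _ => ?_
    rw [add_dotProduct, sign_add, dotProduct_comm p.2, map_add, add_sub_assoc, Matrix.mulVec_add,
      add_dotProduct, sign_add, ← neg_sub x, Matrix.mulVec_neg, neg_dotProduct, CharTwo.neg_eq]
    ring
  rw [Finset.sum_filter, Finset.sum_congr rfl h4, Finset.sum_comm]
  have h5 : ∀ b : Fin q.k → F2, ∑ p ∈ S ×ˢ (Finset.univ : Finset (Fin q.kaux → F2)),
      sign ((b ᵥ* G + e) ⬝ᵥ p.1) * sign (p.2 ⬝ᵥ (A *ᵥ (restr P (b ᵥ* G + e) - x))) =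
      if A *ᵥ restr P (b ᵥ* G + e) = A *ᵥ x then 2 ^ q.kaux *
        q.kk n (hammingNorm (restr Pᶜ (b ᵥ* G + e))) (hammingNorm (restr P (b ᵥ* G + e)))
      else 0 := by
    intro b
    rw [Finset.sum_product]
    dsimp only
    rw [← Finset.sum_mul_sum, sum_sign_sphere hP, sum_sign_dotProduct,
      Matrix.mulVec_sub]
    simp only [sub_eq_zero]
    split_ifs
    · ring
    · ring
  rw [Finset.sum_congr rfl fun b _ => h5 b, ← Finset.sum_filter, cosetSum, Finset.mul_sum]
  -- the codewords are parametrized by the messages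
  refine Finset.sum_bij (fun b _ => b ᵥ* G + e) ?_ ?_ ?_ ?_
  · intro b hb
    refine Finset.mem_filter.mpr ⟨Finset.mem_univ _, ?_, (Finset.mem_filter.mp hb).2⟩
    rw [add_sub_cancel_right, rowCode]
    rw [← range_vecMulLinear]
    exact ⟨b, rfl⟩
  · intro b _ b' _ h
    exact Matrix.vecMul_injective_iff.mpr (mem_genMatrices.mp hG) (add_right_cancel h)
  · intro z hz
    obtain ⟨-, h6, h7⟩ := Finset.mem_filter.mp hz
    simp only [rowCode] at h6
    rw [← range_vecMulLinear] at h6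
    obtain ⟨b, hb⟩ := h6
    have hb : b ᵥ* G + e = z := by rw [← Matrix.vecMulLinear_apply, hb, sub_add_cancel]
    exact ⟨b, Finset.mem_filter.mpr ⟨Finset.mem_univ _, by rw [hb]; exact h7⟩, hb⟩
  · intro b _
    rfl

end Poisson

/-! ### The sample space of the conjecture -/

section WeightSpace

variable {α β : Type}

lemma prob_product (A : Finset α) (B : Finset β) (E : α × β → Prop) :
    prob (A ×ˢ B) E = 𝔼 a ∈ A, prob B fun b => E (a, b) := by
  rw [prob_eq_expect, Finset.expect_product]
  exact Finset.expect_congr rfl fun a _ => (prob_eq_expect _ _).symm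

lemma prob_le_of_subset {A B : Finset α} (h : A ⊆ B) {c : ℝ} (hc : 0 ≤ c)
    (hcard : (B.card : ℝ) ≤ c * A.card) (E : α → Prop) : prob A E ≤ c * prob B E := by
  rcases A.eq_empty_or_nonempty with rfl | hA
  · rw [prob_eq_zero (by simp)]
    exact mul_nonneg hc (prob_nonneg _ _)
  have hA0 : (0 : ℝ) < A.card := by exact_mod_cast hA.card_pos
  have hB0 : (0 : ℝ) < B.card := by exact_mod_cast (hA.mono h).card_pos
  have h1 : ((A.filter E).card : ℝ) ≤ (B.filter E).card := by
    exact_mod_cast Finset.card_le_card (Finset.filter_subset_filter E h)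
  unfold prob
  rw [← mul_div_assoc, div_le_div_iff₀ hA0 hB0]
  calc ((A.filter E).card : ℝ) * B.card ≤ (B.filter E).card * (c * A.card) := by gcongr
    _ = _ := by ring

lemma prob_add_prob_not {A : Finset α} (hA : A.Nonempty) (E : α → Prop) :
    prob A E + prob A (fun a => ¬ E a) = 1 := by
  unfold prob
  rw [← add_div, div_eq_one_iff_eq (by exact_mod_cast hA.card_pos.ne')]
  have := Finset.card_filter_add_card_filter_not (s := A) E
  rw [← this]
  push_cast
  congr!

lemma card_le_mul_card {A B : Finset α} (hA : A.Nonempty) (E F : α → Prop) {p r : ℝ}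
    (hE : prob A E ≤ p) (hF : prob A F ≤ r) (h : ∀ a ∈ A, ¬ E a → ¬ F a → a ∈ B) :
    (1 - p - r) * A.card ≤ B.card := by
  have h1 := prob_add_prob_not hA fun a => E a ∨ F a
  have h2 := prob_or_le A E F
  have h3 : prob A (fun a => ¬ (E a ∨ F a)) ≤ B.card / A.card := by
    rw [prob_eq_card]
    refine div_le_div_of_nonneg_right (Nat.cast_le.mpr (Finset.card_le_card fun a ha => ?_))
      (Nat.cast_nonneg _)
    obtain ⟨ha1, ha2⟩ := Finset.mem_filter.mp ha
    exact h a ha1 (fun hh => ha2 (Or.inl hh)) fun hh => ha2 (Or.inr hh)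
  rw [← le_div_iff₀ (by exact_mod_cast hA.card_pos)]
  linarith

variable {n : ℕ} {q : Params} {P : Finset (Fin n)}

lemma prob_mulVec_eq_le {A : Matrix (Fin q.kaux) P F2} (hA : A ∈ genMatrices q.kaux P)
    (y : Fin q.kaux → F2) :
    prob (Finset.univ : Finset (P → F2)) (fun x => A *ᵥ x = y) ≤ 1 / 2 ^ q.kaux := by
  -- the solutions are empty or a coset of the kernel
  rcases (Finset.univ.filter fun x : P → F2 => A *ᵥ x = y).eq_empty_or_nonempty with h0 | ⟨x₀, hx₀⟩
  · rw [prob_eq_zero fun x _ hx => Finset.notMem_empty x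
      (h0 ▸ Finset.mem_filter.mpr ⟨Finset.mem_univ _, hx⟩)]
    positivity
  have hk := le_card_of_mem_genMatrices hA
  have hx₀ := (Finset.mem_filter.mp hx₀).2
  have h1 : ((Finset.univ : Finset (P → F2)).filter fun x => A *ᵥ x = y).card ≤
      2 ^ (Fintype.card P - q.kaux) := by
    rw [← finrank_ker_genMatrix hA]
    have h2 : Nat.card (LinearMap.ker A.mulVecLin) =
        2 ^ Module.finrank F2 (LinearMap.ker A.mulVecLin) := by
      rw [Module.natCard_eq_pow_finrank (K := F2), Nat.card_zmod]
    rw [← h2, Nat.card_eq_fintype_card, Fintype.card_subtype]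
    refine Finset.card_le_card_of_injOn (fun x => x - x₀) (fun x hx => ?_)
      fun x _ y _ h => sub_left_injective h
    refine Finset.mem_filter.mpr ⟨Finset.mem_univ _, ?_⟩
    rw [LinearMap.mem_ker, map_sub, Matrix.mulVecLin_apply, Matrix.mulVecLin_apply, hx₀,
      (Finset.mem_filter.mp hx).2, sub_self]
  rw [prob_eq_card, div_le_div_iff₀ (by simp) (by positivity), one_mul, Finset.card_univ,
    Fintype.card_fun, ZMod.card]
  calc (((Finset.univ.filter fun x : P → F2 => A *ᵥ x = y).card : ℕ) : ℝ) * 2 ^ q.kaux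
      ≤ 2 ^ (Fintype.card P - q.kaux) * 2 ^ q.kaux := by
        gcongr
        exact_mod_cast h1
    _ = ((2 ^ Fintype.card P : ℕ) : ℝ) := by
        rw [← pow_add, Nat.sub_add_cancel hk]
        push_cast
        rfl

lemma finrank_punctured_le (C : Submodule F2 (Fin n → F2)) :
    Module.finrank F2 (punctured C P) ≤ P.card := by
  refine (Submodule.finrank_le _).trans ?_
  simp

/-- A code whose puncturing is not the full space has a nonzero parity-check supported on `P`. -/
lemma exists_mulVec_ext_eq_zero {k : ℕ} {G : Matrix (Fin k) (Fin n) F2}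
    (h : Module.finrank F2 (punctured (rowCode G) P) ≠ P.card) :
    ∃ v : P → F2, v ≠ 0 ∧ G *ᵥ ext P v = 0 := by
  have hlt : punctured (rowCode G) P < ⊤ := by
    refine lt_top_iff_ne_top.mpr fun ht => h ?_
    rw [ht, finrank_top]
    simp
  obtain ⟨f, hf0, hf⟩ := Submodule.exists_le_ker_of_lt_top _ hlt
  obtain ⟨v, hv⟩ := exists_dotProduct_eq f
  refine ⟨v, ?_, ?_⟩
  · rintro rfl
    refine hf0 (LinearMap.ext fun x => ?_)
    rw [hv, dotProduct_zero]
    rfl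
  · rw [← forall_mem_rowCode]
    intro c hc
    rw [dotProduct_eq_add P, restr_ext, restr_compl_ext, dotProduct_zero, add_zero, ← hv]
    exact hf ⟨c, hc, rfl⟩

lemma prod_one_sub_inv_pow_ge (s : ℕ) :
    (1 : ℝ) / 4 ≤ ∏ i ∈ Finset.range s, (1 - 1 / 2 ^ (i + 1)) := by
  -- the additional summand makes the induction work
  have h : ∀ s : ℕ, (1 : ℝ) / 4 + 1 / 2 ^ (s + 2) ≤
      ∏ i ∈ Finset.range (s + 1), (1 - 1 / 2 ^ (i + 1)) := by
    intro s
    induction s with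
    | zero => norm_num
    | succ s ih =>
      rw [Finset.prod_range_succ]
      have hx : (0 : ℝ) < 1 / 2 ^ s := by positivity
      have hx1 : (1 : ℝ) / 2 ^ s ≤ 1 := by
        rw [div_le_one (by positivity)]
        exact one_le_pow₀ (by norm_num)
      have e1 : (1 : ℝ) / 2 ^ (s + 2) = 1 / 2 ^ s / 4 := by rw [pow_add]; field_simp; norm_num
      have e2 : (1 : ℝ) / 2 ^ (s + 1 + 2) = 1 / 2 ^ s / 8 := by
        rw [add_assoc, pow_add]; field_simp; norm_num
      have e3 : (1 : ℝ) / 2 ^ (s + 1 + 1) = 1 / 2 ^ s / 4 := by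
        rw [add_assoc, pow_add]; field_simp; norm_num
      rw [e1] at ih
      rw [e2, e3]
      set x := (1 : ℝ) / 2 ^ s
      have := mul_le_mul_of_nonneg_right ih (by linarith : (0 : ℝ) ≤ 1 - x / 4)
      nlinarith
  rcases s with _ | s
  · norm_num
  · have : (0 : ℝ) < 1 / 2 ^ (s + 2) := by positivity
    linarith [h s]

/-- At least a quarter of the square matrices are invertible. -/
lemma card_genMatrices_ge (hP : P.card = q.s) :
    (2 : ℝ) ^ (q.s * q.s) / 4 ≤ (genMatrices q.s P).card := by
  have h1 : (genMatrices q.s P).card =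
      Nat.card {v : Fin q.s → (P → F2) // LinearIndependent F2 v} := by
    rw [← Fintype.card_coe, ← Nat.card_eq_fintype_card]
    exact Nat.card_congr ((Matrix.of.symm).subtypeEquiv fun v => mem_genMatrices)
  have hf : Module.finrank F2 (P → F2) = q.s := by simp [hP]
  have h2 := card_linearIndependent (K := F2) (V := P → F2) (k := q.s) hf.ge
  rw [h1, h2, hf, ZMod.card, Fin.prod_univ_eq_prod_range (fun i => 2 ^ q.s - 2 ^ i) q.s]
  push_cast
  have h3 : ∀ i ∈ Finset.range q.s, (((2 ^ q.s - 2 ^ i : ℕ) : ℕ) : ℝ) =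
      2 ^ q.s * (1 - 1 / 2 ^ (q.s - 1 - i + 1)) := by
    intro i hi
    have hi := Finset.mem_range.mp hi
    rw [Nat.cast_sub (Nat.pow_le_pow_right (by norm_num) hi.le)]
    have e : q.s = (q.s - 1 - i + 1) + i := by omega
    have e2 : (2 : ℝ) ^ q.s = 2 ^ (q.s - 1 - i + 1) * 2 ^ i := by rw [← pow_add, ← e]
    push_cast
    rw [mul_sub, mul_one, mul_one_div]
    congr 1
    rw [e2, mul_div_cancel_left₀ _ (by positivity)]
  rw [Finset.prod_congr rfl h3, Finset.prod_mul_distrib, Finset.prod_const, Finset.card_range,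
    Finset.prod_range_reflect (fun i => (1 : ℝ) - 1 / 2 ^ (i + 1)) q.s, ← pow_mul]
  have := prod_one_sub_inv_pow_ge q.s
  have h0 : (0 : ℝ) < 2 ^ (q.s * q.s) := by positivity
  nlinarith

/-- With probability at least `1 / 4`, the punctured code is the full space. -/
lemma prob_finrank_punctured_ne_le (hP : P.card = q.s) (hsk : q.s ≤ q.k) (hkn : q.k ≤ n) :
    prob (genMatrices q.k (Fin n))
      (fun G => Module.finrank F2 (punctured (rowCode G) P) ≠ q.s) ≤ 3 / 4 := by
  rcases hsk.lt_or_eq with hlt | heq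
  · -- union bound over the possible parity-checks supported on `P`
    refine (prob_mono (F := fun G => ∃ v ∈ (Finset.univ : Finset (P → F2)).erase 0,
      G *ᵥ ext P v = 0) fun G _ hG => ?_).trans ((prob_exists_le _ _ (p := 1 / 2 ^ q.k)
        fun v hv => ?_).trans ?_)
    · obtain ⟨v, hv0, hv⟩ := exists_mulVec_ext_eq_zero (P := P) (G := G) (by rwa [hP])
      exact ⟨v, Finset.mem_erase.mpr ⟨hv0, Finset.mem_univ _⟩, hv⟩
    · have h0 : ext P v ≠ 0 := fun h => Finset.ne_of_mem_erase hv
        (ext_injective P (h.trans (map_zero _).symm))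
      have := prob_mulVec_eq_zero_le q.k (fun _ : Fin 1 => ext P v)
        (LinearIndependent.of_subsingleton (R := F2) (0 : Fin 1) h0)
      simpa using this
    · have h1 : ((((Finset.univ : Finset (P → F2)).erase 0).card : ℕ) : ℝ) ≤ 2 ^ q.s := by
        have : ((Finset.univ : Finset (P → F2)).erase 0).card ≤ 2 ^ q.s := by
          refine (Finset.card_erase_le).trans ?_
          simp [ZMod.card, hP]
        exact_mod_cast this
      have h2 : (2 : ℝ) ^ q.s * 2 ≤ 2 ^ q.k := by
        rw [← pow_succ]
        exact pow_le_pow_right₀ (by norm_num) hlt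
      rw [mul_one_div, div_le_iff₀ (by positivity)]
      have : (0 : ℝ) < 2 ^ q.k := by positivity
      linarith
  · -- the invertible square blocks on `P` are completed arbitrarily
    have hne : (genMatrices q.k (Fin n)).Nonempty := genMatrices_nonempty (by simpa using hkn)
    have h1 := prob_add_prob_not hne fun G => Module.finrank F2 (punctured (rowCode G) P) = q.s
    suffices 1 / 4 ≤ prob (genMatrices q.k (Fin n))
        (fun G => Module.finrank F2 (punctured (rowCode G) P) = q.s) by
      have h2 : prob (genMatrices q.k (Fin n))
          (fun G => Module.finrank F2 (punctured (rowCode G) P) ≠ q.s) =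
        prob (genMatrices q.k (Fin n))
          (fun G => ¬ Module.finrank F2 (punctured (rowCode G) P) = q.s) := rfl
      linarith
    have h2 : (genMatrices q.s P).card * 2 ^ (q.s * (n - q.s)) ≤
        ((genMatrices q.k (Fin n)).filter
          fun G => Module.finrank F2 (punctured (rowCode G) P) = q.s).card := by
      have h3 : 2 ^ (q.s * (n - q.s)) =
          (Finset.univ : Finset (Fin q.s → ↥Pᶜ → F2)).card := by
        rw [Finset.card_univ, Fintype.card_fun, Fintype.card_fun, ZMod.card, Fintype.card_fin,
          card_compl_coe P hP, ← pow_mul, mul_comm]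
      rw [h3, ← Finset.card_product, ← heq]
      refine Finset.card_le_card_of_injOn (fun p i => ext P (p.1 i) + ext Pᶜ (p.2 i)) ?_ ?_
      · intro p hp
        have hp1 := mem_genMatrices.mp (Finset.mem_product.mp hp).1
        have hres : ∀ i, restr P (ext P (p.1 i) + ext Pᶜ (p.2 i)) = p.1 i := fun i => by
          simp [map_add]
        refine Finset.mem_filter.mpr ⟨mem_genMatrices.mpr ?_, ?_⟩
        · refine LinearIndependent.of_comp (restr P) ?_
          have : (restr P ∘ Matrix.row fun i => ext P (p.1 i) + ext Pᶜ (p.2 i)) = p.1.row :=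
            funext hres
          rwa [this]
        · refine le_antisymm ((finrank_punctured_le _).trans hP.le) ?_
          have hle : rowCode p.1 ≤ punctured
              (rowCode fun i => ext P (p.1 i) + ext Pᶜ (p.2 i)) P := by
            refine Submodule.span_le.mpr ?_
            rintro _ ⟨i, rfl⟩
            exact ⟨_, Submodule.subset_span ⟨i, rfl⟩, hres i⟩
          refine le_trans ?_ (Submodule.finrank_mono hle)
          rw [finrank_rowCode (Finset.mem_product.mp hp).1]
      · intro p _ p' _ h
        have h4 : ∀ i, ext P (p.1 i) + ext Pᶜ (p.2 i) = ext P (p'.1 i) + ext Pᶜ (p'.2 i) :=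
          fun i => congrFun h i
        refine Prod.ext (funext fun i => ?_) (funext fun i => ?_)
        · simpa [map_add] using congrArg (restr P) (h4 i)
        · simpa [map_add] using congrArg (restr Pᶜ) (h4 i)
    have h5 : (genMatrices q.k (Fin n)).card ≤ 2 ^ (q.s * n) := by
      refine (Finset.card_le_univ _).trans (le_of_eq ?_)
      rw [← heq]
      change Fintype.card (Fin q.s → Fin n → F2) = _
      rw [Fintype.card_fun, Fintype.card_fun, ZMod.card, Fintype.card_fin, Fintype.card_fin,
        ← pow_mul, mul_comm]
    have h6 := card_genMatrices_ge hP
    rw [prob, div_le_div_iff₀ (by norm_num) (by exact_mod_cast hne.card_pos), one_mul]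
    have h7 : (2 : ℝ) ^ (q.s * n) = 2 ^ (q.s * q.s) * 2 ^ (q.s * (n - q.s)) := by
      rw [← pow_add, ← mul_add, Nat.add_sub_cancel' (hsk.trans hkn)]
    calc ((genMatrices q.k (Fin n)).card : ℝ) ≤ 2 ^ (q.s * n) := by exact_mod_cast h5
      _ = 2 ^ (q.s * q.s) / 4 * 2 ^ (q.s * (n - q.s)) * 4 := by rw [h7]; ring
      _ ≤ (genMatrices q.s P).card * 2 ^ (q.s * (n - q.s)) * 4 := by gcongr
      _ ≤ _ := by
        refine mul_le_mul_of_nonneg_right ?_ (by norm_num)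
        have h8 : ((genMatrices q.s P).card : ℝ) * 2 ^ (q.s * (n - q.s)) ≤
            (((genMatrices q.k (Fin n)).filter
              fun G => Module.finrank F2 (punctured (rowCode G) P) = q.s).card : ℕ) := by
          exact_mod_cast h2
        refine h8.trans (le_of_eq ?_)
        congr!

/-- The sample space without the conditions of full dimension and of non-membership. -/
def wholeSpace (q : Params) (P : Finset (Fin n)) :
    Finset (Matrix (Fin q.k) (Fin n) F2 × Matrix (Fin q.kaux) P F2 × (P → F2)) :=
  genMatrices q.k (Fin n) ×ˢ genMatrices q.kaux P ×ˢ Finset.univ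

lemma prob_wholeSpace
    (E : Matrix (Fin q.k) (Fin n) F2 × Matrix (Fin q.kaux) P F2 × (P → F2) → Prop) :
    prob (wholeSpace q P) E = 𝔼 G ∈ genMatrices q.k (Fin n), 𝔼 A ∈ genMatrices q.kaux P,
      prob Finset.univ fun x => E (G, A, x) := by
  rw [wholeSpace, prob_product]
  exact Finset.expect_congr rfl fun G _ => prob_product _ _ _

lemma prob_le_one (A : Finset α) (E : α → Prop) : prob A E ≤ 1 :=
  div_le_one_of_le₀ (by exact_mod_cast Finset.card_filter_le _ _) (Nat.cast_nonneg _)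

lemma prob_wholeSpace_and_le (E : Matrix (Fin q.k) (Fin n) F2 → Prop)
    (F : Matrix (Fin q.k) (Fin n) F2 × Matrix (Fin q.kaux) P F2 × (P → F2) → Prop) {p : ℝ}
    (hp : 0 ≤ p) (h : ∀ G, ∀ A ∈ genMatrices q.kaux P,
      prob (Finset.univ : Finset (P → F2)) (fun x => F (G, A, x)) ≤ p) :
    prob (wholeSpace q P) (fun a => E a.1 ∧ F a) ≤ prob (genMatrices q.k (Fin n)) E * p := by
  rw [prob_wholeSpace, prob_eq_expect (genMatrices q.k (Fin n)) E, Finset.expect_mul]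
  refine expect_mono fun G _ => ?_
  by_cases hG : E G
  · rw [if_pos hG, one_mul]
    exact expect_le_of_le hp fun A hA => (prob_mono fun x _ hx => hx.2).trans (h G A hA)
  · rw [if_neg hG, zero_mul]
    exact expect_le_of_le le_rfl fun A _ => (prob_eq_zero fun x _ hx => hG hx.1).le

lemma prob_wholeSpace_le_add (E : Matrix (Fin q.k) (Fin n) F2 → Prop)
    (F : Matrix (Fin q.k) (Fin n) F2 × Matrix (Fin q.kaux) P F2 × (P → F2) → Prop)
    {R : Matrix (Fin q.k) (Fin n) F2 → ℝ} (hR : ∀ G, 0 ≤ R G)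
    (h : ∀ G, ¬ E G → 𝔼 A ∈ genMatrices q.kaux P,
      prob (Finset.univ : Finset (P → F2)) (fun x => F (G, A, x)) ≤ R G) :
    prob (wholeSpace q P) F ≤
      prob (genMatrices q.k (Fin n)) E + 𝔼 G ∈ genMatrices q.k (Fin n), R G := by
  rw [prob_wholeSpace, prob_eq_expect (genMatrices q.k (Fin n)) E, ← Finset.expect_add_distrib]
  refine expect_mono fun G _ => ?_
  by_cases hG : E G
  · rw [if_pos hG]
    exact (expect_le_of_le zero_le_one fun A _ => prob_le_one _ _).trans
      (le_add_of_nonneg_right (hR G))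
  · rw [if_neg hG, zero_add]
    exact h G hG

lemma weightSpace_subset (e : Fin n → F2) : weightSpace q P e ⊆ wholeSpace q P := by
  intro a ha
  obtain ⟨-, h1, -, h2, -⟩ := Finset.mem_filter.mp ha
  exact Finset.mem_product.mpr ⟨h1, Finset.mem_product.mpr ⟨h2, Finset.mem_univ _⟩⟩

/-- The conditions that define the sample space of the conjecture fail with probability at most
`3 / 4 + 1 / 8`, so that probabilities under these
conditions are at most `8` times those without them. -/
lemma card_wholeSpace_le (hP : P.card = q.s) (hsk : q.s ≤ q.k) (hkn : q.k ≤ n)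
    (hks : q.kaux ≤ q.s) (hk : 3 ≤ q.kaux) (e : Fin n → F2) :
    (wholeSpace q P).Nonempty ∧
      ((wholeSpace q P).card : ℝ) ≤ 8 * (weightSpace q P e).card := by
  have hne1 : (genMatrices q.k (Fin n)).Nonempty := genMatrices_nonempty (by simpa using hkn)
  have hne2 : (genMatrices q.kaux P).Nonempty :=
    genMatrices_nonempty (by rw [Fintype.card_coe, hP]; exact hks)
  have hne : (wholeSpace q P).Nonempty := hne1.product (hne2.product Finset.univ_nonempty)
  refine ⟨hne, ?_⟩
  have h2 : prob (wholeSpace q P)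
      (fun a => Module.finrank F2 (punctured (rowCode a.1) P) ≠ q.s) ≤ 3 / 4 := by
    have := prob_wholeSpace_and_le (P := P) (q := q)
      (fun G => Module.finrank F2 (punctured (rowCode G) P) ≠ q.s) (fun _ => True) zero_le_one
      fun G A _ => prob_le_one _ _
    rw [mul_one] at this
    exact (prob_mono fun a _ ha => ⟨ha, trivial⟩).trans
      (this.trans (prob_finrank_punctured_ne_le hP hsk hkn))
  have h3 : prob (wholeSpace q P) (fun a => a.2.1 *ᵥ a.2.2 = a.2.1 *ᵥ restr P e) ≤ 1 / 8 := by
    rw [prob_wholeSpace]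
    refine expect_le_of_le (by norm_num) fun G _ => expect_le_of_le (by norm_num) fun A hA => ?_
    refine (prob_mulVec_eq_le hA (A *ᵥ restr P e)).trans ?_
    have : (2 : ℝ) ^ 3 ≤ 2 ^ q.kaux := pow_le_pow_right₀ (by norm_num) hk
    rw [div_le_div_iff₀ (by positivity) (by norm_num)]
    linarith
  have h4 := card_le_mul_card (B := weightSpace q P e) hne _ _ h2 h3 fun a ha ha1 ha2 => by
    obtain ⟨ha3, ha4⟩ := Finset.mem_product.mp ha
    exact Finset.mem_filter.mpr
      ⟨Finset.mem_univ _, ha3, not_not.mp ha1, (Finset.mem_product.mp ha4).1, ha2⟩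
  norm_num at h4
  linarith

/-- The probability that the coset contains a word of given weights, by the union bound.  The word
`e` itself is excluded by the condition on `x`. -/
lemma prob_numWords_ne_zero_le (hP : P.card = q.s) (hsk : q.s ≤ q.k) (hkn : q.k ≤ n)
    (hks : q.kaux ≤ q.s) (hk : 3 ≤ q.kaux) (e : Fin n → F2) (i j : ℕ) :
    prob (weightSpace q P e) (fun a => numWords P e a i j ≠ 0) ≤
      8 * ((q.s.choose j : ℝ) * ((n - q.s).choose i : ℝ) *
        (2 ^ q.k / 2 ^ n * (1 / 2 ^ q.kaux))) := by
  let Z := (Finset.univ.filter fun z : Fin n → F2 => hammingNorm (restr P z + 0) = j ∧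
    hammingNorm (restr Pᶜ z) = i).filter fun z => z ≠ e
  have h1 := prob_exists_le (Ω := wholeSpace q P) Z
    (fun z a => z - e ∈ rowCode a.1 ∧ a.2.1 *ᵥ a.2.2 = a.2.1 *ᵥ restr P z)
    (p := 2 ^ q.k / 2 ^ n * (1 / 2 ^ q.kaux)) (by
      intro z hz
      have hz0 : z - e ≠ 0 := sub_ne_zero.mpr (Finset.mem_filter.mp hz).2
      have h2 : prob (genMatrices q.k (Fin n)) (fun G => z - e ∈ rowCode G) ≤
          2 ^ q.k / 2 ^ n := by
        have := prob_mem_rowCode_le q.k (fun _ : Fin 1 => z - e)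
          (LinearIndependent.of_subsingleton (R := F2) (0 : Fin 1) hz0)
        simpa using this
      have h3 := prob_wholeSpace_and_le (P := P) (q := q) (fun G => z - e ∈ rowCode G)
        (fun a => a.2.1 *ᵥ a.2.2 = a.2.1 *ᵥ restr P z) (p := 1 / 2 ^ q.kaux) (by positivity)
        fun G A hA => prob_mulVec_eq_le hA (A *ᵥ restr P z)
      exact h3.trans (mul_le_mul_of_nonneg_right h2 (by positivity)))
  obtain ⟨-, hc⟩ := card_wholeSpace_le hP hsk hkn hks hk e
  have h3 : prob (weightSpace q P e) (fun a => numWords P e a i j ≠ 0) ≤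
      prob (weightSpace q P e) (fun a => ∃ z ∈ Z,
        z - e ∈ rowCode a.1 ∧ a.2.1 *ᵥ a.2.2 = a.2.1 *ᵥ restr P z) := by
    refine prob_mono fun a ha hN => ?_
    obtain ⟨z, hz⟩ := Finset.card_ne_zero.mp hN
    obtain ⟨-, hz1, hz2, hz3, hz4⟩ := Finset.mem_filter.mp hz
    obtain ⟨-, -, -, -, hx⟩ := Finset.mem_filter.mp ha
    refine ⟨z, Finset.mem_filter.mpr ⟨Finset.mem_filter.mpr ⟨Finset.mem_univ _, by rwa [add_zero],
      hz4⟩, ?_⟩, hz1, hz2.symm⟩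
    rintro rfl
    exact hx hz2.symm
  refine h3.trans ((prob_le_of_subset (weightSpace_subset e) (by norm_num) hc _).trans ?_)
  refine mul_le_mul_of_nonneg_left (h1.trans ?_) (by norm_num)
  refine mul_le_mul_of_nonneg_right ?_ (by positivity)
  refine le_trans (Nat.cast_le.mpr (Finset.card_filter_le _ _)) (le_of_eq ?_)
  have := card_filter_split P 0 j i
  rw [hP] at this
  exact_mod_cast this

/-- The mean-square bound for the scores of the candidates, in probability. -/
lemma prob_le_sq_fft_le (hP : P.card = q.s) (hs : 0 < q.s) (hsn : q.s ≤ n) (hkn : q.k ≤ n)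
    (c l : ℕ) (cost : DecCost n q) (e : Fin n → F2) {ρ T β : ℝ} (hρ : 0 ≤ ρ)
    (hT : 0 < T) (hβ : β ≠ 0)
    (h₁ : (q.s.choose q.taux : ℝ) * ((n - q.s).choose q.w : ℝ) * (1 / 2 ^ q.k) ≤ ρ * T) :
    prob (wholeSpace q P) (fun a => β ^ 2 ≤ (((fft q.kaux (sampleTable e
      (lpnSamples c cost (rowCode a.1) P a.2.1).val)).val (a.2.1 *ᵥ a.2.2) : ℤ) : ℝ) ^ 2) ≤
      8 ^ n * ρ ^ l + (T + 2 ^ l) / β ^ 2 *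
        (1 + (q.s.choose q.taux : ℝ) * ((n - q.s).choose q.w : ℝ) / 2 ^ q.k +
          (1 + 2 ^ q.s * ((n - q.s).choose q.w : ℝ) / 2 ^ q.k) * auxDensity q) := by
  have hne : (genMatrices q.k (Fin n)).Nonempty := genMatrices_nonempty (by simpa using hkn)
  have had0 := auxDensity_nonneg q
  have hβ2 : 0 < β ^ 2 := by positivity
  have hT0 : 0 ≤ T + 2 ^ l := by positivity
  let bad := fun G : Matrix (Fin q.k) (Fin n) F2 => ∃ v ∈ (Finset.univ : Finset (P → F2)),
      T + 2 ^ l < ((checksNear q P (rowCode G) v).card : ℝ)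
  have h2 := prob_wholeSpace_le_add (P := P) (q := q) bad
    (fun a => β ^ 2 ≤ (((fft q.kaux (sampleTable e
      (lpnSamples c cost (rowCode a.1) P a.2.1).val)).val (a.2.1 *ᵥ a.2.2) : ℤ) : ℝ) ^ 2)
    (R := fun G => (T + 2 ^ l) / β ^ 2 *
      ((checksNear q P (rowCode G) 0).card + (checks q P (rowCode G)).card * auxDensity q))
    (fun G => by positivity) (by
      intro G hb
      have hnb : ∀ v, ((checksNear q P (rowCode G) v).card : ℝ) ≤ T + 2 ^ l := by
        intro v
        by_contra hv
        exact hb ⟨v, Finset.mem_univ _, not_le.mp hv⟩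
      refine le_trans (expect_mono fun A hA => ?_) ((Finset.mul_expect _ _ _).symm.le.trans
        (mul_le_mul_of_nonneg_left (expect_sum_decodeAux_le (q := q) (rowCode G) hP hs)
          (div_nonneg hT0 hβ2.le)))
      set H := (lpnSamples c cost (rowCode G) P A).val with hH
      set F := fun y => (((fft q.kaux (sampleTable e H)).val y : ℤ) : ℝ) with hF
      -- the messages with a large score
      let Y := Finset.univ.filter fun y => β ^ 2 ≤ F y ^ 2
      have h3 : (Y.card : ℝ) * β ^ 2 ≤ 2 ^ q.kaux * ((T + 2 ^ l) * H.card) := by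
        refine le_trans ?_ (sum_sq_fft_le c cost (rowCode G) e A hT0 hnb)
        rw [← nsmul_eq_mul, ← Finset.sum_const]
        exact (Finset.sum_le_sum fun y hy => (Finset.mem_filter.mp hy).2).trans
          (Finset.sum_le_sum_of_subset_of_nonneg (Finset.subset_univ _) fun _ _ _ => sq_nonneg _)
      have h4 : prob Finset.univ (fun x => β ^ 2 ≤ F (A *ᵥ x) ^ 2) ≤
          Y.card * (1 / 2 ^ q.kaux) := by
        refine le_trans (prob_mono fun x _ hx => ?_) (prob_exists_le Y (fun y x => A *ᵥ x = y)
          fun y _ => prob_mulVec_eq_le hA y)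
        exact ⟨A *ᵥ x, Finset.mem_filter.mpr ⟨Finset.mem_univ _, hx⟩, rfl⟩
      refine h4.trans ?_
      have h5 := card_lpnSamples_le c cost (rowCode G) A
      have h6 : (Y.card : ℝ) * (1 / 2 ^ q.kaux) ≤ (T + 2 ^ l) / β ^ 2 * H.card := by
        rw [mul_one_div, div_mul_eq_mul_div, div_le_div_iff₀ (by positivity) hβ2]
        linarith
      exact h6.trans (mul_le_mul_of_nonneg_left h5 (div_nonneg hT0 hβ2.le)))
  refine h2.trans ?_
  rw [← Finset.mul_expect, Finset.expect_add_distrib,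
    ← Finset.expect_mul]
  have eW : 𝔼 G ∈ genMatrices q.k (Fin n), ((checks q P (rowCode G)).card : ℝ) ≤
      1 + 2 ^ q.s * ((n - q.s).choose q.w : ℝ) / 2 ^ q.k :=
    expect_card_dualWords_le q.k _ (card_filter_checks q hP).le
  have eZ : 𝔼 G ∈ genMatrices q.k (Fin n), ((checksNear q P (rowCode G) 0).card : ℝ) ≤
      1 + (q.s.choose q.taux : ℝ) * ((n - q.s).choose q.w : ℝ) / 2 ^ q.k :=
    expect_card_dualWords_le q.k _ (card_filter_checksNear q hP 0).le
  have eB := prob_exists_checksNear_gt_le hP hsn l hρ hT h₁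
  gcongr

end WeightSpace

/-! ### Negative bias -/

section NegativeBias

variable {n : ℕ} {q : Params} {P : Finset (Fin n)}

/-- The mean number of words with a dominant pair of weights is at most `n ^ 6.4 / (δ ^ 2 H̃)`.
Parseval's bound for the two Krawtchouk polynomials shows that few words have weights at which
their product is as large as dominance requires. -/
lemma bias_sq_mul_samples_mul_le (hv : q.Valid n) {i j : ℕ} (hij : (i, j) ∈ dominantPairs n q) :
    q.bias n ^ 2 * q.samples n * ((q.s.choose j : ℝ) * ((n - q.s).choose i : ℝ) *
      (2 ^ q.k / 2 ^ n * (1 / 2 ^ q.kaux))) ≤ (n : ℝ) ^ (6.4 : ℝ) := by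
  obtain ⟨-, hij⟩ := Finset.mem_filter.mp hij
  have hA1 : (0 : ℝ) < (n - q.s).choose q.w := by exact_mod_cast Nat.choose_pos hv.w_le
  have hA2 : (0 : ℝ) < q.s.choose q.taux := by exact_mod_cast Nat.choose_pos hv.taux_le_s
  have hkk : q.kaux ≤ q.k := hv.kaux_le_s.trans hv.s_le_k
  have h1 : ((krawtchouk (n - q.s) q.w i : ℤ) : ℝ) ^ 2 * ((n - q.s).choose i : ℝ) ≤
      2 ^ (n - q.s) * ((n - q.s).choose q.w : ℝ) := by
    exact_mod_cast krawtchouk_sq_mul_choose_le (n - q.s) q.w i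
  have h2 : ((krawtchouk q.s q.taux j : ℤ) : ℝ) ^ 2 * (q.s.choose j : ℝ) ≤
      2 ^ q.s * (q.s.choose q.taux : ℝ) := by
    exact_mod_cast krawtchouk_sq_mul_choose_le q.s q.taux j
  set KK : ℝ := (q.kk n q.u (q.t - q.u) : ℝ) with hKK
  set D : ℝ := (q.s.choose j : ℝ) * ((n - q.s).choose i : ℝ) with hD
  set A : ℝ := ((n - q.s).choose q.w : ℝ) * (q.s.choose q.taux : ℝ) with hA
  have hD0 : 0 ≤ D := by positivity
  have hA0 : 0 < A := by positivity
  have h3 : (q.kk n i j : ℝ) ^ 2 * D ≤ 2 ^ n * A := by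
    have e : (2 : ℝ) ^ n = 2 ^ (n - q.s) * 2 ^ q.s := by
      rw [← pow_add, Nat.sub_add_cancel (hv.s_le_k.trans hv.k_le_n)]
    have := mul_le_mul h1 h2 (by positivity) (by positivity)
    rw [Params.kk, hD, hA, e]
    push_cast
    linarith
  have h4 : KK ^ 2 ≤ (n : ℝ) ^ (6.4 : ℝ) * (q.kk n i j : ℝ) ^ 2 := by
    have h5 := pow_le_pow_left₀ (abs_nonneg _) hij 2
    rw [mul_pow, sq_abs, sq_abs, ← Real.rpow_mul_natCast (Nat.cast_nonneg n)] at h5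
    norm_num at h5 ⊢
    exact h5
  have h6 : q.bias n ^ 2 * q.samples n * (D * (2 ^ q.k / 2 ^ n * (1 / 2 ^ q.kaux))) =
      KK ^ 2 * D / (2 ^ n * A) := by
    have e : (2 : ℝ) ^ q.k = 2 ^ (q.k - q.kaux) * 2 ^ q.kaux := by
      rw [← pow_add, Nat.sub_add_cancel hkk]
    rw [Params.bias, Params.samples, ← hA, ← hKK, e]
    field_simp
  rw [h6, div_le_iff₀ (by positivity)]
  calc KK ^ 2 * D ≤ (n : ℝ) ^ (6.4 : ℝ) * (q.kk n i j : ℝ) ^ 2 * D := by gcongr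
    _ = (n : ℝ) ^ (6.4 : ℝ) * ((q.kk n i j : ℝ) ^ 2 * D) := by ring
    _ ≤ _ := by gcongr

lemma bias_mul_samples (hv : q.Valid n) :
    q.bias n * q.samples n = (q.kk n q.u (q.t - q.u) : ℝ) * 2 ^ q.kaux / 2 ^ q.k := by
  have hA1 : (0 : ℝ) < (n - q.s).choose q.w := by exact_mod_cast Nat.choose_pos hv.w_le
  have hA2 : (0 : ℝ) < q.s.choose q.taux := by exact_mod_cast Nat.choose_pos hv.taux_le_s
  have e : (2 : ℝ) ^ q.k = 2 ^ (q.k - q.kaux) * 2 ^ q.kaux := by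
    rw [← pow_add, Nat.sub_add_cancel (hv.kaux_le_s.trans hv.s_le_k)]
  rw [Params.bias, Params.samples, e]
  field_simp

/-- By Poisson's summation formula, the threshold on the scores corresponds to the threshold of the
conjecture. -/
lemma fft_le_of_cosetSum_le (hv : q.Valid n) (hP : P.card = q.s) (c : ℕ) (cost : DecCost n q)
    {G : Matrix (Fin q.k) (Fin n) F2} (hG : G ∈ genMatrices q.k (Fin n))
    (A : Matrix (Fin q.kaux) P F2) (x : P → F2) (e : Fin n → F2)
    (h : (cosetSum q P e (G, A, x) : ℝ) ≤ 1 / 2 * q.kk n q.u (q.t - q.u)) :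
    (((fft q.kaux (sampleTable e (lpnSamples c cost (rowCode G) P A).val)).val (A *ᵥ x) : ℤ) : ℝ) ≤
      q.bias n / 2 * q.samples n := by
  have h5 := two_pow_mul_fft_eq hP c cost hG A x e
  generalize (fft q.kaux (sampleTable e (lpnSamples c cost (rowCode G) P A).val)).val (A *ᵥ x) = F
    at h5 ⊢
  generalize cosetSum q P e (G, A, x) = Z at h h5
  have h5 : (2 : ℝ) ^ q.k * F = 2 ^ q.kaux * Z := by exact_mod_cast h5
  rw [div_mul_eq_mul_div, bias_mul_samples hv, div_div, le_div_iff₀ (by positivity)]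
  calc (F : ℝ) * (2 ^ q.k * 2) = 2 ^ q.k * F * 2 := by ring
    _ = 2 ^ q.kaux * Z * 2 := by rw [h5]
    _ ≤ 2 ^ q.kaux * (1 / 2 * q.kk n q.u (q.t - q.u)) * 2 := by gcongr
    _ = _ := by ring

/-- If the bias is negative, then a sum above the threshold is the rule and not the exception, as
soon as the mean-square bound shows that the scores are small.  The conjecture then forces a
dominant pair of weights to occur with non-negligible probability. -/
lemma bias_sq_mul_samples_le (hv : q.Valid n) (hP : P.card = q.s) (hs : 0 < q.s)
    (hk : 3 ≤ q.kaux) (hKK : q.kk n q.u (q.t - q.u) < 0) (c l : ℕ) (cost : DecCost n q)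
    (e : Fin n → F2) {i j : ℕ} (hij : (i, j) ∈ dominantPairs n q) {κ : ℝ} (hκ : 0 ≤ κ)
    (hconj : prob (weightSpace q P e) (fun a =>
      (1 / 2 : ℝ) * q.kk n q.u (q.t - q.u) ≤
        ((∑ j ∈ Finset.range (q.s + 1), ∑ i ∈ Finset.range (n - q.s + 1),
          q.kk n i j * (numWords P e a i j : ℤ) : ℤ) : ℝ)) ≤
      κ * (prob (weightSpace q P e) (fun a => numWords P e a i j ≠ 0) + 1 / 2 ^ n))
    {ρ T : ℝ} (hρ : 0 ≤ ρ) (hT : 0 < T)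
    (h₁ : (q.s.choose q.taux : ℝ) * ((n - q.s).choose q.w : ℝ) * (1 / 2 ^ q.k) ≤ ρ * T)
    (hsmall : 8 ^ n * ρ ^ l + (T + 2 ^ l) / (q.bias n / 2 * q.samples n) ^ 2 *
        (1 + (q.s.choose q.taux : ℝ) * ((n - q.s).choose q.w : ℝ) / 2 ^ q.k +
          (1 + 2 ^ q.s * ((n - q.s).choose q.w : ℝ) / 2 ^ q.k) * auxDensity q) ≤ 1 / 16) :
    q.bias n ^ 2 * q.samples n * (1 / 2 - κ / 2 ^ n) ≤ 8 * κ * (n : ℝ) ^ (6.4 : ℝ) := by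
  have hKK' : (q.kk n q.u (q.t - q.u) : ℝ) < 0 := by exact_mod_cast hKK
  have hbs : q.bias n * q.samples n < 0 := by
    rw [bias_mul_samples hv]
    have : (0 : ℝ) < 2 ^ q.kaux / 2 ^ q.k := by positivity
    rw [mul_div_assoc]
    exact mul_neg_of_neg_of_pos hKK' this
  obtain ⟨hne, hcard⟩ := card_wholeSpace_le hP hv.s_le_k hv.k_le_n hv.kaux_le_s hk e
  have hne' : (weightSpace q P e).Nonempty := by
    rw [← Finset.card_pos]
    by_contra! h0
    have h1 : (0 : ℝ) < (wholeSpace q P).card := by exact_mod_cast hne.card_pos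
    rw [Nat.le_zero.mp h0] at hcard
    norm_num at hcard
    rw [hcard] at hne
    simp at hne
  set β := q.bias n / 2 * q.samples n with hβ
  have hβ0 : β < 0 := by rw [hβ]; linarith
  have h2 := prob_le_sq_fft_le hP hs (hv.s_le_k.trans hv.k_le_n) hv.k_le_n c l cost e hρ hT
    hβ0.ne h₁
  set E : Matrix (Fin q.k) (Fin n) F2 × Matrix (Fin q.kaux) P F2 × (P → F2) → Prop := fun a =>
    β ^ 2 ≤ (((fft q.kaux (sampleTable e
      (lpnSamples c cost (rowCode a.1) P a.2.1).val)).val (a.2.1 *ᵥ a.2.2) : ℤ) : ℝ) ^ 2 with hE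
  have h2 := h2.trans hsmall
  have h2 : prob (weightSpace q P e) E ≤ 8 * (1 / 16) :=
    (prob_le_of_subset (weightSpace_subset e) (by norm_num) hcard E).trans
      (mul_le_mul_of_nonneg_left h2 (by norm_num))
  have h3 := prob_add_prob_not hne' fun a =>
      (1 / 2 : ℝ) * q.kk n q.u (q.t - q.u) ≤
        ((∑ j ∈ Finset.range (q.s + 1), ∑ i ∈ Finset.range (n - q.s + 1),
          q.kk n i j * (numWords P e a i j : ℤ) : ℤ) : ℝ)
  -- below the negative threshold `β`, the square of the score is above `β ^ 2`
  have h4 : prob (weightSpace q P e) (fun a => ¬ (1 / 2 : ℝ) * q.kk n q.u (q.t - q.u) ≤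
        ((∑ j ∈ Finset.range (q.s + 1), ∑ i ∈ Finset.range (n - q.s + 1),
          q.kk n i j * (numWords P e a i j : ℤ) : ℤ) : ℝ)) ≤ 8 * (1 / 16) := by
    refine (prob_mono (F := E) fun a ha hn => ?_).trans h2
    obtain ⟨-, hG, -⟩ := Finset.mem_filter.mp ha
    rw [sum_kk_mul_numWords hP e a, not_le] at hn
    have h6 := fft_le_of_cosetSum_le hv hP c cost hG a.2.1 a.2.2 e hn.le
    rw [hE]
    beta_reduce
    rw [← neg_sq, ← neg_sq (Int.cast _)]
    exact pow_le_pow_left₀ (neg_nonneg.mpr hβ0.le) (neg_le_neg h6) 2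
  have h5 := prob_numWords_ne_zero_le hP hv.s_le_k hv.k_le_n hv.kaux_le_s hk e i j
  have h6 := bias_sq_mul_samples_mul_le hv hij
  set D := (q.s.choose j : ℝ) * ((n - q.s).choose i : ℝ) *
      (2 ^ q.k / 2 ^ n * (1 / 2 ^ q.kaux)) with hD
  have hsam : 0 ≤ q.bias n ^ 2 * q.samples n := by unfold Params.samples; positivity
  have h7 : 1 / 2 - κ / 2 ^ n ≤ 8 * κ * D := by
    have h8 := mul_le_mul_of_nonneg_left (add_le_add_left h5 (1 / 2 ^ n)) hκ
    have h9 : κ * (1 / 2 ^ n) = κ / 2 ^ n := by ring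
    linarith
  calc q.bias n ^ 2 * q.samples n * (1 / 2 - κ / 2 ^ n)
      ≤ q.bias n ^ 2 * q.samples n * (8 * κ * D) := by gcongr
    _ = 8 * κ * (q.bias n ^ 2 * q.samples n * D) := by ring
    _ ≤ _ := by gcongr

end NegativeBias

/-! ### Exponents of the basic quantities -/

section BasicExponents

variable {a : Rel} {q : ℕ → Params}

lemma ExpBound.congr {f g : ℕ → ℝ} {x y : ℝ} (hf : ExpBound f x) (h : ∀ n, g n = f n)
    (hxy : x = y) : ExpBound g y :=
  hxy ▸ hf.mono_left (Eventually.of_forall fun n => (h n).le)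

lemma ExpBound.eventually_le {f : ℕ → ℝ} {x : ℝ} (hf : ExpBound f x) (hx : x < 0) {ε : ℝ}
    (hε : 0 < ε) : ∀ᶠ n in atTop, f n ≤ ε := by
  by_contra h
  have h1 : ∃ᶠ n in atTop, ε ≤ f n := by
    rw [Filter.not_eventually] at h
    exact h.mono fun n hn => (not_le.mp hn).le
  exact absurd (hf.nonneg_of_frequently hε h1) (not_le.mpr hx)

lemma HasLimits.sub_s (hlim : HasLimits q a) (hv : ∀ᶠ n in atTop, (q n).Valid n) :
    Tendsto (fun n => ((n - (q n).s : ℕ) : ℝ) / n) atTop (𝓝 (1 - a.σ)) :=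
  tendsto_natSub (x := fun n => n) tendsto_self_div hlim.s
    (hv.mono fun _ h => h.s_le_k.trans h.k_le_n)

lemma HasLimits.sub_u (hlim : HasLimits q a) (hv : ∀ᶠ n in atTop, (q n).Valid n) :
    Tendsto (fun n => (((q n).t - (q n).u : ℕ) : ℝ) / n) atTop (𝓝 (a.τ - a.μ)) :=
  tendsto_natSub hlim.t hlim.u (hv.mono fun _ h => h.u_le_t)

lemma HasLimits.k_sub_s (hlim : HasLimits q a) (hv : ∀ᶠ n in atTop, (q n).Valid n) :
    Tendsto (fun n => (((q n).k - (q n).s : ℕ) : ℝ) / n) atTop (𝓝 (a.R - a.σ)) :=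
  tendsto_natSub hlim.k hlim.s (hv.mono fun _ h => h.s_le_k)

lemma le_of_tendsto_natCast_div {x y : ℕ → ℕ} {b c : ℝ}
    (hx : Tendsto (fun n => (x n : ℝ) / n) atTop (𝓝 b))
    (hy : Tendsto (fun n => (y n : ℝ) / n) atTop (𝓝 c)) (h : ∀ᶠ n in atTop, x n ≤ y n) : b ≤ c := by
  refine le_of_tendsto_of_tendsto hx hy (h.mono fun n hn => ?_)
  exact div_le_div_of_nonneg_right (by exact_mod_cast hn) (Nat.cast_nonneg _)

lemma HasLimits.Raux_le_σ (hlim : HasLimits q a) (hv : ∀ᶠ n in atTop, (q n).Valid n) :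
    a.Raux ≤ a.σ :=
  le_of_tendsto_natCast_div hlim.kaux hlim.s (hv.mono fun _ h => h.kaux_le_s)

lemma eventually_kk_ne_zero (hc : ParameterConstraint q) :
    ∀ᶠ n in atTop, (q n).kk n (q n).u ((q n).t - (q n).u) ≠ 0 := by
  obtain ⟨α, -, h, -⟩ := hc
  filter_upwards [h.eventually_gt_atTop 0] with n hn h0
  simp [Params.bias, h0] at hn

lemma Params.samples_nonneg (n : ℕ) (q : Params) : 0 ≤ q.samples n := by
  unfold Params.samples; positivity

lemma expBound_sphere (hv : ∀ᶠ n in atTop, (q n).Valid n) (hlim : HasLimits q a) :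
    ExpBound (fun n => ((q n).s.choose (q n).taux : ℝ) * ((n - (q n).s).choose (q n).w : ℝ))
      a.sphereExp :=
  ((ExpBound.choose hlim.s hlim.taux).mul (ExpBound.choose (hlim.sub_s hv) hlim.w)
    fun _ => Nat.cast_nonneg _).congr (fun _ => rfl) (add_comm _ _)

lemma expBound_sphere_div (hv : ∀ᶠ n in atTop, (q n).Valid n) (hlim : HasLimits q a) :
    ExpBound (fun n => ((q n).s.choose (q n).taux : ℝ) * ((n - (q n).s).choose (q n).w : ℝ) *
      (1 / 2 ^ (q n).k)) (a.sphereExp - a.R) :=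
  (expBound_sphere hv hlim).mul (ExpBound.inv_two_pow hlim.k) fun _ => by positivity

lemma expBound_checks (hv : ∀ᶠ n in atTop, (q n).Valid n) (hlim : HasLimits q a) :
    ExpBound (fun n => 2 ^ (q n).s * ((n - (q n).s).choose (q n).w : ℝ) * (1 / 2 ^ (q n).k))
      (a.σ + homEntropy (1 - a.σ) a.ω - a.R) :=
  ((ExpBound.two_pow hlim.s).mul (ExpBound.choose (hlim.sub_s hv) hlim.w)
    fun _ => Nat.cast_nonneg _).mul (ExpBound.inv_two_pow hlim.k) fun _ => by positivity

lemma expBound_auxDensity (hlim : HasLimits q a) :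
    ExpBound (fun n => auxDensity (q n)) (homEntropy a.σ a.τaux + a.Raux - a.σ) :=
  ((((ExpBound.choose hlim.s hlim.taux).mul (ExpBound.two_pow hlim.kaux)
    fun _ => by positivity).mul (ExpBound.inv_two_pow hlim.s)
    fun _ => by positivity).const_mul (fun _ => by positivity) 2).congr
    (fun n => by rw [auxDensity]; ring) (by ring)

lemma Rel.samplesExp_eq (ha : a.Admissible) : a.samplesExp = a.sphereExp - a.R + a.Raux := by
  rw [Rel.samplesExp, ← ha.sphereExp_eq]
  ring

lemma expBound_samples (ha : a.Admissible) (hv : ∀ᶠ n in atTop, (q n).Valid n)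
    (hlim : HasLimits q a) : ExpBound (fun n => (q n).samples n) a.samplesExp := by
  refine ((((expBound_sphere_div hv hlim).mul (ExpBound.two_pow hlim.kaux)
    fun _ => by positivity).congr (g := fun n => ((q n).s.choose (q n).taux : ℝ) *
      ((n - (q n).s).choose (q n).w : ℝ) * (1 / 2 ^ (q n).k) * 2 ^ (q n).kaux)
      (fun _ => rfl) (Rel.samplesExp_eq ha).symm)).mono_left (hv.mono fun n h => le_of_eq ?_)
  have e : (2 : ℝ) ^ (q n).k = 2 ^ ((q n).k - (q n).kaux) * 2 ^ (q n).kaux := by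
    rw [← pow_add, Nat.sub_add_cancel (h.kaux_le_s.trans h.s_le_k)]
  rw [Params.samples, e]
  field_simp

lemma expBound_inv_kk (ha : a.Admissible) (hv : ∀ᶠ n in atTop, (q n).Valid n)
    (hlim : HasLimits q a) (hK : KrawtchoukMagnitude q a) (hc : ParameterConstraint q) :
    ExpBound (fun n => 1 / |((q n).kk n (q n).u ((q n).t - (q n).u) : ℝ)|) (-a.kkExp) := by
  have hne := eventually_kk_ne_zero hc
  have hN := expBound_inv_krawtchouk (hlim.sub_s hv) hlim.w hlim.u (sub_pos.mpr ha.σ_lt)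
    ha.ω_le_half (hv.mono fun _ h => h.u_le)
    (hne.mono fun n h h0 => h (by rw [Params.kk, h0, zero_mul]))
    hK.on_N
  have hP := expBound_inv_krawtchouk hlim.s hlim.taux (hlim.sub_u hv) ha.σ_pos
    ha.τaux_le_half (hv.mono fun _ h => h.tu_le)
    (hne.mono fun n h h0 => h (by rw [Params.kk, h0, mul_zero])) hK.on_P
  refine (hN.mul hP fun _ => by positivity).congr (fun n => ?_) (by rw [Rel.kkExp]; ring)
  rw [Params.kk]
  push_cast
  rw [abs_mul, one_div_mul_one_div]

lemma expBound_inv_threshold_sq (ha : a.Admissible) (hv : ∀ᶠ n in atTop, (q n).Valid n)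
    (hlim : HasLimits q a) (hK : KrawtchoukMagnitude q a) (hc : ParameterConstraint q) :
    ExpBound (fun n => 1 / ((q n).bias n * (q n).samples n) ^ 2) (-a.gain - a.samplesExp) := by
  have h := (((expBound_inv_kk ha hv hlim hK hc).mul (ExpBound.two_pow hlim.k)
    fun _ => by positivity).mul (ExpBound.inv_two_pow hlim.kaux) fun _ => by positivity).pow
    (fun _ => by positivity) 2
  refine (h.mono_left (hv.mono fun n hn => le_of_eq ?_)).mono_right (le_of_eq ?_)
  · rw [bias_mul_samples hn, ← sq_abs, abs_div, abs_mul, abs_of_pos (a := (2 : ℝ) ^ (q n).kaux)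
      (by positivity), abs_of_pos (a := (2 : ℝ) ^ (q n).k) (by positivity), ← one_div_pow]
    congr 1
    rw [one_div_div, one_div_mul_eq_div, div_mul_div_comm, mul_one]
  · rw [ha.gain_eq, Rel.samplesExp_eq ha]
    push_cast
    ring

lemma eventually_gain_pos (hc : ParameterConstraint q) :
    ∀ᶠ n in atTop, 0 < (q n).bias n ^ 2 * (q n).samples n := by
  obtain ⟨α, -, h, -⟩ := hc
  filter_upwards [h.eventually_gt_atTop 0] with n hn
  rw [mul_comm]
  by_contra! h0
  exact absurd hn (not_lt.mpr (div_nonpos_of_nonpos_of_nonneg h0 (by positivity)))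

lemma expBound_inv_gain (ha : a.Admissible) (hv : ∀ᶠ n in atTop, (q n).Valid n)
    (hlim : HasLimits q a) (hK : KrawtchoukMagnitude q a) (hc : ParameterConstraint q) :
    ExpBound (fun n => 1 / ((q n).bias n ^ 2 * (q n).samples n)) (-a.gain) := by
  refine (((expBound_inv_threshold_sq ha hv hlim hK hc).mul (expBound_samples ha hv hlim)
    fun n => (q n).samples_nonneg n).mono_left ?_).mono_right (le_of_eq (by ring))
  filter_upwards [eventually_gain_pos hc] with n hn
  have h1 : (q n).samples n ≠ 0 := fun h => by simp [h] at hn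
  have h2 : (q n).bias n ≠ 0 := fun h => by simp [h] at hn
  refine le_of_eq ?_
  field_simp

/-- The number of samples is not negligible, because the bias is at most `1`. -/
lemma Rel.samplesExp_nonneg (ha : a.Admissible) (hv : ∀ᶠ n in atTop, (q n).Valid n)
    (hlim : HasLimits q a) (hc : ParameterConstraint q) : 0 ≤ a.samplesExp := by
  refine (expBound_samples ha hv hlim).nonneg_of_frequently one_pos (Eventually.frequently ?_)
  obtain ⟨α, hα, h, -⟩ := hc
  filter_upwards [h.eventually_ge_atTop 1, hv, eventually_ge_atTop 1] with n hn hv hn1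
  have hn1 : (1 : ℝ) ≤ n := by exact_mod_cast hn1
  have h1 : (1 : ℝ) ≤ (n : ℝ) ^ (α + 8) := Real.one_le_rpow hn1 (by linarith)
  rw [le_div_iff₀ (by linarith), one_mul] at hn
  have hb : |(q n).bias n| ≤ 1 := by
    have k1 : |((krawtchouk (n - (q n).s) (q n).w (q n).u : ℤ) : ℝ)| ≤
        ((n - (q n).s).choose (q n).w : ℝ) := by exact_mod_cast abs_krawtchouk_le hv.u_le
    have k2 : |((krawtchouk (q n).s (q n).taux ((q n).t - (q n).u) : ℤ) : ℝ)| ≤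
        ((q n).s.choose (q n).taux : ℝ) := by exact_mod_cast abs_krawtchouk_le hv.tu_le
    rw [Params.bias, abs_div, Params.kk]
    push_cast
    rw [abs_mul, abs_mul, Nat.abs_cast, Nat.abs_cast]
    exact div_le_one_of_le₀ (by gcongr) (by positivity)
  have hb2 : (q n).bias n ^ 2 ≤ 1 := by rwa [sq_le_one_iff_abs_le_one]
  have := mul_le_mul_of_nonneg_left hb2 ((q n).samples_nonneg n)
  linarith

end BasicExponents

/-! ### The number of candidates -/

section Candidates

variable {a : Rel} {q : ℕ → Params}

/-- A threshold just above a quantity of exponent `x`, and at least `1`. -/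
def level (x γ : ℝ) (n : ℕ) : ℝ := (2 : ℝ) ^ ((n : ℝ) * (max x 0 + γ))

/-- The exponentially small factor by which a threshold `level x γ` exceeds a quantity of
exponent `x`. -/
def slack (γ : ℝ) (n : ℕ) : ℝ := (2 : ℝ) ^ ((n : ℝ) * -(γ / 2))

lemma level_pos (x γ : ℝ) (n : ℕ) : 0 < level x γ n := Real.rpow_pos_of_pos two_pos _

lemma slack_nonneg (γ : ℝ) (n : ℕ) : 0 ≤ slack γ n := (Real.rpow_pos_of_pos two_pos _).le

lemma ExpBound.le_slack_mul_level {f : ℕ → ℝ} {x γ : ℝ} (hf : ExpBound f x) (hγ : 0 < γ) :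
    ∀ᶠ n in atTop, f n ≤ slack γ n * level x γ n := by
  filter_upwards [hf (γ / 2) (by positivity)] with n hn
  refine hn.trans ?_
  rw [slack, level, ← Real.rpow_add two_pos, ← mul_add]
  refine Real.rpow_le_rpow_of_exponent_le one_le_two (mul_le_mul_of_nonneg_left ?_
    (Nat.cast_nonneg n))
  linarith [le_max_left x 0]

lemma expBound_level_add {x γ : ℝ} (hγ : 0 ≤ γ) (l : ℕ) :
    ExpBound (fun n => level x γ n + 2 ^ l) (max x 0 + γ) :=
  (ExpBound.of_tendsto tendsto_const_nhds).add
    ((ExpBound.const _).mono_right (by positivity))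

lemma expBound_slack_pow (γ : ℝ) (l : ℕ) :
    ExpBound (fun n => 8 ^ n * slack γ n ^ l) (3 - l * (γ / 2)) := by
  refine (ExpBound.of_tendsto (x := fun _ => 3 - l * (γ / 2)) tendsto_const_nhds).congr
    (fun n => ?_) rfl
  have h8 : (8 : ℝ) ^ n = (2 : ℝ) ^ ((n : ℝ) * 3) := by
    rw [mul_comm, Real.rpow_mul_natCast (by norm_num)]
    norm_num
  rw [h8, slack, ← Real.rpow_mul_natCast (by norm_num), ← Real.rpow_add two_pos]
  ring_nf

lemma Rel.Admissible.sphereExp_le (ha : a.Admissible) : a.sphereExp - a.R ≤ 0 := by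
  rw [ha.sphereExp_eq]
  exact ha.checks_le

lemma Rel.Admissible.auxExp_le (ha : a.Admissible) :
    homEntropy a.σ a.τaux + a.Raux - a.σ ≤ 0 := by
  rw [← mul_h₂_div fun h => absurd h ha.σ_pos.ne']
  linarith [ha.aux_le]

/-- The exponents of the number of parity-checks and of the number of neighbouring auxiliary
codewords add up to the exponent of the number of samples. -/
lemma Rel.checksExp_add_auxExp (ha : a.Admissible) : a.σ + homEntropy (1 - a.σ) a.ω - a.R +
    (homEntropy a.σ a.τaux + a.Raux - a.σ) = a.samplesExp := by
  rw [Rel.samplesExp_eq ha, Rel.sphereExp]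
  ring

/-- The bound of the mean number of samples of `expect_sum_decodeAux_le`, averaged over the code. -/
lemma expBound_meanSamples (ha : a.Admissible) (hv : ∀ᶠ n in atTop, (q n).Valid n)
    (hlim : HasLimits q a) (hc : ParameterConstraint q) :
    ExpBound (fun n => 1 + ((q n).s.choose (q n).taux : ℝ) * ((n - (q n).s).choose (q n).w : ℝ) /
        2 ^ (q n).k + (1 + 2 ^ (q n).s * ((n - (q n).s).choose (q n).w : ℝ) / 2 ^ (q n).k) *
          auxDensity (q n)) a.samplesExp := by
  have h0 := Rel.samplesExp_nonneg ha hv hlim hc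
  have h1 := (ExpBound.const 1).mono_right h0
  have h2 := (expBound_sphere_div hv hlim).mono_right (ha.sphereExp_le.trans h0)
  have h3 := (expBound_auxDensity hlim).mono_right (ha.auxExp_le.trans h0)
  have h4 := ((expBound_checks hv hlim).mul (expBound_auxDensity hlim)
    fun n => auxDensity_nonneg _).mono_right (Rel.checksExp_add_auxExp ha).le
  refine (((h1.add h2).add h3).add h4).congr (fun n => ?_) rfl
  simp only [mul_one_div]
  ring

/-- If the bias is negative for infinitely many lengths, then its exponent is just at the limit of
what the constraint on the number of samples allows. -/
lemma gain_nonpos_of_frequently_neg (ha : a.Admissible) (hv : ∀ᶠ n in atTop, (q n).Valid n)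
    (hlim : HasLimits q a) (hK : KrawtchoukMagnitude q a) (hc : ParameterConstraint q)
    (hconj : BiasConjecture q) (hR : 0 < a.Raux)
    (hneg : ∃ᶠ n in atTop, (q n).kk n (q n).u ((q n).t - (q n).u) < 0) : a.gain ≤ 0 := by
  by_contra! hg
  obtain ⟨b, d, hbd⟩ := hconj
  set γ := a.gain / 2 with hγ
  have hγ0 : 0 < γ := by positivity
  obtain ⟨l, hl⟩ := exists_nat_gt (3 / (γ / 2))
  rw [div_lt_iff₀ (by positivity)] at hl
  have hx : max (a.sphereExp - a.R) 0 = 0 := max_eq_right ha.sphereExp_le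
  -- the mean-square bound tends to zero
  have hsmall1 := (expBound_slack_pow γ l).eventually_le (by linarith)
    (by norm_num : (0 : ℝ) < 1 / 32)
  have hsmall2 := (((expBound_level_add (x := a.sphereExp - a.R) hγ0.le l).mul
    ((expBound_inv_threshold_sq ha hv hlim hK hc).const_mul (fun n => by positivity) 4)
    fun n => by positivity).mul (expBound_meanSamples ha hv hlim hc) fun n => by
      have := auxDensity_nonneg (q n)
      positivity).eventually_le (by rw [hx]; linarith) (by norm_num : (0 : ℝ) < 1 / 32)
  have hκ := ((ExpBound.natPow d).mul (ExpBound.inv_two_pow (x := fun n => n) tendsto_self_div)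
    fun n => by positivity).const_mul (fun n => by positivity) b |>.eventually_le (by norm_num)
    (by norm_num : (0 : ℝ) < 1 / 4)
  have hkaux : ∀ᶠ n in atTop, 3 ≤ (q n).kaux := by
    have h1 := hlim.kaux.eventually_const_lt (half_lt_self hR)
    obtain ⟨N, hN⟩ := exists_nat_ge (3 / (a.Raux / 2))
    filter_upwards [h1, eventually_ge_atTop N, eventually_gt_atTop 0] with n h2 h3 h4
    have h4 : (0 : ℝ) < n := by exact_mod_cast h4
    have h3 : (N : ℝ) ≤ n := by exact_mod_cast h3
    rw [lt_div_iff₀ h4] at h2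
    rw [div_le_iff₀ (by positivity)] at hN
    have : (3 : ℝ) ≤ (q n).kaux := by nlinarith
    exact_mod_cast this
  have hs : ∀ᶠ n in atTop, 0 < (q n).s := by
    filter_upwards [hkaux, hv] with n h1 h2
    have := h2.kaux_le_s
    omega
  -- the conjecture bounds `δ ^ 2 H̃` by a polynomial for the lengths with negative bias
  have hfinal : ∃ᶠ n : ℕ in atTop, (1 : ℝ) ≤ 32 * b * ((n : ℝ) ^ d * (n : ℝ) ^ 7) *
      (1 / ((q n).bias n ^ 2 * (q n).samples n)) := by
    refine (hneg.and_eventually (hsmall1.and (hsmall2.and (hκ.and (hkaux.and (hs.and (hv.and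
      (hbd.and ((eventually_gain_pos hc).and ((eventually_ge_atTop 1).and
      ((expBound_sphere_div hv hlim).le_slack_mul_level hγ0))))))))))).mono ?_
    rintro n ⟨h1, h2, h3, h4, h5, h6, h7, h8, h9, h10, h11⟩
    obtain ⟨P, -, hP⟩ := Finset.exists_subset_card_eq (s := (Finset.univ : Finset (Fin n)))
      (n := (q n).s) (by simpa using h7.s_le_k.trans h7.k_le_n)
    obtain ⟨E, -, hE⟩ := Finset.exists_subset_card_eq (s := (Finset.univ : Finset (Fin n)))
      (n := (q n).t) (by simpa using h7.t_le_n)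
    obtain ⟨⟨i, j⟩, hij, hprob⟩ := h8 P hP (fun i => if i ∈ E then 1 else 0) (by
      rw [hammingNorm, ← hE]
      congr 1
      ext i
      simp)
    have h12 := bias_sq_mul_samples_le h7 hP h6 h5 h1 0 l (fun _ _ _ => 0) _ hij
      (by positivity) hprob (slack_nonneg γ n) (level_pos _ γ n) h11 (by
        refine (add_le_add h2 (le_trans (le_of_eq ?_) h3)).trans (by norm_num)
        ring)
    have h13 : 1 / 4 ≤ 1 / 2 - b * (n : ℝ) ^ d / 2 ^ n := by
      have e : (b : ℝ) * (n : ℝ) ^ d / 2 ^ n = b * ((n : ℝ) ^ d * (1 / 2 ^ n)) := by ring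
      rw [e]
      linarith
    have h14 : (n : ℝ) ^ (6.4 : ℝ) ≤ (n : ℝ) ^ 7 := by
      rw [← Real.rpow_natCast]
      exact Real.rpow_le_rpow_of_exponent_le (by exact_mod_cast h10) (by norm_num)
    rw [mul_one_div, le_div_iff₀ h9, one_mul]
    have h15 := mul_le_mul_of_nonneg_left h13 h9.le
    have h16 := mul_le_mul_of_nonneg_left h14 (by positivity : 0 ≤ 8 * (b * (n : ℝ) ^ d))
    linarith
  have := ExpBound.nonneg_of_frequently ((((ExpBound.natPow d).mul (ExpBound.natPow 7)
    fun n => by positivity).const_mul (fun n => by positivity) (32 * b)).mul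
      (expBound_inv_gain ha hv hlim hK hc) fun n => by
        have := (q n).samples_nonneg n
        positivity) one_pos hfinal
  linarith

/-- A bound on the mean number of candidates, outside of the exceptional cases. If
`R_aux ≤ ν_candidates`, the trivial bound `2 ^ k_aux` is good enough. Otherwise the gain is
positive by `le_candidatesExp`, the bias is eventually positive, and Parseval's identity bounds
the number of candidates by `2 ^ k_aux / (δ ^ 2 H̃)` up to subexponential factors. -/
lemma exists_candidates_bound (ha : a.Admissible) (hv : ∀ᶠ n in atTop, (q n).Valid n)
    (hlim : HasLimits q a) (hK : KrawtchoukMagnitude q a) (hc : ParameterConstraint q)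
    (hconj : BiasConjecture q) (cost : (n : ℕ) → DecCost n (q n)) (c l : ℕ) {γ : ℝ} (hγ : 0 ≤ γ) :
    ∃ μ : ℕ → ℝ, (∀ n, 0 ≤ μ n) ∧ ExpBound μ (a.candidatesExp + 2 * γ) ∧
      ∀ᶠ n in atTop, ∀ (P : Finset (Fin n)), P.card = (q n).s → ∀ T₃ : ℝ,
        ∃ M : Submodule F2 (Fin n → F2) → Matrix (Fin (q n).kaux) P F2 → ℝ, (∀ C A, 0 ≤ M C A) ∧
        (∀ C y, ¬ CodeBad (q n) P (level (a.sphereExp - a.R) γ n + 2 ^ l)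
          (level (a.σ + homEntropy (1 - a.σ) a.ω - a.R) γ n + 2 ^ l) T₃ C → ∀ A,
          ((fftDecode (q n) y (lpnSamples c (cost n) C P A).val).val.card : ℝ) ≤ M C A) ∧
        ∀ C, ¬ CodeBad (q n) P (level (a.sphereExp - a.R) γ n + 2 ^ l)
          (level (a.σ + homEntropy (1 - a.σ) a.ω - a.R) γ n + 2 ^ l) T₃ C →
          𝔼 A ∈ genMatrices (q n).kaux P, M C A ≤ μ n := by
  have hRR : a.Raux ≤ a.R := (hlim.Raux_le_σ hv).trans ha.σ_le
  have hcand := ha.le_candidatesExp hRR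
  rcases le_or_gt a.Raux a.candidatesExp with hR | hR
  · -- all the vectors may be candidates
    refine ⟨fun n => 2 ^ (q n).kaux, fun n => by positivity,
      (ExpBound.two_pow hlim.kaux).mono_right (by linarith), Eventually.of_forall fun n P _ T₃ =>
        ⟨fun _ _ => 2 ^ (q n).kaux, fun _ _ => by positivity, fun C y _ A =>
          card_candidates_le y _, fun C _ => expect_le_of_le (by positivity) fun _ _ => le_rfl⟩⟩
  have hR0 : 0 < a.Raux := a.candidatesExp_nonneg.trans_lt hR
  -- the bias is eventually positive, as `0 < R_aux - ν_candidates ≤ gain`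
  have hpos : ∀ᶠ n in atTop, 0 < (q n).kk n (q n).u ((q n).t - (q n).u) := by
    by_contra h
    rw [Filter.not_eventually] at h
    have hneg : ∃ᶠ n in atTop, (q n).kk n (q n).u ((q n).t - (q n).u) < 0 := by
      refine (h.and_eventually (eventually_kk_ne_zero hc)).mono ?_
      rintro n ⟨h1, h2⟩
      omega
    have := gain_nonpos_of_frequently_neg ha hv hlim hK hc hconj hR0 hneg
    linarith
  set t₁ := level (a.sphereExp - a.R) γ with ht₁
  set t₂ := level (a.σ + homEntropy (1 - a.σ) a.ω - a.R) γ with ht₂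
  have ht₁0 : ∀ n, 0 < t₁ n := level_pos _ _
  have ht₂0 : ∀ n, 0 < t₂ n := level_pos _ _
  set K : ℕ → ℝ := fun n => 2 ^ (q n).kaux * (t₁ n + 2 ^ l) *
    (4 * (1 / ((q n).bias n * (q n).samples n) ^ 2)) with hKdef
  have hK0 : ∀ n, 0 ≤ K n := fun n => by
    have := (ht₁0 n).le
    positivity
  have hS0 : ∀ n, 0 ≤ (t₁ n + 2 ^ l) + (t₂ n + 2 ^ l) * auxDensity (q n) := fun n => by
    have := (ht₁0 n).le
    have := (ht₂0 n).le
    have := auxDensity_nonneg (q n)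
    positivity
  refine ⟨fun n => K n * ((t₁ n + 2 ^ l) + (t₂ n + 2 ^ l) * auxDensity (q n)),
    fun n => mul_nonneg (hK0 n) (hS0 n), ?_, ?_⟩
  · have hx : max (a.sphereExp - a.R) 0 = 0 := max_eq_right ha.sphereExp_le
    have hsam := Rel.samplesExp_nonneg ha hv hlim hc
    have e1 := expBound_level_add (x := a.sphereExp - a.R) hγ l
    have e2 := expBound_level_add (x := a.σ + homEntropy (1 - a.σ) a.ω - a.R) hγ l
    have e3 := (e2.mul (expBound_auxDensity hlim) fun n => auxDensity_nonneg _).mono_right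
      (b := a.samplesExp + γ) (by
        have k1 := ha.auxExp_le
        have k2 := Rel.checksExp_add_auxExp ha
        rcases le_total (a.σ + homEntropy (1 - a.σ) a.ω - a.R) 0 with k | k
        · rw [max_eq_right k]; linarith
        · rw [max_eq_left k]; linarith)
    have e4 := (e1.mono_right (b := a.samplesExp + γ) (by rw [hx]; linarith)).add e3
    have e5 := ((ExpBound.two_pow hlim.kaux).mul e1 fun n => by
      have := (ht₁0 n).le
      positivity).mul ((expBound_inv_threshold_sq ha hv hlim hK hc).const_mul
        (fun n => by positivity) 4) fun n => by positivity
    exact (e5.mul e4 hS0).mono_right (by rw [hx]; linarith)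
  · filter_upwards [hpos, hv, hlim.s.eventually_const_lt ha.σ_pos] with n hn hvn hs P hP T₃
    have hs : 0 < (q n).s := by
      rcases Nat.eq_zero_or_pos (q n).s with h0 | h0
      · rw [h0] at hs; simp at hs
      · exact h0
    have hbs : 0 < (q n).bias n * (q n).samples n := by
      rw [bias_mul_samples hvn]
      have : (0 : ℝ) < (q n).kk n (q n).u ((q n).t - (q n).u) := by exact_mod_cast hn
      positivity
    refine ⟨fun C A => K n * sampleSum C A, fun C A => mul_nonneg (hK0 n)
      (Finset.sum_nonneg fun _ _ => Nat.cast_nonneg _), fun C y hb A => ?_, fun C hb => ?_⟩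
    · have hnear : ∀ v, ((checksNear (q n) P C v).card : ℝ) ≤ t₁ n + 2 ^ l := by
        intro v
        by_contra hcon
        exact hb (Or.inl ⟨v, Finset.mem_univ _, not_le.mp hcon⟩)
      have hT0 : 0 ≤ t₁ n + 2 ^ l := (add_pos (ht₁0 n) (by positivity)).le
      have k1 := card_candidates_mul_le c (cost n) C y A hT0 hnear (by
        rw [div_mul_eq_mul_div]; positivity)
      have k2 := card_lpnSamples_le c (cost n) C A
      have k3 : 0 < ((q n).bias n / 2 * (q n).samples n) ^ 2 := by
        rw [div_mul_eq_mul_div]; positivity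
      rw [← le_div_iff₀ k3] at k1
      have e : K n * sampleSum C A = 2 ^ (q n).kaux * ((t₁ n + 2 ^ l) * sampleSum C A) /
          ((q n).bias n / 2 * (q n).samples n) ^ 2 := by
        rw [hKdef]
        field_simp
        ring
      refine k1.trans (le_of_le_of_eq ?_ e.symm)
      have k2 : ((lpnSamples c (cost n) C P A).val.card : ℝ) ≤ sampleSum C A := k2
      gcongr
    · rw [← Finset.mul_expect]
      refine mul_le_mul_of_nonneg_left ?_ (hK0 n)
      refine (expect_sum_decodeAux_le C hP hs).trans ?_
      have k1 : ((checksNear (q n) P C 0).card : ℝ) ≤ t₁ n + 2 ^ l := by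
        by_contra hcon
        exact hb (Or.inl ⟨0, Finset.mem_univ _, not_le.mp hcon⟩)
      have k2 : ((checks (q n) P C).card : ℝ) ≤ t₂ n + 2 ^ l := by
        by_contra hcon
        exact hb (Or.inr (Or.inl (not_le.mp hcon)))
      have k3 := auxDensity_nonneg (q n)
      rw [auxDensity] at k3 ⊢
      gcongr

end Candidates

/-! ### Exponents of the costs -/

section CostExponents

variable {a : Rel} {q : ℕ → Params}

lemma h₂_nonneg {x : ℝ} (h0 : 0 ≤ x) (h1 : x ≤ 1) : 0 ≤ h₂ x :=
  div_nonneg (Real.binEntropy_nonneg h0 h1) (Real.log_nonneg (by norm_num))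

lemma choose_mul_choose_le {m L t p : ℕ} (hL : L ≤ m) (hp : p ≤ t) :
    L.choose p * (m - L).choose (t - p) ≤ m.choose t := by
  have h := Nat.add_choose_eq L (m - L) t
  rw [Nat.add_sub_cancel' hL] at h
  rw [h]
  have hmem : (p, t - p) ∈ Finset.HasAntidiagonal.antidiagonal t := by
    rw [Finset.HasAntidiagonal.mem_antidiagonal]
    exact Nat.add_sub_cancel' hp
  exact Finset.single_le_sum (f := fun ij : ℕ × ℕ => L.choose ij.1 * (m - L).choose ij.2)
    (fun _ _ => Nat.zero_le _) hmem

lemma natCeil_le_two_mul {x : ℝ} (hx : 1 ≤ x) : (⌈x⌉₊ : ℝ) ≤ 2 * x := by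
  linarith [Nat.ceil_lt_add_one (by linarith : 0 ≤ x)]

lemma tendsto_sub_half {x : ℕ → ℕ} {b : ℝ} (hx : Tendsto (fun n => (x n : ℝ) / n) atTop (𝓝 b)) :
    Tendsto (fun n => ((x n - x n / 2 : ℕ) : ℝ) / n) atTop (𝓝 (b / 2)) := by
  have := tendsto_natSub hx (tendsto_half hx) (Eventually.of_forall fun n => Nat.div_le_self _ _)
  rwa [sub_half] at this

section Dumer

variable {m L p t : ℕ → ℕ} {Θ R τ : ℝ} {x : ℝ × ℝ}

/-- On the domain of `(λ, ϑ)` the quotients with denominator zero have numerator zero, so that their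
junk value does no harm. -/
lemma mul_h₂_of_mem_dumerRegion (hx : x ∈ dumerRegion R τ) :
    (R + x.1) * h₂ (x.2 / (R + x.1)) = homEntropy (R + x.1) x.2 ∧
    (1 - R - x.1) * h₂ ((τ - x.2) / (1 - R - x.1)) = homEntropy (1 - R - x.1) (τ - x.2) ∧
    0 ≤ (R + x.1) * h₂ (x.2 / (R + x.1)) := by
  obtain ⟨h1, h2, h3, h4⟩ := hx
  have h5 := (le_max_left _ _).trans h3
  have h6 := (le_max_right _ _).trans h3
  have h7 := h4.trans (min_le_left _ _)
  have h8 := h4.trans (min_le_right _ _)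
  refine ⟨mul_h₂_div fun h => by linarith, mul_h₂_div fun h => by linarith, ?_⟩
  exact mul_nonneg (h6.trans h8) (h₂_nonneg (div_nonneg h6 (h6.trans h8))
    (div_le_one_of_le₀ h8 (h6.trans h8)))

/-- The exponent of the number of windows tried by Dumer's decoder; it is non-negative, as that
number is at least `1`. -/
lemma expBound_dumerRuns (hx : x ∈ dumerRegion R τ) (hΘ : 0 < Θ)
    (hm : Tendsto (fun n => (m n : ℝ) / n) atTop (𝓝 Θ))
    (hL : Tendsto (fun n => (L n : ℝ) / m n) atTop (𝓝 (R + x.1)))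
    (hp : Tendsto (fun n => (p n : ℝ) / m n) atTop (𝓝 x.2))
    (ht : Tendsto (fun n => (t n : ℝ) / n) atTop (𝓝 (Θ * τ)))
    (hv : ∀ᶠ n in atTop, L n ≤ m n ∧ p n ≤ t n ∧ p n ≤ L n ∧ t n - p n ≤ m n - L n) :
    ExpBound (fun n => (⌈((m n).choose (t n) : ℝ) /
      (((L n).choose (p n) : ℝ) * ((m n - L n).choose (t n - p n) : ℝ))⌉₊ : ℝ))
      (Θ * (h₂ τ - (1 - R - x.1) * h₂ ((τ - x.2) / (1 - R - x.1)) -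
        (R + x.1) * h₂ (x.2 / (R + x.1)))) ∧
    0 ≤ Θ * (h₂ τ - (1 - R - x.1) * h₂ ((τ - x.2) / (1 - R - x.1)) -
        (R + x.1) * h₂ (x.2 / (R + x.1))) := by
  obtain ⟨e1, e2, -⟩ := mul_h₂_of_mem_dumerRegion hx
  have hL' := tendsto_mul_of_tendsto_div hL hm hΘ.ne'
  have hp' := tendsto_mul_of_tendsto_div hp hm hΘ.ne'
  have h := (((ExpBound.choose hm ht).mul (ExpBound.inv_choose hL' hp' (hv.mono fun n h => h.2.2.1))
    fun n => by positivity).mul (ExpBound.inv_choose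
      (tendsto_natSub hm hL' (hv.mono fun n h => h.1))
      (tendsto_natSub ht hp' (hv.mono fun n h => h.2.1)) (hv.mono fun n h => h.2.2.2))
      fun n => by positivity).congr (g := fun n => ((m n).choose (t n) : ℝ) /
      (((L n).choose (p n) : ℝ) * ((m n - L n).choose (t n - p n) : ℝ)))
      (y := Θ * (h₂ τ - (1 - R - x.1) * h₂ ((τ - x.2) / (1 - R - x.1)) -
        (R + x.1) * h₂ (x.2 / (R + x.1)))) (fun n => by
        rw [mul_one_div, mul_one_div, div_div]) (by
        rw [e1, e2, h₂_eq_homEntropy]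
        have k1 : Θ - Θ * (R + x.1) = Θ * (1 - R - x.1) := by ring
        have k2 : Θ * τ - Θ * x.2 = Θ * (τ - x.2) := by ring
        have k3 : homEntropy Θ (Θ * τ) = Θ * homEntropy 1 τ := by
          rw [← homEntropy_mul, mul_one]
        rw [k1, k2, k3, homEntropy_mul, homEntropy_mul]
        ring)
  have h1 : ∀ᶠ n in atTop, (1 : ℝ) ≤ ((m n).choose (t n) : ℝ) /
      (((L n).choose (p n) : ℝ) * ((m n - L n).choose (t n - p n) : ℝ)) := by
    filter_upwards [hv] with n hn
    have k1 : (0 : ℝ) < (L n).choose (p n) := by exact_mod_cast Nat.choose_pos hn.2.2.1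
    have k2 : (0 : ℝ) < (m n - L n).choose (t n - p n) := by
      exact_mod_cast Nat.choose_pos hn.2.2.2
    rw [le_div_iff₀ (by positivity), one_mul]
    exact_mod_cast choose_mul_choose_le hn.1 hn.2.1
  exact ⟨(h.const_mul (fun n => by positivity) 2).mono_left
    (h1.mono fun n hn => natCeil_le_two_mul hn), h.nonneg_of_frequently one_pos h1.frequently⟩

/-- The exponent of the cost of Dumer's decoder, when the bound `T` on the number of colliding pairs
exceeds its mean value, and `1`, by at most the exponent `γ`. -/
lemma expBound_dumerCost (hx : x ∈ dumerRegion R τ) (hΘ : 0 < Θ)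
    (hm : Tendsto (fun n => (m n : ℝ) / n) atTop (𝓝 Θ))
    (hL : Tendsto (fun n => (L n : ℝ) / m n) atTop (𝓝 (R + x.1)))
    (hp : Tendsto (fun n => (p n : ℝ) / m n) atTop (𝓝 x.2))
    (ht : Tendsto (fun n => (t n : ℝ) / n) atTop (𝓝 (Θ * τ)))
    (hv : ∀ᶠ n in atTop, L n ≤ m n ∧ p n ≤ t n ∧ p n ≤ L n ∧ t n - p n ≤ m n - L n)
    (c : ℕ) {T : ℕ → ℝ} (hT0 : ∀ n, 0 ≤ T n) {γ : ℝ} (hγ : 0 ≤ γ)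
    (hT : ExpBound T (max (Θ * ((R + x.1) * h₂ (x.2 / (R + x.1)) - x.1)) 0 + γ)) :
    ExpBound (fun n => dumerCost n c (m n) (L n) (p n) (t n) (T n))
      (Θ * dumerExponent R τ x + γ) ∧ 0 ≤ Θ * dumerExponent R τ x := by
  obtain ⟨h1, h2⟩ := expBound_dumerRuns hx hΘ hm hL hp ht hv
  obtain ⟨e1, -, e3⟩ := mul_h₂_of_mem_dumerRegion hx
  have hL' := tendsto_mul_of_tendsto_div hL hm hΘ.ne'
  have hp' := tendsto_mul_of_tendsto_div hp hm hΘ.ne'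
  set v := max ((R + x.1) / 2 * h₂ (x.2 / (R + x.1))) ((R + x.1) * h₂ (x.2 / (R + x.1)) - x.1)
    with hv
  have hv1 : (R + x.1) * h₂ (x.2 / (R + x.1)) / 2 ≤ v := by
    rw [← div_mul_eq_mul_div]
    exact le_max_left _ _
  have hv0 : 0 ≤ v := by linarith
  have hΘv := mul_nonneg hΘ.le hv0
  have hhalf : homEntropy (Θ * (R + x.1) / 2) (Θ * x.2 / 2) ≤ Θ * v + γ := by
    rw [homEntropy_half, homEntropy_mul, ← e1, mul_div_assoc]
    linarith [mul_le_mul_of_nonneg_left hv1 hΘ.le]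
  have k1 := (ExpBound.choose (tendsto_half hL') (tendsto_half hp')).mono_right hhalf
  have k2 := (ExpBound.choose (tendsto_sub_half hL') (tendsto_sub_half hp')).mono_right hhalf
  have k3 := hT.mono_right (b := Θ * v + γ) (add_le_add (max_le
    (mul_le_mul_of_nonneg_left (le_max_right _ _) hΘ.le) hΘv) le_rfl)
  have k4 := ((ExpBound.natPow 3).mono_right (by linarith : 0 ≤ Θ * v + γ)).add
    (((k1.add k2).add k3).natPow_mul (fun n => by have := hT0 n; positivity) 2)
  have e : Θ * dumerExponent R τ x = Θ * (h₂ τ - (1 - R - x.1) *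
      h₂ ((τ - x.2) / (1 - R - x.1)) - (R + x.1) * h₂ (x.2 / (R + x.1))) + Θ * v := by
    rw [dumerExponent, ← hv]
    ring
  rw [e]
  refine ⟨((h1.natPow_mul (fun n => by positivity) c).mul k4 fun n => by
    have := hT0 n; positivity).congr (fun n => rfl) (by ring), by linarith⟩

lemma expBound_dumerPairs (hx : x ∈ dumerRegion R τ) (hΘ : 0 < Θ)
    (hm : Tendsto (fun n => (m n : ℝ) / n) atTop (𝓝 Θ))
    (hL : Tendsto (fun n => (L n : ℝ) / m n) atTop (𝓝 (R + x.1)))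
    (hp : Tendsto (fun n => (p n : ℝ) / m n) atTop (𝓝 x.2)) :
    ExpBound (fun n => (dumerPairs (L n) (p n) : ℝ))
      (Θ * ((R + x.1) * h₂ (x.2 / (R + x.1)))) := by
  have hL' := tendsto_mul_of_tendsto_div hL hm hΘ.ne'
  have hp' := tendsto_mul_of_tendsto_div hp hm hΘ.ne'
  refine ((ExpBound.choose (tendsto_half hL') (tendsto_half hp')).mul
    (ExpBound.choose (tendsto_sub_half hL') (tendsto_sub_half hp'))
    fun n => by positivity).congr (fun n => ?_) ?_
  · rw [dumerPairs]
    push_cast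
    rfl
  · rw [homEntropy_half, add_halves, homEntropy_mul, (mul_h₂_of_mem_dumerRegion hx).1]

end Dumer

lemma homEntropy_σ_eq (ha : a.Admissible) :
    homEntropy a.σ (a.τ - a.μ) = a.σ * h₂ ((a.τ - a.μ) / a.σ) :=
  (mul_h₂_div fun h => absurd h ha.σ_pos.ne').symm

/-- The exponents `x₃`, `x₅` of the mean numbers of collisions in the information set decoders on
the complement of `𝒫` and on `𝒫`, and the resulting exponent of the treatment of one tuple of
candidates. -/
lemma exists_isd_exponents (ha : a.Admissible) {Naux : ℕ} (hv : ∀ᶠ n in atTop, (q n).Valid n)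
    (hlim : HasLimits q a) (hi : OptimalInternal Naux q a) (c : ℕ) : ∃ x₃ x₅ : ℝ,
      ExpBound (fun n => dumerPairs (q n).Lb (q n).pb * (2 ^ (n - (q n).s - (q n).Lb) *
        ((2 : ℝ) ^ (q n).k / 2 ^ n))) x₃ ∧
      ExpBound (fun n => dumerPairs (q n).La (q n).pa * (2 ^ ((q n).s - (q n).La) *
        ((1 : ℝ) / 2 ^ (q n).kaux) ^ Naux)) x₅ ∧
      (∃ K, ExpBound (fun n => (dumerPairs (q n).Lb (q n).pb : ℝ)) K) ∧
      (∃ K, ExpBound (fun n => (dumerPairs (q n).La (q n).pa : ℝ)) K) ∧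
      0 ≤ a.isdExp Naux ∧
      ∀ γ ≥ 0, ∀ T₃ T₄ T₅ : ℕ → ℝ, (∀ n, 0 ≤ T₃ n) → (∀ n, 0 ≤ T₄ n) → (∀ n, 0 ≤ T₅ n) →
        ExpBound T₃ (max x₃ 0 + γ) → ExpBound T₄ (a.isdSolutionsExp Naux + γ) →
        ExpBound T₅ (max x₅ 0 + γ) →
        ExpBound (fun n => isdCost n c (q n) (T₃ n) (T₄ n) (T₅ n)) (a.isdExp Naux + 2 * γ) := by
  obtain ⟨x, hx, hxα, hLa, hpa⟩ := hi.isd_on_P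
  obtain ⟨z, hz, hzα, hLb, hpb⟩ := hi.isd_on_N
  have hθ : 0 < 1 - a.σ := sub_pos.mpr ha.σ_lt
  have hm := hlim.sub_s hv
  have htP : Tendsto (fun n => (((q n).t - (q n).u : ℕ) : ℝ) / n) atTop
      (𝓝 (a.σ * ((a.τ - a.μ) / a.σ))) := by
    rw [mul_div_cancel₀ _ ha.σ_pos.ne']
    exact hlim.sub_u hv
  have htN : Tendsto (fun n => ((q n).u : ℝ) / n) atTop
      (𝓝 ((1 - a.σ) * (a.μ / (1 - a.σ)))) := by
    rw [mul_div_cancel₀ _ hθ.ne']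
    exact hlim.u
  have hvP : ∀ᶠ n in atTop, (q n).La ≤ (q n).s ∧ (q n).pa ≤ (q n).t - (q n).u ∧
      (q n).pa ≤ (q n).La ∧ (q n).t - (q n).u - (q n).pa ≤ (q n).s - (q n).La :=
    hv.mono fun n h => ⟨h.La_le, h.pa_le, h.pa_le_La, h.pa_rest⟩
  have hvN : ∀ᶠ n in atTop, (q n).Lb ≤ n - (q n).s ∧ (q n).pb ≤ (q n).u ∧
      (q n).pb ≤ (q n).Lb ∧ (q n).u - (q n).pb ≤ n - (q n).s - (q n).Lb :=
    hv.mono fun n h => ⟨h.Lb_le, h.pb_le, h.pb_le_Lb, h.pb_rest⟩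
  have hpP := expBound_dumerPairs hx ha.σ_pos hlim.s hLa hpa
  have hpN := expBound_dumerPairs hz hθ hm hLb hpb
  have hLa' := tendsto_mul_of_tendsto_div hLa hlim.s ha.σ_pos.ne'
  have hLb' := tendsto_mul_of_tendsto_div hLb hm hθ.ne'
  have hP0 := (expBound_dumerCost hx ha.σ_pos hlim.s hLa hpa htP hvP c (T := fun _ => 0)
    (fun _ => le_rfl) le_rfl ((ExpBound.const 0).mono_right (by simp))).2
  have hN0 := (expBound_dumerCost hz hθ hm hLb hpb htN hvN c (T := fun _ => 0)
    (fun _ => le_rfl) le_rfl ((ExpBound.const 0).mono_right (by simp))).2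
  rw [hxα] at hP0
  rw [hzα] at hN0
  have hI0 : 0 ≤ a.isdExp Naux := hP0.trans (le_max_left _ _)
  refine ⟨_, _, (hpN.mul ((ExpBound.two_pow (tendsto_natSub hm hLb' (hvN.mono fun n h => h.1))).mul
      (((ExpBound.two_pow hlim.k).mul (ExpBound.inv_two_pow (x := fun n => n) tendsto_self_div)
        fun n => by positivity).congr (fun n => by rw [mul_one_div]) rfl) fun n => by positivity)
        fun n => by positivity).congr (fun n => rfl) (y := (1 - a.σ) * (((a.R - a.σ) / (1 - a.σ) +
          z.1) * h₂ (z.2 / ((a.R - a.σ) / (1 - a.σ) + z.1)) - z.1)) ?_,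
    (hpP.mul ((ExpBound.two_pow (tendsto_natSub hlim.s hLa' (hvP.mono fun n h => h.1))).mul
      ((ExpBound.inv_two_pow hlim.kaux).pow (fun n => by positivity) Naux) fun n => by positivity)
      fun n => by positivity).congr (fun n => rfl) (y := a.σ * ((1 - Naux * a.Raux / a.σ +
          x.1) * h₂ (x.2 / (1 - Naux * a.Raux / a.σ + x.1)) - x.1)) ?_, ⟨_, hpN⟩, ⟨_, hpP⟩,
    hI0, ?_⟩
  · have e : (1 - a.σ) * ((a.R - a.σ) / (1 - a.σ)) = a.R - a.σ := mul_div_cancel₀ _ hθ.ne'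
    rw [mul_sub, mul_add (1 - a.σ) _ z.1, e]
    ring
  · have e : a.σ * (Naux * a.Raux / a.σ) = Naux * a.Raux := mul_div_cancel₀ _ ha.σ_pos.ne'
    have e2 : a.σ * (1 - Naux * a.Raux / a.σ + x.1) = a.σ - Naux * a.Raux + a.σ * x.1 := by
      rw [mul_add, mul_sub, e, mul_one]
    rw [mul_sub a.σ _ x.1, e2]
    ring
  · intro γ hγ T₃ T₄ T₅ hT₃0 hT₄0 hT₅0 hT₃ hT₄ hT₅
    have hP := (expBound_dumerCost hx ha.σ_pos hlim.s hLa hpa htP hvP c hT₅0 hγ hT₅).1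
    have hN := (expBound_dumerCost hz hθ hm hLb hpb htN hvN c hT₃0 hγ hT₃).1
    rw [hxα] at hP
    rw [hzα] at hN
    have k1 := (ExpBound.natPow 2).mono_right (b := a.isdExp Naux + 2 * γ) (by linarith)
    have k2 := hP.mono_right (b := a.isdExp Naux + 2 * γ) (by
      have : _ ≤ a.isdExp Naux := le_max_left _ _
      linarith)
    have k3 := (hT₄.mul (((ExpBound.natPow 3).mono_right (add_nonneg hN0 hγ)).add hN) fun n => by
      have := dumerCost_nonneg (n := n) (c := c) (m := n - (q n).s) (L := (q n).Lb)
        (p := (q n).pb) (t := (q n).u) (hT₃0 n)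
      positivity).mono_right (b := a.isdExp Naux + 2 * γ) (by
      have : _ ≤ a.isdExp Naux := le_max_right _ _
      linarith)
    exact (k1.add k2).add k3

/-- The worst-case treatment of a tuple of candidates is at most exponential. -/
lemma exists_expBound_isdCostMax (ha : a.Admissible) {Naux : ℕ}
    (hv : ∀ᶠ n in atTop, (q n).Valid n) (hlim : HasLimits q a) (hi : OptimalInternal Naux q a)
    (c : ℕ) : ∃ K, ExpBound (fun n => isdCostMax n c (q n)) K := by
  obtain ⟨x₃, x₅, -, -, ⟨K₃, hK₃⟩, ⟨K₅, hK₅⟩, -, h⟩ := exists_isd_exponents ha hv hlim hi c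
  have hK₄ := ExpBound.choose hlim.s (hlim.sub_u hv)
  set γ := max (max K₃ K₅) (max (homEntropy a.σ (a.τ - a.μ)) 0) with hγ
  have h3 : K₃ ≤ γ := (le_max_left _ _).trans (le_max_left _ _)
  have h5 : K₅ ≤ γ := (le_max_right _ _).trans (le_max_left _ _)
  have h4 : homEntropy a.σ (a.τ - a.μ) ≤ γ := (le_max_left _ _).trans (le_max_right _ _)
  have h0 : 0 ≤ γ := (le_max_right _ _).trans (le_max_right _ _)
  have hs : 0 ≤ a.isdSolutionsExp Naux := le_max_right _ _
  exact ⟨_, h γ h0 _ _ _ (fun n => Nat.cast_nonneg _) (fun n => Nat.cast_nonneg _)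
    (fun n => Nat.cast_nonneg _) (hK₃.mono_right (by linarith [le_max_right x₃ 0]))
    (hK₄.mono_right (by linarith)) (hK₅.mono_right (by linarith [le_max_right x₅ 0]))⟩

lemma expBound_numIter (ha : a.Admissible) (hv : ∀ᶠ n in atTop, (q n).Valid n)
    (hlim : HasLimits q a) (c : ℕ) : ExpBound (fun n => (numIter n c (q n) : ℝ)) a.succExp := by
  have hθ : 1 - a.σ ≠ 0 := (sub_pos.mpr ha.σ_lt).ne'
  have h := ((((ExpBound.choose (m := fun n => n) tendsto_self_div hlim.t).mul
    (ExpBound.inv_choose hlim.s (hlim.sub_u hv) (hv.mono fun n h => h.tu_le))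
    fun n => by positivity).mul (ExpBound.inv_choose (hlim.sub_s hv) hlim.u
      (hv.mono fun n h => h.u_le)) fun n => by positivity).natPow_mul (fun n => by positivity)
      c).const_mul (fun n => by positivity) 2
  refine (h.mono_left ?_).mono_right (le_of_eq ?_)
  · filter_upwards [hv, eventually_ge_atTop 1] with n hn hn1
    have k1 : (0 : ℝ) < (q n).s.choose ((q n).t - (q n).u) := by
      exact_mod_cast Nat.choose_pos hn.tu_le
    have k2 : (0 : ℝ) < (n - (q n).s).choose (q n).u := by exact_mod_cast Nat.choose_pos hn.u_le
    have k3 : (0 : ℝ) < n.choose (q n).t := by exact_mod_cast Nat.choose_pos hn.t_le_n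
    have k4 : ((q n).s.choose ((q n).t - (q n).u) : ℝ) * ((n - (q n).s).choose (q n).u : ℝ) ≤
        n.choose (q n).t := by
      have := choose_mul_choose_le (m := n) (L := (q n).s) (t := (q n).t)
        (p := (q n).t - (q n).u) (hn.s_le_k.trans hn.k_le_n) (Nat.sub_le _ _)
      rw [Nat.sub_sub_self hn.u_le_t] at this
      exact_mod_cast this
    have k5 : (1 : ℝ) ≤ (n : ℝ) ^ c := one_le_pow₀ (by exact_mod_cast hn1)
    have k6 : 1 ≤ (n : ℝ) ^ c / (q n).succ n := by
      rw [Params.succ, le_div_iff₀ (by positivity), one_mul]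
      exact (div_le_one_of_le₀ k4 k3.le).trans k5
    refine (natCeil_le_two_mul k6).trans (le_of_eq ?_)
    rw [Params.succ]
    field_simp
  · rw [Rel.succExp, h₂_eq_homEntropy a.τ, mul_h₂_div fun h => absurd h ha.σ_pos.ne',
      mul_h₂_div fun h => absurd h hθ]
    ring

/-- The cost of the search for parity-checks: each of the sizes of the lists and of the numbers of
collisions is accounted for by one of the terms of `bjmmExponent`. The number of parity-checks has
no larger exponent, by the subadditivity of the entropy: in the exponent, a vector of weight `ω`
has `λ₂` representations as a sum of two vectors of weight `π₂`, and there are `2 h(π₂)` pairs of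
such vectors. -/
lemma expBound_checksCost (ha : a.Admissible) {Naux : ℕ} (hv : ∀ᶠ n in atTop, (q n).Valid n)
    (hlim : HasLimits q a) (hi : OptimalInternal Naux q a) (c : ℕ) :
    ExpBound (fun n => checksCost n c (q n))
      ((1 - a.σ) * alphaEq ((a.R - a.σ) / (1 - a.σ)) (a.ω / (1 - a.σ))) ∧
    max (a.σ + homEntropy (1 - a.σ) a.ω - a.R) 0 ≤
      (1 - a.σ) * alphaEq ((a.R - a.σ) / (1 - a.σ)) (a.ω / (1 - a.σ)) := by
  obtain ⟨x, ⟨π₁, π₂, l₁, l₂, rfl, hπ₁, hπ₂, hl₁, -, hl, hlR, hπ, hπω, -, hω, -, -, -, hl₂⟩,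
    hα, hp₁, hp₂, hll₁, hll₂⟩ := hi.parityChecks
  have hθ : 0 < 1 - a.σ := sub_pos.mpr ha.σ_lt
  set θ := 1 - a.σ with hθdef
  set R' := (a.R - a.σ) / θ with hR'
  set ω' := a.ω / θ with hω'
  have hRθ : θ * R' = a.R - a.σ := mul_div_cancel₀ _ hθ.ne'
  have hω'half : ω' ≤ 1 / 2 := by
    rw [hω', div_le_iff₀ hθ]
    linarith [ha.ω_le_half]
  have hω'0 : 0 ≤ ω' := div_nonneg ha.ω_nonneg hθ.le
  rw [← hα]
  set α := bjmmExponent R' (π₁, π₂, l₁, l₂) with hαdef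
  have hm := hlim.sub_s hv
  have hmhalf := tendsto_half hm
  have hmhalf' := tendsto_sub_half hm
  have hp₁' := tendsto_mul_of_tendsto_div hp₁ hm hθ.ne'
  have hp₂' := tendsto_mul_of_tendsto_div hp₂ hm hθ.ne'
  have hl₁' := tendsto_mul_of_tendsto_div hll₁ hm hθ.ne'
  have hl₂' := tendsto_mul_of_tendsto_div hll₂ hm hθ.ne'
  have hks := hlim.k_sub_s hv
  rw [← hRθ] at hks
  have hmin : ∀ {l : ℕ → ℕ} {b : ℝ}, Tendsto (fun n => (l n : ℝ) / n) atTop (𝓝 (θ * b)) →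
      b ≤ R' → Tendsto (fun n => ((min (l n) ((q n).k - (q n).s) : ℕ) : ℝ) / n) atTop
        (𝓝 (θ * b)) := by
    intro l b hl hb
    have h := hl.min hks
    rw [min_eq_left (mul_le_mul_of_nonneg_left hb hθ.le)] at h
    refine h.congr fun n => ?_
    rw [Nat.cast_min, min_div_div_right (Nat.cast_nonneg n)]
  have he₁ := ExpBound.inv_two_pow (hmin hl₁' (hl.trans hlR))
  have he₂ := ExpBound.inv_two_pow (hmin hl₂' hlR)
  have hν : h₂ π₁ / 2 ≤ α ∧ h₂ π₁ - l₁ ≤ α ∧ 2 * (h₂ π₁ - l₁) - (l₂ - l₁) ≤ α ∧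
      h₂ π₂ - l₂ ≤ α ∧ 2 * (h₂ π₂ - l₂) - (R' - l₂) ≤ α := by
    rw [hαdef, bjmmExponent]
    simp only [le_max_iff, le_refl, true_or, or_true, and_self]
  obtain ⟨ν0, ν1, ν2, ν3, ν4⟩ := hν
  have hα0 : 0 ≤ θ * α := mul_nonneg hθ.le
    ((div_nonneg (h₂_nonneg hπ₁ (by linarith)) two_pos.le).trans ν0)
  have eH : ∀ y, homEntropy θ (θ * y) = θ * h₂ y := fun y => by
    rw [h₂_eq_homEntropy, ← homEntropy_mul, mul_one]
  have hN₁ := ExpBound.choose hmhalf (tendsto_half hp₁')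
  have hN₁' := ExpBound.choose hmhalf' (tendsto_sub_half hp₁')
  rw [homEntropy_half, eH] at hN₁ hN₁'
  have hNN := hN₁.mul hN₁' fun n => by positivity
  rw [add_halves] at hNN
  have hN₂ := ExpBound.choose hm hp₂'
  rw [eH] at hN₂
  have scale : ∀ {y : ℝ}, y ≤ α → θ * y ≤ θ * α := fun h => mul_le_mul_of_nonneg_left h hθ.le
  have t0 : ∀ {f : ℕ → ℝ} {y : ℝ}, ExpBound f y → y ≤ θ * α → ExpBound f (θ * α) :=
    fun h h' => h.mono_right h'
  have b1 := ((t0 hN₁ (by linarith [scale ν0])).add (t0 hN₁' (by linarith [scale ν0]))).const_mul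
    (fun n => by positivity) 4
  have b2 := (t0 (hNN.mul he₁ fun n => by positivity) (by linarith [scale ν1])).const_mul
    (fun n => by positivity) 8
  have b3 := (t0 (((hNN.pow (fun n => by positivity) 2).mul he₁ fun n => by positivity).mul he₂
    fun n => by positivity) (by push_cast; linarith [scale ν2])).const_mul
    (fun n => by positivity) 2
  have b4 := t0 (hN₂.mul he₂ fun n => by positivity) (by linarith [scale ν3])
  have b5 := t0 ((((hN₂.pow (fun n => by positivity) 2).mul ((ExpBound.two_pow hlim.s).mul
    (ExpBound.inv_two_pow hlim.k) fun n => by positivity) fun n => by positivity).mul he₂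
    fun n => by positivity)) (by push_cast; linarith [scale ν4])
  refine ⟨(((ExpBound.natPow 3).mono_right hα0).add ((((b1.add b2).add b3).add
    ((b4.const_mul (fun n => by positivity) 3).add b5)).natPow_mul (fun n => by positivity)
    2)).natPow_mul (fun n => by positivity) c |>.congr (fun n => ?_) rfl, max_le ?_ hα0⟩
  · rw [checksCost]
    ring
  · have hsub := entropy_subadditive hω'0 (by linarith) (by linarith : π₂ ≤ 1 - ω' / 2)
      (by linarith)
    rw [← hl₂] at hsub
    have e : a.ω = θ * ω' := (mul_div_cancel₀ _ hθ.ne').symm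
    have := scale (show h₂ ω' - R' ≤ α by linarith)
    rw [e, eH]
    linarith

end CostExponents

/-! ### The running time -/

section RunningTime

variable {a : Rel} {q : ℕ → Params} {Naux c : ℕ}

/-- The exponent of the expected running time, up to every `β > 0` and uniformly in the error. -/
lemma eventually_expectedTime_le (ha : a.Admissible) (hv : ∀ᶠ n in atTop, (q n).Valid n)
    (hlim : HasLimits q a) (hK : KrawtchoukMagnitude q a) (hc : ParameterConstraint q)
    (hi : OptimalInternal Naux q a) (cost : (n : ℕ) → DecCost n (q n))
    (hcost : DecodeIsEfficient a.σ q cost) (hconj : BiasConjecture q) {β : ℝ} (hβ : 0 < β) :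
    ∀ᶠ n in atTop, ∀ e : Fin n → F2,
      expectedTime Naux c (q n) (cost n) e ≤ (2 : ℝ) ^ ((n : ℝ) * (a.exponent Naux + β)) := by
  -- the thresholds of the exceptional cases exceed the mean values by the exponent `γ`, which
  -- enters `2 Naux` times through the candidates and twice through the information set decoders
  set γ := β / (2 * (2 * Naux + 2)) with hγdef
  have hγ : 0 < γ := by positivity
  have hγβ : (2 * Naux + 2) * γ = β / 2 := by
    rw [hγdef]
    field_simp
  obtain ⟨x₃, x₅, h₃, h₅, -, -, hI0, hisd⟩ := exists_isd_exponents ha hv hlim hi c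
  obtain ⟨K, hKmax⟩ := exists_expBound_isdCostMax ha hv hlim hi c
  -- `l` is so large that the exceptional cases do not matter
  obtain ⟨l, hl⟩ := exists_nat_ge ((3 + Naux * a.Raux + K) / (γ / 2))
  rw [div_le_iff₀ (by positivity)] at hl
  obtain ⟨μ, hμ0, hμ, hM⟩ := exists_candidates_bound ha hv hlim hK hc hconj cost c l hγ.le
  obtain ⟨-, ε, hε, hD⟩ := hcost
  set x₁ := a.sphereExp - a.R with hx₁
  set x₂ := a.σ + homEntropy (1 - a.σ) a.ω - a.R with hx₂
  set x₄ := homEntropy a.σ (a.τ - a.μ) + Naux * -a.Raux with hx₄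
  have h₁ : ExpBound (fun n => ((q n).s.choose (q n).taux : ℝ) *
      ((n - (q n).s).choose (q n).w : ℝ) * (1 / 2 ^ (q n).k)) x₁ := expBound_sphere_div hv hlim
  have h₂ : ExpBound (fun n => 2 ^ (q n).s * ((n - (q n).s).choose (q n).w : ℝ) *
      (1 / 2 ^ (q n).k)) x₂ := expBound_checks hv hlim
  have h₄ : ExpBound (fun n => ((q n).s.choose ((q n).t - (q n).u) : ℝ) *
      (1 / 2 ^ (q n).kaux) ^ Naux) x₄ :=
    (ExpBound.choose hlim.s (hlim.sub_u hv)).mul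
      ((ExpBound.inv_two_pow hlim.kaux).pow (fun n => by positivity) Naux) fun n => by positivity
  have hx₄' : max x₄ 0 = a.isdSolutionsExp Naux := by
    rw [Rel.isdSolutionsExp, hx₄, homEntropy_σ_eq ha]
    ring_nf
  set D : ℕ → ℝ := fun n => (2 : ℝ) ^ ((n : ℝ) * a.σ * ε n) with hDdef
  have hD0 : ∀ n, 0 ≤ D n := fun n => by positivity
  have hDb : ExpBound D 0 := by
    have h : Tendsto (fun n => a.σ * ε n) atTop (𝓝 0) := by simpa using hε.const_mul a.σ
    exact (ExpBound.of_tendsto h).congr (fun n => by simp only [hDdef, mul_assoc]) rfl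
  obtain ⟨hE, hEW⟩ := expBound_checksCost ha hv hlim hi c
  set I : ℕ → ℝ := fun n => isdCost n c (q n) (level x₃ γ n + 2 ^ l) (level x₄ γ n + 2 ^ l)
    (level x₅ γ n + 2 ^ l) with hIdef
  have hlev : ∀ x n, 0 ≤ level x γ n + 2 ^ l := fun x n => by
    have := (level_pos x γ n).le
    positivity
  have hIn : ∀ n, 0 ≤ I n := fun n => isdCost_nonneg (hlev _ _) (hlev _ _) (hlev _ _)
  have hIb : ExpBound I (a.isdExp Naux + 2 * γ) :=
    hisd γ hγ.le _ _ _ (hlev _) (hlev _) (hlev _) (expBound_level_add hγ.le l)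
      (hx₄' ▸ expBound_level_add hγ.le l) (expBound_level_add hγ.le l)
  -- the maximum in `a.exponent`
  set X := max (max ((1 - a.σ) * alphaEq ((a.R - a.σ) / (1 - a.σ)) (a.ω / (1 - a.σ)))
    a.samplesExp) (max a.Raux (Naux * a.candidatesExp + a.isdExp Naux)) with hX
  have hX1 : (1 - a.σ) * alphaEq ((a.R - a.σ) / (1 - a.σ)) (a.ω / (1 - a.σ)) ≤ X :=
    (le_max_left _ _).trans (le_max_left _ _)
  have hX2 : a.samplesExp ≤ X := (le_max_right _ _).trans (le_max_left _ _)
  have hX3 : a.Raux ≤ X := (le_max_left _ _).trans (le_max_right _ _)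
  have hX4 : Naux * a.candidatesExp + a.isdExp Naux ≤ X :=
    (le_max_right _ _).trans (le_max_right _ _)
  have hX0 : 0 ≤ X := ha.Raux_nonneg.trans hX3
  have had : ∀ n, 0 ≤ auxDensity (q n) := fun n => auxDensity_nonneg _
  -- the bound of `expect_iteration_le`
  let B : ℕ → ℝ := fun n => (n : ℝ) ^ 3 + (Naux * (checksCost n c (q n) +
    (1 + 2 ^ (q n).s * ((n - (q n).s).choose (q n).w : ℝ) / 2 ^ (q n).k) * ((n : ℝ) ^ 2 + D n) +
    2 * (n : ℝ) ^ 2 * (1 + ((q n).s.choose (q n).taux : ℝ) * ((n - (q n).s).choose (q n).w : ℝ) /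
      2 ^ (q n).k + (1 + 2 ^ (q n).s * ((n - (q n).s).choose (q n).w : ℝ) / 2 ^ (q n).k) *
        auxDensity (q n)) + (n : ℝ) ^ 2 * (((q n).kaux + 3) * 2 ^ (q n).kaux)) +
    (μ n ^ Naux * I n + 5 * 8 ^ n * slack γ n ^ l *
      ((2 ^ (q n).kaux) ^ Naux * isdCostMax n c (q n))))
  have hcc : ∀ n, 0 ≤ checksCost n c (q n) := fun n => by unfold checksCost; positivity
  have hB0 : ∀ n, 0 ≤ B n := fun n => by
    have := hcc n
    have := hD0 n
    have := had n
    have := hμ0 n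
    have := hIn n
    have := slack_nonneg γ n
    have := isdCostMax_nonneg (n := n) (c := c) (q := q n)
    positivity
  have hB : ExpBound B (X + (2 * Naux + 2) * γ) := by
    have hXγ : X ≤ X + (2 * Naux + 2) * γ := le_add_of_nonneg_right (by positivity)
    -- the parity-checks, each of which is passed to the procedure Decode
    have b2 := ((((ExpBound.const 1).mono_right (le_max_right x₂ 0)).add
      (h₂.mono_right (le_max_left x₂ 0))).mul ((ExpBound.natPow 2).add hDb) fun n => by
        have := hD0 n
        positivity).mono_right (b := X) (by linarith)
    -- the samples
    have b3 := (((expBound_meanSamples ha hv hlim hc).natPow_mul (fun n => by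
      have := had n
      positivity) 2).const_mul (fun n => by
      have := had n
      positivity) 2).mono_right hX2
    -- the Fourier transforms
    have b4 := ((((ExpBound.natCast_of_tendsto hlim.kaux).const_mul (fun n => by positivity) 3).mul
      (ExpBound.two_pow hlim.kaux) fun n => by positivity).natPow_mul
      (fun n => by positivity) 2).mono_right (b := X) (by linarith)
    -- the tuples of candidates
    have b5 := ((hμ.pow hμ0 Naux).mul hIb hIn).mono_right (b := X + (2 * Naux + 2) * γ)
      (by linarith)
    -- the exceptional cases
    have b6 := (((expBound_slack_pow γ l).const_mul (fun n => by
      have := slack_nonneg γ n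
      positivity) 5).mul (((ExpBound.two_pow hlim.kaux).pow (fun n => by positivity) Naux).mul hKmax
        fun n => isdCostMax_nonneg) fun n => by
        have := isdCostMax_nonneg (n := n) (c := c) (q := q n)
        positivity).mono_right (b := X) (by linarith)
    refine ((((ExpBound.natPow 3).mono_right hX0).mono_right hXγ).add
      ((((((hE.mono_right hX1).add b2).add b3).add b4).const_mul (fun n => by
        have := hcc n
        have := hD0 n
        have := had n
        positivity) Naux |>.mono_right hXγ).add (b5.add (b6.mono_right hXγ)))).mono_left
      (Eventually.of_forall fun n => ?_)
    have e3 : ((q n).kaux + 3 : ℝ) ≤ 3 * ((q n).kaux + 1) := by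
      have : (0 : ℝ) ≤ (q n).kaux := Nat.cast_nonneg _
      linarith
    have e4 : (n : ℝ) ^ 2 * (((q n).kaux + 3) * 2 ^ (q n).kaux) ≤
        (n : ℝ) ^ 2 * (3 * ((q n).kaux + 1) * 2 ^ (q n).kaux) := by gcongr
    have e5 := mul_le_mul_of_nonneg_left e4 (Nat.cast_nonneg (α := ℝ) Naux)
    simp only [B, mul_one_div]
    linarith
  have htotal := (expBound_numIter ha hv hlim c).mul hB hB0
  have hs : ∀ᶠ n in atTop, 0 < (q n).s := by
    filter_upwards [hlim.s.eventually_const_lt ha.σ_pos] with n hs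
    rcases Nat.eq_zero_or_pos (q n).s with h0 | h0
    · rw [h0] at hs; simp at hs
    · exact h0
  filter_upwards [htotal (β / 2) (by positivity), hv, hs, hD, hM, h₁.le_slack_mul_level hγ,
    h₂.le_slack_mul_level hγ, h₃.le_slack_mul_level hγ, h₄.le_slack_mul_level hγ,
    h₅.le_slack_mul_level hγ] with n hn hvn hs hD hM k₁ k₂ k₃ k₄ k₅ e
  have hn : (numIter n c (q n) : ℝ) * B n ≤ (2 : ℝ) ^ ((n : ℝ) * (a.exponent Naux + β)) := by
    refine hn.trans (le_of_eq ?_)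
    rw [Rel.exponent, ← hX, hγβ]
    ring_nf
  refine (expectedTime_le c (cost n) e (hB0 n) fun P hP => ?_).trans hn
  obtain ⟨M, hM0, hM1, hM2⟩ := hM P hP (level x₃ γ n + 2 ^ l)
  exact expect_iteration_le hP hs (hvn.s_le_k.trans hvn.k_le_n) hvn.k_le_n hvn.kaux_le_s c l
    (cost n) (hD0 n) (hD P hP) (expect_parityCheckEquations_le hP hvn.k_le_n c)
    (slack_nonneg γ n) (level_pos x₁ γ n) (level_pos x₂ γ n) (level_pos x₃ γ n)
    (level_pos x₄ γ n) (level_pos x₅ γ n) k₁ k₂ k₃ k₄ k₅ M hM0 hM1 (hμ0 n) hM2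
    fun G m => m ᵥ* G + e

end RunningTime

end DoubleRLPN

end

theorem mainTheorem5 (a : DoubleRLPN.Rel) (ha : a.Admissible)
    (Naux c : ℕ) (hNaux : 1 ≤ Naux) (hc : 1 ≤ c)
    (q : ℕ → DoubleRLPN.Params) (hvalid : ∀ᶠ n in atTop, (q n).Valid n)
    (hlim : DoubleRLPN.HasLimits q a)
    (hK : DoubleRLPN.KrawtchoukMagnitude q a)
    (hconstraint : DoubleRLPN.ParameterConstraint q)
    (hinternal : DoubleRLPN.OptimalInternal Naux q a)
    (cost : (n : ℕ) → DoubleRLPN.DecCost n (q n))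
    (hcost : DoubleRLPN.DecodeIsEfficient a.σ q cost)
    (hconj : DoubleRLPN.BiasConjecture q) :
    ∃ ε : ℕ → ℝ, Tendsto ε atTop (𝓝 0) ∧
      ∀ᶠ n in atTop, ∀ e : Fin n → ZMod 2, hammingNorm e = (q n).t →
        DoubleRLPN.expectedTime Naux c (q n) (cost n) e ≤
          (2 : ℝ) ^ ((n : ℝ) * (a.exponent Naux + ε n)) := by
  have hT : DoubleRLPN.ExpBound (fun n => ⨆ e : Fin n → ZMod 2,
      DoubleRLPN.expectedTime Naux c (q n) (cost n) e) (a.exponent Naux) := fun β hβ => by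
    filter_upwards [DoubleRLPN.eventually_expectedTime_le (c := c) ha hvalid hlim hK hconstraint
      hinternal cost hcost hconj hβ] with n hn
    exact ciSup_le hn
  obtain ⟨ε, hε, h⟩ := DoubleRLPN.exists_tendsto_zero_of_expBound hT
  refine ⟨ε, hε, h.mono fun n hn e _ => le_trans ?_ hn⟩
  exact le_ciSup (f := fun e => DoubleRLPN.expectedTime Naux c (q n) (cost n) e)
    (Set.finite_range _).bddAbove e
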